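/- Let $G$ be a finite group, $R_G$ (resp. $R_G^s$) the group of virtual complex (resp. virtual symplectic) characters of $G$, $\overline{\mathbf Q}$ the algebraic closure of $\mathbf Q$ in $\mathbf C$, $\Omega=\mathrm{Gal}(\overline{\mathbf Q}/\mathbf Q)$, $J_f$ the group of finite ideles of $\overline{\mathbf Q}$, $\widehat{\mathbf Z}=\prod_p\mathbf Z_p$, and $\mathrm{Det}(x)(\psi)=\det(T_\psi(x))$. A superscript $s$ on a function on $R_G$ means restriction to $R_G^s$. Put $$\mathrm H^s(\mathbf Z[G])=\frac{\mathrm{Hom}_\Omega(R_G^s,J_f)\times\mathrm{Hom}(R_G^s,\mathbf R^\times)}{\mathrm{Im}(\Delta^s)\cdot(\mathrm{Det}^s(\widehat{\mathbf Z}[G]^\times)\times1)},\qquad \mathrm{HCl}(\mathbf Z[G])=\frac{\mathrm{Hom}_\Omega(R_G,J_f)\times\mathrm{Det}(\mathbf R[G]^\times)\times\mathrm{Hom}_\Omega(R_G^s,\overline{\mathbf Q}^\times)}{\mathrm{Im}(\widetilde\Delta)\cdot(\mathrm{Det}(\widehat{\mathbf Z}[G]^\times\times\mathbf R[G]^\times)\times1)},$$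 where $\Delta^s(f)=f\times|f|$ on the group $\mathrm{Hom}_\Omega^+(R_G^s,\overline{\mathbf Q}^\times)$ of equivariant homomorphisms with totally positive values, and $\widetilde\Delta(\mathrm{Det}(a))=\mathrm{Det}(a)\times\mathrm{Det}(a)\times\mathrm{Det}^s(a)^{-1}$ for $a\in\mathbf Q[G]^\times$. Let $P^\bullet$ be a perfect $\mathbf Z[G]$-complex (bounded, with finitely generated locally free terms), and let $\sigma=(\sigma^i)$ be non-degenerate $G$-invariant pairings $\sigma^i:\mathrm H^i(P^\bullet_{\mathbf Q})\times\mathrm H^{-i}(P^\bullet_{\mathbf Q})\to\mathbf Q$ with $\sigma^i(x,y)=\sigma^{-i}(y,x)$; they define symmetric forms $\sigma^{ev},\sigma^{odd}$ on the even and the odd part of the cohomology. For a complex with locally free terms choose $\mathbf Q[G]$-bases $\{a_0^{ij}\}_j$ and $\mathbf Z_p[G]$-bases $\{a_p^{ij}\}_j$ of its terms after $\otimes\,\mathbf Q$ and $\otimes\,\mathbf Z_p$, and let $\lambda_p^i\in GL(\mathbf Q_p[G])$ be such that $\lambda_p^ia_p^{ij}=a_0^{ij}$. Let $W_m$ be symplectic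 representations whose characters $\theta_m$ form a $\mathbf Z$-basis of $R_G^s$, with non-degenerate $G$-invariant alternating forms $\kappa_m$ and hyperbolic bases $\{w_{mn}\}_n$. For a non-degenerate alternating form $h$ on $V$, $\mathrm{Pf}_h$ is the linear functional on $\det V$ with value $1$ at $u_1\wedge u_1'\wedge\dots\wedge u_n\wedge u_n'$ for any hyperbolic basis of $V$; and $\mathbf{pf}(A)=\det B$ for an $h$-self-adjoint automorphism $A$ with $h(Ax,y)=h(Bx,By)$. Put $b^{im}_{jn}=\sum_{g\in G}ga_0^{ij}\otimes gw_{mn}\in(P^i_{\mathbf Q}\otimes W_m)^G$. The class $\chi_{\mathrm H}^s(P^\bullet,\sigma)\in\mathrm H^s(\mathbf Z[G])$ is represented by $$\theta_m\mapsto\prod_{p<\infty}\prod_i\mathrm{Det}(\lambda_p^i)(\theta_m)^{(-1)^i}\times\mathrm{Pf}_{(\sigma\otimes\kappa_m)^G}\Bigl(\xi_m\bigl(\textstyle\bigotimes_i(\bigwedge_{jn}b^{im}_{jn})^{(-1)^i}\bigr)\Bigr),$$ where $\xi_m$ is the canonical isomorphism from the determinant of the complex $(P^\bullet_{\mathbf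 Q}\otimes W_m)^G$ to that of its cohomology and $\mathrm{Pf}_{(\sigma\otimes\kappa_m)^G}=\mathrm{Pf}_{(\sigma^{ev}\otimes\kappa_m)^G}\otimes\mathrm{Pf}_{(\sigma^{odd}\otimes\kappa_m)^G}^{-1}$. The class $d(P^\bullet,\tau)\in\mathrm{HCl}(\mathbf Z[G])$, for pairings $\tau$ of the same kind as $\sigma$, is defined as follows. Add an acyclic perfect complex to $P^\bullet$ so that the terms of the resulting complex, again written $P^\bullet$, have $G$-decompositions $P^i_{\mathbf Q}=B^i\oplus H^i\oplus U^i$, with $B^i=\mathrm{Im}\,\partial^{i-1}$, $H^i\subseteq\ker\partial^i$ identified with the cohomology, and $U^i\cong B^{i+1}$ under $\partial^i$, and carry non-degenerate $G$-invariant pairings $p:P^i_{\mathbf Q}\times P^{-i}_{\mathbf Q}\to\mathbf Q$, symmetric as $\sigma$ is, which are orthogonal sums of pairings $H^i\times H^{-i}$, $B^i\times U^{-i}$, $U^i\times B^{-i}\to\mathbf Q$, agree with $\tau^i$ on $H^i\times H^{-i}$, and satisfy $p(u,\partial u')=p(\partial u,u')$ for $u\in U^{i-1}$, $u'\in U^{-i}$.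 Let $p^0$ be the form on $P^0_{\mathbf Q}$ and $p^i$, $i>0$, the symmetric form on $P^i_{\mathbf Q}\oplus P^{-i}_{\mathbf Q}$ so obtained, and $\widetilde p^{\,i}(x,y)=\sum_{g\in G}p^i(gx,y)g^{-1}$. With $T_m$ the representation of matrices over $\mathbf Q[G]$ on sums of copies of $W_m$, the class $d(P^\bullet,\tau)$ is represented by $$\prod_{p<\infty}\prod_i\mathrm{Det}(\lambda_p^i)^{-(-1)^i}\times1\times\Bigl(\theta_m\mapsto\prod_{i\ge0}\mathbf{pf}\bigl(T_m(\widetilde p^{\,i})\bigr)^{(-1)^i}\Bigr),$$ where $\widetilde p^{\,i}$ is evaluated at the basis $\{a_0^{0j}\}_j$ of $P^0_{\mathbf Q}$ if $i=0$, and at the basis $\{a_0^{ij},a_0^{-ij}\}_j$ of $P^i_{\mathbf Q}\oplus P^{-i}_{\mathbf Q}$ if $i>0$, and $\mathbf{pf}$ is taken with respect to the orthogonal sum of copies of $\kappa_m$. Then restriction to $R_G^s$ on the first factor, the trivial map on the second factor, and inversion of the map induced by $\overline{\mathbf Q}\subset\mathbf C$ on the third factor induce a homomorphism $\phi:\mathrm{HCl}(\mathbf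 Z[G])\to\mathrm H^s(\mathbf Z[G])$, the choices above exist, both constructions give classes, and for all choices $$\chi_{\mathrm H}^s(P^\bullet,\sigma)=\phi\bigl(d(P^\bullet,|G|\sigma)\bigr)^{-1}.$$ -/

import Mathlib

open scoped TensorProduct DirectSum
open CategoryTheory

universe u v w

noncomputable section

namespace HermEuler

/-! ## Scalars, finite ideles of the algebraic closure -/

/-- The algebraic closure of `ℚ` inside `ℂ`. -/
abbrev Qbar : IntermediateField ℚ ℂ := algebraicClosure ℚ ℂ

/-- The absolute Galois group `Ω`. -/
abbrev Gal : Type := Qbar ≃ₐ[ℚ] Qbar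

instance primeFact (p : Nat.Primes) : Fact (p : ℕ).Prime := ⟨p.2⟩

/-- The ring `∏ₚ ℤₚ`. -/
def Zhat : Type := ∀ p : Nat.Primes, ℤ_[(p : ℕ)]

instance : CommRing Zhat := inferInstanceAs (CommRing (∀ p : Nat.Primes, ℤ_[(p : ℕ)]))

/-- The projection `Zhat → ℤₚ`. -/
def zhatProj (p : Nat.Primes) : Zhat →+* ℤ_[(p : ℕ)] :=
  Pi.evalRingHom (fun q : Nat.Primes => ℤ_[(q : ℕ)]) p

/-- The finite adeles of `Qbar`: the direct limit over the number fields `E ⊆ Qbar` of the finite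
adele rings `Zhat ⊗ E` of `E`. -/
def FinAdele : Type := Zhat ⊗[ℤ] Qbar

instance : CommRing FinAdele := inferInstanceAs (CommRing (Zhat ⊗[ℤ] Qbar))

/-- The group `J_f` of finite ideles of `Qbar`: the direct limit over the number fields
`E ⊆ Qbar` of the finite idele groups of `E`. -/
abbrev FinIdele : Type := FinAdeleˣ

/-- The ring `Zhat ⊗ ℂ`. -/
def AdeleC : Type := Zhat ⊗[ℤ] ℂ

instance : CommRing AdeleC := inferInstanceAs (CommRing (Zhat ⊗[ℤ] ℂ))

instance : Algebra Zhat AdeleC := inferInstanceAs (Algebra Zhat (Zhat ⊗[ℤ] ℂ))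

/-- The embedding `ℂ → Zhat ⊗ ℂ`. -/
def adeleInclC : ℂ →+* AdeleC :=
  (Algebra.TensorProduct.includeRight : ℂ →ₐ[ℤ] Zhat ⊗[ℤ] ℂ).toRingHom

/-- The ring `ℚₚ ⊗ ℂ`. -/
def LocalC (p : Nat.Primes) : Type := ℚ_[(p : ℕ)] ⊗[ℤ] ℂ

instance (p : Nat.Primes) : CommRing (LocalC p) :=
  inferInstanceAs (CommRing (ℚ_[(p : ℕ)] ⊗[ℤ] ℂ))

instance (p : Nat.Primes) : Algebra ℚ_[(p : ℕ)] (LocalC p) :=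
  inferInstanceAs (Algebra ℚ_[(p : ℕ)] (ℚ_[(p : ℕ)] ⊗[ℤ] ℂ))

/-- The embedding `ℂ → ℚₚ ⊗ ℂ`. -/
def localInclC (p : Nat.Primes) : ℂ →+* LocalC p :=
  (Algebra.TensorProduct.includeRight : ℂ →ₐ[ℤ] ℚ_[(p : ℕ)] ⊗[ℤ] ℂ).toRingHom

/-- Galois action on finite adeles. -/
def galAdele (ω : Gal) : FinAdele →+* FinAdele :=
  (Algebra.TensorProduct.map (AlgHom.id ℤ Zhat)
    ((ω : Qbar →ₐ[ℚ] Qbar).restrictScalars ℤ) : Zhat ⊗[ℤ] Qbar →ₐ[ℤ] Zhat ⊗[ℤ] Qbar).toRingHom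

/-- Galois action on finite ideles. -/
def galIdele (ω : Gal) : FinIdele →* FinIdele := Units.map (galAdele ω).toMonoidHom

/-- Galois action on `Qbarˣ`. -/
def galUnits (ω : Gal) : Qbarˣ →* Qbarˣ := Units.map (ω : Qbar →* Qbar)

/-- The diagonal embedding of `Qbar` in the finite adeles. -/
def diagAdele : Qbar →+* FinAdele :=
  (Algebra.TensorProduct.includeRight : Qbar →ₐ[ℤ] Zhat ⊗[ℤ] Qbar).toRingHom

/-- The diagonal embedding of `Qbarˣ` in the finite ideles. -/
def diagIdele : Qbarˣ →* FinIdele := Units.map diagAdele.toMonoidHom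

theorem galAdele_diagAdele (ω : Gal) (z : Qbar) :
    galAdele ω (diagAdele z) = diagAdele (ω z) := by
  change Algebra.TensorProduct.map _ _ ((1 : Zhat) ⊗ₜ[ℤ] z) = (1 : Zhat) ⊗ₜ[ℤ] ω z
  rw [Algebra.TensorProduct.map_tmul]
  rfl

/-- The inclusion of `Zhat ⊗ Qbar` in `Zhat ⊗ ℂ`, where determinants of complex representations
live. -/
def adeleToComplex : FinAdele →+* AdeleC :=
  (Algebra.TensorProduct.map (AlgHom.id ℤ Zhat) (Qbar.val.restrictScalars ℤ) :
    Zhat ⊗[ℤ] Qbar →ₐ[ℤ] Zhat ⊗[ℤ] ℂ).toRingHom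

/-- The inclusion of the finite ideles in `(Zhat ⊗ ℂ)ˣ`. -/
def ideleToComplex : FinIdele →* AdeleCˣ := Units.map adeleToComplex.toMonoidHom

/-- The component at `p` of a finite adele, in `ℚₚ ⊗ Qbar ⊆ ℚₚ ⊗ ℂ`. -/
def adeleAt (p : Nat.Primes) : FinAdele →+* LocalC p :=
  (Algebra.TensorProduct.map ((PadicInt.Coe.ringHom (p := (p : ℕ))).comp (zhatProj p)).toIntAlgHom
    (Qbar.val.restrictScalars ℤ) : Zhat ⊗[ℤ] Qbar →ₐ[ℤ] ℚ_[(p : ℕ)] ⊗[ℤ] ℂ).toRingHom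

/-- The component at `p` of a finite idele. -/
def ideleAt (p : Nat.Primes) : FinIdele →* (LocalC p)ˣ := Units.map (adeleAt p).toMonoidHom

/-! ## Characters -/

section Characters

variable (G : Type u) [Group G]

/-- A complex representation is symplectic if it carries a non-degenerate invariant alternating
form. -/
def IsSymplectic {G : Type u} [Group G] {n : ℕ} (ρ : Representation ℂ G (Fin n → ℂ)) : Prop :=
  ∃ κ : LinearMap.BilinForm ℂ (Fin n → ℂ),
    κ.IsAlt ∧ κ.Nondegenerate ∧ ∀ g x y, κ (ρ g x) (ρ g y) = κ x y

/-- The group of virtual complex characters of `G`. -/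
def RG : AddSubgroup (G → ℂ) :=
  AddSubgroup.closure {χ | ∃ (n : ℕ) (ρ : Representation ℂ G (Fin n → ℂ)), χ = ρ.character}

/-- The group of virtual symplectic characters of `G`. -/
def RGs : AddSubgroup (G → ℂ) :=
  AddSubgroup.closure
    {χ | ∃ (n : ℕ) (ρ : Representation ℂ G (Fin n → ℂ)), IsSymplectic ρ ∧ χ = ρ.character}

theorem RGs_le_RG : RGs G ≤ RG G :=
  AddSubgroup.closure_mono (by rintro χ ⟨n, ρ, -, h⟩; exact ⟨n, ρ, h⟩)

variable {G}

/-- The character of a representation as an element of `RG G`. -/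
def charR {n : ℕ} (ρ : Representation ℂ G (Fin n → ℂ)) : RG G :=
  ⟨ρ.character, AddSubgroup.subset_closure ⟨n, ρ, rfl⟩⟩

/-- The character of a symplectic representation as an element of `RGs G`. -/
def charRs {n : ℕ} (ρ : Representation ℂ G (Fin n → ℂ)) (h : IsSymplectic ρ) : RGs G :=
  ⟨ρ.character, AddSubgroup.subset_closure ⟨n, ρ, h, rfl⟩⟩

/-- `ψ'` is the conjugate of `ψ` by `ω`, both having values in `Qbar`. -/
def IsConjBy (ω : Gal) (ψ ψ' : G → ℂ) : Prop :=
  ∀ g, ∃ z : Qbar, ψ g = (z : ℂ) ∧ ψ' g = ((ω z : Qbar) : ℂ)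

/-- The Galois equivariant homomorphisms from a group of virtual characters to `M`. -/
def equivHom (S : AddSubgroup (G → ℂ)) (M : Type*) [CommGroup M] (act : Gal → M →* M) :
    Subgroup (Multiplicative S →* M) where
  carrier := {f | ∀ (ω : Gal) (ψ ψ' : S), IsConjBy ω (ψ : G → ℂ) (ψ' : G → ℂ) →
    f (Multiplicative.ofAdd ψ') = act ω (f (Multiplicative.ofAdd ψ))}
  one_mem' := by intro ω ψ ψ' _; simp
  mul_mem' := by
    intro f g hf hg ω ψ ψ' h
    simp only [MonoidHom.mul_apply, map_mul, hf ω ψ ψ' h, hg ω ψ ψ' h]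
  inv_mem' := by
    intro f hf ω ψ ψ' h
    simp only [MonoidHom.inv_apply, map_inv, hf ω ψ ψ' h]

/-- Inclusion of `RGs` in `RG`, multiplicatively. -/
def inclR : Multiplicative (RGs G) →* Multiplicative (RG G) :=
  AddMonoidHom.toMultiplicative (AddSubgroup.inclusion (RGs_le_RG G))

/-- Restriction of equivariant homomorphisms from `RG` to `RGs`. -/
def restrictHom (M : Type*) [CommGroup M] (act : Gal → M →* M) :
    equivHom (RG G) M act →* equivHom (RGs G) M act where
  toFun f := ⟨f.1.comp inclR, fun ω ψ ψ' h =>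
    f.2 ω (AddSubgroup.inclusion (RGs_le_RG G) ψ) (AddSubgroup.inclusion (RGs_le_RG G) ψ') h⟩
  map_one' := by ext; rfl
  map_mul' _ _ := by ext; rfl

/-- The map on equivariant homomorphisms induced by `Qbarˣ → FinIdele`. -/
def toIdele (S : AddSubgroup (G → ℂ)) : equivHom S Qbarˣ galUnits →* equivHom S FinIdele galIdele where
  toFun f := ⟨diagIdele.comp f.1, fun ω ψ ψ' h => by
    have := f.2 ω ψ ψ' h
    simp only [MonoidHom.comp_apply, this]
    exact Units.ext (galAdele_diagAdele ω _).symm⟩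
  map_one' := by ext; simp
  map_mul' f g := Subtype.ext (MonoidHom.ext fun ψ => map_mul diagIdele (f.1 ψ) (g.1 ψ))

/-- The inclusion `Qbarˣ → ℂˣ`. -/
def qbarToC : Qbarˣ →* ℂˣ := Units.map (Qbar.val : Qbar →* ℂ)

/-! ## Determinants of group ring elements -/

/-- The matrices of a representation. -/
def matRep {n : ℕ} (ρ : Representation ℂ G (Fin n → ℂ)) : G →* Matrix (Fin n) (Fin n) ℂ :=
  ((LinearMap.toMatrixAlgEquiv' : ((Fin n → ℂ) →ₗ[ℂ] (Fin n → ℂ)) ≃ₐ[ℂ] _) :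
    ((Fin n → ℂ) →ₗ[ℂ] (Fin n → ℂ)) →* Matrix (Fin n) (Fin n) ℂ).comp ρ

/-- The extension of a representation to the group ring over `A`, with values in matrices over a
common extension `S` of `A` and `ℂ`. -/
def ringRep (A : Type*) {S : Type*} [CommRing A] [CommRing S] [Algebra A S] (φ : ℂ →+* S) {n : ℕ}
    (ρ : Representation ℂ G (Fin n → ℂ)) :
    MonoidAlgebra A G →ₐ[A] Matrix (Fin n) (Fin n) S :=
  MonoidAlgebra.lift A (Matrix (Fin n) (Fin n) S) G
    ((RingHom.mapMatrix φ).toMonoidHom.comp (matRep ρ))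

/-- `x ↦ Det(x)(ρ) = det(ρ(x))` on units of the group ring. -/
def detUnit (A : Type*) {S : Type*} [CommRing A] [CommRing S] [Algebra A S] (φ : ℂ →+* S) {n : ℕ}
    (ρ : Representation ℂ G (Fin n → ℂ)) : (MonoidAlgebra A G)ˣ →* Sˣ :=
  Units.map (Matrix.detMonoidHom.comp (ringRep A φ ρ).toRingHom.toMonoidHom)

/-- `x ↦ Det(x)(ρ)` on invertible matrices over the group ring. -/
def detGL (A : Type*) {S : Type*} [CommRing A] [CommRing S] [Algebra A S] (φ : ℂ →+* S) {n r : ℕ}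
    (ρ : Representation ℂ G (Fin n → ℂ)) :
    (Matrix (Fin r) (Fin r) (MonoidAlgebra A G))ˣ →* Sˣ :=
  Units.map (Matrix.detMonoidHom.comp
    ((Matrix.compRingEquiv (Fin r) (Fin n) S).toRingHom.comp
      (RingHom.mapMatrix (ringRep A φ ρ).toRingHom)).toMonoidHom)

variable (G)

/-- `Det(Zhat[G]ˣ)`. -/
def detZhat : Subgroup (equivHom (RG G) FinIdele galIdele) where
  carrier := {f | ∃ x : (MonoidAlgebra Zhat G)ˣ, ∀ (n : ℕ) (ρ : Representation ℂ G (Fin n → ℂ)),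
    ideleToComplex (f.1 (Multiplicative.ofAdd (charR ρ))) = detUnit Zhat adeleInclC ρ x}
  one_mem' := ⟨1, fun n ρ => by simp⟩
  mul_mem' := by
    rintro f g ⟨x, hx⟩ ⟨y, hy⟩
    refine ⟨x * y, fun n ρ => ?_⟩
    rw [map_mul, ← hx, ← hy]
    exact map_mul ideleToComplex _ _
  inv_mem' := by
    rintro f ⟨x, hx⟩
    exact ⟨x⁻¹, fun n ρ => by simp [hx]⟩

/-- `Det(ℝ[G]ˣ)`. -/
def detR : Subgroup (Multiplicative (RG G) →* ℂˣ) where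
  carrier := {f | ∃ x : (MonoidAlgebra ℝ G)ˣ, ∀ (n : ℕ) (ρ : Representation ℂ G (Fin n → ℂ)),
    f (Multiplicative.ofAdd (charR ρ)) = detUnit ℝ (RingHom.id ℂ) ρ x}
  one_mem' := ⟨1, fun n ρ => by simp⟩
  mul_mem' := by
    rintro f g ⟨x, hx⟩ ⟨y, hy⟩
    exact ⟨x * y, fun n ρ => by simp [hx, hy]⟩
  inv_mem' := by
    rintro f ⟨x, hx⟩
    exact ⟨x⁻¹, fun n ρ => by simp [hx]⟩

/-- `Det(ℚ[G]ˣ)`. -/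
def detQ : Subgroup (equivHom (RG G) Qbarˣ galUnits) where
  carrier := {f | ∃ x : (MonoidAlgebra ℚ G)ˣ, ∀ (n : ℕ) (ρ : Representation ℂ G (Fin n → ℂ)),
    qbarToC (f.1 (Multiplicative.ofAdd (charR ρ))) = detUnit ℚ (RingHom.id ℂ) ρ x}
  one_mem' := ⟨1, fun n ρ => by simp⟩
  mul_mem' := by
    rintro f g ⟨x, hx⟩ ⟨y, hy⟩
    exact ⟨x * y, fun n ρ => by simp [hx, hy]⟩
  inv_mem' := by
    rintro f ⟨x, hx⟩
    exact ⟨x⁻¹, fun n ρ => by simp [hx]⟩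

/-! ## The group of symplectic hermitian classes -/

/-- Equivariant homomorphisms on `RGs` with totally positive values. -/
def posHom : Subgroup (equivHom (RGs G) Qbarˣ galUnits) where
  carrier := {f | ∀ (ψ : Multiplicative (RGs G)) (ω : Gal), ∃ r : ℝ, 0 < r ∧
    ((ω (f.1 ψ : Qbar) : Qbar) : ℂ) = (r : ℂ)}
  one_mem' := fun ψ ω => ⟨1, one_pos, by simp⟩
  mul_mem' := by
    intro f g hf hg ψ ω
    obtain ⟨r, hr, h⟩ := hf ψ ω
    obtain ⟨s, hs, h'⟩ := hg ψ ω
    exact ⟨r * s, mul_pos hr hs, by simp [h, h']⟩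
  inv_mem' := by
    intro f hf ψ ω
    obtain ⟨r, hr, h⟩ := hf ψ ω
    exact ⟨r⁻¹, inv_pos.2 hr, by simp [h]⟩

/-- `Hom_Ω(RGs, J_f) × Hom(RGs, ℝˣ)`. -/
def HsNum : Type u := equivHom (RGs G) FinIdele galIdele × (Multiplicative (RGs G) →* ℝˣ)

instance : CommGroup (HsNum G) :=
  inferInstanceAs (CommGroup (equivHom (RGs G) FinIdele galIdele × (Multiplicative (RGs G) →* ℝˣ)))

/-- The absolute value `Qbarˣ → ℝˣ`. -/
def absQ : Qbarˣ →* ℝˣ :=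
  (Units.map ((normHom : ℂ →*₀ ℝ) : ℂ →* ℝ)).comp qbarToC

/-- The diagonal map `f ↦ f × |f|`. -/
def deltaS : posHom G →* HsNum G :=
  MonoidHom.prod ((toIdele (RGs G)).comp (posHom G).subtype)
    { toFun := fun f => absQ.comp f.1.1
      map_one' := by ext; simp
      map_mul' := fun _ _ => by ext; simp }

/-- `Im(Δˢ) · (Detˢ(Zhat[G]ˣ) × 1)`. -/
def HsDen : Subgroup (HsNum G) :=
  (deltaS G).range ⊔ ((detZhat G).map (restrictHom FinIdele galIdele)).prod ⊥

/-- The group `Hˢ(ℤ[G])` of symplectic hermitian classes. -/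
abbrev Hs : Type u := HsNum G ⧸ HsDen G

/-! ## The hermitian class group -/

/-- `Hom_Ω(RG, J_f) × Det(ℝ[G]ˣ) × Hom_Ω(RGs, Qbarˣ)`. -/
def HClNum : Type u :=
  equivHom (RG G) FinIdele galIdele × detR G × equivHom (RGs G) Qbarˣ galUnits

instance : CommGroup (HClNum G) :=
  inferInstanceAs
    (CommGroup (equivHom (RG G) FinIdele galIdele × detR G × equivHom (RGs G) Qbarˣ galUnits))

variable {G} in
theorem ringRep_map {n : ℕ} (ρ : Representation ℂ G (Fin n → ℂ)) (x : MonoidAlgebra ℚ G) :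
    ringRep ℝ (RingHom.id ℂ) ρ (MonoidAlgebra.mapRingHom G (algebraMap ℚ ℝ) x) =
      ringRep ℚ (RingHom.id ℂ) ρ x := by
  induction x using MonoidAlgebra.induction_on with
  | of g => simp [ringRep]
  | add x y hx hy => simp only [map_add, hx, hy]
  | smul r x hx =>
    have h : MonoidAlgebra.mapRingHom G (algebraMap ℚ ℝ) (r • x) =
        (algebraMap ℚ ℝ r) • MonoidAlgebra.mapRingHom G (algebraMap ℚ ℝ) x := by
      ext g
      simp
    rw [h, map_smul, map_smul, hx, algebraMap_smul]

/-- `Det(ℚ[G]ˣ) → Det(ℝ[G]ˣ)`. -/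
def detQtoR : detQ G →* detR G where
  toFun f := ⟨qbarToC.comp f.1.1, by
    obtain ⟨x, hx⟩ := f.2
    refine ⟨Units.map (MonoidAlgebra.mapRingHom G (algebraMap ℚ ℝ) : _ →* _) x, fun n ρ => ?_⟩
    rw [MonoidHom.comp_apply, hx]
    ext
    simp [detUnit, ringRep_map]⟩
  map_one' := by ext; simp
  map_mul' _ _ := by ext; simp

/-- The twisted diagonal map `Det(a) ↦ Det(a) × Det(a) × Detˢ(a)⁻¹`. -/
def deltaTilde : detQ G →* HClNum G :=
  MonoidHom.prod ((toIdele (RG G)).comp (detQ G).subtype)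
    (MonoidHom.prod (detQtoR G) (((restrictHom Qbarˣ galUnits).comp (detQ G).subtype)⁻¹))

/-- `Im(Δ~) · (Det(Zhat[G]ˣ × ℝ[G]ˣ) × 1)`. -/
def HClDen : Subgroup (HClNum G) :=
  (deltaTilde G).range ⊔ (detZhat G).prod (Subgroup.prod ⊤ ⊥)

/-- The hermitian class group `HCl(ℤ[G])`. -/
abbrev HCl : Type u := HClNum G ⧸ HClDen G

/-! ## The comparison map -/

variable {G}

theorem isAlgebraic_character [Finite G] {n : ℕ} (ρ : Representation ℂ G (Fin n → ℂ)) (g : G) :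
    IsAlgebraic ℚ (ρ.character g) := by
  have hc : ρ.character g = (matRep ρ g).trace := by
    rw [Representation.character, LinearMap.trace_eq_matrix_trace ℂ (Pi.basisFun ℂ (Fin n))]
    rfl
  rw [hc, Matrix.trace_eq_sum_roots_charpoly]
  have : ∀ z ∈ (matRep ρ g).charpoly.roots, z ∈ algebraicClosure ℚ ℂ := by
    intro z hz
    have h1 := Matrix.mem_spectrum_iff_isRoot_charpoly.2 (Polynomial.isRoot_of_mem_roots hz)
    have h2 := spectrum.pow_mem_pow _ (Nat.card G) h1
    rw [← map_pow, pow_card_eq_one', map_one] at h2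
    have h3 : z ^ Nat.card G = 1 := by
      rcases isEmpty_or_nonempty (Fin n) with h | h
      · rw [spectrum.of_subsingleton] at h2
        exact h2.elim
      · simpa [spectrum.one_eq] using h2
    rw [mem_algebraicClosure_iff]
    exact IsAlgebraic.of_pow Nat.card_pos (h3 ▸ isAlgebraic_one)
  exact mem_algebraicClosure_iff.1 (multiset_sum_mem _ this)

theorem character_inv_of_isSymplectic {n : ℕ} (ρ : Representation ℂ G (Fin n → ℂ))
    (h : IsSymplectic ρ) (g : G) : ρ.character g⁻¹ = ρ.character g := by
  obtain ⟨κ, -, hn, hi⟩ := h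
  have e : ρ.Equiv ρ.dual := Representation.Equiv.mk (κ.toDual hn) (by
    intro g
    ext x y
    have := hi g (Pi.single x 1) (ρ g⁻¹ (Pi.single y 1))
    rw [← Module.End.mul_apply, ← map_mul, mul_inv_cancel, map_one] at this
    simpa [LinearMap.BilinForm.toDual_def, Module.Dual.transpose_apply] using this)
  have := congrFun (Representation.char_iso e) g
  rw [this, Representation.char_dual]

open scoped ComplexOrder in
theorem conj_character [Finite G] {n : ℕ} (ρ : Representation ℂ G (Fin n → ℂ)) (g : G) :
    (starRingEnd ℂ) (ρ.character g) = ρ.character g⁻¹ := by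
  have hc : ∀ g, ρ.character g = (matRep ρ g).trace := by
    intro g
    rw [Representation.character, LinearMap.trace_eq_matrix_trace ℂ (Pi.basisFun ℂ (Fin n))]
    rfl
  have := Fintype.ofFinite G
  classical
  set M := matRep ρ
  set S : Matrix (Fin n) (Fin n) ℂ := ∑ h, (M h).conjTranspose * M h with hS
  have hpos : S.PosDef := by
    rw [hS, ← Finset.add_sum_erase _ _ (Finset.mem_univ (1 : G))]
    refine Matrix.PosDef.add_posSemidef (by simpa using Matrix.PosDef.one) ?_
    exact Finset.sum_induction _ Matrix.PosSemidef (fun _ _ ha hb => ha.add hb)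
      Matrix.PosSemidef.zero (fun _ _ => Matrix.posSemidef_conjTranspose_mul_self _)
  have hinv : (M g).conjTranspose * S * M g = S := by
    rw [hS, Finset.mul_sum, Finset.sum_mul]
    refine Fintype.sum_equiv (Equiv.mulRight g) _ _ fun h => ?_
    simp only [Equiv.coe_mulRight, map_mul, Matrix.conjTranspose_mul, Matrix.mul_assoc]
  have hu : IsUnit S.det := (Matrix.isUnit_iff_isUnit_det _).1 hpos.isUnit
  have hM : M g * M g⁻¹ = 1 := by rw [← map_mul, mul_inv_cancel, map_one]
  have h1 : (M g).conjTranspose * S = S * M g⁻¹ := by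
    calc (M g).conjTranspose * S = (M g).conjTranspose * S * (M g * M g⁻¹) := by rw [hM, mul_one]
      _ = S * M g⁻¹ := by rw [← mul_assoc, hinv]
  have h2 : M g⁻¹ = S⁻¹ * ((M g).conjTranspose * S) := by
    rw [h1, ← mul_assoc, Matrix.nonsing_inv_mul _ hu, one_mul]
  rw [hc, hc, h2, Matrix.trace_mul_comm, Matrix.mul_assoc, Matrix.mul_nonsing_inv _ hu, mul_one,
    Matrix.trace_conjTranspose]
  rfl

instance normalQbar : Normal ℚ Qbar :=
  haveI : IsAlgClosure ℚ Qbar := algebraicClosure.isAlgClosure ℚ ℂ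
  IsAlgClosure.normal ℚ Qbar

/-- Complex conjugation as an element of `Gal`. -/
def conjGal : Gal := (Complex.conjAe.restrictScalars ℚ).restrictNormal Qbar

theorem conjGal_apply (z : Qbar) : ((conjGal z : Qbar) : ℂ) = (starRingEnd ℂ) (z : ℂ) :=
  AlgEquiv.restrictNormal_commutes (Complex.conjAe.restrictScalars ℚ) Qbar z

theorem isConjBy_conjGal [Finite G] (ψ : RGs G) : IsConjBy conjGal (ψ : G → ℂ) (ψ : G → ℂ) := by
  suffices h : ∀ g, IsAlgebraic ℚ ((ψ : G → ℂ) g) ∧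
      (starRingEnd ℂ) ((ψ : G → ℂ) g) = (ψ : G → ℂ) g by
    intro g
    exact ⟨⟨_, mem_algebraicClosure_iff.2 (h g).1⟩, rfl, by rw [conjGal_apply]; exact (h g).2.symm⟩
  obtain ⟨ψ, hψ⟩ := ψ
  induction hψ using AddSubgroup.closure_induction with
  | mem χ h =>
    obtain ⟨n, ρ, hρ, rfl⟩ := h
    exact fun g => ⟨isAlgebraic_character ρ g, by
      change (starRingEnd ℂ) (ρ.character g) = ρ.character g
      rw [conj_character, character_inv_of_isSymplectic ρ hρ g]⟩
  | zero => exact fun g => ⟨isAlgebraic_zero, by simp⟩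
  | add x y _ _ hx hy => exact fun g => ⟨(hx g).1.add (hy g).1, by
      change (starRingEnd ℂ) (x g + y g) = x g + y g
      rw [map_add, (show (starRingEnd ℂ) (x g) = x g from (hx g).2),
        (show (starRingEnd ℂ) (y g) = y g from (hy g).2)]⟩
  | neg x _ hx => exact fun g => ⟨(hx g).1.neg, by
      change (starRingEnd ℂ) (-x g) = -x g
      rw [map_neg, (show (starRingEnd ℂ) (x g) = x g from (hx g).2)]⟩

theorem equivHom_real [Finite G] (f : equivHom (RGs G) Qbarˣ galUnits)
    (ψ : Multiplicative (RGs G)) :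
    (((f.1 ψ : Qbar) : ℂ).re : ℂ) = ((f.1 ψ : Qbar) : ℂ) := by
  have h := f.2 conjGal ψ.toAdd ψ.toAdd (isConjBy_conjGal _)
  have h' := congrArg (fun u : Qbarˣ => ((u : Qbar) : ℂ)) h
  simp only [galUnits, Units.coe_map] at h'
  refine Complex.conj_eq_iff_re.1 ?_
  rw [← conjGal_apply]
  exact h'.symm

/-- The inclusion `Qbar ⊆ ℂ` maps equivariant homomorphisms on `RGs` to real valued ones. -/
def toReal [Finite G] : equivHom (RGs G) Qbarˣ galUnits →* (Multiplicative (RGs G) →* ℝˣ) where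
  toFun f :=
    { toFun := fun ψ => Units.mk0 ((f.1 ψ : Qbar) : ℂ).re (by
        intro h
        have := equivHom_real f ψ
        rw [h] at this
        exact (f.1 ψ).ne_zero (Subtype.ext (by simpa using this.symm)))
      map_one' := by ext; simp
      map_mul' := fun x y => by
        ext
        apply Complex.ofReal_injective
        simp only [Units.val_mk0, Units.val_mul, Complex.ofReal_mul, equivHom_real]
        simp }
  map_one' := by ext; simp
  map_mul' f g := by
    refine MonoidHom.ext fun ψ => Units.ext (Complex.ofReal_injective ?_)
    change ((((f * g).1 ψ : Qbar) : ℂ).re : ℂ) =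
      ((((f.1 ψ : Qbar) : ℂ).re * ((g.1 ψ : Qbar) : ℂ).re : ℝ) : ℂ)
    rw [Complex.ofReal_mul, equivHom_real, equivHom_real, equivHom_real]
    rfl

variable (G)

/-- The map on representatives which induces the comparison map: restriction on the first factor,
trivial on the second one, inversion of the inclusion `Qbar ⊆ ℂ` on the third one. -/
def comparisonNum [Finite G] : HClNum G →* HsNum G :=
  MonoidHom.prod ((restrictHom FinIdele galIdele).comp (MonoidHom.fst _ _))
    ((toReal.comp ((MonoidHom.snd _ _).comp (MonoidHom.snd _ _)))⁻¹)

/-- The comparison map `φ : HCl(ℤ[G]) → Hˢ(ℤ[G])` induced by `comparisonNum`. -/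
def comparison [Finite G] (h : HClDen G ≤ (HsDen G).comap (comparisonNum G)) : HCl G →* Hs G :=
  QuotientGroup.map (HClDen G) (HsDen G) (comparisonNum G) h

end Characters

/-! ## Complexes -/

section Complexes

variable {G : Type u} [Group G]

/-- The action of `G` on a `ℤ[G]`-module. -/
def actZ (M : Type v) [AddCommGroup M] [Module (MonoidAlgebra ℤ G) M] : Representation ℤ G M where
  toFun g := (DistribSMul.toAddMonoidHom M (MonoidAlgebra.of ℤ G g)).toIntLinearMap
  map_one' := by ext x; exact (congrArg (· • x) (map_one (MonoidAlgebra.of ℤ G))).trans (one_smul _ x)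
  map_mul' g h := by
    ext x
    exact (congrArg (· • x) (map_mul (MonoidAlgebra.of ℤ G) g h)).trans (mul_smul _ _ x)

/-- The action of `G` on `A ⊗ M`. -/
def repOver (A : Type w) [CommRing A] (M : Type v) [AddCommGroup M]
    [Module (MonoidAlgebra ℤ G) M] : Representation A G (A ⊗[ℤ] M) where
  toFun g := (actZ M g).baseChange A
  map_one' := by rw [map_one]; exact LinearMap.baseChange_id
  map_mul' g h := by rw [map_mul]; exact LinearMap.baseChange_comp _ _

/-- The family `a` is a basis over the group ring `A[G]`: its translates form a basis over `A`. -/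
def IsGroupBasis {A : Type*} [CommRing A] {V : Type*} [AddCommGroup V] [Module A V] {ι : Type*}
    (τ : Representation A G V) (a : ι → V) : Prop :=
  LinearIndependent A (fun x : G × ι => τ x.1 (a x.2)) ∧
    Submodule.span A (Set.range fun x : G × ι => τ x.1 (a x.2)) = ⊤

/-- A perfect complex: a bounded complex of finitely generated locally free `ℤ[G]`-modules. -/
structure IsPerfect (P : CochainComplex (ModuleCat.{v} (MonoidAlgebra ℤ G)) ℤ) : Prop where
  bounded : ∃ N : ℤ, ∀ i, N < |i| → Subsingleton (P.X i)
  finite : ∀ i, Module.Finite (MonoidAlgebra ℤ G) (P.X i)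
  locallyFree : ∀ (i : ℤ) (p : Nat.Primes), ∃ (r : ℕ) (a : Fin r → ℤ_[(p : ℕ)] ⊗[ℤ] P.X i),
    IsGroupBasis (G := G) (repOver ℤ_[(p : ℕ)] (P.X i)) a

variable (P Q A : CochainComplex (ModuleCat.{v} (MonoidAlgebra ℤ G)) ℤ)

/-- The terms of the complex `ℚ ⊗ P`. -/
abbrev QT (i : ℤ) : Type v := ℚ ⊗[ℤ] P.X i

/-- The action of `G` on `ℚ ⊗ Pⁱ`. -/
abbrev repQ (i : ℤ) : Representation ℚ G (QT P i) := repOver ℚ (P.X i)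

/-- The `ℚ`-linear extension of a homomorphism of `ℤ[G]`-modules. -/
def extQ {M N : ModuleCat.{v} (MonoidAlgebra ℤ G)} (f : M ⟶ N) : ℚ ⊗[ℤ] M →ₗ[ℚ] ℚ ⊗[ℤ] N :=
  (f.hom.toAddMonoidHom.toIntLinearMap).baseChange ℚ

theorem extQ_comp {L M N : ModuleCat.{v} (MonoidAlgebra ℤ G)} (f : L ⟶ M) (g : M ⟶ N)
    (x : ℚ ⊗[ℤ] L) : extQ g (extQ f x) = extQ (f ≫ g) x := by
  induction x using TensorProduct.induction_on with
  | zero => simp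
  | tmul q m => rfl
  | add x y hx hy => simp only [map_add, hx, hy]

theorem extQ_zero {M N : ModuleCat.{v} (MonoidAlgebra ℤ G)} (x : ℚ ⊗[ℤ] M) :
    extQ (0 : M ⟶ N) x = 0 := by
  induction x using TensorProduct.induction_on with
  | zero => simp
  | tmul q m => exact TensorProduct.tmul_zero _ q
  | add x y hx hy => simp only [map_add, hx, hy, add_zero]

theorem extQ_rep {M N : ModuleCat.{v} (MonoidAlgebra ℤ G)} (f : M ⟶ N) (g : G)
    (x : ℚ ⊗[ℤ] M) : extQ f (repOver ℚ M g x) = repOver ℚ N g (extQ f x) := by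
  induction x using TensorProduct.induction_on with
  | zero => simp
  | tmul q m => exact congrArg (q ⊗ₜ[ℤ] ·) (f.hom.map_smul (MonoidAlgebra.of ℤ G g) m)
  | add x y hx hy => simp only [map_add, hx, hy]

/-- The differentials of `ℚ ⊗ P`. -/
abbrev dQ (i j : ℤ) : QT P i →ₗ[ℚ] QT P j := extQ (P.d i j)

/-- Cycles of `ℚ ⊗ P`. -/
abbrev Zc (i : ℤ) : Submodule ℚ (QT P i) := LinearMap.ker (dQ P i (i + 1))

/-- Boundaries of `ℚ ⊗ P`. -/
abbrev Bc (i : ℤ) : Submodule ℚ (QT P i) := LinearMap.range (dQ P (i - 1) i)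

/-- The cohomology of `ℚ ⊗ P`. -/
def H (i : ℤ) : Type v := Zc P i ⧸ (Bc P i).comap (Zc P i).subtype

instance (i : ℤ) : AddCommGroup (H P i) :=
  inferInstanceAs (AddCommGroup (Zc P i ⧸ (Bc P i).comap (Zc P i).subtype))

instance (i : ℤ) : Module ℚ (H P i) :=
  inferInstanceAs (Module ℚ (Zc P i ⧸ (Bc P i).comap (Zc P i).subtype))

/-- The action of `G` on cycles. -/
abbrev repZ (i : ℤ) : Representation ℚ G (Zc P i) :=
  (repQ P i).subrepresentation (Zc P i) fun g x hx => by
    rw [Submodule.mem_comap, LinearMap.mem_ker, extQ_rep, LinearMap.mem_ker.1 hx, map_zero]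

/-- The action of `G` on cohomology. -/
def repH (i : ℤ) : Representation ℚ G (H P i) :=
  (repZ P i).quotient ((Bc P i).comap (Zc P i).subtype) fun g => by
    rintro ⟨x, hx⟩ ⟨y, hy⟩
    exact ⟨repQ P (i - 1) g y, (extQ_rep _ g y).trans (congrArg (repQ P i g) hy)⟩

/-- The class of a cycle. -/
def classH (i : ℤ) : Zc P i →ₗ[ℚ] H P i := Submodule.mkQ ((Bc P i).comap (Zc P i).subtype)

variable {P Q} in
/-- The map on cycles induced by a morphism of complexes. -/
def mapZ (f : Q ⟶ P) (i : ℤ) : Zc Q i →ₗ[ℚ] Zc P i :=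
  (extQ (f.f i)).restrict fun x hx => by
    rw [LinearMap.mem_ker, extQ_comp, f.comm, ← extQ_comp, LinearMap.mem_ker.1 hx, map_zero]

variable {P Q} in
/-- The map on cohomology induced by a morphism of complexes. -/
def mapH (f : Q ⟶ P) (i : ℤ) : H Q i →ₗ[ℚ] H P i :=
  Submodule.mapQ ((Bc Q i).comap (Zc Q i).subtype) ((Bc P i).comap (Zc P i).subtype) (mapZ f i) (by
    rintro ⟨x, hx⟩ ⟨y, hy⟩
    refine ⟨extQ (f.f (i - 1)) y, ?_⟩
    rw [extQ_comp, f.comm, ← extQ_comp]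
    exact congrArg (extQ (f.f i)) hy)

/-- The direct sum of two complexes. -/
def dirSum : CochainComplex (ModuleCat.{v} (MonoidAlgebra ℤ G)) ℤ where
  X i := ModuleCat.of (MonoidAlgebra ℤ G) (P.X i × A.X i)
  d i j := ModuleCat.ofHom (LinearMap.prodMap (P.d i j).hom (A.d i j).hom)
  shape i j h := by rw [P.shape i j h, A.shape i j h]; rfl
  d_comp_d' i j k _ _ := by
    rw [← ModuleCat.ofHom_comp, LinearMap.prodMap_comp, ← ModuleCat.hom_comp, ← ModuleCat.hom_comp,
      P.d_comp_d, A.d_comp_d]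
    rfl

/-- The projection of a direct sum to its first summand. -/
def dirSumFst : dirSum P A ⟶ P where
  f i := ModuleCat.ofHom (LinearMap.fst (MonoidAlgebra ℤ G) (P.X i) (A.X i))
  comm' _ _ _ := rfl

/-! ## Pairings on cohomology -/

/-- Pairings `σⁱ : Hⁱ × H⁻ⁱ → ℚ`. -/
def GradedPairing : Type v := ∀ i j : ℤ, i + j = 0 → H P i →ₗ[ℚ] H P j →ₗ[ℚ] ℚ

variable {P Q}

/-- The pairings are symmetric, `G`-invariant and non-degenerate. -/
structure IsSymmetricPairing (σ : GradedPairing P) : Prop where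
  symm : ∀ (i j : ℤ) (h : i + j = 0) (h' : j + i = 0) (x : H P i) (y : H P j),
    σ i j h x y = σ j i h' y x
  inv : ∀ (i j : ℤ) (h : i + j = 0) (g : G) (x : H P i) (y : H P j),
    σ i j h (repH P i g x) (repH P j g y) = σ i j h x y
  nondeg : ∀ (i j : ℤ) (h : i + j = 0), (σ i j h).Nondegenerate

/-- The multiples of a family of pairings. -/
def GradedPairing.scale (c : ℚ) (σ : GradedPairing P) : GradedPairing P :=
  fun i j h => c • σ i j h

/-- The pullback of pairings along a morphism of complexes. -/
def GradedPairing.pullback (f : Q ⟶ P) (σ : GradedPairing P) : GradedPairing Q :=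
  fun i j h => (σ i j h).compl₁₂ (mapH f i) (mapH f j)

variable (P) in
/-- The sum of the cohomology groups in the degrees which belong to `S`. -/
def Hpart (S : Set ℤ) : Type v := ⨁ i : S, H P i

instance (S : Set ℤ) : AddCommGroup (Hpart P S) :=
  inferInstanceAs (AddCommGroup (⨁ i : S, H P i))

instance (S : Set ℤ) : Module ℚ (Hpart P S) := inferInstanceAs (Module ℚ (⨁ i : S, H P i))

variable (P) in
/-- The action of `G` on a sum of cohomology groups. -/
def repPart (S : Set ℤ) : Representation ℚ G (Hpart P S) :=
  (Representation.directSum fun i : S => repH P i : Representation ℚ G (⨁ i : S, H P i))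

variable (P) in
/-- The class of a cycle in a sum of cohomology groups. -/
def classPart (S : Set ℤ) (i : S) : Zc P i →ₗ[ℚ] Hpart P S :=
  (DirectSum.lof ℚ S (fun i : S => H P i) i).comp (classH P i)

theorem classPart_rep (S : Set ℤ) (i : S) (g : G) (z : Zc P i) :
    classPart P S i (repZ P i g z) = repPart P S g (classPart P S i z) :=
  (DirectSum.lmap_lof (fun i : S => repH P i g) i (classH P i z)).symm

/-- The form on a sum of cohomology groups defined by graded pairings: `∑ σⁱ(xᵢ, y₋ᵢ)`. -/
def GradedPairing.part (σ : GradedPairing P) (S : Set ℤ) (hS : ∀ i ∈ S, -i ∈ S) :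
    LinearMap.BilinForm ℚ (Hpart P S) :=
  (DirectSum.toModule ℚ S ((⨁ i : S, H P i) →ₗ[ℚ] ℚ) fun i =>
    (σ i (-i) (add_neg_cancel _)).compl₂
      (DirectSum.component ℚ S (fun j : S => H P j) ⟨-i, hS i i.2⟩) :
    LinearMap.BilinForm ℚ (⨁ i : S, H P i))

/-! ## Invariants of tensor products -/

section Invariants

variable {V V' : Type v} [AddCommGroup V] [Module ℚ V] [AddCommGroup V'] [Module ℚ V']
  {n : ℕ} (ρ : Representation ℂ G (Fin n → ℂ))

/-- The diagonal action of `G` on `W ⊗ V`. -/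
def tensorRep (τ : Representation ℚ G V) : Representation ℂ G ((Fin n → ℂ) ⊗[ℚ] V) where
  toFun g := TensorProduct.AlgebraTensorModule.map (ρ g) (τ g)
  map_one' := by rw [map_one, map_one]; exact TensorProduct.AlgebraTensorModule.map_id
  map_mul' g h := by
    rw [map_mul, map_mul]; exact TensorProduct.AlgebraTensorModule.map_comp _ _ _ _

/-- The space `(W ⊗ V)^G`. -/
abbrev Inv (τ : Representation ℚ G V) : Submodule ℂ ((Fin n → ℂ) ⊗[ℚ] V) :=
  (tensorRep ρ τ).invariants

/-- The map `(W ⊗ V)^G → (W ⊗ V')^G` induced by an equivariant map. -/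
def invMap {τ : Representation ℚ G V} {τ' : Representation ℚ G V'} (f : V →ₗ[ℚ] V')
    (hf : ∀ g x, f (τ g x) = τ' g (f x)) : Inv ρ τ →ₗ[ℂ] Inv ρ τ' :=
  (TensorProduct.AlgebraTensorModule.map (LinearMap.id : (Fin n → ℂ) →ₗ[ℂ] (Fin n → ℂ))
    f).restrict fun x hx g => by
      have key : ∀ y : (Fin n → ℂ) ⊗[ℚ] V,
          tensorRep ρ τ' g (TensorProduct.AlgebraTensorModule.map
              (LinearMap.id : (Fin n → ℂ) →ₗ[ℂ] (Fin n → ℂ)) f y) =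
            TensorProduct.AlgebraTensorModule.map
              (LinearMap.id : (Fin n → ℂ) →ₗ[ℂ] (Fin n → ℂ)) f (tensorRep ρ τ g y) := by
        intro y
        induction y using TensorProduct.induction_on with
        | zero => simp
        | tmul a b => exact congrArg (ρ g a ⊗ₜ[ℚ] ·) (hf g b).symm
        | add a b ha hb => simp only [map_add, ha, hb]
      rw [key, hx g]

/-- The element `∑_g g w ⊗ g u` of `(W ⊗ V)^G`. -/
def rG [Fintype G] (τ : Representation ℚ G V) (w : Fin n → ℂ) (u : V) : Inv ρ τ :=
  ⟨∑ g : G, ρ g w ⊗ₜ[ℚ] τ g u, fun h => by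
    rw [map_sum]
    refine Fintype.sum_equiv (Equiv.mulLeft h) _ _ fun g => ?_
    change ρ h (ρ g w) ⊗ₜ[ℚ] τ h (τ g u) = ρ (h * g) w ⊗ₜ[ℚ] τ (h * g) u
    rw [map_mul, map_mul]; rfl⟩

/-- The restriction `(κ ⊗ β)^G` of the form `κ ⊗ β` to `(W ⊗ V)^G`. -/
def invForm (τ : Representation ℚ G V) (κ : LinearMap.BilinForm ℂ (Fin n → ℂ))
    (β : LinearMap.BilinForm ℚ V) : LinearMap.BilinForm ℂ (Inv ρ τ) :=
  LinearMap.BilinForm.restrict (LinearMap.BilinForm.tmul κ β) (Inv ρ τ)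

end Invariants

end Complexes

/-! ## Pfaffians -/

section Pfaffians

variable {K : Type*} [Field K] {V : Type*} [AddCommGroup V] [Module K V]

/-- A hyperbolic basis: the pairs `u (a, 0)`, `u (a, 1)` are hyperbolic pairs which are orthogonal
to each other. -/
def IsHyperbolic {α : Type*} (h : LinearMap.BilinForm K V)
    (u : Module.Basis (α × Fin 2) K V) : Prop :=
  (∀ a b, h (u (a, 0)) (u (b, 0)) = 0) ∧ (∀ a b, h (u (a, 1)) (u (b, 1)) = 0) ∧
    (∀ a, h (u (a, 0)) (u (a, 1)) = 1) ∧ (∀ a b, a ≠ b → h (u (a, 0)) (u (b, 1)) = 0)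

/-- The number `z` is the value of the functional `Pf_h` at the exterior product of the bivectors
`v (a, 0) ∧ v (a, 1)`; here `Pf_h` is the linear functional on `det V` with value one at the
exterior product of a hyperbolic basis. -/
def IsPfValue {α : Type*} (h : LinearMap.BilinForm K V) (v : α × Fin 2 → V) (z : K) : Prop :=
  ∃ (_ : Fintype α) (_ : DecidableEq α) (u : Module.Basis (α × Fin 2) K V),
    IsHyperbolic h u ∧ z = u.det v

open Classical in
/-- The value of `Pf_h` at the exterior product of the bivectors `v (a, 0) ∧ v (a, 1)`, for a
non-degenerate alternating form `h` on a space of dimension `2 |α|`. It does not depend on the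
hyperbolic basis, symplectic automorphisms having determinant one. -/
def Pf {α : Type*} (h : LinearMap.BilinForm K V) (v : α × Fin 2 → V) : K :=
  if hz : ∃ z, IsPfValue h v z then hz.choose else 0

open Classical in
/-- The Pfaffian `det B` of a self-adjoint automorphism `A` with respect to an alternating form `h`,
where `h (A x, y) = h (B x, B y)`. -/
def pfEnd (h : LinearMap.BilinForm K V) (A : V →ₗ[K] V) : K :=
  if hB : ∃ B : V →ₗ[K] V, ∀ x y, h (A x) y = h (B x) (B y) then LinearMap.det hB.choose else 0

end Pfaffians

/-! ## Symplectic representations -/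

section Symplectic

variable (G : Type u) [Group G]

/-- A symplectic representation with an invariant form and a hyperbolic basis. -/
structure SymplecticRep where
  n : ℕ
  ρ : Representation ℂ G (Fin n → ℂ)
  κ : LinearMap.BilinForm ℂ (Fin n → ℂ)
  alt : κ.IsAlt
  nondeg : κ.Nondegenerate
  inv : ∀ g x y, κ (ρ g x) (ρ g y) = κ x y
  k : ℕ
  w : Module.Basis (Fin k × Fin 2) ℂ (Fin n → ℂ)
  hyp : IsHyperbolic κ w

variable {G} in
theorem SymplecticRep.isSymplectic (W : SymplecticRep G) : IsSymplectic W.ρ :=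
  ⟨W.κ, W.alt, W.nondeg, W.inv⟩

/-- A family of symplectic representations whose characters form a basis of `RGs G`. -/
structure SymplecticFamily where
  N : ℕ
  W : Fin N → SymplecticRep G
  θ : Module.Basis (Fin N) ℤ (RGs G)
  θ_eq : ∀ m, θ m = charRs (W m).ρ (W m).isSymplectic

variable {G}

/-- The `m`-th character of the family, as an element of the multiplicative group `RGs G`. -/
def SymplecticFamily.elem (F : SymplecticFamily G) (m : Fin F.N) : Multiplicative (RGs G) :=
  Multiplicative.ofAdd (F.θ m)

end Symplectic

/-! ## Local bases -/

section Euler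

variable {G : Type u} [Group G] {P Q : CochainComplex (ModuleCat.{v} (MonoidAlgebra ℤ G)) ℤ}

/-- The map `ℤₚ ⊗ M → ℚₚ ⊗ M`. -/
def fromZp (p : Nat.Primes) (M : Type v) [AddCommGroup M] :
    ℤ_[(p : ℕ)] ⊗[ℤ] M →ₗ[ℤ] ℚ_[(p : ℕ)] ⊗[ℤ] M :=
  LinearMap.rTensor M (algebraMap ℤ_[(p : ℕ)] ℚ_[(p : ℕ)]).toAddMonoidHom.toIntLinearMap

/-- The map `ℚ ⊗ M → ℚₚ ⊗ M`. -/
def fromQ (p : Nat.Primes) (M : Type v) [AddCommGroup M] :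
    ℚ ⊗[ℤ] M →ₗ[ℤ] ℚ_[(p : ℕ)] ⊗[ℤ] M :=
  LinearMap.rTensor M (algebraMap ℚ ℚ_[(p : ℕ)]).toAddMonoidHom.toIntLinearMap

variable (P) in
/-- Bases of the terms of a complex over `ℚ[G]` and over the rings `ℤₚ[G]`, and the invertible
matrices over `ℚₚ[G]` which transform the latter into the former. -/
structure LocalBases where
  r : ℤ → ℕ
  a0 : ∀ i, Fin (r i) → QT P i
  a0_basis : ∀ i, IsGroupBasis (repQ P i) (a0 i)
  ap : ∀ (p : Nat.Primes) (i : ℤ), Fin (r i) → ℤ_[(p : ℕ)] ⊗[ℤ] P.X i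
  ap_basis : ∀ (p : Nat.Primes) (i : ℤ),
    IsGroupBasis (G := G) (repOver ℤ_[(p : ℕ)] (P.X i)) (ap p i)
  lam : ∀ (p : Nat.Primes) (i : ℤ),
    (Matrix (Fin (r i)) (Fin (r i)) (MonoidAlgebra ℚ_[(p : ℕ)] G))ˣ
  lam_spec : ∀ (p : Nat.Primes) (i : ℤ) (j : Fin (r i)),
    ∑ k, (repOver (G := G) ℚ_[(p : ℕ)] (P.X i)).asAlgebraHom ((lam p i).1 j k)
      (fromZp p (P.X i) (ap p i k)) = fromQ p (P.X i) (a0 i j)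

/-- `∏ᵢ Det(λₚⁱ)(ρ)^((-1)ⁱ)`, with values in `(ℚₚ ⊗ ℂ)ˣ`. -/
def LocalBases.detLam (L : LocalBases P) (p : Nat.Primes) {n : ℕ}
    (ρ : Representation ℂ G (Fin n → ℂ)) : (LocalC p)ˣ :=
  ∏ᶠ i : ℤ, (detGL ℚ_[(p : ℕ)] (localInclC p) ρ (L.lam p i)) ^ ((i.negOnePow : ℤˣ) : ℤ)

/-! ## The hermitian Euler characteristic -/

variable [Fintype G]

/-- The basis `r_G(a_j ⊗ w_n)` of `(W ⊗ ℚPⁱ)^G`. -/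
def bVec (W : SymplecticRep G) (L : LocalBases P) (i : ℤ) (x : (Fin (L.r i) × Fin W.k) × Fin 2) :
    Inv W.ρ (repQ P i) :=
  rG W.ρ (repQ P i) (W.w (x.1.2, x.2)) (L.a0 i x.1.1)

/-- Bases of the spaces `(W ⊗ ℚPⁱ)^G` adapted to the differentials. The basis in degree `i`
has a part of `2 s (i - 1)` vectors which are the images of the third part of the basis in degree
`i - 1`, a part of `2 t i` cycles, and a part of `2 s i` other vectors. -/
structure AdaptedBases (W : SymplecticRep G) (L : LocalBases P) where
  s : ℤ → ℕ
  t : ℤ → ℕ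
  v : ∀ i, Module.Basis ((Fin (s (i - 1)) ⊕ Fin (t i) ⊕ Fin (s i)) × Fin 2) ℂ (Inv W.ρ (repQ P i))
  y : ∀ i, Fin (t i) × Fin 2 → Inv W.ρ (repZ P i)
  v_cycle : ∀ i a ε,
    invMap W.ρ (τ' := repQ P i) (Zc P i).subtype (fun _ _ => rfl) (y i (a, ε)) =
      v i (Sum.inr (Sum.inl a), ε)
  v_boundary : ∀ i a ε,
    invMap W.ρ (τ' := repQ P i) (dQ P (i - 1) i) (extQ_rep _) (v (i - 1) (Sum.inr (Sum.inr a), ε)) =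
      v i (Sum.inl a, ε)
  e : ∀ i, Fin (L.r i) × Fin W.k ≃ Fin (s (i - 1)) ⊕ Fin (t i) ⊕ Fin (s i)

/-- The classes of the cycles of an adapted basis in `(W ⊗ H^S)^G`, where `H^S` is the sum of the
cohomology groups in the degrees which belong to `S`. -/
def AdaptedBases.classes {W : SymplecticRep G} {L : LocalBases P} (E : AdaptedBases W L)
    (S : Set ℤ) (x : (Σ i : S, Fin (E.t i)) × Fin 2) : Inv W.ρ (repPart P S) :=
  invMap W.ρ (τ := repZ P x.1.1) (τ' := repPart P S) (classPart P S x.1.1)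
    (classPart_rep S x.1.1) (E.y x.1.1 (x.1.2, x.2))

/-- The value of `Pf_{(σ ⊗ κ)^G}` at `ξ (⊗ᵢ (∧ b_{jn})^((-1)ⁱ))`, where `ξ` is the canonical
isomorphism from the determinant of a complex to that of its cohomology. The isomorphism `ξ` is
expressed through adapted bases: it maps `⊗ᵢ (∧ vᵢ)^((-1)ⁱ)` to `⊗ᵢ (∧ yᵢ)^((-1)ⁱ)`, where `vᵢ` is
the basis in degree `i` and `yᵢ` is the set of classes of its middle part. All spaces have even
dimension, so there are no signs. -/
def AdaptedBases.pfValue {W : SymplecticRep G} {L : LocalBases P} (E : AdaptedBases W L)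
    (σ : GradedPairing P) : ℂ :=
  (∏ᶠ i : ℤ, ((E.v i).det fun x => bVec W L i ((E.e i).symm x.1, x.2)) ^
      ((i.negOnePow : ℤˣ) : ℤ)) *
    Pf (invForm W.ρ (repPart P {i | Even i}) W.κ (σ.part {i | Even i} fun _ h => h.neg))
      (E.classes {i | Even i}) *
    (Pf (invForm W.ρ (repPart P {i | Odd i}) W.κ (σ.part {i | Odd i} fun _ h => h.neg))
      (E.classes {i | Odd i}))⁻¹

/-- The class `c` is the hermitian Euler characteristic `χ_Hˢ(P, σ)`: for suitable choices it is
represented by the character function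
`θ_m ↦ ∏ₚ Det(λₚⁱ)(θ_m)^((-1)ⁱ) × Pf_{(σ ⊗ κ_m)^G}(ξ_m (⊗ᵢ (∧ b_{jn})^((-1)ⁱ)))`. -/
def IsHermitianEulerChar (P : CochainComplex (ModuleCat.{v} (MonoidAlgebra ℤ G)) ℤ)
    (σ : GradedPairing P) (c : Hs G) : Prop :=
  ∃ (F : SymplecticFamily G) (L : LocalBases P) (E : ∀ m, AdaptedBases (F.W m) L)
    (f : equivHom (RGs G) FinIdele galIdele) (g : Multiplicative (RGs G) →* ℝˣ),
    (∀ m p, ideleAt p (f.1 (F.elem m)) = L.detLam p (F.W m).ρ) ∧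
    (∀ m, (((g (F.elem m) : ℝˣ) : ℝ) : ℂ) = (E m).pfValue σ) ∧
    c = QuotientGroup.mk' (HsDen G) (f, g)

/-! ## The hermitian class defined by lifted pairings -/

/-- Decompositions `ℚQⁱ = Bⁱ ⊕ Hⁱ ⊕ Uⁱ` and pairings on the terms of `ℚ ⊗ Q` which lift pairings
`τ` on its cohomology. -/
structure PairingLift (τ : GradedPairing Q) where
  Hc : ∀ i, Submodule ℚ (QT Q i)
  U : ∀ i, Submodule ℚ (QT Q i)
  Hc_stable : ∀ i g, ∀ x ∈ Hc i, repQ Q i g x ∈ Hc i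
  U_stable : ∀ i g, ∀ x ∈ U i, repQ Q i g x ∈ U i
  Hc_le : ∀ i, Hc i ≤ Zc Q i
  disjoint_B_Hc : ∀ i, Disjoint (Bc Q i) (Hc i)
  isCompl_U : ∀ i, IsCompl (Bc Q i ⊔ Hc i) (U i)
  disjoint_U : ∀ i, Disjoint (U i) (Zc Q i)
  map_U : ∀ i, (U (i - 1)).map (dQ Q (i - 1) i) = Bc Q i
  p : ∀ i j : ℤ, i + j = 0 → QT Q i →ₗ[ℚ] QT Q j →ₗ[ℚ] ℚ
  symm : ∀ (i j : ℤ) (h : i + j = 0) (h' : j + i = 0) (x : QT Q i) (y : QT Q j),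
    p i j h x y = p j i h' y x
  inv : ∀ (i j : ℤ) (h : i + j = 0) (g : G) (x : QT Q i) (y : QT Q j),
    p i j h (repQ Q i g x) (repQ Q j g y) = p i j h x y
  nondeg : ∀ (i j : ℤ) (h : i + j = 0), (p i j h).Nondegenerate
  orth_B_B : ∀ (i j : ℤ) (h : i + j = 0), ∀ x ∈ Bc Q i, ∀ y ∈ Bc Q j, p i j h x y = 0
  orth_B_H : ∀ (i j : ℤ) (h : i + j = 0), ∀ x ∈ Bc Q i, ∀ y ∈ Hc j, p i j h x y = 0
  orth_U_H : ∀ (i j : ℤ) (h : i + j = 0), ∀ x ∈ U i, ∀ y ∈ Hc j, p i j h x y = 0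
  orth_U_U : ∀ (i j : ℤ) (h : i + j = 0), ∀ x ∈ U i, ∀ y ∈ U j, p i j h x y = 0
  lifts : ∀ (i j : ℤ) (h : i + j = 0) (x : Zc Q i) (y : Zc Q j), (x : QT Q i) ∈ Hc i →
    (y : QT Q j) ∈ Hc j → p i j h x y = τ i j h (classH Q i x) (classH Q j y)
  adjoint : ∀ (i j : ℤ) (h : i + j = 0) (h' : (i - 1) + (j + 1) = 0), ∀ u ∈ U (i - 1), ∀ u' ∈ U j,
    p (i - 1) (j + 1) h' u (dQ Q j (j + 1) u') = p i j h (dQ Q (i - 1) i u) u'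

/-- The matrix over `ℚ[G]` of the group ring valued form `∑_g B(g x, y) g⁻¹` for the family `a`. -/
def groupGram {V : Type*} [AddCommGroup V] [Module ℚ V] {ι : Type*} (τ : Representation ℚ G V)
    (B : LinearMap.BilinForm ℚ V) (a : ι → V) : Matrix ι ι (MonoidAlgebra ℚ G) :=
  Matrix.of fun j k => ∑ g : G, MonoidAlgebra.single g⁻¹ (B (τ g (a j)) (a k))

/-- The action of a matrix over `ℚ[G]` on a sum of copies of a representation. -/
def matAct {ι : Type*} [Fintype ι] {n : ℕ} (ρ : Representation ℂ G (Fin n → ℂ))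
    (M : Matrix ι ι (MonoidAlgebra ℚ G)) : (ι → Fin n → ℂ) →ₗ[ℂ] (ι → Fin n → ℂ) :=
  LinearMap.pi fun j => ∑ k, (Matrix.toLin' (ringRep ℚ (RingHom.id ℂ) ρ (M j k))).comp
    (LinearMap.proj k)

/-- The orthogonal sum of copies of a form. -/
def copies {n : ℕ} (ι : Type*) [Fintype ι] (κ : LinearMap.BilinForm ℂ (Fin n → ℂ)) :
    LinearMap.BilinForm ℂ (ι → Fin n → ℂ) :=
  ∑ j : ι, κ.compl₁₂ (LinearMap.proj j) (LinearMap.proj j)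

/-- The Pfaffian of `T_W` of the group ring valued Gram matrix of the form `B` for the family `a`. -/
def pfGram {V : Type*} [AddCommGroup V] [Module ℚ V] {ι : Type*} [Fintype ι] (W : SymplecticRep G)
    (τ : Representation ℚ G V) (B : LinearMap.BilinForm ℚ V) (a : ι → V) : ℂ :=
  pfEnd (copies ι W.κ) (matAct W.ρ (groupGram τ B a))

/-- The form `pⁱ` on `ℚQⁱ ⊕ ℚQ⁻ⁱ`. -/
def PairingLift.sumForm {τ : GradedPairing Q} (D : PairingLift τ) (i : ℤ) :
    LinearMap.BilinForm ℚ (QT Q i × QT Q (-i)) :=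
  (D.p i (-i) (add_neg_cancel i)).compl₁₂ (LinearMap.fst ℚ _ _) (LinearMap.snd ℚ _ _) +
    (D.p (-i) i (neg_add_cancel i)).compl₁₂ (LinearMap.snd ℚ _ _) (LinearMap.fst ℚ _ _)

/-- `∏_{i ≥ 0} pf(T_W(pⁱ~))^((-1)ⁱ)`, where `p⁰` is a form on `ℚQ⁰`, and `pⁱ` is a form on
`ℚQⁱ ⊕ ℚQ⁻ⁱ` if `i > 0`. -/
def PairingLift.pfProd {τ : GradedPairing Q} (D : PairingLift τ) (L : LocalBases Q)
    (W : SymplecticRep G) : ℂ :=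
  pfGram W (repQ Q 0) (D.p 0 0 (add_zero 0)) (L.a0 0) *
    ∏ᶠ i : {i : ℤ // 0 < i},
      (pfGram W ((repQ Q i).prod (repQ Q (-i))) (D.sumForm i)
        (Sum.elim (fun j => (L.a0 i j, 0)) (fun j => (0, L.a0 (-i) j)))) ^
        (((i : ℤ).negOnePow : ℤˣ) : ℤ)

/-- The class `d` is the hermitian class `d(P, τ)` in `HCl(ℤ[G])`: after the addition of a suitable
acyclic perfect complex to `P`, for suitable choices, it is represented by
`∏ₚ Det(λₚⁱ)^(-(-1)ⁱ) × 1 × (θ_m ↦ ∏_{i ≥ 0} pf(T_m(pⁱ~))^((-1)ⁱ))`. -/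
def IsFroehlichClass (P : CochainComplex (ModuleCat.{v} (MonoidAlgebra ℤ G)) ℤ)
    (τ : GradedPairing P) (d : HCl G) : Prop :=
  ∃ (A : CochainComplex (ModuleCat.{v} (MonoidAlgebra ℤ G)) ℤ) (_ : IsPerfect A) (_ : A.Acyclic)
    (D : PairingLift (τ.pullback (dirSumFst P A))) (F : SymplecticFamily G)
    (L : LocalBases (dirSum P A))
    (f : equivHom (RG G) FinIdele galIdele) (h : equivHom (RGs G) Qbarˣ galUnits),
    (∀ (n : ℕ) (ρ : Representation ℂ G (Fin n → ℂ)) (p : Nat.Primes),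
      ideleAt p (f.1 (Multiplicative.ofAdd (charR ρ))) = (L.detLam p ρ)⁻¹) ∧
    (∀ m, ((h.1 (F.elem m) : Qbar) : ℂ) = D.pfProd L (F.W m)) ∧
    d = QuotientGroup.mk' (HClDen G) (f, 1, h)

end Euler

end HermEuler

end

noncomputable section
namespace HermEuler

set_option linter.unusedSectionVars false
open Matrix
open Function (update update_of_ne Surjective mulSupport)
open Finset (prod_congr sum_congr prod_ne_zero_iff mem_univ mul_sum sum_mul univ sum_comm smul_sum
  prod_erase_mul sum_eq_single prod_const card_univ sum_add_distrib sum_eq_zero)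
open MultilinearMap (alternatization)
open Pi (basisFun)
open LinearEquiv (ofBijective)
open Fintype (sum_equiv card equivOfCardEq equivFin card_ne_zero card_fin sum_sum_type sum_prod_type
  card_congr card_prod card_pos ofFinite)
open Submodule (span smul_mem subset_span mem_top)
open Module (Basis finrank finrank_eq_card_basis finBasis)
open LinearMap.BilinForm (IsAlt toMatrix_apply)
open LinearMap (BilinForm ker range mem_ker det_toMatrix fst snd toMatrix' rTensor toSpanSingleton
  compl₁₂_apply)
open RingHom (map_det mapMatrix_apply)
open AddMonoidHom (map_trace)
open Algebra (adjoin)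
open MonoidAlgebra (lift_apply ofCoeff coeff_mapRingHom coeff_sum coeff_smul)
open Equiv (sumProdDistrib sumComm mulLeft coe_mulLeft)
open AddSubgroup (closure_induction)
open Subtype (val)
open Units (val_mul)
open Nat (Primes cast_ne_zero)
open PadicInt.Coe (ringHom)
open TensorProduct (induction_on smul_tmul add_tmul finsuppRight smul_tmul' tmul_add tmul_zero
  tmul_smul)
open Module.Projective (of_split)
open Submodule.Quotient (mk_surjective)
open IsLocalRing (maximalIdeal)
open Module.Finite (fg_top)
open PadicInt (toZMod)
open TensorProduct.AlgebraTensorModule (cancelBaseChange cancelBaseChange_tmul)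
open Finsupp (coe_finsetSum)
open Basis (repr_self)
open Multiplicative (ofAdd)
open Sum (inl inr)
open scoped MonoidAlgebra

/-- Complex matrix representations. -/
abbrev CRep (G : Type*) [Group G] (n : ℕ) := Representation ℂ G (Fin n → ℂ)

/-- Matrices of bilinear forms for a basis which consists of pairs. -/
abbrev PairMatrix (α R : Type*) := Matrix (α × Fin 2) (α × Fin 2) R

variable {G : Type u} [Group G] [Fintype G] {P Q A : CochainComplex (ModuleCat.{v} ℤ[G]) ℤ}

local notation "repO" => repOver (G := G)

section

variable {α : Type*} [DecidableEq α] {R : Type*} [CommRing R]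

variable (α R) in
/-- The standard alternating matrix. -/
def stdJ : PairMatrix α R :=
  kronecker (1 : Matrix α α R) !![0, 1; -1, 0]

lemma stdJ_apply (a b : α) (ε δ : Fin 2) :
    stdJ α R (a, ε) (b, δ) = if a = b then (!![0, 1; -1, 0] : Matrix (Fin 2) (Fin 2) R) ε δ else 0 := by
  simp [stdJ, Matrix.kroneckerMap_apply, one_apply]

end

section

open Matrix Equiv

variable {α : Type*} [Fintype α] [DecidableEq α] {R : Type*} [CommRing R]

/-- The multilinear map `v ↦ ∏ₐ K(v (a, 0), v (a, 1))`. -/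
def pairProd (K : PairMatrix α R) :
    MultilinearMap R (fun _ : α × Fin 2 => (α × Fin 2 → R)) R where
  toFun v := ∏ a, v (a, 0) ⬝ᵥ K *ᵥ v (a, 1)
  map_update_add' := by
    intro _ v ⟨a, ε⟩ x y
    simp only [Fintype.prod_eq_mul_prod_compl a]
    have h : ∀ z, ∏ i ∈ {a}ᶜ, update v (a, ε) z (i, 0) ⬝ᵥ
        K *ᵥ update v (a, ε) z (i, 1) = ∏ i ∈ {a}ᶜ, v (i, 0) ⬝ᵥ K *ᵥ v (i, 1) := by
      intro z
      refine prod_congr rfl fun i hi => ?_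
      have hi : i ≠ a := by simpa using hi
      rw [update_of_ne (by simp [hi]), update_of_ne (by simp [hi])]
    simp only [h]
    fin_cases ε
    · simp [update_of_ne, add_mul]
    · simp [update_of_ne, add_mul, Matrix.mulVec_add]
  map_update_smul' := by
    intro _ v ⟨a, ε⟩ c x
    simp only [Fintype.prod_eq_mul_prod_compl a]
    have h : ∀ z, ∏ i ∈ {a}ᶜ, update v (a, ε) z (i, 0) ⬝ᵥ
        K *ᵥ update v (a, ε) z (i, 1) = ∏ i ∈ {a}ᶜ, v (i, 0) ⬝ᵥ K *ᵥ v (i, 1) := by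
      intro z
      refine prod_congr rfl fun i hi => ?_
      have hi : i ≠ a := by simpa using hi
      rw [update_of_ne (by simp [hi]), update_of_ne (by simp [hi])]
    simp only [h]
    fin_cases ε
    · simp [update_of_ne, mul_assoc]
    · simp [update_of_ne, mul_assoc, Matrix.mulVec_smul]

/-- The sum `∑_σ sgn(σ) ∏ₐ K(σ(a, 0), σ(a, 1))`, a multiple of the Pfaffian. -/
def pfSum (K : PairMatrix α R) : R :=
  ∑ σ : Perm (α × Fin 2), Perm.sign σ • ∏ a, K (σ (a, 0)) (σ (a, 1))

lemma pfSum_conj (C K : PairMatrix α R) :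
    pfSum (C * K * Cᵀ) = C.det * pfSum K := by
  have h : ∀ D : PairMatrix α R,
      pfSum (D * K * Dᵀ) = alternatization (pairProd K) D.row := by
    intro D
    rw [MultilinearMap.alternatization_apply]
    refine sum_congr rfl fun σ _ => congrArg _ (prod_congr rfl fun a _ => ?_)
    rw [Matrix.mul_assoc]
    simp only [mul_apply, dotProduct, mulVec, transpose_apply, Matrix.row_def]
  have h1 := h 1
  rw [Matrix.one_mul, Matrix.transpose_one, Matrix.mul_one] at h1
  rw [h, h1, AlternatingMap.eq_smul_basis_det (basisFun R (α × Fin 2))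
    (alternatization (pairProd K))]
  simp only [Pi.basisFun_det, AlternatingMap.smul_apply, smul_eq_mul]
  have h2 : (1 : PairMatrix α R).row = basisFun R (α × Fin 2) := by
    ext i j
    simp [one_apply, Pi.single_apply, eq_comm]
  have h3 : (Matrix.detRowAlternating : (α × Fin 2 → R) [⋀^α × Fin 2]→ₗ[R] R) C.row = C.det := rfl
  rw [h3, h2, ← Pi.basisFun_det, Basis.det_self]
  ring

lemma stdJ_det : (stdJ α R).det = 1 := by
  simp [stdJ, det_kronecker]

lemma stdJ_map {S : Type*} [CommRing S] (f : R →+* S) : (stdJ α R).map f = stdJ α S := by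
  ext ⟨a, ε⟩ ⟨b, δ⟩
  rw [map_apply, stdJ_apply, stdJ_apply]
  split_ifs
  · fin_cases ε <;> fin_cases δ <;> simp
  · simp

lemma pfSum_map {S : Type*} [CommRing S] (f : R →+* S) (K : PairMatrix α R) :
    pfSum (K.map f) = f (pfSum K) := by
  simp only [pfSum, map_sum, Units.smul_def, map_zsmul, map_prod, map_apply]

lemma sign_mul_prod_stdJ (σ : Perm (α × Fin 2)) (h : ∏ a, stdJ α ℤ (σ (a, 0)) (σ (a, 1)) ≠ 0) :
    Perm.sign σ • ∏ a, stdJ α ℤ (σ (a, 0)) (σ (a, 1)) = 1 := by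
  have h1 : ∀ a, (σ (a, 0)).1 = (σ (a, 1)).1 ∧ (σ (a, 0)).2 ≠ (σ (a, 1)).2 := by
    intro a
    have := prod_ne_zero_iff.1 h a (mem_univ a)
    rw [← Prod.mk.eta (p := σ (a, 0)), ← Prod.mk.eta (p := σ (a, 1)), stdJ_apply] at this
    have h2 : (σ (a, 0)).1 = (σ (a, 1)).1 := by
      by_contra hne
      simp [hne] at this
    refine ⟨h2, fun h3 => this ?_⟩
    rw [if_pos h2, h3]
    generalize (σ (a, 1)).2 = δ
    fin_cases δ <;> simp
  let f : α → Perm (Fin 2) := fun a => if (σ (a, 0)).2 = 0 then 1 else Equiv.swap 0 1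
  have hf : ∀ a ε, (σ (a, ε)).2 = f a ε := by
    intro a ε
    have key : ∀ x y : Fin 2, x ≠ y → x = (if x = 0 then (1 : Perm (Fin 2)) else Equiv.swap 0 1) 0 ∧
        y = (if x = 0 then (1 : Perm (Fin 2)) else Equiv.swap 0 1) 1 := by decide
    have := key _ _ (h1 a).2
    fin_cases ε
    · exact this.1
    · exact this.2
  have hτ : ∀ a ε, (σ (a, ε)).1 = (σ (a, 0)).1 := by
    intro a ε
    fin_cases ε
    · rfl
    · exact (h1 a).1.symm
  have hsurj : Surjective fun a => (σ (a, 0)).1 := by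
    intro b
    obtain ⟨⟨a, ε⟩, ha⟩ := σ.surjective (b, 0)
    exact ⟨a, by simp only [← hτ a ε, ha]⟩
  let τ : Perm α := Equiv.ofBijective _ (Finite.injective_iff_surjective.2 hsurj |> fun hi => ⟨hi, hsurj⟩)
  have hσ : σ = prodCongrLeft (fun _ : Fin 2 => τ) * prodCongrRight f := by
    ext1 ⟨a, ε⟩
    refine Prod.ext ?_ ?_
    · exact hτ a ε
    · exact hf a ε
  have hs : Perm.sign σ = ∏ a, Perm.sign (f a) := by
    rw [hσ, Perm.sign_mul, Perm.sign_prodCongrLeft, Perm.sign_prodCongrRight]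
    simp
  have hp : ∏ a, stdJ α ℤ (σ (a, 0)) (σ (a, 1)) = ∏ a, ((Perm.sign (f a) : ℤˣ) : ℤ) := by
    refine prod_congr rfl fun a _ => ?_
    rw [← Prod.mk.eta (p := σ (a, 0)), ← Prod.mk.eta (p := σ (a, 1)), stdJ_apply, if_pos (h1 a).1,
      hf, hf]
    simp only [f]
    split_ifs <;> simp
  rw [hp, hs, Units.smul_def, smul_eq_mul, Units.coe_prod, ← Finset.prod_mul_distrib]
  exact Finset.prod_eq_one fun a _ => Int.units_coe_mul_self _

lemma pfSum_stdJ_pos : 0 < pfSum (stdJ α ℤ) := by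
  refine Finset.sum_pos' (fun σ _ => ?_) ⟨1, mem_univ _, ?_⟩
  · by_cases h : ∏ a, stdJ α ℤ (σ (a, 0)) (σ (a, 1)) = 0
    · rw [h, smul_zero]
    · rw [sign_mul_prod_stdJ σ h]; exact zero_le_one
  · rw [sign_mul_prod_stdJ 1 (by simp [stdJ_apply])]
    exact one_pos

lemma pfSum_reindex {β : Type*} [Fintype β] [DecidableEq β] (e : β ≃ α)
    (K : PairMatrix α R) :
    pfSum (K.submatrix (fun x : β × Fin 2 => (e x.1, x.2)) (fun x => (e x.1, x.2))) = pfSum K := by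
  let e' : β × Fin 2 ≃ α × Fin 2 := e.prodCongr (Equiv.refl _)
  refine sum_equiv e'.permCongr _ _ fun σ => ?_
  rw [Perm.sign_permCongr]
  congr 1
  refine Fintype.prod_equiv e _ _ fun b => ?_
  simp [e', Equiv.permCongr_apply]
  rfl

variable [Algebra ℚ R]

/-- The Pfaffian of a matrix, normalized to be one at the standard alternating matrix. -/
def pfm (K : PairMatrix α R) : R :=
  algebraMap ℚ R (pfSum (stdJ α ℚ))⁻¹ * pfSum K

lemma pfSum_stdJ_ne_zero : pfSum (stdJ α ℚ) ≠ 0 := by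
  rw [← stdJ_map (Int.castRingHom ℚ), pfSum_map]
  simpa using (pfSum_stdJ_pos (α := α)).ne'

lemma pfm_conj (C K : PairMatrix α R) :
    pfm (C * K * Cᵀ) = C.det * pfm K := by
  rw [pfm, pfSum_conj, pfm]; ring

lemma pfm_stdJ : pfm (stdJ α R) = 1 := by
  rw [pfm, ← stdJ_map (algebraMap ℚ R), pfSum_map, ← map_mul, inv_mul_cancel₀ pfSum_stdJ_ne_zero,
    map_one]

lemma pfm_map {S : Type*} [CommRing S] [Algebra ℚ S] (f : R →+* S)
    (K : PairMatrix α R) : pfm (K.map f) = f (pfm K) := by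
  rw [pfm, pfm, pfSum_map, map_mul, RingHom.map_rat_algebraMap]

lemma pfm_congr_stdJ (C : PairMatrix α R) :
    pfm (C * stdJ α R * Cᵀ) = C.det := by
  rw [pfm_conj, pfm_stdJ, mul_one]

lemma pfm_reindex {β : Type*} [Fintype β] [DecidableEq β] (e : β ≃ α)
    (K : PairMatrix α R) :
    pfm (K.submatrix (fun x : β × Fin 2 => (e x.1, x.2)) (fun x => (e x.1, x.2))) = pfm K := by
  have hJ : (stdJ α ℚ).submatrix (fun x : β × Fin 2 => (e x.1, x.2)) (fun x => (e x.1, x.2)) =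
      stdJ β ℚ := by
    ext ⟨a, ε⟩ ⟨b, δ⟩
    simp [stdJ_apply]
  rw [pfm, pfSum_reindex, pfm, ← hJ, pfSum_reindex]

end

section

variable {K : Type*} [Field K] {V : Type*} [AddCommGroup V] [Module K V]

/-- The Gram matrix of a family of vectors. -/
def gram {ι : Type*} (h : BilinForm K V) (v : ι → V) : Matrix ι ι K :=
  of fun x y => h (v x) (v y)

lemma gram_apply {ι : Type*} (h : BilinForm K V) (v : ι → V) (x y : ι) :
    gram h v x y = h (v x) (v y) := rfl

lemma gram_mul {ι κ : Type*} [Fintype κ] (h : BilinForm K V) (v : κ → V)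
    (C : Matrix ι κ K) : gram h (fun x => ∑ y, C x y • v y) = C * gram h v * Cᵀ := by
  ext x y
  simp only [gram_apply, mul_apply, map_sum, LinearMap.sum_apply, map_smul,
    LinearMap.smul_apply, smul_eq_mul, mul_sum, sum_mul, transpose_apply]
  refine sum_congr rfl fun z _ => sum_congr rfl fun w _ => ?_
  ring

lemma linearIndependent_of_gram {ι : Type*} [Fintype ι] [DecidableEq ι]
    (h : BilinForm K V) (v : ι → V) (hv : (gram h v).det ≠ 0) : LinearIndependent K v := by
  rw [Fintype.linearIndependent_iff]
  intro c hc
  have h1 : c ᵥ* gram h v = 0 := by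
    ext y
    have := congrArg (fun z => h z (v y)) hc
    simpa [Matrix.vecMul, dotProduct, gram_apply] using this
  exact congrFun (Matrix.eq_zero_of_vecMul_eq_zero hv h1)

lemma isHyperbolic_iff_gram {α : Type*} [DecidableEq α] (h : BilinForm K V)
    (ha : h.IsAlt) (u : Basis (α × Fin 2) K V) : IsHyperbolic h u ↔ gram h u = stdJ α K := by
  constructor
  · rintro ⟨h0, h1, h2, h3⟩
    ext ⟨a, ε⟩ ⟨b, δ⟩
    rw [gram_apply]
    simp only [stdJ_apply]
    fin_cases ε <;> fin_cases δ
    · simp [h0]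
    · by_cases hab : a = b
      · subst hab; simp [h2]
      · simp [h3 a b hab, hab]
    · have := ha.neg_eq (u (b, 0)) (u (a, 1))
      by_cases hab : a = b
      · subst hab; simp [← this, h2]
      · simp [← this, h3 b a (Ne.symm hab), hab]
    · simp [h1]
  · intro hg
    have key : ∀ a b ε δ, h (u (a, ε)) (u (b, δ)) = stdJ α K (a, ε) (b, δ) := by
      intro a b ε δ; rw [← hg, gram_apply]
    simp only [IsHyperbolic, key]
    simp only [stdJ_apply]
    refine ⟨by simp, by simp, by simp, fun a b hab => by simp [hab]⟩

lemma exists_gram_eq_stdJ_succ [FiniteDimensional K V] (h : BilinForm K V) (ha : h.IsAlt)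
    (hn : h.Nondegenerate) {k : ℕ} (v : Fin k × Fin 2 → V) (hv : gram h v = stdJ (Fin k) K)
    (hs : span K (Set.range v) ≠ ⊤) :
    ∃ v' : Fin (k + 1) × Fin 2 → V, gram h v' = stdJ (Fin (k + 1)) K := by
  have key : ∀ a b ε δ, h (v (a, ε)) (v (b, δ)) = stdJ (Fin k) K (a, ε) (b, δ) := by
    intro a b ε δ; rw [← hv, gram_apply]
  let π : V → V := fun z => z - ∑ a, (h z (v (a, 1)) • v (a, 0) - h z (v (a, 0)) • v (a, 1))
  have hπ : ∀ z b ε, h (π z) (v (b, ε)) = 0 := by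
    intro z b ε
    simp only [π, map_sub, map_sum, LinearMap.sub_apply, LinearMap.sum_apply, map_smul,
      LinearMap.smul_apply, smul_eq_mul, key]
    simp only [stdJ_apply]
    fin_cases ε <;> simp
  have hπ' : ∀ z b ε, h (v (b, ε)) (π z) = 0 := by
    intro z b ε
    rw [← ha.neg_eq, hπ, neg_zero]
  have hπ2 : ∀ z y, h (π z) (π y) = h (π z) y := by
    intro z y
    conv_lhs => rw [show π y = y - ∑ a, (h y (v (a, 1)) • v (a, 0) - h y (v (a, 0)) • v (a, 1)) from rfl]
    simp only [map_sub, map_sum, map_smul, hπ, smul_zero, sub_zero, Finset.sum_const_zero]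
  obtain ⟨z, hz⟩ : ∃ z, z ∉ span K (Set.range v) := by
    by_contra hcon
    push Not at hcon
    exact hs (eq_top_iff.2 fun z _ => hcon z)
  have hz' : π z ≠ 0 := by
    intro h0
    apply hz
    rw [sub_eq_zero.1 h0]
    refine Submodule.sum_mem _ fun a _ => Submodule.sub_mem _ ?_ ?_ <;>
    exact smul_mem _ _ (subset_span ⟨_, rfl⟩)
  obtain ⟨y, hy⟩ : ∃ y, h (π z) y ≠ 0 := by
    by_contra hcon
    push Not at hcon
    exact hz' (hn.1 _ hcon)
  let x0 := π z
  let x1 := (h (π z) y)⁻¹ • π y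
  have h01 : h x0 x1 = 1 := by
    simp only [x0, x1, map_smul, smul_eq_mul, hπ2]
    exact inv_mul_cancel₀ hy
  refine ⟨fun x => Fin.cases (if x.2 = 0 then x0 else x1) (fun a => v (a, x.2)) x.1, ?_⟩
  ext ⟨a, ε⟩ ⟨b, δ⟩
  rw [gram_apply]
  simp only [stdJ_apply]
  induction a using Fin.cases with
  | zero =>
    induction b using Fin.cases with
    | zero =>
      fin_cases ε <;> fin_cases δ
      · simpa using ha x0
      · simpa using h01
      · simpa [← ha.neg_eq x0 x1] using h01
      · simpa using ha x1
    | succ b =>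
      have : (0 : Fin (k + 1)) ≠ b.succ := (Fin.succ_ne_zero b).symm
      fin_cases ε
      · simp [this, x0, hπ]
      · simp [this, x1, hπ]
  | succ a =>
    induction b using Fin.cases with
    | zero =>
      fin_cases δ
      · simp [x0, hπ']
      · simp [x1, hπ']
    | succ b =>
      simp only [Fin.cases_succ, Fin.succ_inj, key]
      simp only [stdJ_apply]

lemma exists_hyperbolic [FiniteDimensional K V] (h : BilinForm K V) (ha : h.IsAlt)
    (hn : h.Nondegenerate) :
    ∃ (k : ℕ) (u : Basis (Fin k × Fin 2) K V), IsHyperbolic h u := by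
  by_contra hcon
  push Not at hcon
  have hall : ∀ k : ℕ, ∃ v : Fin k × Fin 2 → V, gram h v = stdJ (Fin k) K := by
    intro k
    induction k with
    | zero => exact ⟨fun _ => 0, by ext ⟨a, _⟩; exact a.elim0⟩
    | succ k ih =>
      obtain ⟨v, hv⟩ := ih
      refine exists_gram_eq_stdJ_succ h ha hn v hv fun hs => ?_
      have hli := linearIndependent_of_gram h v (by rw [hv, stdJ_det]; exact one_ne_zero)
      refine hcon k (Basis.mk hli hs.ge) ?_
      rw [isHyperbolic_iff_gram h ha, Basis.coe_mk]
      exact hv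
  obtain ⟨v, hv⟩ := hall (finrank K V + 1)
  have hli := linearIndependent_of_gram h v (by rw [hv, stdJ_det]; exact one_ne_zero)
  have := hli.fintype_card_le_finrank
  simp at this
  omega

variable {α : Type*} [Fintype α] [DecidableEq α]

lemma exists_hyperbolic_of_basis {α : Type*} [Fintype α] (h : BilinForm K V) (ha : h.IsAlt)
    (hn : h.Nondegenerate) (b : Basis (α × Fin 2) K V) :
    ∃ u : Basis (α × Fin 2) K V, IsHyperbolic h u := by
  have := b.finiteDimensional_of_finite
  obtain ⟨k, u, hu⟩ := exists_hyperbolic h ha hn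
  have h1 := finrank_eq_card_basis b
  have h2 := finrank_eq_card_basis u
  rw [h1] at h2
  have h3 : card (Fin k) = card α := by
    simp at h2 ⊢; omega
  let e := equivOfCardEq h3
  refine ⟨u.reindex (e.prodCongr (Equiv.refl _)), ?_⟩
  obtain ⟨h0, h1, h2, h3⟩ := hu
  simp only [IsHyperbolic, Basis.reindex_apply]
  exact ⟨fun a b => h0 _ _, fun a b => h1 _ _, fun a => h2 _,
    fun a b hab => h3 _ _ (fun hc => hab (e.symm.injective hc))⟩

lemma exists_congr_stdJ (A : PairMatrix α K) (ha : A.toBilin'.IsAlt)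
    (hd : A.det ≠ 0) : ∃ C : PairMatrix α K, A = C * stdJ α K * Cᵀ ∧ C.det ≠ 0 := by
  have hn : A.toBilin'.Nondegenerate :=
    LinearMap.BilinForm.nondegenerate_toBilin'_of_det_ne_zero' A hd
  obtain ⟨u, hu⟩ := exists_hyperbolic_of_basis A.toBilin' ha hn (basisFun K _)
  rw [isHyperbolic_iff_gram _ ha] at hu
  have h1 : gram A.toBilin' (basisFun K (α × Fin 2)) = A := by
    ext x y
    rw [gram_apply]
    simp
  let C : PairMatrix α K := of fun x y => u.repr (basisFun K _ x) y
  have h2 : (fun x => ∑ y, C x y • u y) = basisFun K (α × Fin 2) := by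
    ext1 x
    exact u.sum_repr _
  have h3 : A = C * stdJ α K * Cᵀ := by
    rw [← hu, ← gram_mul, h2, h1]
  refine ⟨C, h3, fun h0 => hd ?_⟩
  rw [h3, det_mul, det_mul, h0, zero_mul, zero_mul]

lemma toBilin'_isAlt (A : PairMatrix α ℂ) (h : Aᵀ = -A) :
    A.toBilin'.IsAlt := by
  intro x
  have h1 : ∀ x y, A.toBilin' x y = x ⬝ᵥ A *ᵥ y := fun x y => Matrix.toBilin'_apply' A x y
  have h2 : x ⬝ᵥ A *ᵥ x = - (x ⬝ᵥ A *ᵥ x) := by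
    conv_lhs => rw [dotProduct_mulVec, ← mulVec_transpose, h, dotProduct_comm]
    rw [Matrix.neg_mulVec, dotProduct_neg]
  rw [h1]
  exact self_eq_neg.1 h2

lemma pfm_sq (A : PairMatrix α ℂ) (h : Aᵀ = -A) (hd : A.det ≠ 0) :
    pfm A ^ 2 = A.det := by
  obtain ⟨C, hC, -⟩ := exists_congr_stdJ A (toBilin'_isAlt A h) hd
  rw [hC, pfm_congr_stdJ, det_mul, det_mul, stdJ_det, det_transpose]
  ring

lemma pfm_ne_zero (A : PairMatrix α ℂ) (h : Aᵀ = -A) (hd : A.det ≠ 0) :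
    pfm A ≠ 0 := by
  intro h0
  rw [← pfm_sq A h hd, h0] at hd
  simp at hd

lemma gram_transpose {ι : Type*} (h : BilinForm K V) (ha : h.IsAlt) (v : ι → V) :
    (gram h v)ᵀ = - gram h v := by
  ext x y
  simp only [transpose_apply, gram_apply, Matrix.neg_apply, ha.neg_eq]

variable [CharZero K]

lemma IsPfValue.eq_pfm {α : Type*} [I1 : Fintype α] [I2 : DecidableEq α] (h : BilinForm K V) (ha : h.IsAlt)
    (v : α × Fin 2 → V) {z : K} (hz : IsPfValue h v z) : z = pfm (gram h v) := by
  obtain ⟨i1, i2, u, hu, hz⟩ := hz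
  obtain rfl : i1 = I1 := Subsingleton.elim _ _
  obtain rfl : i2 = I2 := Subsingleton.elim _ _
  subst hz
  rw [isHyperbolic_iff_gram _ ha] at hu
  let C : PairMatrix α K := of fun x y => u.repr (v x) y
  have h2 : (fun x => ∑ y, C x y • u y) = v := by
    ext1 x
    exact u.sum_repr _
  rw [← h2, gram_mul, hu, pfm_congr_stdJ, h2, Basis.det_apply, ← det_transpose]
  rfl

lemma Pf_eq_pfm (h : BilinForm K V) (ha : h.IsAlt) (hn : h.Nondegenerate)
    (b : Basis (α × Fin 2) K V) (v : α × Fin 2 → V) : Pf h v = pfm (gram h v) := by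
  have hex : ∃ z, IsPfValue h v z := by
    obtain ⟨u, hu⟩ := exists_hyperbolic_of_basis h ha hn b
    exact ⟨u.det v, inferInstance, inferInstance, u, hu, rfl⟩
  rw [Pf, dif_pos hex]
  exact IsPfValue.eq_pfm h ha v hex.choose_spec

lemma pfEnd_eq_pfm (h : BilinForm K V) (ha : h.IsAlt) (e : Basis (α × Fin 2) K V)
    (he : IsHyperbolic h e) (A : V →ₗ[K] V) (hA : IsAlt (LinearMap.comp h A))
    (hAn : LinearMap.BilinForm.Nondegenerate (LinearMap.comp h A)) :
    pfEnd h A = pfm (gram (LinearMap.comp h A) e) := by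
  have hB : ∃ B : V →ₗ[K] V, ∀ x y, h (A x) y = h (B x) (B y) := by
    obtain ⟨u, hu⟩ := exists_hyperbolic_of_basis (LinearMap.comp h A) hA hAn e
    rw [isHyperbolic_iff_gram _ ha] at he
    rw [isHyperbolic_iff_gram _ hA] at hu
    refine ⟨u.equiv e (Equiv.refl _), ?_⟩
    have : (LinearMap.comp h A : BilinForm K V) =
        h.compl₁₂ (u.equiv e (Equiv.refl _) : V →ₗ[K] V) (u.equiv e (Equiv.refl _) : V →ₗ[K] V) := by
      refine u.ext fun x => u.ext fun y => ?_
      have h1 := congrFun (congrFun (hu.trans he.symm) x) y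
      simp only [gram_apply] at h1
      simpa using h1
    intro x y
    exact congrFun (congrArg DFunLike.coe (congrFun (congrArg DFunLike.coe this) x)) y
  rw [pfEnd, dif_pos hB]
  have hsp := hB.choose_spec
  generalize hB.choose = B at hsp
  rw [isHyperbolic_iff_gram _ ha] at he
  let C : PairMatrix α K := of fun x y => e.repr (B (e x)) y
  have h2 : (fun x => ∑ y, C x y • e y) = fun x => B (e x) := by
    ext1 x
    exact e.sum_repr _
  have h3 : gram (LinearMap.comp h A) e = gram h (fun x => B (e x)) := by
    ext x y
    exact hsp _ _
  rw [h3, ← h2, gram_mul, he, pfm_congr_stdJ, ← det_transpose,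
    ← det_toMatrix e]
  congr 1
  ext x y
  simp [C, LinearMap.toMatrix_apply]

end

section

lemma det_blockDiagonal' {o : Type*} [Fintype o] [DecidableEq o] {X : o → Type*}
    [∀ i, Fintype (X i)] [∀ i, DecidableEq (X i)] {R : Type*} [CommRing R]
    (B : ∀ i, Matrix (X i) (X i) R) : (blockDiagonal' B).det = ∏ i, (B i).det := by
  let _ : LinearOrder o := LinearOrder.lift' (equivFin o) (equivFin o).injective
  rw [(blockTriangular_blockDiagonal' B).det_fintype]
  refine prod_congr rfl fun i _ => ?_
  let e : X i ≃ {a : Σ i, X i // a.1 = i} :=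
    { toFun := fun x => ⟨⟨i, x⟩, rfl⟩
      invFun := fun a => a.2 ▸ a.1.2
      left_inv := fun x => rfl
      right_inv := by
        rintro ⟨⟨j, x⟩, h⟩
        change j = i at h
        subst h
        rfl }
  rw [← det_submatrix_equiv_self e]
  congr 1
  ext x y
  simp [e, Matrix.toSquareBlock_def, blockDiagonal'_apply_eq]

lemma pfm_sigma {o : Type*} [Fintype o] [DecidableEq o] {X : o → Type*} [∀ i, Fintype (X i)]
    [∀ i, DecidableEq (X i)] (A : Matrix ((Σ i, X i) × Fin 2) ((Σ i, X i) × Fin 2) ℂ)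
    (hA : ∀ x y, x.1.1 ≠ y.1.1 → A x y = 0) (ha : Aᵀ = -A) (hd : A.det ≠ 0) :
    pfm A = ∏ i, pfm (A.submatrix (fun x : X i × Fin 2 => ((⟨i, x.1⟩ : Σ i, X i), x.2))
      (fun x : X i × Fin 2 => ((⟨i, x.1⟩ : Σ i, X i), x.2))) := by
  set B : ∀ i, Matrix (X i × Fin 2) (X i × Fin 2) ℂ := fun i =>
    A.submatrix (fun x : X i × Fin 2 => ((⟨i, x.1⟩ : Σ i, X i), x.2))
      (fun x : X i × Fin 2 => ((⟨i, x.1⟩ : Σ i, X i), x.2)) with hB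
  let e : (Σ i, X i) × Fin 2 ≃ Σ i, (X i × Fin 2) := Equiv.sigmaProdDistrib X (Fin 2)
  have hAB : A = (blockDiagonal' B).submatrix e e := by
    ext ⟨⟨i, x⟩, ε⟩ ⟨⟨j, y⟩, δ⟩
    rw [submatrix_apply]
    change _ = blockDiagonal' B ⟨i, (x, ε)⟩ ⟨j, (y, δ)⟩
    by_cases hij : i = j
    · subst hij
      rw [blockDiagonal'_apply_eq]
      rfl
    · rw [blockDiagonal'_apply_ne _ _ _ hij]
      exact hA _ _ hij
  have hBt : ∀ i, (B i)ᵀ = -B i := by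
    intro i
    ext x y
    exact congrFun (congrFun ha _) _
  have hBd : ∀ i, (B i).det ≠ 0 := by
    rw [hAB, det_submatrix_equiv_self, det_blockDiagonal'] at hd
    exact fun i => prod_ne_zero_iff.1 hd i (mem_univ i)
  choose C hC hCd using fun i => exists_congr_stdJ (B i) (toBilin'_isAlt _ (hBt i)) (hBd i)
  have hJ : stdJ (Σ i, X i) ℂ = (blockDiagonal' fun i => stdJ (X i) ℂ).submatrix e e := by
    ext ⟨⟨i, x⟩, ε⟩ ⟨⟨j, y⟩, δ⟩
    rw [submatrix_apply]
    change _ = blockDiagonal' (fun i => stdJ (X i) ℂ) ⟨i, (x, ε)⟩ ⟨j, (y, δ)⟩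
    by_cases hij : i = j
    · subst hij
      rw [blockDiagonal'_apply_eq, stdJ_apply, stdJ_apply]
      simp
    · rw [blockDiagonal'_apply_ne _ _ _ hij, stdJ_apply, if_neg]
      intro h
      exact hij (congrArg Sigma.fst h)
  have hAC : A = ((blockDiagonal' C).submatrix e e) * stdJ _ ℂ * ((blockDiagonal' C).submatrix e e)ᵀ := by
    rw [hJ, transpose_submatrix, submatrix_mul_equiv, submatrix_mul_equiv,
      Matrix.blockDiagonal'_transpose, ← Matrix.blockDiagonal'_mul, ← Matrix.blockDiagonal'_mul, hAB]
    simp only [← hC]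
  calc pfm A = (blockDiagonal' C).det := by
        conv_lhs => rw [hAC]
        rw [pfm_congr_stdJ, det_submatrix_equiv_self]
    _ = ∏ i, pfm (B i) := by
        rw [det_blockDiagonal']
        refine prod_congr rfl fun i _ => ?_
        rw [hC i, pfm_congr_stdJ]

lemma pfm_of_isEmpty {α : Type*} [Fintype α] [DecidableEq α] [IsEmpty α]
    (A : PairMatrix α ℂ) : pfm A = 1 := by
  rw [← pfm_stdJ (α := α) (R := ℂ)]
  congr 1
  exact Subsingleton.elim _ _

open Classical in
lemma pfm_colour {α Γ : Type*} [Fintype α] [DecidableEq α] (c : α → Γ)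
    (A : PairMatrix α ℂ)
    (hA : ∀ x y, c x.1 ≠ c y.1 → A x y = 0) (ha : Aᵀ = -A) (hd : A.det ≠ 0) :
    pfm A = ∏ᶠ γ, pfm (A.submatrix (fun x : {a // c a = γ} × Fin 2 => (x.1.1, x.2))
      (fun x : {a // c a = γ} × Fin 2 => (x.1.1, x.2))) := by
  set F : Γ → ℂ := fun γ => pfm (A.submatrix (fun x : {a // c a = γ} × Fin 2 => (x.1.1, x.2))
      (fun x : {a // c a = γ} × Fin 2 => (x.1.1, x.2))) with hF
  set s : Finset Γ := univ.image c with hs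
  have hsupp : mulSupport F ⊆ s := by
    intro γ hγ
    by_contra hγ'
    have : IsEmpty {a // c a = γ} := ⟨fun a => hγ' (by rw [hs]; simpa using ⟨a.1, a.2⟩)⟩
    exact hγ (pfm_of_isEmpty _)
  rw [finprod_eq_prod_of_mulSupport_subset F hsupp, ← Finset.prod_coe_sort]
  let e : (Σ γ : s, {a // c a = γ.1}) ≃ α :=
    { toFun := fun x => x.2.1
      invFun := fun a => ⟨⟨c a, by rw [hs]; simp⟩, ⟨a, rfl⟩⟩
      left_inv := by
        rintro ⟨⟨γ, hγ⟩, ⟨a, ha⟩⟩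
        change c a = γ at ha
        subst ha
        rfl
      right_inv := fun a => rfl }
  rw [← pfm_reindex e A, pfm_sigma]
  · rfl
  · rintro ⟨⟨γ, ⟨a, ha⟩⟩, ε⟩ ⟨⟨γ', ⟨b, hb⟩⟩, δ⟩ h
    refine hA _ _ ?_
    simp only [e, Equiv.coe_fn_mk, ha, hb]
    exact fun hc => h (Subtype.ext hc)
  · ext x y
    exact congrFun (congrFun ha _) _
  · have := det_submatrix_equiv_self (e.prodCongr (Equiv.refl (Fin 2))) A
    change (A.submatrix (e.prodCongr (Equiv.refl (Fin 2))) (e.prodCongr (Equiv.refl (Fin 2)))).det ≠ 0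
    rw [this]
    exact hd

end

section

open Matrix Polynomial

variable {ι : Type*} [Fintype ι] [DecidableEq ι] {R : Type*} [CommRing R]

lemma derivative_charpoly (A : Matrix ι ι R) :
    derivative A.charpoly = (adjugate (charmatrix A)).trace := by
  set M := charmatrix A
  have h1 : derivative M.det = ∑ i, ∑ σ : Equiv.Perm ι, Equiv.Perm.sign σ •
      ((∏ j ∈ univ.erase i, M j (σ j)) * derivative (M i (σ i))) := by
    rw [← det_transpose, Matrix.det_apply, derivative_sum, sum_comm]
    refine sum_congr rfl fun σ _ => ?_
    rw [Units.smul_def, derivative_smul, derivative_prod_finset, smul_sum]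
    rfl
  rw [charpoly, h1, trace]
  refine sum_congr rfl fun i _ => ?_
  have h2 : ∀ j, derivative (M i j) = (1 : Matrix ι ι R[X]) i j := by
    intro j
    by_cases h : i = j
    · subst h; simp [M, charmatrix_apply_eq]
    · simp [M, charmatrix_apply_ne _ _ _ h, Matrix.one_apply_ne h]
  rw [diag_apply, Matrix.adjugate_apply, ← det_transpose, Matrix.det_apply]
  refine sum_congr rfl fun σ _ => ?_
  rw [← prod_erase_mul _ _ (mem_univ i), h2]
  congr 2
  · refine prod_congr rfl fun j hj => ?_
    rw [transpose_apply, Matrix.updateRow_ne (Finset.ne_of_mem_erase hj)]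
  · simp [one_apply, Pi.single_apply, eq_comm]

lemma det_mem_of_trace_pow_mem [Algebra ℚ R] (A : Matrix ι ι R) (S : Subalgebra ℚ R)
    (h : ∀ k, 0 < k → (A ^ k).trace ∈ S) : A.det ∈ S := by
  nontriviality R
  set n := card ι with hn
  set Q := matPolyEquiv (adjugate (charmatrix A)) with hQ
  have hQM : Q * (X - C A) = A.charpoly.map (algebraMap R (Matrix ι ι R)) := by
    rw [← matPolyEquiv_charmatrix, hQ, ← map_mul, Matrix.adjugate_mul, ← matPolyEquiv_smul_one]
    rfl
  have hrec : ∀ k, Q.coeff k = algebraMap R (Matrix ι ι R) (A.charpoly.coeff (k + 1)) +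
      Q.coeff (k + 1) * A := by
    intro k
    have := congrArg (fun p => p.coeff (k + 1)) hQM
    simp only [coeff_mul_X_sub_C, coeff_map] at this
    rw [← this]; abel
  have hzero : - (Q.coeff 0 * A) = algebraMap R (Matrix ι ι R) (A.charpoly.coeff 0) := by
    have := congrArg (fun p => p.coeff 0) hQM
    simp only [mul_coeff_zero, coeff_map, coeff_sub, coeff_X_zero, coeff_C_zero, zero_sub] at this
    rw [← this, mul_neg]
  have htr : ∀ k, (Q.coeff k).trace = (k + 1) * A.charpoly.coeff (k + 1) := by
    intro k
    have h1 : (Q.coeff k).trace = ((adjugate (charmatrix A)).trace).coeff k := by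
      simp only [trace, diag_apply, Polynomial.finsetSum_coeff, hQ,
        matPolyEquiv_coeff_apply]
    rw [h1, ← derivative_charpoly, coeff_derivative]
    ring
  have htA : ∀ c : R, (algebraMap R (Matrix ι ι R) c).trace = n * c := by
    intro c
    rw [Algebra.algebraMap_eq_smul_one, trace_smul, trace_one, smul_eq_mul, mul_comm]
  have hdiv : ∀ (m : ℤ) (c : R), m ≠ 0 → (m : R) * c ∈ S → c ∈ S := by
    intro m c hm hc
    have : c = (m : ℚ)⁻¹ • ((m : R) * c) := by
      rw [← zsmul_eq_mul, ← Int.cast_smul_eq_zsmul ℚ, smul_smul, inv_mul_cancel₀ (by exact_mod_cast hm),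
        one_smul]
    rw [this]
    exact S.smul_mem hc _
  have key : ∀ j k, k + j = Q.natDegree + n + 1 → A.charpoly.coeff (k + 1) ∈ S ∧
      ∀ i, (Q.coeff k * A ^ i).trace ∈ S := by
    intro j
    induction j with
    | zero =>
      intro k hk
      have h1 : A.charpoly.coeff (k + 1) = 0 :=
        coeff_eq_zero_of_natDegree_lt (by rw [Matrix.charpoly_natDegree_eq_dim]; omega)
      have h2 : Q.coeff k = 0 := coeff_eq_zero_of_natDegree_lt (by omega)
      exact ⟨h1 ▸ S.zero_mem, fun i => by rw [h2, zero_mul, trace_zero]; exact S.zero_mem⟩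
    | succ j ih =>
      intro k hk
      obtain ⟨-, hB⟩ := ih (k + 1) (by omega)
      have hc : A.charpoly.coeff (k + 1) ∈ S := by
        by_cases hkn : k + 1 = n
        · have := (Matrix.charpoly_monic A).coeff_natDegree
          rw [Matrix.charpoly_natDegree_eq_dim, ← hn, ← hkn] at this
          rw [this]; exact S.one_mem
        · have h1 := congrArg trace (hrec k)
          rw [htr, trace_add, htA] at h1
          refine hdiv ((k : ℤ) + 1 - n) _ (by omega) ?_
          have h2 := hB 1
          rw [pow_one] at h2
          convert h2 using 1
          push_cast
          linear_combination h1
      refine ⟨hc, fun i => ?_⟩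
      rw [hrec k, add_mul, mul_assoc, ← pow_succ', trace_add]
      refine S.add_mem ?_ (hB (i + 1))
      rw [Algebra.algebraMap_eq_smul_one, smul_mul_assoc, one_mul, trace_smul, smul_eq_mul]
      refine S.mul_mem hc ?_
      rcases Nat.eq_zero_or_pos i with rfl | hi
      · rw [pow_zero, trace_one]
        exact natCast_mem S _
      · exact h i hi
  rw [Matrix.det_eq_sign_charpoly_coeff]
  refine S.mul_mem (S.pow_mem (S.neg_mem S.one_mem) _) ?_
  rcases isEmpty_or_nonempty ι with hι | hι
  · have : A.charpoly = 1 := by simp [charpoly]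
    rw [this]; simpa using S.one_mem
  · have hpos : n ≠ 0 := card_ne_zero
    refine hdiv n _ (by exact_mod_cast hpos) ?_
    have h1 := congrArg trace hzero
    rw [htA, trace_neg] at h1
    have h2 := (key (Q.natDegree + n + 1) 0 (by omega)).2 1
    rw [pow_one] at h2
    have h3 := S.neg_mem h2
    rw [h1] at h3
    exact_mod_cast h3

lemma det_eq_of_trace_pow_eq [Algebra ℚ R] (A B : Matrix ι ι R)
    (h : ∀ k, 0 < k → (A ^ k).trace = (B ^ k).trace) : A.det = B.det := by
  let D : Matrix ι ι (R × R) := of fun i j => (A i j, B i j)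
  have h1 : ∀ f : R × R →+* R, f D.det = (f.mapMatrix D).det := fun f => map_det f D
  have hA : (RingHom.fst R R).mapMatrix D = A := rfl
  have hB : (RingHom.snd R R).mapMatrix D = B := rfl
  let S : Subalgebra ℚ (R × R) := AlgHom.equalizer (AlgHom.fst ℚ R R) (AlgHom.snd ℚ R R)
  have hmem : D.det ∈ S := by
    refine det_mem_of_trace_pow_mem D S fun k hk => ?_
    rw [AlgHom.mem_equalizer]
    have h2 : ∀ (D : Matrix ι ι (R × R)) (f : R × R →+* R),
        f (D ^ k).trace = ((f.mapMatrix D) ^ k).trace := by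
      intro D f
      rw [← map_pow, mapMatrix_apply]
      exact map_trace f.toAddMonoidHom _
    have h3 := h2 D (RingHom.fst R R)
    have h4 := h2 D (RingHom.snd R R)
    rw [hA] at h3
    rw [hB] at h4
    exact h3.trans ((h k hk).trans h4.symm)
  rw [AlgHom.mem_equalizer] at hmem
  have h3 := h1 (RingHom.fst R R)
  have h4 := h1 (RingHom.snd R R)
  rw [hA] at h3
  rw [hB] at h4
  exact h3.symm.trans (hmem.trans h4)

end

section

lemma exists_extension (ω : Gal) : ∃ φ : ℂ →+* ℂ, ∀ z : Qbar, φ z = (ω z : Qbar) := by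
  obtain ⟨s, hs⟩ := exists_isTranscendenceBasis Qbar ℂ
  have : IsAlgClosure (adjoin Qbar (Set.range ((↑) : s → ℂ))) ℂ :=
    IsAlgClosed.isAlgClosure_of_transcendence_basis _ hs
  let e : adjoin Qbar (Set.range ((↑) : s → ℂ)) ≃+*
      adjoin Qbar (Set.range ((↑) : s → ℂ)) :=
    hs.1.aevalEquiv.symm.toRingEquiv.trans
      ((MvPolynomial.mapEquiv s ω.toRingEquiv).trans hs.1.aevalEquiv.toRingEquiv)
  refine ⟨(IsAlgClosure.equivOfEquiv ℂ ℂ e : ℂ ≃+* ℂ), fun z => ?_⟩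
  have h := IsAlgClosure.equivOfEquiv_algebraMap ℂ ℂ e
    (algebraMap Qbar (adjoin Qbar (Set.range ((↑) : s → ℂ))) z)
  have h1 : e (algebraMap Qbar (adjoin Qbar (Set.range ((↑) : s → ℂ))) z) =
      algebraMap Qbar (adjoin Qbar (Set.range ((↑) : s → ℂ))) (ω z) := by
    change hs.1.aevalEquiv (MvPolynomial.map _ (hs.1.aevalEquiv.symm (algebraMap Qbar _ z))) = _
    rw [AlgEquiv.commutes, MvPolynomial.algebraMap_eq, MvPolynomial.map_C]
    exact hs.1.aevalEquiv.commutes _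
  rw [h1] at h
  exact h

end

section

/-- The representation with given matrices. -/
def ofMat {n : ℕ} (M : G →* Matrix (Fin n) (Fin n) ℂ) : CRep G n :=
  ((Matrix.toLinAlgEquiv' : Matrix (Fin n) (Fin n) ℂ ≃ₐ[ℂ] _) :
    Matrix (Fin n) (Fin n) ℂ →* ((Fin n → ℂ) →ₗ[ℂ] (Fin n → ℂ))).comp M

lemma matRep_ofMat {n : ℕ} (M : G →* Matrix (Fin n) (Fin n) ℂ) : matRep (ofMat M) = M := by
  ext1 g
  exact LinearMap.toMatrixAlgEquiv'_toLinAlgEquiv' (M g)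

lemma matRep_mulVec {n : ℕ} (ρ : CRep G n) (g : G) (x : Fin n → ℂ) :
    matRep ρ g *ᵥ x = ρ g x := by
  change (toMatrix' (ρ g)) *ᵥ x = _
  rw [LinearMap.toMatrix'_mulVec]

lemma character_eq_trace {n : ℕ} (ρ : CRep G n) (g : G) :
    ρ.character g = (matRep ρ g).trace := by
  rw [Representation.character, LinearMap.trace_eq_matrix_trace ℂ (basisFun ℂ (Fin n))]
  rfl

lemma character_one {n : ℕ} (ρ : CRep G n) : ρ.character 1 = n := by
  rw [character_eq_trace, map_one, trace_one, card_fin]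

lemma isSymplectic_iff {n : ℕ} (ρ : CRep G n) :
    IsSymplectic ρ ↔ ∃ K : Matrix (Fin n) (Fin n) ℂ, Kᵀ = -K ∧ K.det ≠ 0 ∧
      ∀ g, (matRep ρ g)ᵀ * K * matRep ρ g = K := by
  constructor
  · rintro ⟨κ, ha, hn, hi⟩
    refine ⟨LinearMap.BilinForm.toMatrix' κ, ?_, ?_, fun g => ?_⟩
    · ext i j
      simp only [transpose_apply, Matrix.neg_apply, LinearMap.BilinForm.toMatrix'_apply,
        ha.neg_eq]
    · exact (LinearMap.BilinForm.nondegenerate_toMatrix'_iff.2 hn).det_ne_zero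
    · change (toMatrix' (ρ g))ᵀ * _ * toMatrix' (ρ g) = _
      rw [← LinearMap.BilinForm.toMatrix'_comp (B := κ) (ρ g) (ρ g)]
      congr 1
      ext x y
      simp [hi]
  · rintro ⟨K, ha, hn, hi⟩
    refine ⟨K.toBilin', ?_, LinearMap.BilinForm.nondegenerate_toBilin'_of_det_ne_zero' K hn,
      fun g x y => ?_⟩
    · intro x
      have h2 : x ⬝ᵥ K *ᵥ x = - (x ⬝ᵥ K *ᵥ x) := by
        conv_lhs => rw [dotProduct_mulVec, ← mulVec_transpose, ha, dotProduct_comm]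
        rw [Matrix.neg_mulVec, dotProduct_neg]
      rw [Matrix.toBilin'_apply']
      exact self_eq_neg.1 h2
    · rw [Matrix.toBilin'_apply', Matrix.toBilin'_apply', ← matRep_mulVec, ← matRep_mulVec]
      conv_rhs => rw [← hi g]
      rw [Matrix.mul_assoc, ← mulVec_mulVec, ← mulVec_mulVec, dotProduct_mulVec x,
        Matrix.vecMul_transpose]

/-- The conjugate of a representation by a ring endomorphism of `ℂ`. -/
def conjRep (φ : ℂ →+* ℂ) {n : ℕ} (ρ : CRep G n) :
    CRep G n :=
  ofMat ((RingHom.mapMatrix φ).toMonoidHom.comp (matRep ρ))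

lemma matRep_conjRep (φ : ℂ →+* ℂ) {n : ℕ} (ρ : CRep G n) (g : G) :
    matRep (conjRep φ ρ) g = (matRep ρ g).map φ := by
  rw [conjRep, matRep_ofMat]; rfl

lemma character_conjRep (φ : ℂ →+* ℂ) {n : ℕ} (ρ : CRep G n) (g : G) :
    (conjRep φ ρ).character g = φ (ρ.character g) := by
  rw [character_eq_trace, character_eq_trace, matRep_conjRep]
  exact (map_trace φ.toAddMonoidHom _).symm

lemma IsSymplectic.conjRep {n : ℕ} {ρ : CRep G n} (h : IsSymplectic ρ)
    (φ : ℂ →+* ℂ) : IsSymplectic (conjRep φ ρ) := by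
  rw [isSymplectic_iff] at h ⊢
  obtain ⟨K, ha, hn, hi⟩ := h
  refine ⟨K.map φ, ?_, ?_, fun g => ?_⟩
  · rw [← Matrix.transpose_map, ha]
    ext; simp
  · rw [← mapMatrix_apply, ← map_det]
    exact (map_ne_zero φ).2 hn
  · rw [matRep_conjRep, ← Matrix.transpose_map, ← Matrix.map_mul, ← Matrix.map_mul, hi]

/-- The direct sum of two matrix representations. -/
def sumRep {n m : ℕ} (ρ : CRep G n) (ρ' : CRep G m) :
    Representation ℂ G (Fin (n + m) → ℂ) :=
  ofMat
    { toFun := fun g => (fromBlocks (matRep ρ g) 0 0 (matRep ρ' g)).submatrix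
        finSumFinEquiv.symm finSumFinEquiv.symm
      map_one' := by simp
      map_mul' := fun g h => by simp [submatrix_mul_equiv, fromBlocks_multiply] }

lemma matRep_sumRep {n m : ℕ} (ρ : CRep G n)
    (ρ' : CRep G m) (g : G) :
    matRep (sumRep ρ ρ') g = (fromBlocks (matRep ρ g) 0 0 (matRep ρ' g)).submatrix
        finSumFinEquiv.symm finSumFinEquiv.symm := by
  rw [sumRep, matRep_ofMat]; rfl

lemma character_sumRep {n m : ℕ} (ρ : CRep G n)
    (ρ' : CRep G m) :
    (sumRep ρ ρ').character = ρ.character + ρ'.character := by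
  ext g
  rw [Pi.add_apply, character_eq_trace, character_eq_trace, character_eq_trace, matRep_sumRep]
  have h := Equiv.sum_comp finSumFinEquiv.symm
    (fun i => (fromBlocks (matRep ρ g) 0 0 (matRep ρ' g)) i i)
  rw [sum_sum_type] at h
  exact h

lemma IsSymplectic.sumRep {n m : ℕ} {ρ : CRep G n}
    {ρ' : CRep G m} (h : IsSymplectic ρ) (h' : IsSymplectic ρ') :
    IsSymplectic (sumRep ρ ρ') := by
  rw [isSymplectic_iff] at h h' ⊢
  obtain ⟨K, ha, hn, hi⟩ := h
  obtain ⟨K', ha', hn', hi'⟩ := h'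
  refine ⟨(fromBlocks K 0 0 K').submatrix finSumFinEquiv.symm finSumFinEquiv.symm, ?_, ?_,
    fun g => ?_⟩
  · rw [transpose_submatrix, Matrix.fromBlocks_transpose, ha, ha']
    ext a b
    rw [Matrix.neg_apply, submatrix_apply, submatrix_apply]
    rcases finSumFinEquiv.symm a with a | a <;> rcases finSumFinEquiv.symm b with b | b <;> simp
  · rw [det_submatrix_equiv_self, Matrix.det_fromBlocks_zero₂₁]
    exact mul_ne_zero hn hn'
  · rw [matRep_sumRep, transpose_submatrix, submatrix_mul_equiv,
      submatrix_mul_equiv, Matrix.fromBlocks_transpose, fromBlocks_multiply,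
      fromBlocks_multiply]
    simp [hi, hi']

lemma isSymplectic_zero (ρ : Representation ℂ G (Fin 0 → ℂ)) : IsSymplectic ρ :=
  (isSymplectic_iff ρ).2 ⟨1, Subsingleton.elim _ _, by simp, fun _ => Subsingleton.elim _ _⟩

end

section

variable (A : Type*) {S : Type*} [CommRing A] [CommRing S] [Algebra A S]
  (φ : ℂ →+* S) {n : ℕ} (ρ : CRep G n)
  {ι : Type*} [Fintype ι] [DecidableEq ι]

/-- The action of matrices over the group ring on a sum of copies of a representation. -/
def bigRep : Matrix ι ι A[G] →+* Matrix (ι × Fin n) (ι × Fin n) S :=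
  (Matrix.compRingEquiv ι (Fin n) S).toRingHom.comp
    (RingHom.mapMatrix (ringRep A φ ρ).toRingHom)

lemma bigRep_apply (X : Matrix ι ι A[G]) (x y : ι × Fin n) :
    bigRep A φ ρ X x y = ringRep A φ ρ (X x.1 y.1) x.2 y.2 := rfl

/-- The determinant of a matrix over the group ring at a representation. -/
def detM : Matrix ι ι A[G] →* S :=
  Matrix.detMonoidHom.comp (bigRep A φ ρ).toMonoidHom

notation "detC" => detM ℚ (RingHom.id ℂ)

lemma detM_apply (X : Matrix ι ι A[G]) : detM A φ ρ X = (bigRep A φ ρ X).det := rfl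

lemma detGL_val {r : ℕ} (X : (Matrix (Fin r) (Fin r) A[G])ˣ) :
    ((detGL A φ ρ X : Sˣ) : S) = detM A φ ρ X.1 := rfl

lemma detUnit_val (x : A[G]ˣ) :
    ((detUnit A φ ρ x : Sˣ) : S) = detM A φ ρ (of fun _ _ : Unit => x.1) := by
  change (ringRep A φ ρ x.1).det = _
  rw [detM_apply, ← det_submatrix_equiv_self (Equiv.punitProd (Fin n)).symm]
  rfl

lemma ringRep_apply (x : A[G]) (a b : Fin n) :
    ringRep A φ ρ x a b = ∑ g, algebraMap A S (x.coeff g) * φ (matRep ρ g a b) := by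
  classical
  have h : ringRep A φ ρ x = ∑ g, x.coeff g • (matRep ρ g).map φ := by
    rw [ringRep, lift_apply, Finsupp.sum_fintype _ _ (by simp)]
    rfl
  rw [h, Matrix.sum_apply]
  refine sum_congr rfl fun g _ => ?_
  rw [Matrix.smul_apply, map_apply, Algebra.smul_def]

lemma trace_ringRep (x : A[G]) :
    (ringRep A φ ρ x).trace = ∑ g, algebraMap A S (x.coeff g) * φ (ρ.character g) := by
  simp only [trace, diag_apply, ringRep_apply, character_eq_trace, map_sum]
  rw [sum_comm]
  exact sum_congr rfl fun g _ => (mul_sum _ _ _).symm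

lemma trace_bigRep (X : Matrix ι ι A[G]) :
    (bigRep A φ ρ X).trace = ∑ i, ∑ g, algebraMap A S ((X i i).coeff g) * φ (ρ.character g) := by
  simp only [trace, diag_apply, bigRep_apply, sum_prod_type]
  exact sum_congr rfl fun i _ => trace_ringRep A φ ρ (X i i)

lemma detM_mem [Algebra ℚ S] (T : Subalgebra ℚ S)
    (h : ∀ (a : A) (g : G), algebraMap A S a * φ (ρ.character g) ∈ T)
    (X : Matrix ι ι A[G]) : detM A φ ρ X ∈ T := by
  rw [detM_apply]
  refine det_mem_of_trace_pow_mem _ T fun k _ => ?_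
  rw [← map_pow, trace_bigRep]
  exact Subalgebra.sum_mem _ fun i _ => Subalgebra.sum_mem _ fun g _ => h _ _

variable {ρ} in
lemma eq_of_character_eq {m : ℕ} {ρ' : CRep G m}
    (h : ρ.character = ρ'.character) : n = m := by
  have := congrFun h 1
  rw [character_one, character_one] at this
  exact_mod_cast this

variable {ρ} in
lemma detM_congr [Algebra ℚ S] {m : ℕ} {ρ' : CRep G m}
    (h : ρ.character = ρ'.character) (X : Matrix ι ι A[G]) :
    detM A φ ρ X = detM A φ ρ' X := by
  obtain rfl := eq_of_character_eq h
  rw [detM_apply, detM_apply]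
  refine det_eq_of_trace_pow_eq _ _ fun k _ => ?_
  rw [← map_pow, ← map_pow, trace_bigRep, trace_bigRep, h]

lemma ringRep_mapRingHom {A' S' : Type*} [CommRing A'] [CommRing S'] [Algebra A' S']
    (f : S →+* S') (g : A →+* A') (h : ∀ a, f (algebraMap A S a) = algebraMap A' S' (g a))
    (x : A[G]) :
    ringRep A' (f.comp φ) ρ (MonoidAlgebra.mapRingHom G g x) = (ringRep A φ ρ x).map f := by
  ext a b
  rw [map_apply, ringRep_apply, ringRep_apply, map_sum]
  refine sum_congr rfl fun k _ => ?_
  rw [map_mul, h]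
  simp

lemma detM_map {A' S' : Type*} [CommRing A'] [CommRing S'] [Algebra A' S']
    (f : S →+* S') (g : A →+* A') (h : ∀ a, f (algebraMap A S a) = algebraMap A' S' (g a))
    (X : Matrix ι ι A[G]) :
    detM A' (f.comp φ) ρ (X.map (MonoidAlgebra.mapRingHom G g)) = f (detM A φ ρ X) := by
  rw [detM_apply, detM_apply, map_det]
  congr 1
  ext x y
  rw [bigRep_apply, map_apply, ringRep_mapRingHom A φ ρ f g h, mapMatrix_apply]
  rfl

lemma detM_conjRep (ψ : ℂ →+* ℂ) (X : Matrix ι ι A[G]) :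
    detM A φ (conjRep ψ ρ) X = detM A (φ.comp ψ) ρ X := by
  rw [detM_apply, detM_apply]
  congr 1
  ext x y
  simp only [bigRep_apply, ringRep_apply, matRep_conjRep, map_apply, RingHom.comp_apply]

lemma detM_sumRep {m : ℕ} (ρ' : CRep G m)
    (X : Matrix ι ι A[G]) :
    detM A φ (sumRep ρ ρ') X = detM A φ ρ X * detM A φ ρ' X := by
  let e : (ι × Fin n) ⊕ (ι × Fin m) ≃ ι × Fin (n + m) :=
    (Equiv.prodSumDistrib ι (Fin n) (Fin m)).symm.trans
      ((Equiv.refl ι).prodCongr finSumFinEquiv)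
  have h : (bigRep A φ (sumRep ρ ρ') X).submatrix e e =
      fromBlocks (bigRep A φ ρ X) 0 0 (bigRep A φ ρ' X) := by
    ext (⟨i, a⟩ | ⟨i, a⟩) (⟨j, b⟩ | ⟨j, b⟩) <;>
    simp [e, bigRep_apply, ringRep_apply, matRep_sumRep]
  rw [detM_apply, detM_apply, detM_apply, ← det_submatrix_equiv_self e, h,
    Matrix.det_fromBlocks_zero₂₁]

lemma detM_reindex {ι' : Type*} [Fintype ι'] [DecidableEq ι'] (e : ι' ≃ ι)
    (X : Matrix ι ι A[G]) : detM A φ ρ (X.submatrix e e) = detM A φ ρ X := by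
  rw [detM_apply, detM_apply,
    ← det_submatrix_equiv_self (e.prodCongr (Equiv.refl (Fin n))) (bigRep A φ ρ X)]
  rfl

lemma detM_fromBlocks {ι' : Type*} [Fintype ι'] [DecidableEq ι']
    (X : Matrix ι ι A[G]) (Y : Matrix ι ι' A[G])
    (Z : Matrix ι' ι' A[G]) :
    detM A φ ρ (fromBlocks X Y 0 Z) = detM A φ ρ X * detM A φ ρ Z := by
  rw [detM_apply, ← det_submatrix_equiv_self (sumProdDistrib ι ι' (Fin n)).symm]
  have : (bigRep A φ ρ (fromBlocks X Y 0 Z)).submatrix (sumProdDistrib ι ι' (Fin n)).symm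
      (sumProdDistrib ι ι' (Fin n)).symm = fromBlocks (bigRep A φ ρ X)
      (of fun x y => ringRep A φ ρ (Y x.1 y.1) x.2 y.2) 0 (bigRep A φ ρ Z) := by
    ext (⟨i, a⟩ | ⟨i, a⟩) (⟨j, b⟩ | ⟨j, b⟩) <;> simp [bigRep_apply]
  rw [this, Matrix.det_fromBlocks_zero₂₁]
  rfl

lemma detM_blockDiagonal' {o : Type*} [Fintype o] [DecidableEq o] {X : o → Type*}
    [∀ i, Fintype (X i)] [∀ i, DecidableEq (X i)] (B : ∀ i, Matrix (X i) (X i) A[G]) :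
    detM A φ ρ (blockDiagonal' B) = ∏ i, detM A φ ρ (B i) := by
  rw [detM_apply, ← det_submatrix_equiv_self (Equiv.sigmaProdDistrib X (Fin n)).symm]
  have : (bigRep A φ ρ (blockDiagonal' B)).submatrix (Equiv.sigmaProdDistrib X (Fin n)).symm
      (Equiv.sigmaProdDistrib X (Fin n)).symm = blockDiagonal' fun i => bigRep A φ ρ (B i) := by
    ext ⟨i, x, a⟩ ⟨j, y, b⟩
    rw [submatrix_apply]
    change ringRep A φ ρ (blockDiagonal' B ⟨i, x⟩ ⟨j, y⟩) a b = _
    by_cases hij : i = j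
    · subst hij
      rw [blockDiagonal'_apply_eq, blockDiagonal'_apply_eq]
      rfl
    · rw [blockDiagonal'_apply_ne _ _ _ hij, blockDiagonal'_apply_ne _ _ _ hij, map_zero]
      rfl
  rw [this, det_blockDiagonal']
  rfl

end

section

lemma exists_equivHom (S : AddSubgroup (G → ℂ))
    (Pr : ∀ n : ℕ, CRep G n → Prop)
    (hS : S = AddSubgroup.closure {χ | ∃ (n : ℕ) (ρ : CRep G n),
      Pr n ρ ∧ χ = ρ.character})
    (hPr0 : ∀ ρ, Pr 0 ρ)
    (hPrs : ∀ n m ρ ρ', Pr n ρ → Pr m ρ' → Pr (n + m) (sumRep ρ ρ'))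
    (hPrc : ∀ n ρ φ, Pr n ρ → Pr n (conjRep φ ρ))
    {M : Type*} [CommGroup M] (act : Gal → M →* M)
    (Φ : ∀ n : ℕ, CRep G n → M)
    (hcongr : ∀ n m ρ ρ', Pr n ρ → Pr m ρ' → ρ.character = ρ'.character → Φ n ρ = Φ m ρ')
    (hsum : ∀ n m ρ ρ', Pr n ρ → Pr m ρ' → Φ (n + m) (sumRep ρ ρ') = Φ n ρ * Φ m ρ')
    (hgal : ∀ n ρ ω (φ : ℂ →+* ℂ), (∀ z : Qbar, φ z = (ω z : Qbar)) → Pr n ρ →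
      Φ n (conjRep φ ρ) = act ω (Φ n ρ)) :
    ∃ f : equivHom S M act, ∀ n ρ, Pr n ρ → ∀ h : ρ.character ∈ S,
      f.1 (ofAdd ⟨ρ.character, h⟩) = Φ n ρ := by
  have hrep : ∀ ψ : S, ∃ (n m : ℕ) (ρ : CRep G n)
      (ρ' : CRep G m), Pr n ρ ∧ Pr m ρ' ∧
      (ψ : G → ℂ) + ρ'.character = ρ.character := by
    suffices hc : ∀ ψ ∈ AddSubgroup.closure {χ | ∃ (n : ℕ) (ρ : CRep G n),
        Pr n ρ ∧ χ = ρ.character}, ∃ (n m : ℕ) (ρ : CRep G n)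
        (ρ' : CRep G m), Pr n ρ ∧ Pr m ρ' ∧
        ψ + ρ'.character = ρ.character from fun ψ => hc ψ (hS ▸ ψ.2)
    intro ψ hψ
    induction hψ using closure_induction with
    | mem χ h =>
      obtain ⟨n, ρ, hρ, rfl⟩ := h
      refine ⟨n + 0, 0, sumRep ρ (ofMat 1), ofMat 1, hPrs _ _ _ _ hρ (hPr0 _), hPr0 _, ?_⟩
      rw [character_sumRep]
    | zero => exact ⟨0, 0, ofMat 1, ofMat 1, hPr0 _, hPr0 _, zero_add _⟩
    | add x y _ _ hx hy =>
      obtain ⟨n, m, ρ, ρ', h, h', e⟩ := hx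
      obtain ⟨n2, m2, ρ2, ρ2', h2, h2', e2⟩ := hy
      refine ⟨_, _, sumRep ρ ρ2, sumRep ρ' ρ2', hPrs _ _ _ _ h h2, hPrs _ _ _ _ h' h2', ?_⟩
      rw [character_sumRep, character_sumRep, ← e, ← e2]
      abel
    | neg x _ hx =>
      obtain ⟨n, m, ρ, ρ', h, h', e⟩ := hx
      refine ⟨m, n, ρ', ρ, h', h, ?_⟩
      rw [← e]; abel
  choose n m ρ ρ' h h' e using hrep
  have hwd : ∀ (ψ : S) (k l : ℕ) (τ : Representation ℂ G (Fin k → ℂ))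
      (τ' : Representation ℂ G (Fin l → ℂ)), Pr k τ → Pr l τ' →
      (ψ : G → ℂ) + τ'.character = τ.character →
      Φ _ (ρ ψ) * (Φ _ (ρ' ψ))⁻¹ = Φ k τ * (Φ l τ')⁻¹ := by
    intro ψ k l τ τ' hτ hτ' he
    have h1 := hcongr _ _ (sumRep (ρ ψ) τ') (sumRep τ (ρ' ψ)) (hPrs _ _ _ _ (h ψ) hτ')
      (hPrs _ _ _ _ hτ (h' ψ)) (by
        rw [character_sumRep, character_sumRep, ← e, ← he]; abel)
    rw [hsum _ _ _ _ (h ψ) hτ', hsum _ _ _ _ hτ (h' ψ)] at h1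
    rw [mul_inv_eq_iff_eq_mul, mul_assoc, mul_comm _ (Φ _ (ρ' ψ)), ← mul_assoc, ← h1, mul_assoc,
      mul_inv_cancel, mul_one]
  let F : Multiplicative S →* M :=
    { toFun := fun ψ => Φ _ (ρ ψ.toAdd) * (Φ _ (ρ' ψ.toAdd))⁻¹
      map_one' := by
        rw [hwd _ 0 0 (ofMat 1) (ofMat 1) (hPr0 _) (hPr0 _) (zero_add _), mul_inv_cancel]
      map_mul' := fun x y => by
        rw [hwd (x * y).toAdd _ _ (sumRep (ρ x.toAdd) (ρ y.toAdd)) (sumRep (ρ' x.toAdd) (ρ' y.toAdd))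
          (hPrs _ _ _ _ (h _) (h _)) (hPrs _ _ _ _ (h' _) (h' _)) (by
            rw [character_sumRep, character_sumRep, ← e, ← e]
            change (x.toAdd : G → ℂ) + (y.toAdd : G → ℂ) + _ = _
            abel), hsum _ _ _ _ (h _) (h _), hsum _ _ _ _ (h' _) (h' _), mul_inv,
          mul_mul_mul_comm] }
  refine ⟨⟨F, fun ω ψ ψ' hc => ?_⟩, fun k τ hτ hmem => ?_⟩
  · obtain ⟨φ, hφ⟩ := exists_extension ω
    have hψ : ∀ g, (ψ' : G → ℂ) g = φ ((ψ : G → ℂ) g) := by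
      intro g
      obtain ⟨z, h1, h2⟩ := hc g
      rw [h1, h2, hφ]
    change Φ _ (ρ ψ') * (Φ _ (ρ' ψ'))⁻¹ = act ω (Φ _ (ρ ψ) * (Φ _ (ρ' ψ))⁻¹)
    rw [map_mul, map_inv, ← hgal _ _ ω φ hφ (h ψ), ← hgal _ _ ω φ hφ (h' ψ)]
    refine hwd ψ' _ _ _ _ (hPrc _ _ _ (h ψ)) (hPrc _ _ _ (h' ψ)) ?_
    ext g
    rw [Pi.add_apply, character_conjRep, character_conjRep, hψ, ← map_add, ← e ψ, Pi.add_apply]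
  · change Φ _ (ρ ⟨_, hmem⟩) * (Φ _ (ρ' ⟨_, hmem⟩))⁻¹ = _
    rw [hwd ⟨_, hmem⟩ _ _ (sumRep τ (ofMat 1)) (ofMat 1) (hPrs _ _ _ _ hτ (hPr0 _)) (hPr0 _)
      (by rw [character_sumRep]), hsum _ _ _ _ hτ (hPr0 _), mul_inv_cancel_right]

end

section

open Matrix Polynomial

lemma eq_of_sq_eq_of_eval_zero {q q' : ℂ[X]} (h : q ^ 2 = q' ^ 2) (h0 : q.eval 0 = 1)
    (h0' : q'.eval 0 = 1) : q = q' := by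
  rcases sq_eq_sq_iff_eq_or_eq_neg.1 h with h | h
  · exact h
  · rw [h, eval_neg, h0'] at h0
    norm_num at h0

lemma exists_pfaffian_pencil {α : Type*} [Fintype α] [DecidableEq α]
    (K L : PairMatrix α ℂ) (hK : Kᵀ = -K) (hL : Lᵀ = -L) (hd : K.det ≠ 0) :
    ∃ q : ℂ[X], q.eval 0 = 1 ∧ (∀ t, pfm (K + t • (L - K)) = pfm K * q.eval t) ∧
      ∀ t, (K + t • (L - K)).det = K.det * q.eval t ^ 2 := by
  set N : PairMatrix α ℂ[X] := K.map (C : ℂ → ℂ[X]) + (X : ℂ[X]) • (L - K).map (C : ℂ → ℂ[X]) with hN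
  have hev : ∀ t, N.map (evalRingHom t) = K + t • (L - K) := by
    intro t; ext x y; simp [hN]
  have h0 := pfm_ne_zero K hK hd
  have hpf : ∀ t, (pfm N).eval t = pfm (K + t • (L - K)) := fun t => by
    rw [← hev, pfm_map]; rfl
  have hdet : ∀ t, (N.det).eval t = (K + t • (L - K)).det := fun t => by
    rw [← hev, ← mapMatrix_apply, ← map_det]; rfl
  have halt : ∀ t : ℂ, (K + t • (L - K))ᵀ = -(K + t • (L - K)) := fun t => by
    rw [transpose_add, transpose_smul, transpose_sub, hK, hL]
    ext; simp; ring
  have hD : N.det ≠ 0 := fun h => hd (by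
    have := hdet 0
    rw [h] at this
    simpa using this.symm)
  have hsq : pfm N ^ 2 = N.det := by
    refine mul_right_cancel₀ hD (Polynomial.funext fun t => ?_)
    rw [eval_mul, eval_mul, eval_pow, hpf, hdet]
    by_cases h : (K + t • (L - K)).det = 0
    · rw [h, mul_zero, mul_zero]
    · rw [pfm_sq _ (halt t) h]
  refine ⟨C (pfm K)⁻¹ * pfm N, ?_, fun t => ?_, fun t => ?_⟩
  · rw [eval_mul, eval_C, hpf, zero_smul, add_zero, inv_mul_cancel₀ h0]
  · rw [eval_mul, eval_C, hpf, mul_inv_cancel_left₀ h0]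
  · rw [eval_mul, eval_C, mul_pow, ← eval_pow, hsq, hdet, ← pfm_sq K hK hd, inv_pow,
      mul_inv_cancel_left₀ (pow_ne_zero 2 h0)]

open scoped ComplexOrder in
lemma det_pos_of_adjoint {α : Type*} [Fintype α] [DecidableEq α] {m : Type*} [Fintype m]
    [DecidableEq m] (e : α × Fin 2 ≃ m) (K S X X' : Matrix m m ℂ) (hK : Kᵀ = -K) (hd : K.det ≠ 0)
    (hS : S.PosDef) (h1 : X'ᵀ * K = K * X) (h2 : S * X' = Xᴴ * S) (hX : X.det ≠ 0) :
    ∃ r : ℝ, 0 < r ∧ X.det = r := by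
  have hKX : K * X' = Xᵀ * K := by
    have := congrArg transpose h1
    rw [transpose_mul, transpose_mul, transpose_transpose, hK, Matrix.neg_mul, Matrix.mul_neg,
      neg_inj] at this
    exact this
  have hL : K * (X' * X) = Xᵀ * K * X := by rw [← mul_assoc, hKX]
  have hLt : (K * (X' * X))ᵀ = -(K * (X' * X)) := by
    rw [hL, transpose_mul, transpose_mul, transpose_transpose, hK]
    simp [mul_assoc]
  have hsub : ∀ A B : Matrix m m ℂ, (A * B).submatrix e e = A.submatrix e e * B.submatrix e e :=
    fun A B => (submatrix_mul_equiv A B e e e).symm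
  obtain ⟨q, q0, qpf, qdet⟩ := exists_pfaffian_pencil (K.submatrix e e)
    ((K * (X' * X)).submatrix e e) (by rw [transpose_submatrix, hK]; rfl)
    (by rw [transpose_submatrix, hLt]; rfl) (by rwa [det_submatrix_equiv_self])
  have hKs : (K.submatrix e e)ᵀ = -K.submatrix e e := by rw [transpose_submatrix, hK]; rfl
  have hds : (K.submatrix e e).det ≠ 0 := by rwa [det_submatrix_equiv_self]
  have q1 : q.eval 1 = X.det := by
    have := qpf 1
    rw [one_smul, add_sub_cancel, hL, hsub, hsub] at this
    have h3 : (Xᵀ).submatrix e e * K.submatrix e e * X.submatrix e e =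
      (Xᵀ).submatrix e e * K.submatrix e e * ((Xᵀ).submatrix e e)ᵀ := rfl
    rw [h3, pfm_conj, mul_comm] at this
    rw [← mul_left_cancel₀ (pfm_ne_zero _ hKs hds) this, det_submatrix_equiv_self, det_transpose]
  have hSZ : S * (X' * X) = Xᴴ * S * X := by rw [← mul_assoc, h2]
  have hpos : ∀ t : ℝ, 0 ≤ t → t ≤ 1 → ∃ d : ℝ, 0 < d ∧ q.eval (t : ℂ) ^ 2 = d := by
    intro t ht0 ht1
    have hP : ((1 - t) • S + t • (Xᴴ * S * X)).PosDef := by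
      have hX' : (Xᴴ * S * X).PosDef := by
        refine hS.conjTranspose_mul_mul_same ?_
        exact Matrix.mulVec_injective_of_isUnit ((Matrix.isUnit_iff_isUnit_det _).2 hX.isUnit)
      rcases ht0.eq_or_lt with rfl | h
      · simpa using hS
      · exact (hX'.smul h).posSemidef_add (hS.posSemidef.smul (sub_nonneg.2 ht1))
    have hdet : ((1 - t) • S + t • (Xᴴ * S * X)).det = S.det * q.eval (t : ℂ) ^ 2 := by
      have h3 : (1 - t) • S + t • (Xᴴ * S * X) = S * (1 + (t : ℂ) • (X' * X - 1)) := by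
        rw [← hSZ, mul_add, mul_smul_comm, mul_sub, mul_one]
        ext i j
        simp only [Matrix.add_apply, Matrix.smul_apply, Matrix.sub_apply, Complex.real_smul,
          smul_eq_mul]
        push_cast
        ring
      have h4 := qdet t
      have h5 : K.submatrix e e + (t : ℂ) • ((K * (X' * X)).submatrix e e - K.submatrix e e) =
          (K * (1 + (t : ℂ) • (X' * X - 1))).submatrix e e := by
        rw [mul_add, mul_smul_comm, mul_sub, mul_one]; rfl
      rw [h5, det_submatrix_equiv_self, det_submatrix_equiv_self, det_mul] at h4
      rw [h3, det_mul, mul_left_cancel₀ hd h4]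
    have hpr : ∀ z : ℂ, 0 < z → ∃ a : ℝ, 0 < a ∧ (a : ℂ) = z := fun z hz =>
      ⟨z.re, (Complex.pos_iff.1 hz).1, Complex.ext rfl (Complex.pos_iff.1 hz).2⟩
    obtain ⟨a, ha, ha'⟩ := hpr _ hP.det_pos
    obtain ⟨b, hb, hb'⟩ := hpr _ hS.det_pos
    refine ⟨a / b, div_pos ha hb, ?_⟩
    rw [← ha', ← hb'] at hdet
    rw [Complex.ofReal_div, hdet, mul_div_cancel_left₀]
    exact_mod_cast hb.ne'
  have hre : ∀ t : ℝ, 0 ≤ t → t ≤ 1 → (q.eval (t : ℂ)).im = 0 ∧ (q.eval (t : ℂ)).re ≠ 0 := by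
    intro t h h'
    obtain ⟨d, hd0, hdd⟩ := hpos t h h'
    have h3 := congrArg Complex.re hdd
    have h4 := congrArg Complex.im hdd
    simp only [sq, Complex.mul_re, Complex.mul_im, Complex.ofReal_re, Complex.ofReal_im] at h3 h4
    have h5 : (q.eval (t : ℂ)).re * (q.eval (t : ℂ)).im = 0 := by linarith
    rcases mul_eq_zero.1 h5 with h6 | h6
    · rw [h6] at h3
      nlinarith [sq_nonneg (q.eval (t : ℂ)).im]
    · refine ⟨h6, fun h7 => ?_⟩
      rw [h6, h7] at h3
      linarith
  have hc : ContinuousOn (fun t : ℝ => (q.eval (t : ℂ)).re) (Set.Icc 0 1) :=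
    (Complex.continuous_re.comp (q.continuous.comp Complex.continuous_ofReal)).continuousOn
  refine ⟨X.det.re, ?_, ?_⟩
  · by_contra hneg
    have h01 := intermediate_value_Icc' (zero_le_one' ℝ) hc
    have : (0 : ℝ) ∈ Set.Icc ((q.eval ((1 : ℝ) : ℂ)).re) ((q.eval ((0 : ℝ) : ℂ)).re) := by
      rw [Complex.ofReal_one, Complex.ofReal_zero, q1, q0]
      exact ⟨not_lt.1 hneg, by simp⟩
    obtain ⟨t, ht, h0⟩ := h01 this
    exact (hre t ht.1 ht.2).2 h0
  · have := (hre 1 zero_le_one le_rfl).1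
    rw [Complex.ofReal_one, q1] at this
    exact Complex.ext rfl (by simpa using this)

end

section

variable {ι : Type*} [Fintype ι] [DecidableEq ι]

/-- The involution of the group ring. -/
def starG {A : Type*} [CommRing A] (x : A[G]) : A[G] :=
  ofCoeff (x.coeff.equivMapDomain (Equiv.inv G))

lemma starG_coeff {A : Type*} [CommRing A] (x : A[G]) (g : G) :
    (starG x).coeff g = x.coeff g⁻¹ := rfl

/-- The adjoint of a matrix over the group ring. -/
def starM {A : Type*} [CommRing A] {ι κ : Type*} (X : Matrix ι κ A[G]) :
    Matrix κ ι A[G] :=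
  of fun i j => starG (X j i)

/-- A block diagonal matrix with equal blocks. -/
def diagBlocks (ι : Type*) [DecidableEq ι] {n : Type*} {R : Type*} [CommRing R] (K : Matrix n n R) :
    Matrix (ι × n) (ι × n) R :=
  of fun x y => if x.1 = y.1 then K x.2 y.2 else 0

lemma diagBlocks_mul_apply {n : Type*} [Fintype n] {R : Type*} [CommRing R] (K : Matrix n n R)
    {o : Type*} (Y : Matrix (ι × n) o R) (x : ι × n) (y : o) :
    (diagBlocks ι K * Y) x y = ∑ c, K x.2 c * Y (x.1, c) y := by
  rw [mul_apply, sum_prod_type, sum_eq_single x.1]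
  · simp [diagBlocks]
  · intro b _ hb
    simp [diagBlocks, hb.symm]
  · simp

lemma mul_diagBlocks_apply {n : Type*} [Fintype n] {R : Type*} [CommRing R] (K : Matrix n n R)
    {o : Type*} (Y : Matrix o (ι × n) R) (x : o) (y : ι × n) :
    (Y * diagBlocks ι K) x y = ∑ c, Y x (y.1, c) * K c y.2 := by
  rw [mul_apply, sum_prod_type, sum_eq_single y.1]
  · simp [diagBlocks]
  · intro b _ hb
    simp [diagBlocks, hb]
  · simp

lemma diagBlocks_transpose {n : Type*} {R : Type*} [CommRing R] (K : Matrix n n R) :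
    (diagBlocks ι K)ᵀ = diagBlocks ι Kᵀ := by
  ext x y
  simp only [diagBlocks, of_apply, transpose_apply, eq_comm]

lemma diagBlocks_neg {n : Type*} {R : Type*} [CommRing R] (K : Matrix n n R) :
    diagBlocks ι (-K) = -diagBlocks ι K := by
  ext x y
  simp only [diagBlocks, of_apply, Matrix.neg_apply]
  split_ifs <;> simp

lemma det_diagBlocks {n : Type*} [Fintype n] [DecidableEq n] {R : Type*} [CommRing R]
    (K : Matrix n n R) : (diagBlocks ι K).det = K.det ^ card ι := by
  rw [← det_submatrix_equiv_self (Equiv.prodComm n ι)]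
  have : (diagBlocks ι K).submatrix (Equiv.prodComm n ι) (Equiv.prodComm n ι) =
      blockDiagonal fun _ : ι => K := by
    ext ⟨a, i⟩ ⟨b, j⟩
    simp [diagBlocks, Matrix.blockDiagonal_apply]
  rw [this, Matrix.det_blockDiagonal, prod_const, card_univ]

variable {A : Type*} [CommRing A] [Algebra A ℂ] {n : ℕ} (ρ : CRep G n)

lemma ringRep_starG (K : Matrix (Fin n) (Fin n) ℂ)
    (hK : ∀ g, (matRep ρ g)ᵀ * K * matRep ρ g = K) (x : A[G]) :
    (ringRep A (RingHom.id ℂ) ρ (starG x))ᵀ * K = K * ringRep A (RingHom.id ℂ) ρ x := by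
  have h : ∀ y : A[G], ringRep A (RingHom.id ℂ) ρ y =
      ∑ g, (algebraMap A ℂ (y.coeff g)) • matRep ρ g := by
    intro y
    ext a b
    rw [ringRep_apply, Matrix.sum_apply]
    rfl
  have hk : ∀ g, (matRep ρ g⁻¹)ᵀ * K = K * matRep ρ g := by
    intro g
    conv_rhs => rw [← hK g⁻¹]
    rw [Matrix.mul_assoc _ (matRep ρ g⁻¹), ← map_mul, inv_mul_cancel, map_one, Matrix.mul_one]
  rw [h, h, Matrix.transpose_sum, sum_mul, mul_sum,
    ← Equiv.sum_comp (Equiv.inv G)]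
  refine sum_congr rfl fun g _ => ?_
  rw [Matrix.transpose_smul, starG_coeff, Equiv.inv_apply, inv_inv, Matrix.smul_mul,
    Matrix.mul_smul, hk]

lemma bigRep_starM (K : Matrix (Fin n) (Fin n) ℂ)
    (hK : ∀ g, (matRep ρ g)ᵀ * K * matRep ρ g = K) (X : Matrix ι ι A[G]) :
    (bigRep A (RingHom.id ℂ) ρ (starM X))ᵀ * diagBlocks ι K =
      diagBlocks ι K * bigRep A (RingHom.id ℂ) ρ X := by
  ext ⟨i, a⟩ ⟨j, b⟩
  rw [mul_diagBlocks_apply, diagBlocks_mul_apply]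
  exact congrFun (congrFun (ringRep_starG ρ K hK (X i j)) a) b

lemma bigRep_starM_conj (S : Matrix (Fin n) (Fin n) ℂ)
    (hS : ∀ g, (matRep ρ g)ᴴ * S * matRep ρ g = S) (X : Matrix ι ι ℚ[G]) :
    diagBlocks ι S * bigRep ℚ (RingHom.id ℂ) ρ (starM X) =
      (bigRep ℚ (RingHom.id ℂ) ρ X)ᴴ * diagBlocks ι S := by
  have h : ∀ y : ℚ[G], ringRep ℚ (RingHom.id ℂ) ρ y =
      ∑ g, (algebraMap ℚ ℂ (y.coeff g)) • matRep ρ g := by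
    intro y
    ext a b
    rw [ringRep_apply, Matrix.sum_apply]
    rfl
  have hk : ∀ g, S * matRep ρ g⁻¹ = (matRep ρ g)ᴴ * S := by
    intro g
    conv_lhs => rw [← hS g]
    rw [Matrix.mul_assoc _ (matRep ρ g), ← map_mul, mul_inv_cancel, map_one, Matrix.mul_one]
  have key : ∀ x : ℚ[G], S * ringRep ℚ (RingHom.id ℂ) ρ (starG x) =
      (ringRep ℚ (RingHom.id ℂ) ρ x)ᴴ * S := by
    intro x
    rw [h, h, Matrix.conjTranspose_sum, sum_mul, mul_sum,
      ← Equiv.sum_comp (Equiv.inv G)]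
    refine sum_congr rfl fun g _ => ?_
    rw [Matrix.conjTranspose_smul, starG_coeff, Equiv.inv_apply, inv_inv, Matrix.smul_mul,
      Matrix.mul_smul, hk]
    congr 1
    simp
  ext ⟨i, a⟩ ⟨j, b⟩
  rw [mul_diagBlocks_apply, diagBlocks_mul_apply]
  exact congrFun (congrFun (key (X j i)) a) b

lemma exists_pair_equiv {κ : BilinForm ℂ (Fin n → ℂ)} (ha : κ.IsAlt)
    (hn : κ.Nondegenerate) : ∃ k, Nonempty (Fin k × Fin 2 ≃ Fin n) := by
  obtain ⟨k, u, -⟩ := exists_hyperbolic κ ha hn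
  exact ⟨k, ⟨u.indexEquiv (basisFun ℂ (Fin n))⟩⟩

lemma IsSymplectic.exists_matrix (h : IsSymplectic ρ) :
    ∃ (k : ℕ) (_ : Fin k × Fin 2 ≃ Fin n) (K : Matrix (Fin n) (Fin n) ℂ), Kᵀ = -K ∧ K.det ≠ 0 ∧
      ∀ g, (matRep ρ g)ᵀ * K * matRep ρ g = K := by
  obtain ⟨k, ⟨e⟩⟩ := let ⟨_, ha, hn, _⟩ := h; exists_pair_equiv ha hn
  exact ⟨k, e, (isSymplectic_iff ρ).1 h⟩

open scoped ComplexOrder in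
lemma exists_posDef_invariant : ∃ S : Matrix (Fin n) (Fin n) ℂ, S.PosDef ∧
    ∀ g, (matRep ρ g)ᴴ * S * matRep ρ g = S := by
  classical
  refine ⟨∑ h, (matRep ρ h)ᴴ * matRep ρ h, ?_, fun g => ?_⟩
  · rw [← Finset.add_sum_erase _ _ (mem_univ (1 : G))]
    refine PosDef.add_posSemidef (by simpa using PosDef.one) ?_
    exact Finset.sum_induction _ PosSemidef (fun _ _ ha hb => ha.add hb)
      PosSemidef.zero (fun _ _ => Matrix.posSemidef_conjTranspose_mul_self _)
  · rw [mul_sum, sum_mul]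
    refine sum_equiv (Equiv.mulRight g) _ _ fun h => ?_
    simp only [Equiv.coe_mulRight, map_mul, Matrix.conjTranspose_mul, Matrix.mul_assoc]

/-- A reindexing of sums of copies of a space with a basis of pairs. -/
def pairEquiv (ι : Type*) {k n : ℕ} (e : Fin k × Fin 2 ≃ Fin n) : (ι × Fin k) × Fin 2 ≃ ι × Fin n :=
  (Equiv.prodAssoc ι (Fin k) (Fin 2)).trans ((Equiv.refl ι).prodCongr e)

open scoped ComplexOrder in
lemma posDef_diagBlocks {S : Matrix (Fin n) (Fin n) ℂ} (hS : S.PosDef) :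
    (diagBlocks ι S).PosDef := by
  have : diagBlocks ι S = kronecker 1 S := by
    ext x y
    simp [diagBlocks, one_apply]
  rw [this]
  exact PosDef.one.kronecker hS

lemma detM_pos (h : IsSymplectic ρ) (X : Matrix ι ι ℚ[G])
    (hX : detC ρ X ≠ 0) :
    ∃ r : ℝ, 0 < r ∧ detC ρ X = r := by
  obtain ⟨k, e, K, hK, hd, hi⟩ := h.exists_matrix
  obtain ⟨S, hS, hSi⟩ := exists_posDef_invariant ρ
  refine det_pos_of_adjoint (pairEquiv ι e) (diagBlocks ι K) (diagBlocks ι S)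
    (bigRep ℚ (RingHom.id ℂ) ρ X) (bigRep ℚ (RingHom.id ℂ) ρ (starM X)) ?_ ?_
    (posDef_diagBlocks hS) (bigRep_starM ρ K hi X) (bigRep_starM_conj ρ S hSi X) hX
  · rw [diagBlocks_transpose, hK, diagBlocks_neg]
  · rw [det_diagBlocks]
    exact pow_ne_zero _ hd

end

section

open Matrix Polynomial

variable {ι : Type*} [Fintype ι] [DecidableEq ι]

lemma detM_mem_Qbar {n : ℕ} (ρ : CRep G n)
    (X : Matrix ι ι ℚ[G]) : detC ρ X ∈ Qbar := by
  refine detM_mem ℚ (RingHom.id ℂ) ρ Qbar.toSubalgebra (fun a g => ?_) X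
  exact mul_mem (algebraMap_mem Qbar a) (mem_algebraicClosure_iff.2 (isAlgebraic_character ρ g))

lemma detM_ne_zero {n : ℕ} (ρ : CRep G n)
    {X : Matrix ι ι ℚ[G]} (hX : IsUnit X) :
    detC ρ X ≠ 0 :=
  (hX.map (detC ρ)).ne_zero

lemma detM_conj_apply (φ : ℂ →+* ℂ) {n : ℕ} (ρ : CRep G n)
    (X : Matrix ι ι ℚ[G]) :
    detC (conjRep φ ρ) X = φ (detC ρ X) := by
  have h := detM_map ℚ (RingHom.id ℂ) ρ φ (RingHom.id ℚ) (fun a => by simp) X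
  have h2 : X.map (MonoidAlgebra.mapRingHom G (RingHom.id ℚ)) = X := by
    ext i j g
    simp
  rw [h2] at h
  rw [← h, detM_conjRep]
  rfl

lemma exists_detHom (X : Matrix ι ι ℚ[G]) (hX : IsUnit X) :
    ∃ f : equivHom (RG G) Qbarˣ galUnits, ∀ n (ρ : CRep G n),
      ((f.1 (ofAdd (charR ρ)) : Qbar) : ℂ) = detC ρ X := by
  let Φ : ∀ n : ℕ, CRep G n → Qbarˣ := fun n ρ =>
    Units.mk0 ⟨_, detM_mem_Qbar ρ X⟩ fun h => detM_ne_zero ρ hX (congrArg val h)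
  have hΦ : ∀ n ρ, ((Φ n ρ : Qbar) : ℂ) = detC ρ X := fun _ _ => rfl
  have hext : ∀ x y : Qbarˣ, ((x : Qbar) : ℂ) = ((y : Qbar) : ℂ) → x = y :=
    fun x y h => Units.ext (Subtype.ext h)
  obtain ⟨f, hf⟩ := exists_equivHom (RG G) (fun _ _ => True) (by simp [RG]) (fun _ => trivial)
    (fun _ _ _ _ _ _ => trivial) (fun _ _ _ _ => trivial) galUnits Φ
    (fun n m ρ ρ' _ _ h => hext _ _ (by rw [hΦ, hΦ, detM_congr ℚ _ h]))
    (fun n m ρ ρ' _ _ => hext _ _ (by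
      rw [hΦ, detM_sumRep, val_mul, MulMemClass.coe_mul, hΦ, hΦ]))
    (fun n ρ ω φ hφ _ => hext _ _ (by
      rw [hΦ, detM_conj_apply, ← hΦ, hφ]; rfl))
  exact ⟨f, fun n ρ => by rw [← hΦ]; exact congrArg _ (congrArg _ (hf n ρ trivial (charR ρ).2))⟩

lemma charRs_ofAdd_eq {M : Type*} [CommGroup M] {act : Gal → M →* M}
    (f : equivHom (RG G) M act) {n : ℕ} (ρ : CRep G n) (h : IsSymplectic ρ) :
    (restrictHom M act f).1 (ofAdd (charRs ρ h)) =
      f.1 (ofAdd (charR ρ)) := rfl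

lemma equivHom_induction (p : Multiplicative (RGs G) → Prop)
    (h : ∀ n (ρ : CRep G n) (hρ : IsSymplectic ρ),
      p (ofAdd (charRs ρ hρ)))
    (one : p 1) (mul : ∀ x y, p x → p y → p (x * y)) (inv : ∀ x, p x → p x⁻¹) : ∀ x, p x := by
  suffices hs : ∀ (ψ : G → ℂ) (hψ : ψ ∈ RGs G), p (ofAdd ⟨ψ, hψ⟩) from
    fun x => hs x.toAdd.1 x.toAdd.2
  intro ψ hψ
  induction hψ using closure_induction with
  | mem χ hχ =>
    obtain ⟨n, ρ, hρ, rfl⟩ := hχ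
    exact h n ρ hρ
  | zero => exact one
  | add x y hx hy h1 h2 => exact mul _ _ h1 h2
  | neg x hx h1 => exact inv _ h1

lemma equivHom_RG_induction (p : Multiplicative (RG G) → Prop)
    (h : ∀ n (ρ : CRep G n), p (ofAdd (charR ρ)))
    (one : p 1) (mul : ∀ x y, p x → p y → p (x * y)) (inv : ∀ x, p x → p x⁻¹) : ∀ x, p x := by
  suffices hs : ∀ (ψ : G → ℂ) (hψ : ψ ∈ RG G), p (ofAdd ⟨ψ, hψ⟩) from
    fun x => hs x.toAdd.1 x.toAdd.2
  intro ψ hψ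
  induction hψ using closure_induction with
  | mem χ hχ =>
    obtain ⟨n, ρ, rfl⟩ := hχ
    exact h n ρ
  | zero => exact one
  | add x y hx hy h1 h2 => exact mul _ _ h1 h2
  | neg x hx h1 => exact inv _ h1

lemma detHom_mem_posHom (X : Matrix ι ι ℚ[G]) (hX : IsUnit X)
    (f : equivHom (RG G) Qbarˣ galUnits)
    (hf : ∀ n (ρ : CRep G n),
      ((f.1 (ofAdd (charR ρ)) : Qbar) : ℂ) = detC ρ X) :
    restrictHom Qbarˣ galUnits f ∈ posHom G := by
  intro ψ ω
  revert ψ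
  obtain ⟨φ, hφ⟩ := exists_extension ω
  refine equivHom_induction _ (fun n ρ hρ => ?_) ?_ ?_ ?_
  · rw [charRs_ofAdd_eq, ← hφ, hf, ← detM_conj_apply]
    exact detM_pos _ (hρ.conjRep φ) X (detM_ne_zero _ hX)
  · exact ⟨1, one_pos, by simp⟩
  · rintro x y ⟨r, hr, h⟩ ⟨s, hs, h'⟩
    exact ⟨r * s, mul_pos hr hs, by simp [h, h']⟩
  · rintro x ⟨r, hr, h⟩
    exact ⟨r⁻¹, inv_pos.2 hr, by simp [h]⟩

/-- The determinant of `1 + t (M - 1)` at a representation, as a polynomial in `t`. -/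
def pencilDet (M : Matrix ι ι ℚ[G]) {n : ℕ} (ρ : CRep G n) :
    ℂ[X] :=
  detM ℂ[X] C ρ (1 + (MonoidAlgebra.single (1 : G) (X : ℂ[X])) •
    (M.map (MonoidAlgebra.mapRingHom G (algebraMap ℚ ℂ[X])) - 1))

lemma eval_pencilDet (M : Matrix ι ι ℚ[G]) {n : ℕ}
    (ρ : CRep G n) (t : ℂ) :
    (pencilDet M ρ).eval t = (1 + t • (bigRep ℚ (RingHom.id ℂ) ρ M - 1)).det := by
  change evalRingHom t (detM ℂ[X] C ρ (1 + (MonoidAlgebra.single (1 : G) (X : ℂ[X])) •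
    (M.map (MonoidAlgebra.mapRingHom G (algebraMap ℚ ℂ[X])) - 1))) = _
  rw [detM_apply, map_det, map_add, map_one, map_add, map_one]
  congr 2
  have h2 : bigRep ℂ[X] C ρ ((MonoidAlgebra.single (1 : G) (X : ℂ[X])) •
      (M.map (MonoidAlgebra.mapRingHom G (algebraMap ℚ ℂ[X])) - 1)) = (X : ℂ[X]) •
      (bigRep ℂ[X] C ρ (M.map (MonoidAlgebra.mapRingHom G (algebraMap ℚ ℂ[X]))) - 1) := by
    rw [← map_one (bigRep ℂ[X] C ρ), ← map_sub]
    ext x y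
    rw [bigRep_apply, Matrix.smul_apply, Matrix.smul_apply, bigRep_apply, smul_eq_mul]
    have : MonoidAlgebra.single (1 : G) (X : ℂ[X]) = algebraMap ℂ[X] (MonoidAlgebra ℂ[X] G) X := rfl
    rw [this, ← Algebra.smul_def, map_smul]
    rfl
  rw [h2]
  ext x y
  rw [mapMatrix_apply, map_apply, Matrix.smul_apply, Matrix.smul_apply, smul_eq_mul,
    map_mul, Matrix.sub_apply, Matrix.sub_apply, map_sub, bigRep_apply, bigRep_apply, map_apply,
    ringRep_apply, ringRep_apply, map_sum]
  simp only [coe_evalRingHom, eval_X, smul_eq_mul]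
  congr 2
  · refine sum_congr rfl fun g _ => ?_
    simp
  · simp only [one_apply]
    split_ifs <;> simp

lemma pencilDet_congr (M : Matrix ι ι ℚ[G]) {n m : ℕ}
    {ρ : CRep G n} {ρ' : CRep G m}
    (h : ρ.character = ρ'.character) : pencilDet M ρ = pencilDet M ρ' :=
  detM_congr _ _ h _

lemma pencilDet_sumRep (M : Matrix ι ι ℚ[G]) {n m : ℕ}
    (ρ : CRep G n) (ρ' : CRep G m) :
    pencilDet M (sumRep ρ ρ') = pencilDet M ρ * pencilDet M ρ' :=
  detM_sumRep _ _ _ _ _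

lemma pencilDet_conjRep (M : Matrix ι ι ℚ[G]) {n : ℕ}
    (ρ : CRep G n) (φ : ℂ →+* ℂ) :
    pencilDet M (conjRep φ ρ) = (pencilDet M ρ).map φ := by
  have h := detM_map ℂ[X] C ρ (mapRingHom φ) (mapRingHom φ) (fun a => rfl)
    (1 + (MonoidAlgebra.single (1 : G) (X : ℂ[X])) •
      (M.map (MonoidAlgebra.mapRingHom G (algebraMap ℚ ℂ[X])) - 1))
  change _ = mapRingHom φ _
  rw [pencilDet, pencilDet, ← h, detM_conjRep]
  have h1 : (mapRingHom φ).comp C = C.comp φ := by ext <;> simp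
  rw [h1]
  congr 1
  rw [← mapMatrix_apply (MonoidAlgebra.mapRingHom G (mapRingHom φ)), map_add, map_one]
  congr 1
  ext i j : 2
  simp only [Matrix.smul_apply, mapMatrix_apply, map_apply, smul_eq_mul, map_mul,
    Matrix.sub_apply, map_sub]
  have h2 : MonoidAlgebra.mapRingHom G (mapRingHom φ) (MonoidAlgebra.single 1 X) =
      MonoidAlgebra.single 1 X := by simp
  rw [h2]
  have h3 : (MonoidAlgebra.mapRingHom G (algebraMap ℚ ℂ[X])) (M i j) =
      (MonoidAlgebra.mapRingHom G (mapRingHom φ))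
        ((MonoidAlgebra.mapRingHom G (algebraMap ℚ ℂ[X])) (M i j)) := by
    rw [← RingHom.comp_apply, ← MonoidAlgebra.mapRingHom_comp]
    congr 2
    exact Subsingleton.elim _ _
  rw [← h3]
  simp only [one_apply]
  split_ifs <;> simp

lemma exists_pfHom (M : Matrix ι ι ℚ[G]) (hM : starM M = M) (hu : IsUnit M) :
    ∃ h : equivHom (RGs G) Qbarˣ galUnits, ∀ (n k : ℕ) (ρ : CRep G n)
      (hρ : IsSymplectic ρ) (e : Fin k × Fin 2 ≃ Fin n) (K : Matrix (Fin n) (Fin n) ℂ), Kᵀ = -K →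
      K.det ≠ 0 → (∀ g, (matRep ρ g)ᵀ * K * matRep ρ g = K) →
      pfm ((diagBlocks ι K * bigRep ℚ (RingHom.id ℂ) ρ M).submatrix (pairEquiv ι e)
          (pairEquiv ι e)) =
        pfm ((diagBlocks ι K).submatrix (pairEquiv ι e) (pairEquiv ι e)) *
        ((h.1 (ofAdd (charRs ρ hρ)) : Qbar) : ℂ) := by
  classical
  have hq : ∀ (n k : ℕ) (ρ : CRep G n)
      (e : Fin k × Fin 2 ≃ Fin n) (K : Matrix (Fin n) (Fin n) ℂ), Kᵀ = -K →
      K.det ≠ 0 → (∀ g, (matRep ρ g)ᵀ * K * matRep ρ g = K) → ∃ q : ℂ[X], q.eval 0 = 1 ∧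
      q ^ 2 = pencilDet M ρ ∧
      pfm ((diagBlocks ι K * bigRep ℚ (RingHom.id ℂ) ρ M).submatrix (pairEquiv ι e)
          (pairEquiv ι e)) =
        pfm ((diagBlocks ι K).submatrix (pairEquiv ι e) (pairEquiv ι e)) * q.eval 1 := by
    intro n k ρ e K hK hd hi
    have hKt : (diagBlocks ι K)ᵀ = -diagBlocks ι K := by
      rw [diagBlocks_transpose, hK, diagBlocks_neg]
    have hB := bigRep_starM ρ K hi M
    rw [hM] at hB
    have hKd : (diagBlocks ι K).det ≠ 0 := by rw [det_diagBlocks]; exact pow_ne_zero _ hd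
    obtain ⟨q, q0, qpf, qdet⟩ := exists_pfaffian_pencil
      ((diagBlocks ι K).submatrix (pairEquiv ι e) (pairEquiv ι e))
      ((diagBlocks ι K * bigRep ℚ (RingHom.id ℂ) ρ M).submatrix (pairEquiv ι e) (pairEquiv ι e))
      (by rw [transpose_submatrix, hKt]; rfl)
      (by rw [transpose_submatrix, transpose_mul, hKt, Matrix.mul_neg, hB]; rfl)
      (by rwa [det_submatrix_equiv_self])
    refine ⟨q, q0, Polynomial.funext fun t => ?_, ?_⟩
    · rw [eval_pow, eval_pencilDet]
      have h := qdet t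
      have h5 : (diagBlocks ι K).submatrix (pairEquiv ι e) (pairEquiv ι e) +
          t • ((diagBlocks ι K * bigRep ℚ (RingHom.id ℂ) ρ M).submatrix (pairEquiv ι e)
            (pairEquiv ι e) - (diagBlocks ι K).submatrix (pairEquiv ι e) (pairEquiv ι e)) =
          (diagBlocks ι K * (1 + t • (bigRep ℚ (RingHom.id ℂ) ρ M - 1))).submatrix (pairEquiv ι e)
            (pairEquiv ι e) := by
        rw [mul_add, mul_smul_comm, mul_sub, mul_one]; rfl
      rw [h5, det_submatrix_equiv_self, det_submatrix_equiv_self, det_mul] at h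
      exact (mul_left_cancel₀ hKd h).symm
    · have h := qpf 1
      rwa [one_smul, add_sub_cancel] at h
  let Q : ∀ n : ℕ, CRep G n → ℂ[X] := fun n ρ =>
    if h : ∃ q : ℂ[X], q.eval 0 = 1 ∧ q ^ 2 = pencilDet M ρ then h.choose else 0
  have hQ : ∀ n (ρ : CRep G n), IsSymplectic ρ →
      (Q n ρ).eval 0 = 1 ∧ (Q n ρ) ^ 2 = pencilDet M ρ := by
    intro n ρ hρ
    obtain ⟨k, e, K, hK, hd, hi⟩ := hρ.exists_matrix
    obtain ⟨q, h1, h2, -⟩ := hq n k ρ e K hK hd hi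
    have h : ∃ q : ℂ[X], q.eval 0 = 1 ∧ q ^ 2 = pencilDet M ρ := ⟨q, h1, h2⟩
    simp only [Q, dif_pos h]
    exact h.choose_spec
  have hQu : ∀ n (ρ : CRep G n), IsSymplectic ρ → ∀ q : ℂ[X],
      q.eval 0 = 1 → q ^ 2 = pencilDet M ρ → Q n ρ = q := fun n ρ hρ q h1 h2 =>
    eq_of_sq_eq_of_eval_zero ((hQ n ρ hρ).2.trans h2.symm) (hQ n ρ hρ).1 h1
  have hP1 : ∀ n (ρ : CRep G n),
      (pencilDet M ρ).eval 1 = detC ρ M := fun n ρ => by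
    rw [eval_pencilDet, one_smul, add_sub_cancel]; rfl
  have hsq : ∀ n (ρ : CRep G n), IsSymplectic ρ →
      ((Q n ρ).eval 1) ^ 2 = detC ρ M := fun n ρ hρ => by
    rw [← eval_pow, (hQ n ρ hρ).2, hP1]
  let Φ : ∀ n : ℕ, CRep G n → Qbarˣ := fun n ρ =>
    if h : ∃ z : Qbarˣ, ((z : Qbar) : ℂ) = (Q n ρ).eval 1 then h.choose else 1
  have hΦ : ∀ n (ρ : CRep G n), IsSymplectic ρ →
      ((Φ n ρ : Qbar) : ℂ) = (Q n ρ).eval 1 := by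
    intro n ρ hρ
    have h : ∃ z : Qbarˣ, ((z : Qbar) : ℂ) = (Q n ρ).eval 1 := by
      have hmem : (Q n ρ).eval 1 ∈ Qbar := by
        refine mem_algebraicClosure_iff.2 (IsAlgebraic.of_pow two_pos ?_)
        rw [hsq n ρ hρ]
        exact mem_algebraicClosure_iff.1 (detM_mem_Qbar ρ M)
      refine ⟨Units.mk0 ⟨_, hmem⟩ fun h0 => detM_ne_zero ρ hu ?_, rfl⟩
      have h1 : (Q n ρ).eval 1 = 0 := congrArg val h0
      rw [← hsq n ρ hρ, h1, zero_pow two_ne_zero]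
    simp only [Φ, dif_pos h]
    exact h.choose_spec
  have hext : ∀ x y : Qbarˣ, ((x : Qbar) : ℂ) = ((y : Qbar) : ℂ) → x = y :=
    fun x y h => Units.ext (Subtype.ext h)
  obtain ⟨f, hf⟩ := exists_equivHom (RGs G) (fun n ρ => IsSymplectic ρ) rfl isSymplectic_zero
    (fun _ _ _ _ h h' => h.sumRep h') (fun _ _ φ h => h.conjRep φ) galUnits Φ
    (fun n m ρ ρ' hρ hρ' h => hext _ _ (by
      obtain rfl := eq_of_character_eq h
      rw [hΦ _ _ hρ, hΦ _ _ hρ', hQu _ ρ hρ _ (hQ _ ρ' hρ').1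
        (by rw [(hQ _ ρ' hρ').2, pencilDet_congr M h])]))
    (fun n m ρ ρ' hρ hρ' => hext _ _ (by
      rw [hΦ _ _ (hρ.sumRep hρ'), val_mul, MulMemClass.coe_mul, hΦ _ _ hρ, hΦ _ _ hρ',
        ← eval_mul]
      rw [hQu _ _ (hρ.sumRep hρ') (Q _ ρ * Q _ ρ')
        (by rw [eval_mul, (hQ _ _ hρ).1, (hQ _ _ hρ').1, one_mul])
        (by rw [mul_pow, (hQ _ _ hρ).2, (hQ _ _ hρ').2, pencilDet_sumRep])]))
    (fun n ρ ω φ hφ hρ => hext _ _ (by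
      have h1 : ((galUnits ω (Φ n ρ) : Qbar) : ℂ) = φ ((Φ n ρ : Qbar) : ℂ) := (hφ _).symm
      rw [h1, hΦ _ _ hρ, hΦ _ _ (hρ.conjRep φ), hQu _ _ (hρ.conjRep φ) ((Q _ ρ).map φ) ?_ ?_]
      · have := Polynomial.eval₂_at_apply (p := Q n ρ) φ 1
        rw [map_one] at this
        rw [← this, Polynomial.eval_map]
      · have := Polynomial.eval₂_at_apply (p := Q n ρ) φ 0
        rw [map_zero, (hQ _ _ hρ).1, map_one] at this
        rw [← this, Polynomial.eval_map]
      · rw [← Polynomial.map_pow, (hQ _ _ hρ).2, pencilDet_conjRep]))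
  refine ⟨f, fun n k ρ hρ e K hK hd hi => ?_⟩
  obtain ⟨q, h1, h2, h3⟩ := hq n k ρ e K hK hd hi
  have h4 : f.1 (ofAdd (charRs ρ hρ)) = Φ n ρ := hf n ρ hρ (charRs ρ hρ).2
  rw [h3, h4, hΦ _ _ hρ, hQu _ _ hρ q h1 h2]

end

section

/-- The component at `p` on `Zhat ⊗ ℂ`. -/
def adeleAtC (p : Primes) : AdeleC →+* LocalC p :=
  (Algebra.TensorProduct.map ((ringHom (p := (p : ℕ))).comp (zhatProj p)).toIntAlgHom
    (AlgHom.id ℤ ℂ) : Zhat ⊗[ℤ] ℂ →ₐ[ℤ] ℚ_[p] ⊗[ℤ] ℂ).toRingHom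

lemma finAdele_hom_ext {M : Type*} [AddCommMonoid M] (f g : FinAdele →+ M)
    (h : ∀ (z : Zhat) (c : Qbar), f (z ⊗ₜ[ℤ] c : Zhat ⊗[ℤ] Qbar) = g (z ⊗ₜ[ℤ] c : Zhat ⊗[ℤ] Qbar))
    (x : FinAdele) : f x = g x :=
  induction_on (motive := fun x => f x = g x) (x : Zhat ⊗[ℤ] Qbar)
    ((map_zero f).trans (map_zero g).symm) h
    fun x y hx hy => (map_add f x y).trans ((congrArg₂ (· + ·) hx hy).trans (map_add g x y).symm)

lemma adeleAtC_adeleToComplex (p : Primes) (x : FinAdele) :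
    adeleAtC p (adeleToComplex x) = adeleAt p x :=
  finAdele_hom_ext ((adeleAtC p).comp adeleToComplex).toAddMonoidHom (adeleAt p).toAddMonoidHom
    (fun _ _ => rfl) x

lemma adeleAtC_comp_adeleInclC (p : Primes) :
    (adeleAtC p).comp adeleInclC = localInclC p := by
  ext z
  change ((ringHom.comp (zhatProj p)) 1) ⊗ₜ[ℤ] z = (1 : ℚ_[p]) ⊗ₜ[ℤ] z
  rw [map_one]

lemma adeleAtC_algebraMap (p : Primes) (a : Zhat) :
    adeleAtC p (algebraMap Zhat AdeleC a) =
      algebraMap ℚ_[p] (LocalC p) ((ringHom.comp (zhatProj p)) a) := rfl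

/-- The map on `Zhat ⊗ ℂ` induced by a ring endomorphism of `ℂ`. -/
def conjAdeleC (φ : ℂ →+* ℂ) : AdeleC →+* AdeleC :=
  (Algebra.TensorProduct.map (AlgHom.id ℤ Zhat) φ.toIntAlgHom :
    Zhat ⊗[ℤ] ℂ →ₐ[ℤ] Zhat ⊗[ℤ] ℂ).toRingHom

lemma conjAdeleC_comp_adeleInclC (φ : ℂ →+* ℂ) :
    (conjAdeleC φ).comp adeleInclC = adeleInclC.comp φ := rfl

lemma conjAdeleC_algebraMap (φ : ℂ →+* ℂ) (a : Zhat) :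
    conjAdeleC φ (algebraMap Zhat AdeleC a) = algebraMap Zhat AdeleC (RingHom.id Zhat a) := by
  change a ⊗ₜ[ℤ] (φ 1) = a ⊗ₜ[ℤ] (1 : ℂ)
  rw [map_one]

lemma conjAdeleC_adeleToComplex (φ : ℂ →+* ℂ) (ω : Gal) (h : ∀ z : Qbar, φ z = (ω z : Qbar))
    (x : FinAdele) : conjAdeleC φ (adeleToComplex x) = adeleToComplex (galAdele ω x) :=
  finAdele_hom_ext ((conjAdeleC φ).comp adeleToComplex).toAddMonoidHom
    (adeleToComplex.comp (galAdele ω)).toAddMonoidHom (fun z c => congrArg (z ⊗ₜ[ℤ] ·) (h c)) x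

lemma zhat_tmul_rat (x : Zhat ⊗[ℤ] ℚ) :
    ∃ (z : Zhat) (D : ℕ), D ≠ 0 ∧ x = z ⊗ₜ[ℤ] (1 / (D : ℚ)) := by
  induction x using induction_on with
  | zero => exact ⟨0, 1, one_ne_zero, by simp⟩
  | tmul z q =>
    refine ⟨q.num • z, q.den, q.den_nz, ?_⟩
    rw [smul_tmul]
    congr 1
    rw [zsmul_eq_mul, mul_one_div, Rat.num_div_den]
  | add x y hx hy =>
    obtain ⟨z, D, hD, rfl⟩ := hx
    obtain ⟨z', D', hD', rfl⟩ := hy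
    refine ⟨(D' : ℤ) • z + (D : ℤ) • z', D * D', mul_ne_zero hD hD', ?_⟩
    rw [add_tmul, smul_tmul, smul_tmul]
    have h1 : (D : ℚ) ≠ 0 := by exact_mod_cast hD
    have h2 : (D' : ℚ) ≠ 0 := by exact_mod_cast hD'
    congr 2 <;> rw [zsmul_eq_mul] <;> push_cast <;> field_simp

/-- The multiplication map `ℚₚ ⊗ ℚ → ℚₚ`. -/
def padicMul (p : Primes) : ℚ_[p] ⊗[ℤ] ℚ →ₗ[ℤ] ℚ_[p] :=
  TensorProduct.lift ((LinearMap.mul ℤ ℚ_[p]).compl₂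
    (algebraMap ℚ ℚ_[p]).toAddMonoidHom.toIntLinearMap)

lemma padicMul_tmul (p : Primes) (x : ℚ_[p]) (q : ℚ) :
    padicMul p (x ⊗ₜ[ℤ] q) = x * algebraMap ℚ ℚ_[p] q := rfl

lemma zhat_tmul_rat_eq_zero (x : Zhat ⊗[ℤ] ℚ)
    (h : ∀ p, padicMul p (rTensor ℚ
      ((ringHom (p := (p : ℕ))).comp (zhatProj p)).toAddMonoidHom.toIntLinearMap x) = 0) :
    x = 0 := by
  obtain ⟨z, D, hD, rfl⟩ := zhat_tmul_rat x
  have hz : z = 0 := by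
    funext p
    have := h p
    rw [LinearMap.rTensor_tmul, padicMul_tmul] at this
    rcases mul_eq_zero.1 this with h1 | h1
    · exact Subtype.ext h1
    · rw [map_eq_zero] at h1
      simp [hD] at h1
  rw [hz, TensorProduct.zero_tmul]

lemma finAdele_eq_zero (x : FinAdele) (h : ∀ p, adeleAt p x = 0) : x = 0 := by
  classical
  let b := Basis.ofVectorSpace ℚ Qbar
  let e : Zhat ⊗[ℤ] Qbar ≃ₗ[ℤ] Zhat ⊗[ℤ] (_ →₀ ℚ) :=
    LinearEquiv.lTensor Zhat (b.repr.restrictScalars ℤ)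
  have key : ∀ i, TensorProduct.map LinearMap.id ((b.coord i).restrictScalars ℤ)
      (x : Zhat ⊗[ℤ] Qbar) = 0 := by
    intro i
    refine zhat_tmul_rat_eq_zero _ fun p => ?_
    obtain ⟨ℓ, hℓ⟩ := LinearMap.exists_extend (p := Subalgebra.toSubmodule Qbar.toSubalgebra)
      (b.coord i)
    let F1 : FinAdele →+ ℚ_[p] := (padicMul p ∘ₗ rTensor ℚ
      ((ringHom (p := (p : ℕ))).comp (zhatProj p)).toAddMonoidHom.toIntLinearMap ∘ₗ
      (TensorProduct.map LinearMap.id ((b.coord i).restrictScalars ℤ) :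
        Zhat ⊗[ℤ] Qbar →ₗ[ℤ] Zhat ⊗[ℤ] ℚ)).toAddMonoidHom
    let F2 : LocalC p →+ ℚ_[p] := (padicMul p ∘ₗ
      LinearMap.lTensor ℚ_[p] (ℓ.restrictScalars ℤ)).toAddMonoidHom
    have hF : F1 x = (F2.comp (adeleAt p).toAddMonoidHom) x := by
      refine finAdele_hom_ext _ _ (fun z c => ?_) x
      have : ℓ (c : ℂ) = b.coord i c := LinearMap.congr_fun hℓ c
      change _ * algebraMap ℚ ℚ_[p] (b.coord i c) = _ * algebraMap ℚ ℚ_[p] (ℓ (c : ℂ))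
      rw [this]
      rfl
    exact hF.trans ((congrArg F2 (h p)).trans (map_zero F2))
  have h0 : finsuppRight ℤ ℤ Zhat ℚ _ (e x) = 0 := by
    ext1 i
    rw [Finsupp.zero_apply, ← key i]
    let F1 : FinAdele →+ Zhat ⊗[ℤ] ℚ := ((Finsupp.lapply i : _ →ₗ[ℤ] Zhat ⊗[ℤ] ℚ) ∘ₗ
      (finsuppRight ℤ ℤ Zhat ℚ _).toLinearMap ∘ₗ e.toLinearMap).toAddMonoidHom
    let F2 : FinAdele →+ Zhat ⊗[ℤ] ℚ :=
      (TensorProduct.map LinearMap.id ((b.coord i).restrictScalars ℤ) :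
        Zhat ⊗[ℤ] Qbar →ₗ[ℤ] Zhat ⊗[ℤ] ℚ).toAddMonoidHom
    refine finAdele_hom_ext F1 F2 (fun z c => ?_) x
    change finsuppRight ℤ ℤ Zhat ℚ _ (z ⊗ₜ[ℤ] b.repr c) i = _
    rw [TensorProduct.finsuppRight_apply_tmul_apply]
    rfl
  exact e.injective (((LinearEquiv.map_eq_zero_iff _).1 h0).trans (map_zero e).symm)

lemma adeleToComplex_injective : Function.Injective adeleToComplex := by
  rw [injective_iff_map_eq_zero]
  intro x hx
  refine finAdele_eq_zero x fun p => ?_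
  rw [← adeleAtC_adeleToComplex, hx, map_zero]

lemma finIdele_ext {x y : FinIdele} (h : ∀ p, ideleAt p x = ideleAt p y) : x = y := by
  refine Units.ext (sub_eq_zero.1 (finAdele_eq_zero _ fun p => ?_))
  rw [map_sub, sub_eq_zero]
  exact congrArg Units.val (h p)

end

section

variable {ι : Type*} [Fintype ι] [DecidableEq ι]

/-- The inclusion `ℤₚ[G] → ℚₚ[G]`. -/
def toQp (G : Type u) [Group G] (p : Primes) :
    ℤ_[p][G] →+* ℚ_[p][G] :=
  MonoidAlgebra.mapRingHom G (ringHom (p := (p : ℕ)))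

/-- The projection `Zhat[G] → ℤₚ[G]`. -/
def projG (G : Type u) [Group G] (p : Primes) :
    Zhat[G] →+* ℤ_[p][G] :=
  MonoidAlgebra.mapRingHom G (zhatProj p)

lemma projG_coeff (p : Primes) (x : Zhat[G]) (g : G) :
    (projG G p x).coeff g = zhatProj p (x.coeff g) := by
  simp [projG]

/-- The element of `Zhat[G]` with given components. -/
def glueG (x : ∀ p : Primes, ℤ_[p][G]) : Zhat[G] :=
  ofCoeff (Finsupp.equivFunOnFinite.symm fun g => (fun p => (x p).coeff g : Zhat))

lemma projG_glueG (x : ∀ p : Primes, ℤ_[p][G]) (p : Primes) :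
    projG G p (glueG x) = x p := by
  ext g : 2
  rw [projG_coeff]
  rfl

lemma projG_ext {x y : Zhat[G]} (h : ∀ p, projG G p x = projG G p y) : x = y := by
  ext g : 2
  funext p
  have := congrArg (fun z => z.coeff g) (h p)
  simp only [projG_coeff] at this
  exact this

lemma mapRingHom_coe_comp_zhatProj (p : Primes) (x : Zhat[G]) :
    MonoidAlgebra.mapRingHom G (ringHom.comp (zhatProj p)) x =
      toQp G p (projG G p x) := by
  ext g
  simp [toQp, projG]

lemma adeleAtC_detM (p : Primes) {n : ℕ} (ρ : CRep G n)
    (X : Matrix ι ι Zhat[G]) :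
    adeleAtC p (detM Zhat adeleInclC ρ X) =
      detM ℚ_[p] (localInclC p) ρ ((X.map (projG G p)).map (toQp G p)) := by
  rw [← detM_map Zhat adeleInclC ρ (adeleAtC p)
    (ringHom.comp (zhatProj p)) (adeleAtC_algebraMap p) X, adeleAtC_comp_adeleInclC]
  congr 1
  refine Matrix.ext fun i j => ?_
  exact mapRingHom_coe_comp_zhatProj p _

lemma detM_mem_range (X : Matrix ι ι Zhat[G]) {n : ℕ}
    (ρ : CRep G n) :
    ∃ z : FinAdele, adeleToComplex z = detM Zhat adeleInclC ρ X := by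
  let : Algebra ℚ AdeleC := (adeleInclC.comp (algebraMap ℚ ℂ)).toAlgebra
  let T : Subalgebra ℚ AdeleC :=
    { adeleToComplex.range with
      algebraMap_mem' := fun r => ⟨diagAdele (algebraMap ℚ Qbar r), rfl⟩ }
  refine detM_mem Zhat adeleInclC ρ T (fun a g => ?_) X
  refine ⟨(a ⊗ₜ[ℤ] (⟨ρ.character g, mem_algebraicClosure_iff.2 (isAlgebraic_character ρ g)⟩ : Qbar) :
    Zhat ⊗[ℤ] Qbar), ?_⟩
  change a ⊗ₜ[ℤ] ρ.character g =
    ((a ⊗ₜ[ℤ] (1 : ℂ)) * ((1 : Zhat) ⊗ₜ[ℤ] ρ.character g) : Zhat ⊗[ℤ] ℂ)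
  rw [Algebra.TensorProduct.tmul_mul_tmul, mul_one, one_mul]

lemma adele_detM_congr (X : Matrix ι ι Zhat[G]) {n m : ℕ}
    {ρ : CRep G n} {ρ' : CRep G m}
    (h : ρ.character = ρ'.character) :
    detM Zhat adeleInclC ρ X = detM Zhat adeleInclC ρ' X := by
  let : Algebra ℚ AdeleC := (adeleInclC.comp (algebraMap ℚ ℂ)).toAlgebra
  exact detM_congr Zhat adeleInclC h X

lemma exists_ideleHom_of_mul_eq (X X' : Matrix ι ι Zhat[G]) (N : ℕ) (hN : N ≠ 0)
    (h : X * X' = (N : Matrix ι ι Zhat[G])) :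
    ∃ f : equivHom (RG G) FinIdele galIdele, ∀ n (ρ : CRep G n),
      adeleToComplex (f.1 (ofAdd (charR ρ)) : FinIdele) =
        detM Zhat adeleInclC ρ X := by
  have hunit : ∀ n (ρ : CRep G n),
      ∃ z : FinIdele, adeleToComplex z = detM Zhat adeleInclC ρ X := by
    intro n ρ
    obtain ⟨z, hz⟩ := detM_mem_range X ρ
    obtain ⟨z', hz'⟩ := detM_mem_range X' ρ
    have hdet : detM Zhat adeleInclC ρ (N : Matrix ι ι Zhat[G]) =
        adeleToComplex (diagAdele ((N : Qbar) ^ (card (ι × Fin n)))) := by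
      rw [detM_apply, map_natCast, map_pow, map_pow, map_natCast, map_natCast,
        ← Matrix.diagonal_natCast, Matrix.det_diagonal, prod_const, card_univ]
    have hzz : z * z' = diagAdele ((N : Qbar) ^ (card (ι × Fin n))) := by
      apply adeleToComplex_injective
      rw [map_mul, hz, hz', ← map_mul, h, hdet]
    have hu : IsUnit (z * z') := by
      rw [hzz]
      exact (IsUnit.mk0 _ (pow_ne_zero _ (cast_ne_zero.2 hN))).map diagAdele
    obtain ⟨w, hw⟩ := isUnit_of_mul_isUnit_left hu
    exact ⟨w, by rw [hw, hz]⟩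
  choose Φ hΦ using hunit
  have hext : ∀ x y : FinIdele, adeleToComplex x = adeleToComplex y → x = y :=
    fun x y h => Units.ext (adeleToComplex_injective h)
  obtain ⟨f, hf⟩ := exists_equivHom (RG G) (fun _ _ => True) (by simp [RG]) (fun _ => trivial)
    (fun _ _ _ _ _ _ => trivial) (fun _ _ _ _ => trivial) galIdele Φ
    (fun n m ρ ρ' _ _ h => hext _ _ (by rw [hΦ, hΦ, adele_detM_congr X h]))
    (fun n m ρ ρ' _ _ => hext _ _ (by
      rw [hΦ, detM_sumRep, val_mul, map_mul, hΦ, hΦ]))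
    (fun n ρ ω φ hφ _ => hext _ _ (by
      have h1 : adeleToComplex (galIdele ω (Φ n ρ) : FinIdele) =
        conjAdeleC φ (adeleToComplex (Φ n ρ)) := (conjAdeleC_adeleToComplex φ ω hφ _).symm
      rw [h1, hΦ, hΦ, detM_conjRep, ← detM_map Zhat adeleInclC ρ (conjAdeleC φ) (RingHom.id Zhat)
        (conjAdeleC_algebraMap φ), conjAdeleC_comp_adeleInclC]
      congr 1
      ext i j g
      simp))
  exact ⟨f, fun n ρ => by rw [← hΦ]; exact congrArg _ (congrArg _ (hf n ρ trivial (charR ρ).2))⟩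

lemma exists_ideleHom (X : ∀ p : Primes, (Matrix ι ι ℚ_[p][G])ˣ)
    (N : ℕ) (hN : N ≠ 0) (Y Z : ∀ p : Primes, Matrix ι ι ℤ_[p][G])
    (hY : ∀ p, (Y p).map (toQp G p) = (N : Matrix ι ι ℚ_[p][G]) * (X p).1)
    (hZ : ∀ p, (Z p).map (toQp G p) =
      (N : Matrix ι ι ℚ_[p][G]) * ((X p)⁻¹).1) :
    ∃ f : equivHom (RG G) FinIdele galIdele, ∀ n (ρ : CRep G n)
      (p : Primes), ideleAt p (f.1 (ofAdd (charR ρ))) =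
        Units.map (detM ℚ_[p] (localInclC p) ρ) (X p) := by
  have hinj : ∀ p : Primes, Function.Injective (fun M : Matrix ι ι ℤ_[p][G] =>
      M.map (toQp G p)) := by
    intro p M M' hMM
    ext i j g
    have := congrArg (fun z => (z i j).coeff g) hMM
    simp only [map_apply, toQp, coeff_mapRingHom] at this
    exact Subtype.ext this
  have hglue : ∀ (M : ∀ p : Primes, Matrix ι ι ℤ_[p][G]) (p : Primes),
      (of fun i j => glueG fun p => M p i j : Matrix ι ι Zhat[G]).map
        (projG G p) = M p := by
    intro M p
    refine Matrix.ext fun i j => ?_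
    exact projG_glueG _ p
  obtain ⟨f, hf⟩ := exists_ideleHom_of_mul_eq
    (of fun i j => glueG fun p => Y p i j) (of fun i j => glueG fun p => Z p i j)
    (N * N) (mul_ne_zero hN hN) (by
      refine Matrix.ext fun i j => ?_
      refine projG_ext fun p => ?_
      have h1 : Y p * Z p = ((N * N : ℕ) : Matrix ι ι ℤ_[p][G]) := by
        apply hinj p
        change (toQp G p).mapMatrix _ = (toQp G p).mapMatrix _
        rw [map_mul, map_natCast]
        change (Y p).map (toQp G p) * (Z p).map (toQp G p) = _
        rw [hY, hZ, mul_assoc, ← mul_assoc (X p).1, (Nat.cast_commute N (X p).1).symm.eq, mul_assoc,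
          Units.mul_inv, mul_one, Nat.cast_mul]
      have h2 := congrArg (fun M => M i j) h1
      have h3 : (projG G p).mapMatrix (((N * N : ℕ) : Matrix ι ι Zhat[G])) =
        ((N * N : ℕ) : Matrix ι ι ℤ_[p][G]) := map_natCast _ _
      have h4 : (projG G p).mapMatrix ((of fun i j => glueG fun p => Y p i j) *
        (of fun i j => glueG fun p => Z p i j)) = Y p * Z p := by
        rw [map_mul]
        exact congrArg₂ (· * ·) (hglue Y p) (hglue Z p)
      exact congrArg (fun M => M i j) (h4.trans (h1.trans h3.symm)))
  obtain ⟨f', hf'⟩ := exists_ideleHom_of_mul_eq (ι := ι) (G := G) N 1 N hN (mul_one _)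
  refine ⟨f * f'⁻¹, fun n ρ p => ?_⟩
  have h1 : ideleAt p ((f * f'⁻¹).1 (ofAdd (charR ρ))) =
      ideleAt p (f.1 (ofAdd (charR ρ))) *
      (ideleAt p (f'.1 (ofAdd (charR ρ))))⁻¹ := by
    rw [← map_inv, ← map_mul]; rfl
  rw [h1, mul_inv_eq_iff_eq_mul]
  refine Units.ext ?_
  have h2 : ∀ z : FinIdele, ((ideleAt p z : (LocalC p)ˣ) : LocalC p) =
    adeleAtC p (adeleToComplex z) := fun z => (adeleAtC_adeleToComplex p z).symm
  rw [val_mul, h2, h2, hf, hf', Units.coe_map, adeleAtC_detM, adeleAtC_detM, hglue, hY]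
  have h3 : ((N : Matrix ι ι Zhat[G]).map (projG G p)).map (toQp G p) =
      (N : Matrix ι ι ℚ_[p][G]) := by
    have e1 := map_natCast ((projG G p).mapMatrix (m := ι)) N
    have e2 := map_natCast ((toQp G p).mapMatrix (m := ι)) N
    rw [mapMatrix_apply] at e1 e2
    rw [e1, e2]
  rw [h3, map_mul, mul_comm]

lemma exists_mem_detZhat (x : ∀ p : Primes, ℤ_[p][G]ˣ) :
    ∃ f ∈ detZhat G, ∀ n (ρ : CRep G n) (p : Primes),
      ((ideleAt p (f.1 (ofAdd (charR ρ))) : (LocalC p)ˣ) : LocalC p) =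
        detM ℚ_[p] (localInclC p) ρ (of fun _ _ : Unit => toQp G p (x p)) := by
  let y : Zhat[G]ˣ :=
    ⟨glueG fun p => x p, glueG fun p => (x p)⁻¹.1,
      projG_ext fun p => by rw [map_mul, map_one, projG_glueG, projG_glueG, Units.mul_inv],
      projG_ext fun p => by rw [map_mul, map_one, projG_glueG, projG_glueG, Units.inv_mul]⟩
  obtain ⟨f, hf⟩ := exists_ideleHom_of_mul_eq (of fun _ _ : Unit => y.1)
    (of fun _ _ : Unit => y⁻¹.1) 1 one_ne_zero (by
      refine Matrix.ext fun i j => ?_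
      rw [mul_apply]
      simp)
  refine ⟨f, ⟨y, fun n ρ => Units.ext ?_⟩, fun n ρ p => ?_⟩
  · rw [detUnit_val, ← hf]; rfl
  · have h2 : ∀ z : FinIdele, ((ideleAt p z : (LocalC p)ˣ) : LocalC p) =
      adeleAtC p (adeleToComplex z) := fun z => (adeleAtC_adeleToComplex p z).symm
    rw [h2, hf, adeleAtC_detM]
    congr 1
    refine Matrix.ext fun i j => ?_
    exact congrArg (toQp G p) (projG_glueG (fun p => (x p : ℤ_[p][G])) p)

end

section

lemma exists_ne_zero_hom {F : Type*} {M K C D E : Type v} [Ring F] [AddCommGroup M] [Module F M]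
    [AddCommGroup K] [Module F K] [AddCommGroup C] [Module F C] [AddCommGroup D] [Module F D]
    [AddCommGroup E] [Module F E] [Finite K] [Finite C] [Finite D]
    (e₁ : (K × C) ≃ₗ[F] M) (e₂ : (E × D) ≃ₗ[F] M) (e₃ : C ≃ₗ[F] E) [Nontrivial K] :
    ∃ h : K →ₗ[F] D, h ≠ 0 := by
  by_contra! hz
  have hf : ∀ (X : Type v) [AddCommGroup X] [Module F X] [Finite X], Finite (K →ₗ[F] X) :=
    fun X _ _ _ => Finite.of_injective _ (DFunLike.coe_injective (F := K →ₗ[F] X))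
  have := hf K
  have := hf C
  have := hf D
  have c1 : Nat.card ((K →ₗ[F] K) × (K →ₗ[F] C)) = Nat.card ((K →ₗ[F] E) × (K →ₗ[F] D)) :=
    Nat.card_congr ((LinearMap.prodEquiv ℕ).toEquiv.trans
      ((LinearEquiv.arrowCongrAddEquiv (LinearEquiv.refl F K) (e₁.trans e₂.symm)).toEquiv.trans
      (LinearMap.prodEquiv ℕ).toEquiv.symm))
  have c2 : Nat.card (K →ₗ[F] E) = Nat.card (K →ₗ[F] C) :=
    Nat.card_congr (LinearEquiv.arrowCongrAddEquiv (LinearEquiv.refl F K) e₃.symm).toEquiv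
  have c3 : Nat.card (K →ₗ[F] D) = 1 := by
    rw [Nat.card_eq_one_iff_unique]
    exact ⟨⟨fun a b => (hz a).trans (hz b).symm⟩, ⟨0⟩⟩
  rw [Nat.card_prod, Nat.card_prod, c2, c3, mul_one] at c1
  have h0 : 0 < Nat.card (K →ₗ[F] C) := Nat.card_pos
  have c4 : Nat.card (K →ₗ[F] K) = 1 := Nat.eq_of_mul_eq_mul_right h0 (c1.trans (one_mul _).symm)
  rw [Nat.card_eq_one_iff_unique] at c4
  obtain ⟨x, hx⟩ := exists_ne (0 : K)
  exact hx (LinearMap.congr_fun (c4.1.elim LinearMap.id 0) x)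

lemma exists_isUnit_add_mul_of_isSemisimpleRing {F : Type v} [Ring F] [Finite F]
    [IsSemisimpleRing F] (a b x y : F) (h : x * a + y * b = 1) : ∃ t, IsUnit (a + t * b) := by
  let f : F → (F →ₗ[F] F) := fun t => toSpanSingleton F F (a + t * b)
  let t := Function.argmin (fun t => Nat.card (ker (f t))) 
  have ht : ∀ t', Nat.card (ker (f t)) ≤ Nat.card (ker (f t')) :=
    fun t' => Function.argmin_le (fun t => Nat.card (ker (f t))) t'
  have hfa : ∀ t r, f t r = r * (a + t * b) := fun t r => rfl
  suffices hk : ker (f t) = ⊥ by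
    refine ⟨t, ?_⟩
    obtain ⟨s, hs⟩ := Finite.surjective_of_injective (LinearMap.ker_eq_bot.1 hk) 1
    have hs' : s * (a + t * b) = 1 := hs
    exact ⟨⟨a + t * b, s, mul_eq_one_symm hs', hs'⟩, rfl⟩
  by_contra hK
  have hnt : Nontrivial (ker (f t)) := Submodule.nontrivial_iff_ne_bot.2 hK
  obtain ⟨C, hC⟩ := exists_isCompl (ker (f t))
  obtain ⟨D, hD⟩ := exists_isCompl (range (f t))
  obtain ⟨h', hh'⟩ := exists_ne_zero_hom (Submodule.prodEquivOfIsCompl _ _ hC)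
    (Submodule.prodEquivOfIsCompl _ _ hD) ((f t).kerComplementEquivRange hC.symm)
  let pD : F →ₗ[F] D := Submodule.projectionOnto D (range (f t)) hD.symm
  let pK : F →ₗ[F] ker (f t) := Submodule.projectionOnto _ C hC
  let g : F →ₗ[F] F := toSpanSingleton F F b
  have hg : ∀ r, g r = r * b := fun r => rfl
  have hpf : ∀ r, pD (f t r) = 0 := fun r =>
    (Submodule.projectionOnto_apply_eq_zero_iff hD.symm).2 ⟨r, rfl⟩
  have hpD : ∀ d : D, pD (d : F) = d := Submodule.projectionOnto_apply_left hD.symm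
  have hsurj : Surjective (pD.comp g) := by
    intro d
    refine ⟨d * (y - x * t), ?_⟩
    have h1 : (d : F) = f t (d * x) + g (d * (y - x * t)) := by
      rw [hfa, hg]
      calc (d : F) = d * (x * a + y * b) := by rw [h, mul_one]
        _ = _ := by noncomm_ring
    have h2 := hpD d
    rw [h1, map_add, hpf, zero_add] at h2
    exact h2
  have : Module.Projective F D := of_split D.subtype pD (LinearMap.ext hpD)
  obtain ⟨s, hs⟩ := Module.projective_lifting_property (pD.comp g) (LinearMap.id : D →ₗ[F] D) hsurj
  have hs' : ∀ d, pD (g (s d)) = d := fun d => LinearMap.congr_fun hs d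
  let k : F →ₗ[F] F := s ∘ₗ h' ∘ₗ pK
  have hk : ∀ r, k r = r * k 1 := fun r => by
    rw [← smul_eq_mul, ← map_smul, smul_eq_mul, mul_one]
  have hkt : ∀ r, f (t + k 1) r = f t r + g (k r) := by
    intro r
    rw [hfa, hfa, hg, hk r]
    noncomm_ring
  have hsub : ∀ r ∈ ker (f (t + k 1)), ∃ hr : r ∈ ker (f t), h' ⟨r, hr⟩ = 0 := by
    intro r hr
    rw [mem_ker, hkt] at hr
    have h1 : h' (pK r) = 0 := by
      have := congrArg pD hr
      rw [map_add, hpf, zero_add, map_zero] at this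
      rw [← hs' (h' (pK r))]
      exact this
    have h2 : k r = 0 := by
      change s (h' (pK r)) = 0
      rw [h1, map_zero]
    rw [h2, map_zero, add_zero] at hr
    refine ⟨hr, ?_⟩
    have h3 : pK r = ⟨r, hr⟩ := Submodule.projectionOnto_apply_left hC ⟨r, hr⟩
    rw [← h3, h1]
  refine absurd (ht (t + k 1)) (not_le.2 ?_)
  refine Set.ncard_lt_ncard (s := (ker (f (t + k 1)) : Set F))
    (t := (ker (f t) : Set F)) ⟨fun r hr => (hsub r hr).1, fun hle => hh' ?_⟩
    (Set.toFinite _)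
  ext r
  obtain ⟨_, h1⟩ := hsub r (hle r.2)
  exact congrArg val h1

lemma exists_isUnit_add_mul {R : Type v} [Ring R] [Finite R] (a b x y : R)
    (h : x * a + y * b = 1) : ∃ t, IsUnit (a + t * b) := by
  have : Finite (R ⧸ Ring.jacobson R) := Finite.of_surjective _ (Ideal.Quotient.mk_surjective)
  let q := Ideal.Quotient.mk (Ring.jacobson R)
  obtain ⟨t, ht⟩ := exists_isUnit_add_mul_of_isSemisimpleRing (q a) (q b) (q x) (q y) (by
    rw [← map_mul, ← map_mul, ← map_add, h, map_one])
  obtain ⟨t, rfl⟩ := Ideal.Quotient.mk_surjective t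
  refine ⟨t, ?_⟩
  obtain ⟨z, hz⟩ := ht.exists_left_inv
  obtain ⟨z, rfl⟩ := Ideal.Quotient.mk_surjective z
  have h1 : z * (a + t * b) - 1 ∈ Ideal.jacobson (⊥ : Ideal R) := by
    rw [Ideal.jacobson_bot]
    refine Ideal.Quotient.eq.1 ?_
    rw [map_mul, map_add, map_mul, map_one]
    exact hz
  obtain ⟨s, hs⟩ := Ideal.exists_mul_sub_mem_of_sub_one_mem_jacobson _ h1
  have h2 : s * z * (a + t * b) = 1 := by
    rw [mul_assoc]
    exact sub_eq_zero.1 hs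
  exact ⟨⟨a + t * b, s * z, mul_eq_one_symm h2, h2⟩, rfl⟩

lemma isUnit_of_map_isUnit {A R F : Type*} [CommRing A] [IsLocalRing A] [Ring R] [Algebra A R]
    [Module.Finite A R] [Ring F] (φ : R →+* F) (hφ : Surjective φ)
    (hk : ∀ r, φ r = 0 → r ∈ (maximalIdeal A) • (⊤ : Submodule A R)) {x : R}
    (hx : IsUnit (φ x)) : IsUnit x := by
  have key : ∀ z y : R, φ z * φ y = 1 → ∃ s, z * s = 1 := by
    intro z y hzy
    have h1 : (⊤ : Submodule A R) ≤ range (LinearMap.mulLeft A z) := by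
      refine Submodule.le_of_le_smul_of_le_jacobson_bot (I := maximalIdeal A)
        fg_top (IsLocalRing.maximalIdeal_le_jacobson _) ?_
      intro r _
      have h2 : r - z * (y * r) ∈ (maximalIdeal A) • (⊤ : Submodule A R) := by
        refine hk _ ?_
        rw [map_sub, map_mul, map_mul, ← mul_assoc, hzy, one_mul, sub_self]
      rw [← add_sub_cancel (z * (y * r)) r]
      exact Submodule.add_mem_sup ⟨y * r, rfl⟩ h2
    obtain ⟨s, hs⟩ := h1 (mem_top : (1 : R) ∈ _)
    exact ⟨s, hs⟩
  obtain ⟨w, hw⟩ := hφ ↑hx.unit⁻¹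
  obtain ⟨s, hs⟩ := key x w (by rw [hw, IsUnit.mul_val_inv])
  have h3 : φ s * φ x = 1 := by
    have h4 := congrArg φ hs
    rw [map_mul, map_one] at h4
    obtain ⟨c, hc⟩ := hx.exists_left_inv
    have : φ s = c := by
      calc φ s = c * φ x * φ s := by rw [hc, one_mul]
        _ = c := by rw [mul_assoc, h4, mul_one]
    rw [this, hc]
  obtain ⟨s', hs'⟩ := key s x h3
  have : s' = x := by
    calc s' = x * s * s' := by rw [hs, one_mul]
      _ = x := by rw [mul_assoc, hs', mul_one]
  exact ⟨⟨x, s, hs, this ▸ hs'⟩, rfl⟩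

lemma exists_isUnit_add_mul_padic (p : Primes) (a b x y : ℤ_[p][G])
    (h : x * a + y * b = 1) : ∃ t, IsUnit (a + t * b) := by
  let φ : ℤ_[p][G] →+* MonoidAlgebra (ZMod p) G :=
    MonoidAlgebra.mapRingHom G (toZMod (p := (p : ℕ)))
  have hφ : Surjective φ := by
    intro z
    choose c hc using fun g => ZMod.ringHom_surjective (toZMod (p := (p : ℕ))) (z.coeff g)
    refine ⟨ofCoeff (Finsupp.equivFunOnFinite.symm c), ?_⟩
    ext g
    simp only [φ, coeff_mapRingHom]
    exact hc g
  have hfin : Finite (MonoidAlgebra (ZMod p) G) :=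
    Finite.of_injective (fun z => (z.coeff : G → ZMod p)) fun z z' hz => by
      ext g; exact congrFun hz g
  obtain ⟨t, ht⟩ := exists_isUnit_add_mul (φ a) (φ b) (φ x) (φ y) (by
    rw [← map_mul, ← map_mul, ← map_add, h, map_one])
  obtain ⟨t, rfl⟩ := hφ t
  have : Module.Finite ℤ_[p] ℤ_[p][G] := inferInstance
  refine ⟨t, isUnit_of_map_isUnit (A := ℤ_[p]) φ hφ (fun r hr => ?_)
    (by rwa [map_add, map_mul])⟩
  have hr' : r = ∑ g, r.coeff g • MonoidAlgebra.single g (1 : ℤ_[p]) := by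
    ext g
    simp [coeff_sum]
  rw [hr']
  refine Submodule.sum_mem _ fun g _ => Submodule.smul_mem_smul ?_ mem_top
  rw [← PadicInt.ker_toZMod, RingHom.mem_ker]
  have := congrArg (fun z => z.coeff g) hr
  simpa [φ] using this

end

section

variable {A : Type*} {S : Type*} [CommRing A] [CommRing S]
  [Algebra A S] (φ : ℂ →+* S) {R : Type*} [Ring R] (f : R →+* A[G])

lemma detM_fromBlocks_one_lower {n : ℕ} (ρ : CRep G n) {ι ι' : Type*}
    [Fintype ι] [DecidableEq ι] [Fintype ι'] [DecidableEq ι']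
    (W : Matrix ι' ι A[G]) : detM A φ ρ (fromBlocks 1 0 W 1) = 1 := by
  rw [← detM_reindex A φ ρ (sumComm ι' ι)]
  have : (fromBlocks (1 : Matrix ι ι A[G]) 0 W 1).submatrix (sumComm ι' ι)
      (sumComm ι' ι) = fromBlocks 1 W 0 1 := by
    ext (i | i) (j | j) : 2 <;> rfl
  rw [this, detM_fromBlocks, map_one, map_one, mul_one]

lemma isUnit_fromBlocks_one_upper {ι ι' : Type*} [Fintype ι] [DecidableEq ι] [Fintype ι']
    [DecidableEq ι'] (V : Matrix ι ι' R) : IsUnit (fromBlocks (1 : Matrix ι ι R) V 0 (1 : Matrix ι' ι' R)) := by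
  refine ⟨⟨fromBlocks 1 V 0 1, fromBlocks 1 (-V) 0 1, ?_, ?_⟩, rfl⟩ <;>
  simp [fromBlocks_multiply]

lemma isUnit_fromBlocks_one_lower {ι ι' : Type*} [Fintype ι] [DecidableEq ι] [Fintype ι']
    [DecidableEq ι'] (W : Matrix ι' ι R) : IsUnit (fromBlocks (1 : Matrix ι ι R) 0 W (1 : Matrix ι' ι' R)) := by
  refine ⟨⟨fromBlocks 1 0 W 1, fromBlocks 1 0 (-W) 1, ?_, ?_⟩, rfl⟩ <;>
  simp [fromBlocks_multiply]

lemma isUnit_of_isUnit_fromBlocks {ι ι' : Type*} [Fintype ι] [DecidableEq ι] [Fintype ι']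
    [DecidableEq ι'] {U U' : Matrix ι ι R} {V : Matrix ι ι' R} {Q : Matrix ι' ι' R}
    (hU : U * U' = 1) (h : IsUnit (fromBlocks U V 0 Q)) : IsUnit Q := by
  obtain ⟨M, h1, h2⟩ := isUnit_iff_exists.1 h
  rw [← fromBlocks_toBlocks M, fromBlocks_multiply, ← fromBlocks_one, fromBlocks_inj] at h1 h2
  simp only [Matrix.zero_mul, Matrix.mul_zero, zero_add, add_zero] at h1 h2
  have hc : M.toBlocks₂₁ = 0 := by
    calc M.toBlocks₂₁ = M.toBlocks₂₁ * U * U' := by rw [Matrix.mul_assoc, hU, Matrix.mul_one]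
      _ = 0 := by rw [h2.2.2.1, Matrix.zero_mul]
  have h3 := h2.2.2.2
  rw [hc, Matrix.zero_mul, zero_add] at h3
  exact ⟨⟨Q, M.toBlocks₂₂, h1.2.2.2, h3⟩, rfl⟩

lemma exists_unit_detM_eq
    (hR : ∀ a b x y : R, x * a + y * b = 1 → ∃ t, IsUnit (a + t * b)) (r : ℕ)
    (X : Matrix (Fin r) (Fin r) R) (hX : IsUnit X) :
    ∃ a : Rˣ, ∀ n (ρ : CRep G n),
      detM A φ ρ (X.map f) = detM A φ ρ (of fun _ _ : Unit => f a) := by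
  induction r with
  | zero =>
    refine ⟨1, fun n ρ => ?_⟩
    have h1 : X.map f = 1 := Subsingleton.elim _ _
    have h2 : (of fun _ _ : Unit => f ((1 : Rˣ) : R)) = 1 := by
      ext i j : 2
      rw [of_apply, Units.val_one, map_one, one_apply, if_pos (Subsingleton.elim i j)]
    rw [h1, h2, map_one, map_one]
  | succ r ih =>
    let e : Unit ⊕ Fin r ≃ Fin (r + 1) := (sumComm _ _).trans
      (((Equiv.refl (Fin r)).sumCongr (Equiv.equivPUnit (Fin 1)).symm).trans finSumFinEquiv)
    let Y : Matrix (Unit ⊕ Fin r) (Unit ⊕ Fin r) R := X.submatrix e e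
    obtain ⟨X', hX1, hX2⟩ := isUnit_iff_exists.1 hX
    let Y' : Matrix (Unit ⊕ Fin r) (Unit ⊕ Fin r) R := X'.submatrix e e
    have hY1 : Y * Y' = 1 := by
      rw [submatrix_mul_equiv, hX1, submatrix_one_equiv]
    have hY2 : Y' * Y = 1 := by
      rw [submatrix_mul_equiv, hX2, submatrix_one_equiv]
    have hYu : IsUnit Y := ⟨⟨Y, Y', hY1, hY2⟩, rfl⟩
    have h1 := congrArg (fun M => M (inl ()) (inl ())) hY2
    simp only [mul_apply, sum_sum_type, Finset.univ_unique, Finset.sum_singleton,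
      Matrix.one_apply_eq] at h1
    obtain ⟨t, u, hu⟩ := hR (Y (inl ()) (inl ()))
      (∑ i : Fin r, Y' (inl ()) (inr i) * Y (inr i) (inl ()))
      (Y' (inl ()) (inl ())) 1 (by rw [one_mul]; exact h1)
    let V₁ : Matrix Unit (Fin r) R := of fun _ i => t * Y' (inl ()) (inr i)
    let U : Matrix Unit Unit R := of fun _ _ => (u : R)
    let U' : Matrix Unit Unit R := of fun _ _ => ((u⁻¹ : Rˣ) : R)
    have hU : U * U' = 1 := by
      refine Matrix.ext fun i j => ?_
      rw [mul_apply, one_apply, if_pos (Subsingleton.elim i j)]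
      simp [U, U']
    have hU' : U' * U = 1 := by
      refine Matrix.ext fun i j => ?_
      rw [mul_apply, one_apply, if_pos (Subsingleton.elim i j)]
      simp [U, U']
    have hZ : (fromBlocks 1 V₁ 0 1 * Y).toBlocks₁₁ = U := by
      refine Matrix.ext fun i j => ?_
      rw [← fromBlocks_toBlocks Y, fromBlocks_multiply, toBlocks_fromBlocks₁₁, Matrix.one_mul,
        Matrix.add_apply, mul_apply]
      simp only [U, V₁, of_apply, hu, mul_sum, mul_assoc]
      rfl
    set Z := fromBlocks 1 V₁ 0 1 * Y with hZdef
    let W := Z.toBlocks₂₁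
    have hT : fromBlocks 1 0 (-(W * U')) 1 * Z =
        fromBlocks U Z.toBlocks₁₂ 0 (Z.toBlocks₂₂ - W * U' * Z.toBlocks₁₂) := by
      conv_lhs => rw [← fromBlocks_toBlocks Z, fromBlocks_multiply]
      rw [hZ]
      congr 1
      · simp
      · simp
      · rw [Matrix.neg_mul, Matrix.mul_assoc, hU', Matrix.mul_one, Matrix.one_mul, neg_add_cancel]
      · rw [Matrix.neg_mul, Matrix.one_mul, neg_add_eq_sub]
    have hQ : IsUnit (Z.toBlocks₂₂ - W * U' * Z.toBlocks₁₂) := by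
      refine isUnit_of_isUnit_fromBlocks (V := Z.toBlocks₁₂) hU ?_
      rw [← hT]
      exact (isUnit_fromBlocks_one_lower _).mul ((isUnit_fromBlocks_one_upper _).mul hYu)
    obtain ⟨a, ha⟩ := ih _ hQ
    refine ⟨u * a, fun n ρ => ?_⟩
    have hm : ∀ M N : Matrix (Unit ⊕ Fin r) (Unit ⊕ Fin r) R,
        detM A φ ρ ((M * N).map f) = detM A φ ρ (M.map f) * detM A φ ρ (N.map f) := fun M N => by
      rw [Matrix.map_mul, map_mul]
    have h2 : detM A φ ρ (X.map f) = detM A φ ρ (Y.map f) :=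
      (detM_reindex A φ ρ e (X.map f)).symm
    have h3 := congrArg (fun M => detM A φ ρ (M.map f)) hT
    simp only [hm, hZdef, fromBlocks_map, Matrix.map_zero f (map_zero f),
      Matrix.map_one f (map_zero f) (map_one f), detM_fromBlocks, detM_fromBlocks_one_lower, map_one,
      mul_one, one_mul] at h3
    rw [h2, h3, ← hZdef, ha, ← map_mul]
    congr 1
    refine Matrix.ext fun i j => ?_
    rw [mul_apply]
    simp [U]

lemma exists_mem_detZhat_matrix {r : ℕ}
    (X : ∀ p : Primes, Matrix (Fin r) (Fin r) ℤ_[p][G])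
    (hX : ∀ p, IsUnit (X p)) :
    ∃ z ∈ detZhat G, ∀ n (ρ : CRep G n) (p : Primes),
      ((ideleAt p (z.1 (ofAdd (charR ρ))) : (LocalC p)ˣ) : LocalC p) =
        detM ℚ_[p] (localInclC p) ρ ((X p).map (toQp G p)) := by
  choose a ha using fun p => exists_unit_detM_eq (localInclC p) (toQp G p)
    (exists_isUnit_add_mul_padic p) r (X p) (hX p)
  obtain ⟨z, hz, h⟩ := exists_mem_detZhat a
  exact ⟨z, hz, fun n ρ p => by rw [h, ha]⟩

end

section

variable {A : Type*} [CommRing A] {V : Type*} [AddCommGroup V]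
  [Module A V] (τ : Representation A G V)

lemma asAlgebraHom_eq_sum (x : A[G]) (v : V) :
    τ.asAlgebraHom x v = ∑ g, x.coeff g • τ g v := by
  classical
  rw [Representation.asAlgebraHom_def, lift_apply,
    Finsupp.sum_fintype _ _ (by simp), LinearMap.sum_apply]
  rfl

/-- The action of matrices over the group ring on families of vectors. -/
def mact {ι κ : Type*} [Fintype κ] (X : Matrix ι κ A[G]) (y : κ → V) : ι → V :=
  fun j => ∑ k, τ.asAlgebraHom (X j k) (y k)

variable {τ}

lemma mact_mul {ι κ μ : Type*} [Fintype κ] [Fintype μ] (X : Matrix ι κ A[G])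
    (Y : Matrix κ μ A[G]) (y : μ → V) :
    mact τ (X * Y) y = mact τ X (mact τ Y y) := by
  funext j
  simp only [mact, mul_apply, map_sum, map_mul, LinearMap.sum_apply]
  rw [sum_comm]
  rfl

lemma mact_one {ι : Type*} [Fintype ι] [DecidableEq ι] (y : ι → V) : mact τ 1 y = y := by
  funext j
  rw [mact, sum_eq_single j]
  · rw [Matrix.one_apply_eq, map_one]; rfl
  · intro k _ hk
    rw [Matrix.one_apply_ne hk.symm, map_zero]; rfl
  · simp

lemma mact_add {ι κ : Type*} [Fintype κ] (X Y : Matrix ι κ A[G]) (y : κ → V) :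
    mact τ (X + Y) y = mact τ X y + mact τ Y y := by
  funext j
  simp only [mact, Matrix.add_apply, map_add, LinearMap.add_apply, Pi.add_apply,
    sum_add_distrib]

lemma mact_natCast {ι : Type*} [Fintype ι] [DecidableEq ι] (N : ℕ) (y : ι → V) :
    mact τ (N : Matrix ι ι A[G]) y = N • y := by
  induction N with
  | zero =>
    funext j
    simp [mact]
  | succ N ih => rw [Nat.cast_succ, mact_add, ih, mact_one, succ_nsmul]

lemma asAlgebraHom_map {V' : Type*} [AddCommGroup V'] [Module A V'] {τ' : Representation A G V'}
    (f : V →ₗ[A] V') (hf : ∀ g x, f (τ g x) = τ' g (f x)) (x : A[G]) (v : V) :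
    f (τ.asAlgebraHom x v) = τ'.asAlgebraHom x (f v) := by
  simp only [asAlgebraHom_eq_sum, map_sum, map_smul, hf]

lemma mact_map {ι κ : Type*} [Fintype κ] {V' : Type*} [AddCommGroup V'] [Module A V']
    {τ' : Representation A G V'} (f : V →ₗ[A] V') (hf : ∀ g x, f (τ g x) = τ' g (f x))
    (X : Matrix ι κ A[G]) (y : κ → V) :
    (fun j => f (mact τ X y j)) = mact τ' X fun k => f (y k) := by
  funext j
  simp only [mact, map_sum, asAlgebraHom_map f hf]

namespace IsGroupBasis

variable {ι : Type*} {a : ι → V}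

/-- The basis over the ground ring defined by a basis over the group ring. -/
def basis (h : IsGroupBasis τ a) : Basis (G × ι) A V := Basis.mk h.1 h.2.ge

lemma basis_apply (h : IsGroupBasis τ a) (x : G × ι) : h.basis x = τ x.1 (a x.2) :=
  Basis.mk_apply _ _ _

lemma of_basis (b : Basis (G × ι) A V) (h : ∀ x, b x = τ x.1 (a x.2)) :
    IsGroupBasis τ a := by
  have : (fun x : G × ι => τ x.1 (a x.2)) = b := funext fun x => (h x).symm
  rw [IsGroupBasis, this]
  exact ⟨b.linearIndependent, b.span_eq⟩

variable [Fintype ι]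

lemma sum_asAlgebraHom (h : IsGroupBasis τ a) (c : ι → A[G]) :
    ∑ k, τ.asAlgebraHom (c k) (a k) =
      h.basis.equivFun.symm fun x => (c x.2).coeff x.1 := by
  rw [Basis.equivFun_symm_apply, sum_prod_type, sum_comm]
  simp only [asAlgebraHom_eq_sum, basis_apply]

lemma exists_coord (h : IsGroupBasis τ a) (v : V) :
    ∃ c : ι → A[G], ∑ k, τ.asAlgebraHom (c k) (a k) = v := by
  refine ⟨fun k => ofCoeff
    (Finsupp.equivFunOnFinite.symm fun g => h.basis.equivFun v (g, k)), ?_⟩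
  rw [h.sum_asAlgebraHom]
  exact h.basis.equivFun.symm_apply_apply v

lemma coord_injective (h : IsGroupBasis τ a) {c c' : ι → A[G]}
    (hc : ∑ k, τ.asAlgebraHom (c k) (a k) = ∑ k, τ.asAlgebraHom (c' k) (a k)) : c = c' := by
  rw [h.sum_asAlgebraHom, h.sum_asAlgebraHom] at hc
  have := h.basis.equivFun.symm.injective hc
  funext k
  ext g
  exact congrFun this (g, k)

lemma exists_matrix {κ : Type*} (h : IsGroupBasis τ a) (b : κ → V) :
    ∃ X : Matrix κ ι A[G], mact τ X a = b := by
  choose c hc using fun j => h.exists_coord (b j)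
  exact ⟨of c, funext hc⟩

lemma mact_injective {κ : Type*} (h : IsGroupBasis τ a) {X Y : Matrix κ ι A[G]}
    (hXY : mact τ X a = mact τ Y a) : X = Y :=
  Matrix.ext fun i j => congrFun (h.coord_injective (c := X i) (c' := Y i) (congrFun hXY i)) j

lemma exists_unit_matrix [DecidableEq ι] (h : IsGroupBasis τ a) {b : ι → V}
    (hb : IsGroupBasis τ b) :
    ∃ X : (Matrix ι ι A[G])ˣ, mact τ X.1 a = b := by
  obtain ⟨X, hX⟩ := h.exists_matrix b
  obtain ⟨Y, hY⟩ := hb.exists_matrix a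
  refine ⟨⟨X, Y, hb.mact_injective ?_, h.mact_injective ?_⟩, hX⟩
  · rw [mact_mul, hY, hX, mact_one]
  · rw [mact_mul, hX, hY, mact_one]

lemma card_eq [Nontrivial A] {κ : Type*} [Fintype κ] (h : IsGroupBasis τ a) {b : κ → V}
    (hb : IsGroupBasis τ b) : card ι = card κ := by
  have := card_congr (h.basis.indexEquiv hb.basis)
  rw [card_prod, card_prod] at this
  exact Nat.eq_of_mul_eq_mul_left card_pos this

lemma finrank_eq [Nontrivial A] (h : IsGroupBasis τ a) :
    finrank A V = card G * card ι := by
  have : StrongRankCondition A := inferInstance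
  rw [finrank_eq_card_basis h.basis, card_prod]

lemma map {V' : Type*} [AddCommGroup V'] [Module A V'] {τ' : Representation A G V'}
    (h : IsGroupBasis τ a) (f : V ≃ₗ[A] V') (hf : ∀ g x, f (τ g x) = τ' g (f x)) :
    IsGroupBasis τ' fun k => f (a k) :=
  of_basis (h.basis.map f) fun x => by rw [Basis.map_apply, h.basis_apply, hf]

lemma reindex {κ : Type*} (h : IsGroupBasis τ a) (e : κ ≃ ι) : IsGroupBasis τ (a ∘ e) :=
  of_basis (h.basis.reindex ((Equiv.refl G).prodCongr e.symm)) fun x => by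
    rw [Basis.reindex_apply, h.basis_apply]; rfl

lemma prod {V' : Type*} [AddCommGroup V'] [Module A V'] {τ' : Representation A G V'} {κ : Type*}
    {b : κ → V'} (h : IsGroupBasis τ a) (h' : IsGroupBasis τ' b) :
    IsGroupBasis (τ.prod τ') (Sum.elim (fun j => (a j, 0)) (fun j => (0, b j))) :=
  of_basis ((h.basis.prod h'.basis).reindex (Equiv.prodSumDistrib G ι κ).symm) fun x => by
    rw [Basis.reindex_apply, Basis.prod_apply]
    obtain ⟨g, j | j⟩ := x
    · exact Prod.ext (h.basis_apply (g, j)) (map_zero (τ' g)).symm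
    · exact Prod.ext (map_zero (τ g)).symm (h'.basis_apply (g, j))

end IsGroupBasis

end

section

/-- The map `A ⊗ M → B ⊗ M`. -/
def fromBase (A B : Type*) [CommRing A] [CommRing B] [Algebra A B] (M : Type v) [AddCommGroup M] :
    A ⊗[ℤ] M →ₗ[ℤ] B ⊗[ℤ] M :=
  rTensor M (algebraMap A B).toAddMonoidHom.toIntLinearMap

variable {A B : Type*} [CommRing A] [CommRing B] [Algebra A B] {M : Type v} [AddCommGroup M]

lemma fromBase_tmul (a : A) (m : M) : fromBase A B M (a ⊗ₜ m) = algebraMap A B a ⊗ₜ m := rfl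

lemma fromBase_smul (a : A) (x : A ⊗[ℤ] M) :
    fromBase A B M (a • x) = algebraMap A B a • fromBase A B M x := by
  induction x using induction_on with
  | zero => simp
  | tmul c m =>
    rw [smul_tmul', fromBase_tmul, fromBase_tmul, smul_tmul',
      smul_eq_mul, smul_eq_mul, map_mul]
  | add x y hx hy => rw [smul_add, map_add, hx, hy, map_add, smul_add]

lemma fromBase_eq_cancel (x : A ⊗[ℤ] M) : fromBase A B M x =
    cancelBaseChange ℤ A B B M ((1 : B) ⊗ₜ[A] x) := by
  induction x using induction_on with
  | zero => simp
  | tmul c m =>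
    rw [cancelBaseChange_tmul, fromBase_tmul,
      Algebra.algebraMap_eq_smul_one]
  | add x y hx hy => rw [map_add, hx, hy, tmul_add, map_add]

variable [Module ℤ[G] M]

lemma fromBase_rep (g : G) (x : A ⊗[ℤ] M) :
    fromBase A B M (repOver A M g x) = repOver B M g (fromBase A B M x) := by
  exact x.induction_on (by simp) (fun c m => rfl) fun x y hx hy => by simp only [map_add, hx, hy]

lemma IsGroupBasis.baseChange {ι : Type*} {a : ι → A ⊗[ℤ] M}
    (h : IsGroupBasis (G := G) (repOver A M) a) :
    IsGroupBasis (G := G) (repOver B M) fun j => fromBase A B M (a j) :=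
  of_basis ((h.basis.baseChange B).map
    (cancelBaseChange ℤ A B B M)) fun x => by
    rw [Basis.map_apply, Basis.baseChange_apply, ← fromBase_eq_cancel, h.basis_apply,
      fromBase_rep]

lemma fromBase_asAlgebraHom (x : A[G]) (v : A ⊗[ℤ] M) :
    fromBase A B M ((repOver A M).asAlgebraHom x v) =
      (repOver B M).asAlgebraHom (MonoidAlgebra.mapRingHom G (algebraMap A B) x)
        (fromBase A B M v) := by
  rw [asAlgebraHom_eq_sum, asAlgebraHom_eq_sum, map_sum]
  refine sum_congr rfl fun g _ => ?_
  rw [fromBase_smul, fromBase_rep, coeff_mapRingHom]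

lemma fromBase_mact {ι κ : Type*} [Fintype κ] (X : Matrix ι κ A[G])
    (y : κ → A ⊗[ℤ] M) (j : ι) :
    fromBase A B M (mact (repOver A M) X y j) =
      mact (repOver B M) (X.map (MonoidAlgebra.mapRingHom G (algebraMap A B)))
        (fun k => fromBase A B M (y k)) j := by
  simp only [mact, map_sum, fromBase_asAlgebraHom, map_apply]

end

section

variable {M : Type v} [AddCommGroup M]
  [Module ℤ[G] M]

lemma subsingleton_tmul {A N : Type*} [CommRing A] [AddCommGroup N] [Subsingleton N] :
    Subsingleton (A ⊗[ℤ] N) :=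
  subsingleton_of_forall_eq 0 fun x => by
    exact x.induction_on rfl (fun a n => by rw [Subsingleton.elim n 0, tmul_zero])
      fun x y hx hy => by rw [hx, hy, add_zero]

lemma finite_int_of_finite_groupRing [Module.Finite ℤ[G] M] :
    Module.Finite ℤ M :=
  Module.Finite.trans ℤ[G] M

lemma exists_nsmul_eq_tmul (x : ℚ ⊗[ℤ] M) : ∃ (n : ℕ) (m : M), n ≠ 0 ∧ n • x = 1 ⊗ₜ[ℤ] m := by
  induction x using induction_on with
  | zero => exact ⟨1, 0, one_ne_zero, by simp⟩
  | tmul q m =>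
    refine ⟨q.den, q.num • m, q.den_nz, ?_⟩
    rw [← smul_tmul, smul_tmul']
    congr 1
    rw [zsmul_eq_mul, mul_one, nsmul_eq_mul, mul_comm, Rat.mul_den_eq_num]
  | add x y hx hy =>
    obtain ⟨n, m, hn, h⟩ := hx
    obtain ⟨n', m', hn', h'⟩ := hy
    refine ⟨n * n', n' • m + n • m', mul_ne_zero hn hn', ?_⟩
    rw [smul_add, mul_comm n n', mul_smul, h, mul_comm n' n, mul_smul, h', tmul_add,
      tmul_smul, tmul_smul]

lemma exists_common_nsmul {κ : Type*} [Finite κ] (x : κ → ℚ ⊗[ℤ] M) :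
    ∃ (n : ℕ) (m : κ → M), n ≠ 0 ∧ ∀ k, n • x k = 1 ⊗ₜ[ℤ] m k := by
  have := ofFinite κ
  classical
  choose n m hn h using fun k => exists_nsmul_eq_tmul (x k)
  refine ⟨∏ k, n k, fun k => (∏ l ∈ univ.erase k, n l) • m k,
    prod_ne_zero_iff.2 fun k _ => hn k, fun k => ?_⟩
  rw [← prod_erase_mul _ _ (mem_univ k), mul_smul, h, tmul_smul]

/-- The inclusion `ℤ[G] → A[G]`. -/
def intG (G : Type u) [Group G] (A : Type*) [CommRing A] :
    ℤ[G] →+* A[G] :=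
  MonoidAlgebra.mapRingHom G (algebraMap ℤ A)

lemma exists_nsmul_eq_intG (x : ℚ[G]) :
    ∃ (n : ℕ) (y : ℤ[G]), n ≠ 0 ∧ n • x = intG G ℚ y := by
  induction x using MonoidAlgebra.induction_on with
  | of g => exact ⟨1, MonoidAlgebra.of ℤ G g, one_ne_zero, by simp [intG]⟩
  | add x y hx hy =>
    obtain ⟨n, m, hn, h⟩ := hx
    obtain ⟨n', m', hn', h'⟩ := hy
    refine ⟨n * n', n' • m + n • m', mul_ne_zero hn hn', ?_⟩
    rw [smul_add, mul_comm n n', mul_smul, h, mul_comm n' n, mul_smul, h', map_add, map_nsmul,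
      map_nsmul]
  | smul q x hx =>
    obtain ⟨n, m, hn, h⟩ := hx
    refine ⟨q.den * n, q.num • m, mul_ne_zero q.den_nz hn, ?_⟩
    have : (q.den * n) • q • x = (q.den * q : ℚ) • (n • x) := by
      rw [mul_smul, ← smul_comm q n x, mul_smul, Nat.cast_smul_eq_nsmul]
    rw [this, h, mul_comm, Rat.mul_den_eq_num, map_zsmul, Int.cast_smul_eq_zsmul]

lemma exists_bound_coord [Module.Finite ℤ[G] M] {ι : Type*} [Fintype ι]
    {a : ι → ℚ ⊗[ℤ] M} (ha : IsGroupBasis (G := G) (repOver ℚ M) a) :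
    ∃ D : ℕ, D ≠ 0 ∧ ∀ m : M, ∃ c : ι → ℤ[G],
      D • ((1 : ℚ) ⊗ₜ[ℤ] m) = ∑ k, (repOver ℚ M).asAlgebraHom (intG G ℚ (c k)) (a k) := by
  classical
  have hM : Module.Finite ℤ M := finite_int_of_finite_groupRing (G := G)
  have h1 : ∀ m : M, ∃ D : ℕ, D ≠ 0 ∧ ∃ c : ι → ℤ[G],
      D • ((1 : ℚ) ⊗ₜ[ℤ] m) = ∑ k, (repOver ℚ M).asAlgebraHom (intG G ℚ (c k)) (a k) := by
    intro m
    obtain ⟨x, hx⟩ := ha.exists_coord ((1 : ℚ) ⊗ₜ[ℤ] m)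
    choose n y hn h using fun k => exists_nsmul_eq_intG (x k)
    refine ⟨∏ k, n k, prod_ne_zero_iff.2 fun k _ => hn k,
      fun k => (∏ l ∈ univ.erase k, n l) • y k, ?_⟩
    rw [← hx, smul_sum]
    refine sum_congr rfl fun k _ => ?_
    rw [map_nsmul, ← h, ← mul_smul, prod_erase_mul _ _ (mem_univ k), map_nsmul]
    rfl
  choose D hD c hc using h1
  obtain ⟨s, hs⟩ := hM.fg_top
  refine ⟨∏ m ∈ s, D m, prod_ne_zero_iff.2 fun k _ => hD k, fun m => ?_⟩
  have hm : m ∈ span ℤ (s : Set M) := hs ▸ mem_top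
  induction hm using Submodule.span_induction with
  | mem x hx =>
    refine ⟨fun k => (∏ l ∈ s.erase x, D l) • c x k, ?_⟩
    rw [← prod_erase_mul _ _ hx, mul_smul, hc, smul_sum]
    refine sum_congr rfl fun k _ => ?_
    rw [map_nsmul, map_nsmul]
    rfl
  | zero => exact ⟨0, by simp⟩
  | add x y _ _ hx hy =>
    obtain ⟨c, hc⟩ := hx
    obtain ⟨c', hc'⟩ := hy
    refine ⟨c + c', ?_⟩
    rw [tmul_add, smul_add, hc, hc', ← sum_add_distrib]
    simp only [Pi.add_apply, map_add, LinearMap.add_apply]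
  | smul n x _ hx =>
    obtain ⟨c, hc⟩ := hx
    refine ⟨n • c, ?_⟩
    rw [tmul_smul, smul_comm, hc, smul_sum]
    refine sum_congr rfl fun k _ => ?_
    rw [Pi.smul_apply, map_zsmul, map_zsmul]
    rfl

lemma toQp_intG (p : Primes) (x : ℤ[G]) :
    toQp G p (intG G ℤ_[p] x) = intG G ℚ_[p] x := by
  rw [toQp, intG, intG, ← RingHom.comp_apply, ← MonoidAlgebra.mapRingHom_comp]
  congr 2

lemma mapRingHom_rat_intG (p : Primes) (x : ℤ[G]) :
    MonoidAlgebra.mapRingHom G (algebraMap ℚ ℚ_[p]) (intG G ℚ x) = intG G ℚ_[p] x := by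
  rw [intG, intG, ← RingHom.comp_apply, ← MonoidAlgebra.mapRingHom_comp]
  congr 2

lemma fromZp_eq (p : Primes) (x : ℤ_[p] ⊗[ℤ] M) :
    fromZp p M x = fromBase ℤ_[p] ℚ_[p] M x := rfl

lemma fromQ_eq (p : Primes) (x : ℚ ⊗[ℤ] M) :
    fromQ p M x = fromBase ℚ ℚ_[p] M x := rfl

lemma exists_integral_transition [Module.Finite ℤ[G] M] {r : ℕ}
    {a : Fin r → ℚ ⊗[ℤ] M} (ha : IsGroupBasis (G := G) (repOver ℚ M) a) :
    ∃ N : ℕ, N ≠ 0 ∧ ∀ (p : Primes) (b : Fin r → ℤ_[p] ⊗[ℤ] M),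
      IsGroupBasis (G := G) (repOver ℤ_[p] M) b →
      ∀ X : (Matrix (Fin r) (Fin r) ℚ_[p][G])ˣ,
      mact (repOver ℚ_[p] M) X.1 (fun k => fromZp p M (b k)) = (fun k => fromQ p M (a k)) →
      ∃ Y Z : Matrix (Fin r) (Fin r) ℤ_[p][G],
        Y.map (toQp G p) = (N : Matrix (Fin r) (Fin r) ℚ_[p][G]) * X.1 ∧
        Z.map (toQp G p) = (N : Matrix (Fin r) (Fin r) ℚ_[p][G]) * (X⁻¹).1 := by
  obtain ⟨D₁, m, hD₁, hm⟩ := exists_common_nsmul a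
  obtain ⟨D₂, hD₂, hc⟩ := exists_bound_coord ha
  refine ⟨D₁ * D₂, mul_ne_zero hD₁ hD₂, fun p b hb X hX => ?_⟩
  have hb' : IsGroupBasis (G := G) (repOver ℚ_[p] M) (fun k => fromZp p M (b k)) :=
    hb.baseChange
  have ha' : IsGroupBasis (G := G) (repOver ℚ_[p] M) (fun k => fromQ p M (a k)) :=
    ha.baseChange
  have hX' : mact (repOver ℚ_[p] M) (X⁻¹).1 (fun k => fromQ p M (a k)) =
      (fun k => fromZp p M (b k)) := by
    rw [← hX, ← mact_mul, Units.inv_mul, mact_one]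
  obtain ⟨Y, hY⟩ := hb.exists_matrix (fun k => (1 : ℤ_[p]) ⊗ₜ[ℤ] m k)
  have hY' : Y.map (toQp G p) = (D₁ : Matrix (Fin r) (Fin r) ℚ_[p][G]) * X.1 := by
    refine hb'.mact_injective ?_
    rw [mact_mul, hX, mact_natCast]
    funext k
    have h1 := fromBase_mact (B := ℚ_[p]) Y b k
    rw [hY, fromBase_tmul, map_one] at h1
    refine Eq.trans h1.symm ?_
    rw [Pi.smul_apply, ← map_nsmul, hm]
    change _ = algebraMap ℚ ℚ_[p] 1 ⊗ₜ[ℤ] m k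
    rw [map_one]
  have hZ : ∀ z : ℤ_[p] ⊗[ℤ] M, ∃ c : Fin r → ℤ_[p][G],
      D₂ • fromZp p M z = ∑ k, (repOver ℚ_[p] M).asAlgebraHom (toQp G p (c k))
        (fromQ p M (a k)) := by
    intro z
    induction z using induction_on with
    | zero => exact ⟨0, by simp⟩
    | tmul s x =>
      obtain ⟨c, hc⟩ := hc x
      refine ⟨fun k => s • intG G ℤ_[p] (c k), ?_⟩
      have h1 := congrArg (fromBase ℚ ℚ_[p] M) hc
      rw [map_nsmul, fromBase_tmul, map_one, map_sum] at h1
      have h2 : fromZp p M (s ⊗ₜ x) = (s : ℚ_[p]) • ((1 : ℚ_[p]) ⊗ₜ[ℤ] x) := by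
        rw [smul_tmul', smul_eq_mul, mul_one]; rfl
      rw [h2, smul_comm, h1, smul_sum]
      refine sum_congr rfl fun k _ => ?_
      have h3 : toQp G p (s • intG G ℤ_[p] (c k)) =
          (s : ℚ_[p]) • intG G ℚ_[p] (c k) := by
        rw [← toQp_intG]
        ext g
        rw [toQp, coeff_mapRingHom, coeff_smul, coeff_smul]
        rw [Finsupp.smul_apply, Finsupp.smul_apply, coeff_mapRingHom, smul_eq_mul,
          map_mul]
        rfl
      rw [h3, map_smul, fromBase_asAlgebraHom, mapRingHom_rat_intG]
      rfl
    | add x y hx hy =>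
      obtain ⟨c, hc⟩ := hx
      obtain ⟨c', hc'⟩ := hy
      refine ⟨c + c', ?_⟩
      rw [map_add, smul_add, hc, hc', ← sum_add_distrib]
      simp only [Pi.add_apply, map_add, LinearMap.add_apply]
  choose c hc using fun k => hZ (b k)
  have hZ' : (of c).map (toQp G p) =
      (D₂ : Matrix (Fin r) (Fin r) ℚ_[p][G]) * (X⁻¹).1 := by
    refine ha'.mact_injective ?_
    rw [mact_mul, hX', mact_natCast]
    funext k
    exact (hc k).symm
  have hn : ∀ (N : ℕ) (Y : Matrix (Fin r) (Fin r) ℤ_[p][G]),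
      ((N : Matrix (Fin r) (Fin r) ℤ_[p][G]) * Y).map (toQp G p) =
        (N : Matrix (Fin r) (Fin r) ℚ_[p][G]) * Y.map (toQp G p) := by
    intro N Y
    rw [Matrix.map_mul]
    congr 1
    have e1 := map_natCast ((toQp G p).mapMatrix (m := Fin r)) N
    rwa [mapMatrix_apply] at e1
  refine ⟨D₂ * Y, D₁ * of c, ?_, ?_⟩
  · rw [hn, hY', Nat.cast_mul, ← mul_assoc, (Nat.cast_commute D₂ _).symm.eq]
  · rw [hn, hZ', Nat.cast_mul, mul_assoc]

lemma exists_groupBasis_descent {K L V V' κ : Type*} [Field K] [Infinite K] [Field L] [Algebra K L]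
    [AddCommGroup V] [Module K V] [AddCommGroup V'] [Module L V'] [Fintype κ] [DecidableEq (G × κ)]
    {τ : Representation K G V} {τ' : Representation L G V'} (e : Basis (G × κ) K V)
    (e' : Basis (G × κ) L V') (φ : V →+ V')
    (hφ : ∀ (c : K) x, φ (c • x) = algebraMap K L c • φ x) (hφe : ∀ x, e' x = φ (e x))
    (hφτ : ∀ g x, φ (τ g x) = τ' g (φ x)) {b : κ → V'} (hb : IsGroupBasis τ' b) :
    ∃ a : κ → V, IsGroupBasis τ a := by
  let F : Matrix (G × κ) (G × κ) (MvPolynomial (κ × (G × κ)) K) :=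
    of fun l x => ∑ k, MvPolynomial.X (x.2, k) *
      MvPolynomial.C (e.repr (τ x.1 (e k)) l)
  have hFa : ∀ l x, F l x = ∑ k, MvPolynomial.X (x.2, k) *
      MvPolynomial.C (e.repr (τ x.1 (e k)) l) := fun _ _ => rfl
  have hFQ : ∀ c : κ × (G × κ) → K, MvPolynomial.eval c F.det =
      e.det fun x : G × κ => τ x.1 (∑ k, c (x.2, k) • e k) := by
    intro c
    rw [map_det, Basis.det_apply]
    congr 1
    ext l x
    rw [mapMatrix_apply, map_apply, hFa, map_sum, Basis.toMatrix_apply]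
    simp only [map_sum, map_smul, coe_finsetSum, Finset.sum_apply, Finsupp.smul_apply,
      smul_eq_mul, map_mul, MvPolynomial.eval_X, MvPolynomial.eval_C]
  have h1 : ∀ (x l : G × κ) (g : G), e'.repr (τ' g (e' x)) l =
      algebraMap K L (e.repr (τ g (e x)) l) := by
    intro x l g
    have h2 : τ' g (e' x) = ∑ l, algebraMap K L (e.repr (τ g (e x)) l) • e' l := by
      rw [hφe, ← hφτ]
      conv_lhs => rw [← e.sum_repr (τ g (e x)), map_sum]
      refine sum_congr rfl fun l _ => ?_
      rw [hφ, hφe]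
    rw [h2, Basis.repr_sum_self]
  have hFp : ∀ c : κ × (G × κ) → L, MvPolynomial.eval₂Hom (algebraMap K L) c F.det =
      e'.det fun x : G × κ => τ' x.1 (∑ k, c (x.2, k) • e' k) := by
    intro c
    rw [map_det, Basis.det_apply]
    congr 1
    ext l x
    rw [mapMatrix_apply, map_apply, hFa, map_sum, Basis.toMatrix_apply]
    simp only [map_sum, map_smul, coe_finsetSum, Finset.sum_apply, Finsupp.smul_apply,
      smul_eq_mul, map_mul, MvPolynomial.eval₂Hom_X', MvPolynomial.eval₂Hom_C, h1]
  have hF0 : F.det ≠ 0 := by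
    intro h0
    have h1 := hFp fun x => e'.repr (b x.1) x.2
    rw [h0, map_zero] at h1
    simp only [Basis.sum_repr] at h1
    have h2 : (fun x : G × κ => τ' x.1 (b x.2)) = hb.basis :=
      funext fun x => (hb.basis_apply x).symm
    rw [h2] at h1
    exact (e'.isUnit_det hb.basis).ne_zero h1.symm
  obtain ⟨c, hc⟩ : ∃ c, MvPolynomial.eval c F.det ≠ 0 := by
    by_contra! h
    exact hF0 (MvPolynomial.funext fun c => by rw [h, map_zero])
  rw [hFQ] at hc
  exact ⟨fun j => ∑ k, c (j, k) • e k, (Basis.is_basis_iff_det e).2 (IsUnit.mk0 _ hc)⟩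

lemma exists_rational_basis [Module.Finite ℤ[G] M] (p : Primes) {r : ℕ}
    {b : Fin r → ℤ_[p] ⊗[ℤ] M} (hb : IsGroupBasis (G := G) (repOver ℤ_[p] M) b) :
    ∃ a : Fin r → ℚ ⊗[ℤ] M, IsGroupBasis (G := G) (repOver ℚ M) a := by
  classical
  have hM : Module.Finite ℤ M := finite_int_of_finite_groupRing (G := G)
  have hb' : IsGroupBasis (G := G) (repOver ℚ_[p] M)
    (fun k => fromBase ℤ_[p] ℚ_[p] M (b k)) := hb.baseChange
  let e₀ := finBasis ℚ (ℚ ⊗[ℤ] M)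
  let e₁ := (e₀.baseChange ℚ_[p]).map
    (cancelBaseChange ℤ ℚ ℚ_[p] ℚ_[p] M)
  let f : Fin (finrank ℚ (ℚ ⊗[ℤ] M)) ≃ G × Fin r := e₁.indexEquiv hb'.basis
  refine exists_groupBasis_descent (e₀.reindex f) (e₁.reindex f)
    (fromBase ℚ ℚ_[p] M).toAddMonoidHom (fun c x => fromBase_smul c x) (fun x => ?_)
    (fun g x => fromBase_rep g x) hb'
  rw [Basis.reindex_apply, Basis.reindex_apply, Basis.map_apply,
    Basis.baseChange_apply, ← fromBase_eq_cancel]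
  rfl

end

section

lemma IsPerfect.finrank_local (hP : IsPerfect P) (i : ℤ) (p : Primes) {r : ℕ}
    {b : Fin r → ℤ_[p] ⊗[ℤ] P.X i} (hb : IsGroupBasis (G := G) (repOver _ (P.X i)) b) :
    card G * r = finrank ℚ (QT P i) := by
  have := hP.finite i
  obtain ⟨a, ha⟩ := exists_rational_basis p hb
  rw [ha.finrank_eq, card_fin]

lemma IsPerfect.nonempty_localBases (hP : IsPerfect P) : Nonempty (LocalBases P) := by
  classical
  choose r b hb using hP.locallyFree
  let q : Primes := ⟨2, Nat.prime_two⟩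
  have hr : ∀ i p, r i p = r i q := fun i p =>
    Nat.eq_of_mul_eq_mul_left (card_pos (α := G))
      ((hP.finrank_local i p (hb i p)).trans (hP.finrank_local i q (hb i q)).symm)
  have hap : ∀ (p : Primes) (i : ℤ), ∃ b : Fin (r i q) → ℤ_[p] ⊗[ℤ] P.X i,
      IsGroupBasis (G := G) (repOver _ (P.X i)) b := fun p i => by
    rw [← hr i p]; exact ⟨b i p, hb i p⟩
  have ha0 : ∀ i, ∃ a : Fin (r i q) → QT P i, IsGroupBasis (repQ P i) a := fun i => by
    have := hP.finite i
    exact exists_rational_basis q (hb i q)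
  choose ap hap using hap
  choose a0 ha0 using ha0
  choose lam hlam using fun (p : Primes) (i : ℤ) =>
    ((hap p i).baseChange (B := ℚ_[p])).exists_unit_matrix
      ((ha0 i).baseChange (B := ℚ_[p]))
  exact ⟨⟨fun i => r i q, a0, ha0, ap, hap, lam, fun p i j => congrFun (hlam p i) j⟩⟩

variable (L : LocalBases P)

lemma LocalBases.mact_lam (p : Primes) (i : ℤ) :
    mact (repOver ℚ_[p] (P.X i)) (L.lam p i).1 (fun k => fromZp p (P.X i) (L.ap p i k)) =
      fun j => fromQ p (P.X i) (L.a0 i j) :=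
  funext fun j => L.lam_spec p i j

lemma LocalBases.r_eq_zero (i : ℤ) [Subsingleton (P.X i)] : L.r i = 0 := by
  have h := (L.a0_basis i).finrank_eq
  have : Subsingleton (QT P i) := subsingleton_tmul
  rw [Module.finrank_zero_of_subsingleton, card_fin] at h
  exact (mul_eq_zero.1 h.symm).resolve_left card_pos.ne'

lemma IsPerfect.exists_finset (hP : IsPerfect P) : ∃ s : Finset ℤ, ∀ i, i ∉ s → Subsingleton (P.X i) := by
  obtain ⟨N, hN⟩ := hP.bounded
  refine ⟨Finset.Icc (-N) N, fun i hi => hN i ?_⟩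
  rw [Finset.mem_Icc, ← abs_le] at hi
  exact not_le.1 hi

lemma LocalBases.detGL_eq_one (p : Primes) (i : ℤ) [Subsingleton (P.X i)] {n : ℕ}
    (ρ : CRep G n) :
    detGL ℚ_[p] (localInclC p) ρ (L.lam p i) = 1 := by
  have : IsEmpty (Fin (L.r i)) := by rw [L.r_eq_zero i]; infer_instance
  have h : L.lam p i = 1 := Subsingleton.elim _ _
  rw [h, map_one]

lemma LocalBases.detLam_eq_prod (s : Finset ℤ) (hs : ∀ i, i ∉ s → Subsingleton (P.X i))
    (p : Primes) {n : ℕ} (ρ : CRep G n) :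
    L.detLam p ρ = ∏ i ∈ s, (detGL ℚ_[p] (localInclC p) ρ (L.lam p i)) ^
      (i.negOnePow : ℤ) := by
  refine finprod_eq_prod_of_mulSupport_subset _ fun i hi => ?_
  by_contra h
  have := hs i h
  exact hi ((congrArg (· ^ (i.negOnePow : ℤ)) (L.detGL_eq_one p i ρ)).trans (_root_.one_zpow _))

lemma LocalBases.exists_detLam_hom (hP : IsPerfect P) :
    ∃ f : equivHom (RG G) FinIdele galIdele, ∀ n (ρ : CRep G n)
      (p : Primes), ideleAt p (f.1 (ofAdd (charR ρ))) = L.detLam p ρ := by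
  obtain ⟨s, hs⟩ := hP.exists_finset
  have h1 : ∀ i, ∃ f : equivHom (RG G) FinIdele galIdele,
      ∀ n (ρ : CRep G n) (p : Primes),
      ideleAt p (f.1 (ofAdd (charR ρ))) =
        detGL ℚ_[p] (localInclC p) ρ (L.lam p i) := by
    intro i
    have := hP.finite i
    obtain ⟨N, hN, h⟩ := exists_integral_transition (L.a0_basis i)
    choose Y Z hY hZ using fun p => h p (L.ap p i) (L.ap_basis p i) (L.lam p i) (L.mact_lam p i)
    exact exists_ideleHom (fun p => L.lam p i) N hN Y Z hY hZ
  choose f hf using h1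
  refine ⟨∏ i ∈ s, f i ^ (i.negOnePow : ℤ), fun n ρ p => ?_⟩
  rw [L.detLam_eq_prod s hs]
  have h2 : (∏ i ∈ s, f i ^ (i.negOnePow : ℤ)).1 (ofAdd (charR ρ)) =
      ∏ i ∈ s, (f i).1 (ofAdd (charR ρ)) ^ (i.negOnePow : ℤ) := by
    rw [Subgroup.val_finsetProd, MonoidHom.finsetProd_apply]
    rfl
  rw [h2, map_prod]
  refine prod_congr rfl fun i _ => ?_
  rw [map_zpow, hf]

end

section

variable {L : Type*} [AddCommGroup L]

lemma exists_sub_of_closure_eq_top (X : AddSubmonoid L) (hX : AddSubgroup.closure (X : Set L) = ⊤)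
    (z : L) : ∃ x ∈ X, ∃ y ∈ X, z = x - y := by
  have hz : z ∈ AddSubgroup.closure (X : Set L) := hX ▸ AddSubgroup.mem_top z
  induction hz using closure_induction with
  | mem x h => exact ⟨x, h, 0, X.zero_mem, (sub_zero x).symm⟩
  | zero => exact ⟨0, X.zero_mem, 0, X.zero_mem, (sub_zero 0).symm⟩
  | add a b _ _ ha hb =>
    obtain ⟨x, hx, y, hy, rfl⟩ := ha
    obtain ⟨x', hx', y', hy', rfl⟩ := hb
    exact ⟨x + x', X.add_mem hx hx', y + y', X.add_mem hy hy', by abel⟩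
  | neg a _ ha =>
    obtain ⟨x, hx, y, hy, rfl⟩ := ha
    exact ⟨y, hy, x, hx, by abel⟩

lemma exists_order_unit [Module.Finite ℤ L] [Module.Free ℤ L] (X : AddSubmonoid L)
    (hX : AddSubgroup.closure (X : Set L) = ⊤) :
    ∃ y : L, ∀ z : L, ∃ N₀ : ℕ, ∀ N : ℕ, N₀ ≤ N → z + (N : ℤ) • y ∈ X := by
  let b := finBasis ℤ L
  choose x hx y hy hxy using fun i => exists_sub_of_closure_eq_top X hX (b i)
  refine ⟨∑ i, (x i + y i), fun z => ⟨∑ i, (b.repr z i).natAbs, fun N hN => ?_⟩⟩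
  have hle : ∀ i, (b.repr z i).natAbs ≤ N := fun i =>
    (Finset.single_le_sum (fun _ _ => Nat.zero_le _) (mem_univ i)).trans hN
  have key : z + (N : ℤ) • ∑ i, (x i + y i) =
      ∑ i, (((b.repr z i + N).toNat) • x i + ((N - b.repr z i).toNat) • y i) := by
    conv_lhs => rw [← b.sum_repr z]
    rw [smul_sum, ← sum_add_distrib]
    refine sum_congr rfl fun i _ => ?_
    have h1 : ((b.repr z i + N).toNat : ℤ) = b.repr z i + N :=
      Int.toNat_of_nonneg (by have := hle i; omega)
    have h2 : ((N - b.repr z i).toNat : ℤ) = N - b.repr z i :=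
      Int.toNat_of_nonneg (by have := hle i; omega)
    rw [hxy i, ← natCast_zsmul, ← natCast_zsmul, h1, h2]
    simp only [smul_sub, smul_add, add_smul, sub_smul]
    abel
  rw [key]
  exact X.sum_mem fun i _ => X.add_mem (X.nsmul_mem (hx i) _) (X.nsmul_mem (hy i) _)

lemma exists_basis_smul_eq [Module.Finite ℤ L] [Module.Free ℤ L] (y : L) (hy : y ≠ 0) :
    ∃ (b : Basis (Fin (finrank ℤ L)) ℤ L) (i : Fin (finrank ℤ L)) (a : ℤ),
      y = a • b i := by
  have hli : LinearIndependent ℤ (fun _ : Unit => y) := by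
    rw [linearIndependent_unique_iff]
    exact hy
  let c := Basis.span hli
  obtain ⟨n, S⟩ := Submodule.smithNormalForm (finBasis ℤ L)
    (span ℤ (Set.range fun _ : Unit => y))
  have e := c.indexEquiv S.bN
  have hmem : y ∈ span ℤ (Set.range fun _ : Unit => y) :=
    subset_span ⟨(), rfl⟩
  let k := e ()
  refine ⟨S.bM, S.f k, S.bN.repr ⟨y, hmem⟩ k * S.a k, ?_⟩
  have h1 := congrArg val (S.bN.sum_repr ⟨y, hmem⟩)
  have h2 : ∀ j, j = k := fun j => e.symm.injective (Subsingleton.elim _ _)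
  rw [sum_eq_single k (fun j _ hj => (hj (h2 j)).elim) (by simp)] at h1
  rw [mul_smul, ← S.snf]
  exact h1.symm

lemma exists_basis_mem [Module.Finite ℤ L] [Module.Free ℤ L] (X : AddSubmonoid L)
    (hX : AddSubgroup.closure (X : Set L) = ⊤) (hr : 2 ≤ finrank ℤ L) :
    ∃ b : Basis (Fin (finrank ℤ L)) ℤ L, ∀ i, b i ∈ X := by
  obtain ⟨y, hy⟩ := exists_order_unit X hX
  obtain ⟨b, i0, hb⟩ : ∃ (b : Basis (Fin (finrank ℤ L)) ℤ L)
      (i : Fin (finrank ℤ L)), ∃ a : ℤ, y = a • b i := by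
    by_cases h0 : y = 0
    · exact ⟨finBasis ℤ L, ⟨0, by omega⟩, 0, by rw [h0, zero_smul]⟩
    · obtain ⟨b, i, a, h⟩ := exists_basis_smul_eq y h0
      exact ⟨b, i, a, h⟩
  obtain ⟨a, hya⟩ := hb
  obtain ⟨i1, hi⟩ : ∃ i1, i1 ≠ i0 := by
    have : Nontrivial (Fin (finrank ℤ L)) := Fin.nontrivial_iff_two_le.2 hr
    exact exists_ne i0
  choose N0 hN0 using hy
  let N := (∑ j, N0 (b j)) + N0 (b i0 + b i1)
  have hcoord : b.coord i0 (b i1) = 0 := by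
    rw [Basis.coord_apply, repr_self, Finsupp.single_apply, if_neg hi]
  let ℓ : L →ₗ[ℤ] ℤ := b.constr ℤ fun j => if j = i0 then 0 else (N : ℤ)
  have hℓ : ∀ j, ℓ (b j) = if j = i0 then 0 else (N : ℤ) := fun j => b.constr_basis ℤ _ j
  have hℓy : ℓ y = 0 := by rw [hya, map_smul, hℓ, if_pos rfl, smul_zero]
  let c := (b.map (LinearEquiv.transvection hcoord)).map (LinearEquiv.transvection hℓy)
  refine ⟨c, fun j => ?_⟩
  have hc : c j = b j + b.coord i0 (b j) • b i1 + ℓ (b j + b.coord i0 (b j) • b i1) • y := by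
    simp only [c, Basis.map_apply, LinearEquiv.transvection.apply]
  by_cases hj : j = i0
  · subst hj
    have h1 : b.coord j (b j) = 1 := by
      rw [Basis.coord_apply, repr_self, Finsupp.single_eq_same]
    rw [hc, h1, one_smul, map_add, hℓ, hℓ, if_pos rfl, if_neg hi, zero_add]
    exact hN0 _ N (Nat.le_add_left _ _)
  · have h1 : b.coord i0 (b j) = 0 := by
      rw [Basis.coord_apply, repr_self, Finsupp.single_apply, if_neg hj]
    rw [hc, h1, zero_smul, add_zero, hℓ, if_neg hj]
    refine hN0 _ N (le_trans ?_ (Nat.le_add_right _ _))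
    exact Finset.single_le_sum (f := fun j => N0 (b j)) (fun _ _ => Nat.zero_le _)
      (mem_univ j)

end

section

lemma character_mem_span {n : ℕ} (ρ : CRep G n) (g : G) :
    ρ.character g ∈ span ℤ {z : ℂ | z ^ Nat.card G = 1} := by
  rw [character_eq_trace, Matrix.trace_eq_sum_roots_charpoly]
  refine multiset_sum_mem _ fun z hz => subset_span ?_
  have h1 := Matrix.mem_spectrum_iff_isRoot_charpoly.2 (Polynomial.isRoot_of_mem_roots hz)
  have h2 := spectrum.pow_mem_pow _ (Nat.card G) h1
  rw [← map_pow, pow_card_eq_one', map_one] at h2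
  rcases isEmpty_or_nonempty (Fin n) with h | h
  · rw [spectrum.of_subsingleton] at h2
    exact h2.elim
  · simpa [spectrum.one_eq] using h2

lemma finite_RGs : Module.Finite ℤ (RGs G) := by
  let T := span ℤ {z : ℂ | z ^ Nat.card G = 1}
  have : Module.Finite ℤ T := Module.Finite.span_of_finite ℤ <|
    (Polynomial.nthRoots (Nat.card G) (1 : ℂ)).toFinset.finite_toSet.subset fun z hz =>
      Multiset.mem_toFinset.2 ((Polynomial.mem_nthRoots Nat.card_pos).2 hz)
  have hT : ∀ (ψ : RGs G) (g : G), (ψ : G → ℂ) g ∈ T := by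
    rintro ⟨ψ, hψ⟩ g
    induction hψ using closure_induction with
    | mem χ h =>
      obtain ⟨n, ρ, -, rfl⟩ := h
      exact character_mem_span ρ g
    | zero => exact T.zero_mem
    | add x y _ _ hx hy => exact T.add_mem hx hy
    | neg x _ hx => exact T.neg_mem hx
  let f : RGs G →ₗ[ℤ] (G → T) :=
    { toFun := fun ψ g => ⟨(ψ : G → ℂ) g, hT ψ g⟩
      map_add' := fun x y => rfl
      map_smul' := fun n x => rfl }
  have hf : Function.Injective f := fun x y hxy =>
    Subtype.ext (funext fun g => congrArg val (congrFun hxy g))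
  exact Module.Finite.of_injective f hf

lemma free_RGs : Module.Free ℤ (RGs G) := by
  have := finite_RGs (G := G)
  have : Module.IsTorsionFree ℤ (RGs G) :=
    Function.Injective.moduleIsTorsionFree (fun ψ : RGs G => (ψ : G → ℂ)) Subtype.val_injective
      (fun n x => rfl)
  infer_instance

lemma exists_symplecticRep {n : ℕ} (ρ : CRep G n) (h : IsSymplectic ρ) :
    ∃ W : SymplecticRep G, charRs W.ρ W.isSymplectic = charRs ρ h := by
  obtain ⟨κ, ha, hn, hi⟩ := h
  obtain ⟨k, w, hw⟩ := exists_hyperbolic κ ha hn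
  exact ⟨⟨n, ρ, κ, ha, hn, hi, k, w, hw⟩, rfl⟩

variable (G) in
/-- The characters of symplectic representations. -/
def symplecticCharacters : AddSubmonoid (RGs G) where
  carrier := {ψ | ∃ (n : ℕ) (ρ : CRep G n) (h : IsSymplectic ρ),
    ψ = charRs ρ h}
  zero_mem' := ⟨0, ofMat 1, isSymplectic_zero _, Subtype.ext (by
    funext g
    exact ((character_eq_trace _ g).trans (Matrix.trace_eq_zero_of_isEmpty _)).symm)⟩
  add_mem' := by
    rintro _ _ ⟨n, ρ, h, rfl⟩ ⟨m, ρ', h', rfl⟩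
    exact ⟨n + m, sumRep ρ ρ', h.sumRep h', Subtype.ext (character_sumRep ρ ρ').symm⟩

lemma closure_symplecticCharacters :
    AddSubgroup.closure (symplecticCharacters G : Set (RGs G)) = ⊤ := by
  rw [eq_top_iff]
  rintro ⟨ψ, hψ⟩ -
  induction hψ using closure_induction with
  | mem χ h =>
    obtain ⟨n, ρ, h, rfl⟩ := h
    exact AddSubgroup.subset_closure ⟨n, ρ, h, rfl⟩
  | zero => exact AddSubgroup.zero_mem _
  | add x y _ _ hx hy => exact AddSubgroup.add_mem _ hx hy
  | neg x _ hx => exact AddSubgroup.neg_mem _ hx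

lemma isSymplectic_trivial : IsSymplectic (ofMat (1 : G →* Matrix (Fin 2) (Fin 2) ℂ)) := by
  rw [isSymplectic_iff]
  refine ⟨!![0, 1; -1, 0], ?_, ?_, fun g => ?_⟩
  · ext i j
    fin_cases i <;> fin_cases j <;> simp
  · simp [Matrix.det_fin_two]
  · simp [matRep_ofMat]

lemma family_of_basis {N : ℕ} (b : Basis (Fin N) ℤ (RGs G))
    (hb : ∀ i, b i ∈ symplecticCharacters G) : Nonempty (SymplecticFamily G) := by
  choose n ρ h hbe using hb
  choose W hW using fun i => exists_symplecticRep (ρ i) (h i)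
  exact ⟨⟨N, W, b, fun m => (hbe m).trans (hW m).symm⟩⟩

lemma exists_symplecticFamily : Nonempty (SymplecticFamily G) := by
  have h1 := finite_RGs (G := G)
  have h2 := free_RGs (G := G)
  by_cases hr : 2 ≤ finrank ℤ (RGs G)
  · obtain ⟨b, hb⟩ := exists_basis_mem (symplecticCharacters G) closure_symplecticCharacters hr
    exact family_of_basis b hb
  · let t : RGs G := charRs (ofMat (1 : G →* Matrix (Fin 2) (Fin 2) ℂ)) isSymplectic_trivial
    have ht : ∀ g, (t : G → ℂ) g = 2 := fun g => by
      refine (character_eq_trace _ g).trans ?_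
      rw [matRep_ofMat]
      simp
    have ht0 : t ≠ 0 := fun h0 => by
      have := congrFun (congrArg val h0) 1
      rw [ht] at this
      exact two_ne_zero this
    have hprop : ∀ z : RGs G, ∃ a c : ℤ, a ≠ 0 ∧ a • z = c • t := by
      intro z
      have hnl : ¬ LinearIndependent ℤ ![z, t] := fun hl => by
        have := hl.fintype_card_le_finrank
        simp at this
        omega
      rw [LinearIndependent.pair_iff] at hnl
      push Not at hnl
      obtain ⟨a, c, hac, hne⟩ := hnl
      refine ⟨a, -c, fun ha => ?_, by rw [neg_smul, eq_neg_iff_add_eq_zero, hac]⟩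
      rw [ha, zero_smul, zero_add] at hac
      exact hne ha ((smul_eq_zero.1 hac).resolve_right ht0)
    have hspan : ∀ z : RGs G, z ∈ span ℤ (Set.range fun _ : Fin 1 => t) := by
      intro z
      have hz : z ∈ AddSubgroup.closure (symplecticCharacters G : Set (RGs G)) := by
        rw [closure_symplecticCharacters]
        exact AddSubgroup.mem_top z
      refine (AddSubgroup.closure_le
        (span ℤ (Set.range fun _ : Fin 1 => t)).toAddSubgroup).2 ?_ hz
      rintro _ ⟨n, ρ, h, rfl⟩
      obtain ⟨k, e, -⟩ := IsSymplectic.exists_matrix ρ h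
      obtain ⟨a, c, ha, hac⟩ := hprop (charRs ρ h)
      have hn : n = k * 2 := by simpa using (card_congr e).symm
      have hval : ∀ g, ρ.character g = ρ.character 1 := fun g => by
        have e1 := fun g => congrFun (congrArg val hac) g
        have e2 : ∀ g, (a : ℂ) * ρ.character g = (c : ℂ) * 2 := fun g => by
          have := e1 g
          simpa [ht, charRs] using this
        exact mul_left_cancel₀ (Int.cast_ne_zero.2 ha) ((e2 g).trans (e2 1).symm)
      have : charRs ρ h = (k : ℤ) • t := Subtype.ext (funext fun g => by
        change ρ.character g = ((k : ℤ) • (t : G → ℂ)) g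
        rw [hval, character_one, Pi.smul_apply, ht, hn]
        simp)
      rw [this]
      exact smul_mem _ _ (subset_span ⟨0, rfl⟩)
    have hli : LinearIndependent ℤ (fun _ : Fin 1 => t) := by
      rw [linearIndependent_unique_iff]
      exact ht0
    refine family_of_basis (Basis.mk hli fun z _ => hspan z) fun i => ?_
    rw [Basis.mk_apply]
    exact ⟨2, _, isSymplectic_trivial, rfl⟩

end

section

open scoped Matrix

variable {ι : Type*} [Fintype ι] [DecidableEq ι]

lemma matAct_apply {n : ℕ} (ρ : CRep G n) (M : Matrix ι ι ℚ[G])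
    (f : ι → Fin n → ℂ) (j : ι) :
    matAct ρ M f j = ∑ k, (ringRep ℚ (RingHom.id ℂ) ρ (M j k)).mulVec (f k) := by
  simp [matAct]

lemma matAct_single {n : ℕ} (ρ : CRep G n) (M : Matrix ι ι ℚ[G])
    (k : ι) (w : Fin n → ℂ) (j : ι) :
    matAct ρ M (Pi.single k w) j = (ringRep ℚ (RingHom.id ℂ) ρ (M j k)).mulVec w := by
  rw [matAct_apply, sum_eq_single k]
  · rw [Pi.single_eq_same]
  · intro b _ hb
    rw [Pi.single_eq_of_ne hb, Matrix.mulVec_zero]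
  · simp

lemma det_matAct {n : ℕ} (ρ : CRep G n) (M : Matrix ι ι ℚ[G]) :
    LinearMap.det (matAct ρ M) = detC ρ M := by
  let b : Basis (ι × Fin n) ℂ (ι → Fin n → ℂ) :=
    (Pi.basis fun _ : ι => basisFun ℂ (Fin n)).reindex (Equiv.sigmaEquivProd ι (Fin n))
  rw [← det_toMatrix b, detM_apply]
  congr 1
  refine Matrix.ext fun x y => ?_
  have hb : b y = Pi.single y.1 (Pi.single y.2 1) := by
    rw [Basis.reindex_apply]
    exact (Pi.basis_apply _ _).trans (by simp)
  rw [LinearMap.toMatrix_apply, bigRep_apply, hb]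
  change matAct ρ M (Pi.single y.1 (Pi.single y.2 1)) x.1 x.2 = _
  rw [matAct_single, Matrix.mulVec_single_one]
  rfl

/-- The basis of a sum of copies of a symplectic representation given by its hyperbolic basis. -/
def wBasis (ι : Type*) [Fintype ι] [DecidableEq ι] (W : SymplecticRep G) :
    Basis ((ι × Fin W.k) × Fin 2) ℂ (ι → Fin W.n → ℂ) :=
  (Pi.basis fun _ : ι => W.w).reindex
    ((Equiv.sigmaEquivProd ι (Fin W.k × Fin 2)).trans (Equiv.prodAssoc ι (Fin W.k) (Fin 2)).symm)

lemma wBasis_apply (W : SymplecticRep G) (x : (ι × Fin W.k) × Fin 2) :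
    wBasis ι W x = Pi.single x.1.1 (W.w (x.1.2, x.2)) := by
  rw [wBasis, Basis.reindex_apply]
  exact (Pi.basis_apply _ _)

lemma copies_single (W : SymplecticRep G) (f : ι → Fin W.n → ℂ) (k : ι) (w : Fin W.n → ℂ) :
    copies ι W.κ f (Pi.single k w) = W.κ (f k) w := by
  simp only [copies, LinearMap.sum_apply, compl₁₂_apply, LinearMap.proj_apply]
  rw [sum_eq_single k]
  · rw [Pi.single_eq_same]
  · intro b _ hb
    rw [Pi.single_eq_of_ne hb, map_zero]
  · simp

lemma copies_isAlt (W : SymplecticRep G) : (copies ι W.κ).IsAlt := by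
  intro f
  simp only [copies, LinearMap.sum_apply, compl₁₂_apply, LinearMap.proj_apply]
  exact sum_eq_zero fun j _ => W.alt (f j)

lemma gram_copies (W : SymplecticRep G) : gram (copies ι W.κ) (wBasis ι W) = stdJ (ι × Fin W.k) ℂ := by
  ext ⟨⟨j, a⟩, ε⟩ ⟨⟨k, b⟩, δ⟩
  rw [gram_apply, wBasis_apply, wBasis_apply, copies_single, stdJ_apply]
  by_cases h : j = k
  · subst h
    have h1 := congrFun (congrFun ((isHyperbolic_iff_gram W.κ W.alt W.w).1 W.hyp) (a, ε)) (b, δ)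
    rw [gram_apply, stdJ_apply] at h1
    dsimp only
    rw [Pi.single_eq_same, h1]
    simp
  · dsimp only
    rw [Pi.single_eq_of_ne (Ne.symm h), if_neg (fun h' => h (congrArg Prod.fst h'))]
    simp

lemma wBasis_isHyperbolic (W : SymplecticRep G) : IsHyperbolic (copies ι W.κ) (wBasis ι W) :=
  (isHyperbolic_iff_gram _ (copies_isAlt W) _).2 (gram_copies W)

lemma SymplecticRep.exists_matrix (W : SymplecticRep G) :
    ∃ (K : Matrix (Fin W.n) (Fin W.n) ℂ), Kᵀ = -K ∧ K.det ≠ 0 ∧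
      (∀ g, (matRep W.ρ g)ᵀ * K * matRep W.ρ g = K) ∧
      ∀ x y, W.κ x y = ∑ i, ∑ j, x i * K i j * y j := by
  let K := LinearMap.BilinForm.toMatrix (basisFun ℂ (Fin W.n)) W.κ
  have hK : ∀ x y, W.κ x y = ∑ i, ∑ j, x i * K i j * y j := by
    intro x y
    have := LinearMap.BilinForm.apply_eq_dotProduct_toMatrix_mulVec (basisFun ℂ (Fin W.n)) W.κ x y
    rw [this]
    simp only [dotProduct, mulVec, mul_sum]
    refine sum_congr rfl fun i _ => sum_congr rfl fun j _ => ?_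
    simp [K, mul_assoc]
  refine ⟨K, ?_, ?_, fun g => ?_, hK⟩
  · ext i j
    simp only [K, transpose_apply, Matrix.neg_apply, toMatrix_apply]
    exact (LinearMap.IsAlt.neg W.alt _ _).symm
  · exact (LinearMap.BilinForm.nondegenerate_iff_det_ne_zero _).1 W.nondeg
  · ext i j
    have := W.inv g (Pi.single i 1) (Pi.single j 1)
    rw [hK, ← matRep_mulVec, ← matRep_mulVec, Matrix.mulVec_single_one, Matrix.mulVec_single_one] at this
    have h2 : W.κ (Pi.single i 1) (Pi.single j 1) = K i j := by
      simp [K, toMatrix_apply]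
    rw [h2] at this
    rw [← this]
    simp only [mul_apply, transpose_apply, sum_mul, Matrix.col_apply]
    rw [sum_comm]

lemma detM_starM (W : SymplecticRep G) (X : Matrix ι ι ℚ[G]) :
    detC W.ρ (starM X) = detC W.ρ X := by
  obtain ⟨K, -, hd, hi, -⟩ := W.exists_matrix
  have h := congrArg det (bigRep_starM (A := ℚ) W.ρ K hi X)
  rw [det_mul, det_mul, det_transpose, mul_comm, det_diagBlocks] at h
  exact mul_left_cancel₀ (pow_ne_zero _ hd) h

end

section

open scoped Matrix

variable {V V' : Type v} [AddCommGroup V] [Module ℚ V]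
  [AddCommGroup V'] [Module ℚ V']

section

variable {n : ℕ} {ρ : CRep G n} {τ : Representation ℚ G V}
  {τ' : Representation ℚ G V'}

lemma tensorRep_tmul (g : G) (w : Fin n → ℂ) (u : V) :
    tensorRep ρ τ g (w ⊗ₜ u) = ρ g w ⊗ₜ[ℚ] τ g u := rfl

lemma coe_rG (w : Fin n → ℂ) (u : V) :
    (rG ρ τ w u : (Fin n → ℂ) ⊗[ℚ] V) = ∑ g : G, ρ g w ⊗ₜ[ℚ] τ g u := rfl

variable (ρ τ) in
/-- The map `w ↦ ∑_g g w ⊗ g u`. -/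
def rGLin (u : V) : (Fin n → ℂ) →ₗ[ℂ] Inv ρ τ where
  toFun w := rG ρ τ w u
  map_add' w w' := Subtype.ext (by
    simp only [coe_rG, Submodule.coe_add, map_add, add_tmul, sum_add_distrib])
  map_smul' c w := Subtype.ext (by
    simp only [coe_rG, Submodule.coe_smul, map_smul, RingHom.id_apply, smul_sum]
    rfl)

lemma rGLin_apply (u : V) (w : Fin n → ℂ) : rGLin ρ τ u w = rG ρ τ w u := rfl

lemma rG_add_right (w : Fin n → ℂ) (u u' : V) :
    rG ρ τ w (u + u') = rG ρ τ w u + rG ρ τ w u' := Subtype.ext (by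
  simp only [coe_rG, Submodule.coe_add, map_add, tmul_add, sum_add_distrib])

lemma rG_zero_right (w : Fin n → ℂ) : rG ρ τ w 0 = 0 := Subtype.ext (by
  simp [coe_rG])

lemma rG_sum_right {α : Type*} (s : Finset α) (w : Fin n → ℂ) (u : α → V) :
    rG ρ τ w (∑ i ∈ s, u i) = ∑ i ∈ s, rG ρ τ w (u i) := by
  classical
  induction s using Finset.induction_on with
  | empty => simp [rG_zero_right]
  | insert a s ha ih => rw [Finset.sum_insert ha, Finset.sum_insert ha, rG_add_right, ih]

lemma rG_smul_right (w : Fin n → ℂ) (q : ℚ) (u : V) :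
    rG ρ τ w (q • u) = (q : ℂ) • rG ρ τ w u := Subtype.ext (by
  simp only [coe_rG, Submodule.coe_smul, map_smul, smul_sum]
  refine sum_congr rfl fun g _ => ?_
  rw [tmul_smul]
  exact congrArg (· ⊗ₜ[ℚ] τ g u) (Rat.cast_smul_eq_qsmul ℂ q (ρ g w)).symm)

lemma rG_rep (g : G) (w : Fin n → ℂ) (u : V) :
    rG ρ τ (ρ g w) (τ g u) = rG ρ τ w u := Subtype.ext (by
  rw [coe_rG, coe_rG]
  refine sum_equiv (Equiv.mulRight g) _ _ fun h => ?_
  rw [Equiv.coe_mulRight, map_mul, map_mul]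
  rfl)

lemma rG_asAlgebraHom (w : Fin n → ℂ) (x : ℚ[G]) (u : V) :
    rG ρ τ w (τ.asAlgebraHom x u) =
      rG ρ τ ((ringRep ℚ (RingHom.id ℂ) ρ (starG x)).mulVec w) u := by
  have h1 : (ringRep ℚ (RingHom.id ℂ) ρ (starG x)).mulVec w =
      ∑ g, (x.coeff g : ℂ) • ρ g⁻¹ w := by
    funext a
    simp only [mulVec, dotProduct, ringRep_apply, starG_coeff, Finset.sum_apply, Pi.smul_apply,
      smul_eq_mul, ← matRep_mulVec, sum_mul, mul_sum]
    rw [sum_comm]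
    refine sum_equiv (Equiv.inv G) _ _ fun g => sum_congr rfl fun b _ => ?_
    simp [mul_assoc]
  rw [asAlgebraHom_eq_sum, rG_sum_right, h1, ← rGLin_apply, map_sum]
  refine sum_congr rfl fun g _ => ?_
  rw [rG_smul_right, map_smul, rGLin_apply]
  congr 1
  rw [← rG_rep g⁻¹, ← Module.End.mul_apply, ← map_mul, inv_mul_cancel, map_one]
  rfl

lemma coe_invMap (f : V →ₗ[ℚ] V') (hf : ∀ g x, f (τ g x) = τ' g (f x)) (x : Inv ρ τ) :
    (invMap ρ f hf x : (Fin n → ℂ) ⊗[ℚ] V') = TensorProduct.AlgebraTensorModule.map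
      (LinearMap.id : (Fin n → ℂ) →ₗ[ℂ] (Fin n → ℂ)) f x := rfl

lemma invMap_rG (f : V →ₗ[ℚ] V') (hf : ∀ g x, f (τ g x) = τ' g (f x)) (w : Fin n → ℂ) (u : V) :
    invMap ρ f hf (rG ρ τ w u) = rG ρ τ' w (f u) := Subtype.ext (by
  rw [coe_invMap, coe_rG, coe_rG, map_sum]
  refine sum_congr rfl fun g _ => ?_
  rw [← hf]
  rfl)

end

variable (W : SymplecticRep G) {τ : Representation ℚ G V} {τ' : Representation ℚ G V'}
  {ι : Type*}

variable (τ) in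
/-- The family `∑_g g w_n ⊗ g a_j`. -/
def bfam (a : ι → V) (x : (ι × Fin W.k) × Fin 2) : Inv W.ρ τ :=
  rG W.ρ τ (W.w (x.1.2, x.2)) (a x.1.1)

lemma invMap_bfam (f : V →ₗ[ℚ] V') (hf : ∀ g x, f (τ g x) = τ' g (f x)) (a : ι → V)
    (x : (ι × Fin W.k) × Fin 2) :
    invMap W.ρ f hf (bfam W τ a x) = bfam W τ' (fun j => f (a j)) x :=
  invMap_rG f hf _ _

variable [Fintype ι] [DecidableEq ι]

/-- The matrix by which `bfam` changes if a matrix over the group ring is applied. -/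
def invMatrix (X : Matrix ι ι ℚ[G]) :
    Matrix ((ι × Fin W.k) × Fin 2) ((ι × Fin W.k) × Fin 2) ℂ :=
  (LinearMap.toMatrix (wBasis ι W) (wBasis ι W) (matAct W.ρ (starM X)))ᵀ

lemma det_invMatrix (X : Matrix ι ι ℚ[G]) :
    (invMatrix W X).det = detC W.ρ X := by
  rw [invMatrix, det_transpose, det_toMatrix, det_matAct, detM_starM]

lemma bfam_mact (X : Matrix ι ι ℚ[G]) (a : ι → V) (x : (ι × Fin W.k) × Fin 2) :
    bfam W τ (mact τ X a) x = ∑ y, invMatrix W X x y • bfam W τ a y := by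
  let Θ : (ι → Fin W.n → ℂ) →ₗ[ℂ] Inv W.ρ τ :=
    ∑ k, (rGLin W.ρ τ (a k)).comp (LinearMap.proj k)
  have hΘ : ∀ f, Θ f = ∑ k, rG W.ρ τ (f k) (a k) := fun f => by
    simp [Θ, rGLin_apply]
  have h1 : ∀ y, Θ (wBasis ι W y) = bfam W τ a y := fun y => by
    rw [hΘ, wBasis_apply, sum_eq_single y.1.1]
    · rw [Pi.single_eq_same]; rfl
    · intro k _ hk
      rw [Pi.single_eq_of_ne hk, ← rGLin_apply, map_zero]
    · simp
  have h2 : bfam W τ (mact τ X a) x = Θ (matAct W.ρ (starM X) (wBasis ι W x)) := by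
    rw [hΘ, wBasis_apply]
    change rG W.ρ τ _ (∑ k, τ.asAlgebraHom (X x.1.1 k) (a k)) = _
    rw [rG_sum_right]
    refine sum_congr rfl fun k _ => ?_
    rw [matAct_single, rG_asAlgebraHom]
    rfl
  rw [h2, ← (wBasis ι W).sum_repr (matAct W.ρ (starM X) (wBasis ι W x)), map_sum]
  refine sum_congr rfl fun y _ => ?_
  rw [map_smul, h1]
  congr 1
  exact (LinearMap.toMatrix_apply _ _ _ _ _).symm

end

section

open scoped Matrix

lemma IsGroupBasis.exists_invariants_basis {A : Type*} [CommRing A] {V : Type*} [AddCommGroup V]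
    [Module A V] {τ : Representation A G V} {ι : Type*} [Fintype ι] {c : ι → V}
    (h : IsGroupBasis τ c) :
    ∃ b : Basis ι A τ.invariants, ∀ k, (b k : V) = ∑ g, τ g (c k) := by
  have hmem : ∀ k, ∑ g, τ g (c k) ∈ τ.invariants := fun k g => by
    rw [map_sum]
    refine sum_equiv (mulLeft g) _ _ fun g' => ?_
    rw [coe_mulLeft, map_mul]
    rfl
  let v : ι → τ.invariants := fun k => ⟨_, hmem k⟩
  have hsum : ∀ f : ι → A, ((∑ k, f k • v k : τ.invariants) : V) = ∑ x : G × ι, f x.2 • h.basis x := by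
    intro f
    rw [Fintype.sum_prod_type_right, Submodule.coe_sum]
    refine sum_congr rfl fun k _ => ?_
    rw [Submodule.coe_smul, smul_sum]
    exact sum_congr rfl fun g _ => by rw [h.basis_apply]
  have hli : LinearIndependent A v := by
    rw [Fintype.linearIndependent_iff]
    intro f hf k
    have h0 := hsum f
    rw [hf] at h0
    exact Fintype.linearIndependent_iff.1 h.basis.linearIndependent (fun x => f x.2) h0.symm (1, k)
  have hspan : ∀ u : τ.invariants, u ∈ span A (Set.range v) := by
    intro u
    have hr : ∀ g k, h.basis.repr (u : V) (g, k) = h.basis.repr (u : V) (1, k) := by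
      intro g k
      have h1 : (u : V) = ∑ x : G × ι, h.basis.repr (u : V) (g⁻¹ * x.1, x.2) • h.basis x := by
        conv_lhs => rw [← u.2 g, ← h.basis.sum_repr (u : V), map_sum]
        refine sum_equiv ((mulLeft g).prodCongr (Equiv.refl ι)) _ _ fun x => ?_
        rw [map_smul, h.basis_apply, h.basis_apply]
        simp only [Equiv.prodCongr_apply, Prod.map_fst, Prod.map_snd, coe_mulLeft,
          inv_mul_cancel_left, Equiv.refl_apply, Prod.mk.eta, map_mul]
        rfl
      have h2 := congrArg (fun y => h.basis.repr y (g, k)) h1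
      rw [h2, h.basis.repr_sum_self, inv_mul_cancel]
    have : u = ∑ k, h.basis.repr (u : V) (1, k) • v k := by
      refine Subtype.ext ?_
      rw [hsum, ← h.basis.sum_repr (u : V)]
      refine sum_congr rfl fun x _ => ?_
      rw [h.basis.sum_repr, ← hr x.1 x.2]
    rw [this]
    exact Submodule.sum_mem _ fun k _ => smul_mem _ _ (subset_span ⟨k, rfl⟩)
  exact ⟨Basis.mk hli fun u _ => hspan u, fun k => by rw [Basis.mk_apply]⟩

variable {V : Type v} [AddCommGroup V] [Module ℚ V] {τ : Representation ℚ G V} {ι : Type*}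
  [Fintype ι] [DecidableEq ι]

lemma IsGroupBasis.tensor {n : ℕ} (ρ : CRep G n) {κ : Type*} [Fintype κ]
    (w : Basis κ ℂ (Fin n → ℂ)) {a : ι → V} (h : IsGroupBasis τ a) {ι' : Type*} [Fintype ι']
    (e : ι' ≃ κ × ι) :
    IsGroupBasis (tensorRep ρ τ) fun x : ι' => w (e x).1 ⊗ₜ[ℚ] a (e x).2 := by
  have hspan : (⊤ : Submodule ℂ ((Fin n → ℂ) ⊗[ℚ] V)) ≤ span ℂ
      (Set.range fun x : G × ι' => tensorRep ρ τ x.1 (w (e x.2).1 ⊗ₜ[ℚ] a (e x.2).2)) := by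
    set S := span ℂ
      (Set.range fun x : G × ι' => tensorRep ρ τ x.1 (w (e x.2).1 ⊗ₜ[ℚ] a (e x.2).2)) with hS
    have h1 : ∀ (g : G) (j : ι) (y : Fin n → ℂ), y ⊗ₜ[ℚ] τ g (a j) ∈ S := by
      intro g j y
      have h2 : y = ∑ z, w.repr (ρ g⁻¹ y) z • ρ g (w z) := by
        have : ρ g (ρ g⁻¹ y) = y := by
          rw [← Module.End.mul_apply, ← map_mul, mul_inv_cancel, map_one]; rfl
        conv_lhs => rw [← this, ← w.sum_repr (ρ g⁻¹ y), map_sum]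
        simp
      rw [h2, TensorProduct.sum_tmul]
      refine Submodule.sum_mem _ fun z _ => ?_
      rw [← smul_tmul']
      refine smul_mem _ _ (subset_span ⟨(g, e.symm (z, j)), ?_⟩)
      simp [tensorRep_tmul]
    intro t _
    induction t using induction_on with
    | zero => exact S.zero_mem
    | add x y hx hy => exact S.add_mem (hx trivial) (hy trivial)
    | tmul y u =>
      rw [← h.basis.sum_repr u, TensorProduct.tmul_sum]
      refine Submodule.sum_mem _ fun x _ => ?_
      rw [tmul_smul, smul_tmul', h.basis_apply]
      exact h1 _ _ _
  refine ⟨linearIndependent_of_top_le_span_of_card_eq_finrank hspan ?_, top_le_iff.1 hspan⟩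
  rw [finrank_eq_card_basis (w.tensorProduct h.basis), card_prod, card_congr e]
  simp only [card_prod]
  ring

lemma IsGroupBasis.exists_bfam_basis (W : SymplecticRep G) {a : ι → V} (h : IsGroupBasis τ a) :
    ∃ b : Basis ((ι × Fin W.k) × Fin 2) ℂ (Inv W.ρ τ), ∀ x, b x = bfam W τ a x := by
  obtain ⟨b, hb⟩ := (h.tensor W.ρ W.w ((Equiv.prodAssoc ι (Fin W.k) (Fin 2)).trans
    (Equiv.prodComm _ _))).exists_invariants_basis
  exact ⟨b, fun x => Subtype.ext (hb x)⟩

end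

section

open scoped Matrix

variable {V V' U U' : Type v} [AddCommGroup V] [Module ℚ V]
  [AddCommGroup V'] [Module ℚ V'] [AddCommGroup U] [Module ℚ U] [AddCommGroup U'] [Module ℚ U']
  {n : ℕ}

/-- The map `1 ⊗ f`. -/
abbrev tmap (n : ℕ) (f : V →ₗ[ℚ] V') : (Fin n → ℂ) ⊗[ℚ] V →ₗ[ℂ] (Fin n → ℂ) ⊗[ℚ] V' :=
  TensorProduct.AlgebraTensorModule.map (LinearMap.id : (Fin n → ℂ) →ₗ[ℂ] (Fin n → ℂ)) f

/-- The pairing of `W ⊗ V` and `W ⊗ V'` defined by a form on `W` and a pairing of `V` and `V'`. -/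
def tmulPair (κ : BilinForm ℂ (Fin n → ℂ)) (s : V →ₗ[ℚ] V' →ₗ[ℚ] ℚ) :
    (Fin n → ℂ) ⊗[ℚ] V →ₗ[ℂ] (Fin n → ℂ) ⊗[ℚ] V' →ₗ[ℂ] ℂ :=
  (LinearMap.BilinForm.tmul κ
    (s.compl₁₂ (fst ℚ V V') (snd ℚ V V'))).compl₁₂
      (tmap n (LinearMap.inl ℚ V V')) (tmap n (LinearMap.inr ℚ V V'))

lemma tmulPair_tmul (κ : BilinForm ℂ (Fin n → ℂ)) (s : V →ₗ[ℚ] V' →ₗ[ℚ] ℚ)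
    (x y : Fin n → ℂ) (u : V) (u' : V') :
    tmulPair κ s (x ⊗ₜ u) (y ⊗ₜ u') = (s u u' : ℂ) * κ x y := by
  rw [tmulPair, compl₁₂_apply, TensorProduct.AlgebraTensorModule.map_tmul,
    TensorProduct.AlgebraTensorModule.map_tmul]
  refine (LinearMap.BilinForm.tensorDistrib_tmul ℚ ℂ _ _ _ _ _ _).trans ?_
  rw [Rat.smul_def]
  rfl

lemma tmulPair_ext {κ : BilinForm ℂ (Fin n → ℂ)} {s : V →ₗ[ℚ] V' →ₗ[ℚ] ℚ}
    {P : (Fin n → ℂ) ⊗[ℚ] V →ₗ[ℂ] (Fin n → ℂ) ⊗[ℚ] V' →ₗ[ℂ] ℂ}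
    (h : ∀ x u y u', P (x ⊗ₜ u) (y ⊗ₜ u') = (s u u' : ℂ) * κ x y) : P = tmulPair κ s := by
  refine LinearMap.ext fun a => LinearMap.ext fun b => ?_
  induction a using induction_on with
  | zero => simp
  | add a a' ha ha' => simp only [map_add, LinearMap.add_apply, ha, ha']
  | tmul x u =>
    induction b using induction_on with
    | zero => simp
    | add b b' hb hb' => simp only [map_add, hb, hb']
    | tmul y u' => rw [h, tmulPair_tmul]

lemma tmul_eq_tmulPair (κ : BilinForm ℂ (Fin n → ℂ)) (β : BilinForm ℚ V) :
    LinearMap.BilinForm.tmul κ β = tmulPair κ β := by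
  refine tmulPair_ext fun x u y u' => ?_
  refine (LinearMap.BilinForm.tensorDistrib_tmul ℚ ℂ _ _ _ _ _ _).trans ?_
  rw [Rat.smul_def]

lemma invForm_apply {ρ : CRep G n} (τ : Representation ℚ G V)
    (κ : BilinForm ℂ (Fin n → ℂ)) (β : BilinForm ℚ V) (x y : Inv ρ τ) :
    invForm ρ τ κ β x y = tmulPair κ β x y := by
  rw [← tmul_eq_tmulPair]
  rfl

lemma tmulPair_map (κ : BilinForm ℂ (Fin n → ℂ)) (s : V →ₗ[ℚ] V' →ₗ[ℚ] ℚ)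
    (f : U →ₗ[ℚ] V) (f' : U' →ₗ[ℚ] V') (x : (Fin n → ℂ) ⊗[ℚ] U) (y : (Fin n → ℂ) ⊗[ℚ] U') :
    tmulPair κ s (tmap n f x) (tmap n f' y) = tmulPair κ (s.compl₁₂ f f') x y := by
  have : (tmulPair κ s).compl₁₂ (tmap n f) (tmap n f') = tmulPair κ (s.compl₁₂ f f') :=
    tmulPair_ext fun x u y u' => tmulPair_tmul κ s x y (f u) (f' u')
  exact congrArg (fun P : (Fin n → ℂ) ⊗[ℚ] U →ₗ[ℂ] (Fin n → ℂ) ⊗[ℚ] U' →ₗ[ℂ] ℂ => P x y) this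

lemma tmulPair_flip (κ : BilinForm ℂ (Fin n → ℂ)) (ha : κ.IsAlt)
    (s : V →ₗ[ℚ] V' →ₗ[ℚ] ℚ) (s' : V' →ₗ[ℚ] V →ₗ[ℚ] ℚ) (h : ∀ x y, s' y x = s x y)
    (x : (Fin n → ℂ) ⊗[ℚ] V) (y : (Fin n → ℂ) ⊗[ℚ] V') :
    tmulPair κ s' y x = -tmulPair κ s x y := by
  have : -(tmulPair κ s').flip = tmulPair κ s := tmulPair_ext fun x u y u' => by
    rw [LinearMap.neg_apply, LinearMap.neg_apply, LinearMap.flip_apply, tmulPair_tmul, h,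
      ← LinearMap.IsAlt.neg ha x y, mul_neg, neg_neg]
  rw [← this]
  simp

lemma tmulPair_isAlt {κ : BilinForm ℂ (Fin n → ℂ)} (ha : κ.IsAlt)
    {β : BilinForm ℚ V} (h : ∀ x y, β y x = β x y) :
    IsAlt (tmulPair κ β) := by
  intro x
  have := tmulPair_flip κ ha β β h x x
  exact self_eq_neg.1 this

lemma invForm_isAlt {ρ : CRep G n} (τ : Representation ℚ G V)
    {κ : BilinForm ℂ (Fin n → ℂ)} (ha : κ.IsAlt) {β : BilinForm ℚ V}
    (h : ∀ x y, β y x = β x y) : (invForm ρ τ κ β).IsAlt := fun x =>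
  (invForm_apply τ κ β x x).trans (tmulPair_isAlt ha h _)

lemma tmulPair_rG {ρ : CRep G n} {τ : Representation ℚ G V}
    {τ' : Representation ℚ G V'} {κ : BilinForm ℂ (Fin n → ℂ)}
    (hκ : ∀ g x y, κ (ρ g x) (ρ g y) = κ x y) {s : V →ₗ[ℚ] V' →ₗ[ℚ] ℚ}
    (hs : ∀ g x y, s (τ g x) (τ' g y) = s x y) (x y : Fin n → ℂ) (u : V) (u' : V') :
    tmulPair κ s (rG ρ τ x u : (Fin n → ℂ) ⊗[ℚ] V) (rG ρ τ' y u' : (Fin n → ℂ) ⊗[ℚ] V') =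
      (card G : ℂ) * ∑ g : G, (s u (τ' g u') : ℂ) * κ x (ρ g y) := by
  rw [coe_rG, coe_rG, map_sum (tmulPair κ s), LinearMap.sum_apply]
  rw [← nsmul_eq_mul, ← card_univ, ← Finset.sum_const]
  refine sum_congr rfl fun g _ => ?_
  rw [map_sum]
  refine sum_equiv (mulLeft g⁻¹) _ _ fun h => ?_
  rw [tmulPair_tmul, coe_mulLeft, ← hs g⁻¹, ← hκ g⁻¹]
  simp only [← Module.End.mul_apply, ← map_mul, inv_mul_cancel, map_one]
  rfl

end

section

open scoped Matrix

lemma gram_comp_basis {K V : Type*} [Field K] [AddCommGroup V] [Module K V] {α : Type*} [Fintype α]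
    [DecidableEq α] (h : BilinForm K V) (e : Basis α K V) (A : V →ₗ[K] V) :
    gram (LinearMap.comp h A) e = (LinearMap.toMatrix e e A)ᵀ * gram h e := by
  ext x y
  rw [gram_apply, LinearMap.comp_apply, ← e.sum_repr (A (e x)), map_sum, LinearMap.sum_apply,
    mul_apply]
  refine sum_congr rfl fun z _ => ?_
  rw [map_smul, LinearMap.smul_apply, smul_eq_mul, transpose_apply, LinearMap.toMatrix_apply,
    gram_apply]

lemma isAlt_of_gram {V α : Type*} [AddCommGroup V] [Module ℂ V]
    (h : BilinForm ℂ V) (e : Basis α ℂ V) (hs : (gram h e)ᵀ = -gram h e) :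
    h.IsAlt := by
  have h1 : h + h.flip = 0 := e.ext fun x => e.ext fun y => by
    have := congrFun (congrFun hs x) y
    rw [transpose_apply, Matrix.neg_apply, gram_apply, gram_apply] at this
    simp [this]
  intro x
  have h2 := congrArg (fun P : V →ₗ[ℂ] V →ₗ[ℂ] ℂ => P x x) h1
  simp only [LinearMap.add_apply, LinearMap.zero_apply] at h2
  exact add_self_eq_zero.1 h2

lemma nondegenerate_of_gram {V α : Type*} [AddCommGroup V] [Module ℂ V] [Fintype α] [DecidableEq α]
    (h : BilinForm ℂ V) (e : Basis α ℂ V) (hs : (gram h e).det ≠ 0) :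
    h.Nondegenerate := by
  rw [LinearMap.BilinForm.nondegenerate_iff_det_ne_zero e]
  convert hs using 2
  ext x y
  rw [toMatrix_apply, gram_apply]

variable {V : Type v} [AddCommGroup V] [Module ℚ V]
  {τ : Representation ℚ G V} {B : BilinForm ℚ V} {ι : Type*}

lemma coeff_groupGram (a : ι → V) (j k : ι) (h : G) :
    (groupGram τ B a j k).coeff h = B (τ h⁻¹ (a j)) (a k) := by
  classical
  simp only [groupGram, of_apply, coeff_sum, MonoidAlgebra.coeff_single,
    coe_finsetSum, Finset.sum_apply, Finsupp.single_apply]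
  rw [sum_eq_single h⁻¹]
  · simp
  · intro b _ hb
    rw [if_neg]
    rintro rfl
    exact hb (inv_inv b).symm
  · simp

lemma starM_groupGram (hs : ∀ x y, B x y = B y x) (hi : ∀ g x y, B (τ g x) (τ g y) = B x y)
    (a : ι → V) : starM (groupGram τ B a) = groupGram τ B a := by
  refine Matrix.ext fun j k => MonoidAlgebra.ext (Finsupp.ext fun h => ?_)
  change (starG (groupGram τ B a k j)).coeff h = _
  rw [starG_coeff, coeff_groupGram, coeff_groupGram, inv_inv, ← hi h⁻¹, hs]
  simp only [← Module.End.mul_apply, ← map_mul, inv_mul_cancel, map_one]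
  rfl

variable [Fintype ι] [DecidableEq ι]

lemma isUnit_groupGram {a : ι → V} (ha : IsGroupBasis τ a) (hi : ∀ g x y, B (τ g x) (τ g y) = B x y)
    (hn : ∀ x, (∀ y, B x y = 0) → x = 0) : IsUnit (groupGram τ B a) := by
  set M := groupGram τ B a with hM
  have key : ∀ (c : ι → ℚ[G]) (k : ι) (h : G),
      (∑ j, c j * M j k).coeff h = B (τ h⁻¹ (∑ j, τ.asAlgebraHom (c j) (a j))) (a k) := by
    intro c k h
    rw [coeff_sum, coe_finsetSum, Finset.sum_apply, map_sum, map_sum,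
      LinearMap.sum_apply]
    refine sum_congr rfl fun j _ => ?_
    have h1 : ∀ x : ℚ[G], (x * M j k).coeff h = B (τ h⁻¹ (τ.asAlgebraHom x (a j))) (a k) := by
      intro x
      induction x using MonoidAlgebra.induction_linear with
      | zero => simp
      | add x y hx hy =>
        rw [add_mul, MonoidAlgebra.coeff_add, Finsupp.add_apply, hx, hy, map_add,
          LinearMap.add_apply, map_add, map_add, LinearMap.add_apply]
      | single g r =>
        rw [MonoidAlgebra.coeff_single_mul_eq_mul_coeff (g⁻¹ * h)
          (fun m _ => eq_inv_mul_iff_mul_eq.symm), coeff_groupGram, Representation.asAlgebraHom_single,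
          LinearMap.smul_apply, map_smul, map_smul, LinearMap.smul_apply, smul_eq_mul, _root_.mul_inv_rev,
          inv_inv, map_mul]
        rfl
    exact h1 _
  have hinj : ∀ X : Matrix ι ι ℚ[G], X * M = 0 → X = 0 := by
    intro X hX
    have hrow : ∀ i, ∑ j, τ.asAlgebraHom (X i j) (a j) = 0 := by
      intro i
      apply hn
      intro y
      obtain ⟨c, rfl⟩ : ∃ c : G × ι → ℚ, ∑ x, c x • ha.basis x = y := ⟨_, ha.basis.sum_repr y⟩
      rw [map_sum]
      refine sum_eq_zero fun x _ => ?_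
      rw [map_smul, ha.basis_apply, ← hi x.1⁻¹]
      have := key (X i) x.2 x.1
      rw [show ∑ j, X i j * M j x.2 = (X * M) i x.2 from rfl, hX] at this
      rw [← Module.End.mul_apply (τ x.1⁻¹) (τ x.1), ← map_mul, inv_mul_cancel, map_one,
        Module.End.one_apply, ← this]
      simp
    refine Matrix.ext fun i j => ?_
    refine congrFun (ha.coord_injective (c := X i) (c' := 0) ?_) j
    rw [hrow]
    simp
  let f : Matrix ι ι ℚ[G] →ₗ[ℚ] Matrix ι ι ℚ[G] :=
    LinearMap.mulRight ℚ M
  have hf : Function.Injective f := (injective_iff_map_eq_zero f).2 fun X hX => hinj X hX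
  have hfin : Module.Finite ℚ ℚ[G] := inferInstance
  obtain ⟨N, hN⟩ := (LinearMap.injective_iff_surjective.1 hf) 1
  have hN' : N * M = 1 := hN
  refine ⟨⟨M, N, ?_, hN'⟩, rfl⟩
  refine sub_eq_zero.1 (hinj (M * N - 1) ?_)
  rw [sub_mul, mul_assoc, hN', mul_one, one_mul, sub_self]

lemma gram_copies_matAct (W : SymplecticRep G) (hs : ∀ x y, B x y = B y x)
    {β : BilinForm ℚ V} (hB : ∀ x y, B x y = (card G : ℚ) * β x y)
    (hi : ∀ g x y, B (τ g x) (τ g y) = B x y) (a : ι → V) :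
    gram (LinearMap.comp (copies ι W.κ) (matAct W.ρ (groupGram τ B a))) (wBasis ι W) =
      gram (invForm W.ρ τ W.κ β) (bfam W τ a) := by
  have hc : (card G : ℚ) ≠ 0 := cast_ne_zero.2 card_ne_zero
  have hiβ : ∀ g x y, β (τ g x) (τ g y) = β x y := fun g x y =>
    mul_left_cancel₀ hc (by rw [← hB, ← hB, hi])
  ext x y
  rw [gram_apply, gram_apply, invForm_apply, bfam, bfam, tmulPair_rG W.inv hiβ, LinearMap.comp_apply,
    wBasis_apply, wBasis_apply, copies_single, matAct_single]
  have h1 : (ringRep ℚ (RingHom.id ℂ) W.ρ (groupGram τ B a y.1.1 x.1.1)).mulVec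
      (W.w (x.1.2, x.2)) =
      ∑ h, (B (τ h⁻¹ (a y.1.1)) (a x.1.1) : ℂ) • W.ρ h (W.w (x.1.2, x.2)) := by
    funext c
    simp only [mulVec, dotProduct, ringRep_apply, coeff_groupGram, Finset.sum_apply,
      Pi.smul_apply, smul_eq_mul, ← matRep_mulVec, sum_mul, mul_sum]
    rw [sum_comm]
    refine sum_congr rfl fun g _ => sum_congr rfl fun b _ => ?_
    simp [mul_assoc]
  rw [h1, map_sum, LinearMap.sum_apply, mul_sum]
  refine sum_equiv (Equiv.inv G) _ _ fun h => ?_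
  rw [map_smul, LinearMap.smul_apply, smul_eq_mul, Equiv.inv_apply, ← W.inv h⁻¹, hs, hB, ← mul_assoc]
  simp only [← Module.End.mul_apply, ← map_mul, inv_mul_cancel, map_one]
  push_cast
  rfl

lemma det_gram_bfam_ne_zero (W : SymplecticRep G) (hs : ∀ x y, B x y = B y x)
    {β : BilinForm ℚ V} (hB : ∀ x y, B x y = (card G : ℚ) * β x y)
    (hi : ∀ g x y, B (τ g x) (τ g y) = B x y) (hn : ∀ x, (∀ y, B x y = 0) → x = 0) {a : ι → V}
    (ha : IsGroupBasis τ a) : (gram (invForm W.ρ τ W.κ β) (bfam W τ a)).det ≠ 0 := by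
  rw [← gram_copies_matAct W hs hB hi, gram_comp_basis, det_mul, det_transpose,
    det_toMatrix, det_matAct, gram_copies, stdJ_det, mul_one]
  exact detM_ne_zero _ (isUnit_groupGram ha hi hn)

lemma pfGram_eq_pfm_copies (W : SymplecticRep G) (hs : ∀ x y, B x y = B y x)
    (hi : ∀ g x y, B (τ g x) (τ g y) = B x y) (hn : ∀ x, (∀ y, B x y = 0) → x = 0) {a : ι → V}
    (ha : IsGroupBasis τ a) :
    pfGram W τ B a =
      pfm (gram (LinearMap.comp (copies ι W.κ) (matAct W.ρ (groupGram τ B a))) (wBasis ι W)) := by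
  have hc : (card G : ℚ) ≠ 0 := cast_ne_zero.2 card_ne_zero
  have hB : ∀ x y, B x y = (card G : ℚ) * ((card G : ℚ)⁻¹ • B) x y := fun x y => by
    rw [LinearMap.smul_apply, LinearMap.smul_apply, smul_eq_mul, mul_inv_cancel_left₀ hc]
  have h2 := det_gram_bfam_ne_zero W hs hB hi hn ha
  have h3 : IsAlt
      (LinearMap.comp (copies ι W.κ) (matAct W.ρ (groupGram τ B a))) := by
    refine isAlt_of_gram _ (wBasis ι W) ?_
    rw [gram_copies_matAct W hs hB hi]
    refine gram_transpose _ (invForm_isAlt τ W.alt fun x y => ?_) _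
    rw [LinearMap.smul_apply, LinearMap.smul_apply, LinearMap.smul_apply, LinearMap.smul_apply, hs]
  refine pfEnd_eq_pfm (copies ι W.κ) (copies_isAlt W) (wBasis ι W) (wBasis_isHyperbolic W) _ h3 ?_
  refine nondegenerate_of_gram _ (wBasis ι W) ?_
  rwa [gram_copies_matAct W hs hB hi]

lemma pfGram_eq_pfm (W : SymplecticRep G) (hs : ∀ x y, B x y = B y x)
    {β : BilinForm ℚ V} (hB : ∀ x y, B x y = (card G : ℚ) * β x y)
    (hi : ∀ g x y, B (τ g x) (τ g y) = B x y) (hn : ∀ x, (∀ y, B x y = 0) → x = 0) {a : ι → V}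
    (ha : IsGroupBasis τ a) :
    pfGram W τ B a = pfm (gram (invForm W.ρ τ W.κ β) (bfam W τ a)) := by
  rw [pfGram_eq_pfm_copies W hs hi hn ha, gram_copies_matAct W hs hB hi]

lemma exists_pfGramHom (hs : ∀ x y, B x y = B y x)
    (hi : ∀ g x y, B (τ g x) (τ g y) = B x y) (hn : ∀ x, (∀ y, B x y = 0) → x = 0) {a : ι → V}
    (ha : IsGroupBasis τ a) :
    ∃ h : equivHom (RGs G) Qbarˣ galUnits, ∀ W : SymplecticRep G,
      ((h.1 (ofAdd (charRs W.ρ W.isSymplectic)) : Qbar) : ℂ) = pfGram W τ B a := by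
  set M := groupGram τ B a with hM
  have hst := starM_groupGram hs hi a
  obtain ⟨h, hh⟩ := exists_pfHom M hst (isUnit_groupGram ha hi hn)
  refine ⟨h, fun W => ?_⟩
  obtain ⟨K, hK, hd, hKi, hKκ⟩ := W.exists_matrix
  let e : Fin W.k × Fin 2 ≃ Fin W.n := W.w.indexEquiv (basisFun ℂ (Fin W.n))
  have key := hh W.n W.k W.ρ W.isSymplectic e K hK hd hKi
  let sb : Basis ((ι × Fin W.k) × Fin 2) ℂ (ι → Fin W.n → ℂ) :=
    ((Pi.basis fun _ : ι => basisFun ℂ (Fin W.n)).reindex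
      (Equiv.sigmaEquivProd ι (Fin W.n))).reindex (pairEquiv ι e).symm
  have hsb : ∀ x, sb x = Pi.single (pairEquiv ι e x).1 (Pi.single (pairEquiv ι e x).2 1) := by
    intro x
    rw [Basis.reindex_apply, Basis.reindex_apply]
    exact (Pi.basis_apply _ _).trans (by simp)
  let C : Matrix ((ι × Fin W.k) × Fin 2) ((ι × Fin W.k) × Fin 2) ℂ :=
    of fun x y => sb.repr (wBasis ι W x) y
  have hC : (wBasis ι W : _ → _) = fun x => ∑ y, C x y • sb y :=
    funext fun x => (sb.sum_repr (wBasis ι W x)).symm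
  have hg : ∀ f : BilinForm ℂ (ι → Fin W.n → ℂ),
      pfm (gram f (wBasis ι W)) = C.det * pfm (gram f sb) := fun f => by
    rw [hC, gram_mul, pfm_conj]
  have hKs : ∀ (i : Fin W.n) (y : Fin W.n → ℂ), W.κ y (Pi.single i 1) = ∑ c, y c * K c i := by
    intro i y
    rw [hKκ]
    simp [Pi.single_apply]
  have h1 : gram (copies ι W.κ) sb =
      (diagBlocks ι K).submatrix (pairEquiv ι e) (pairEquiv ι e) := by
    ext x y
    rw [gram_apply, hsb, hsb, copies_single, hKs, submatrix_apply, diagBlocks]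
    by_cases hxy : (pairEquiv ι e x).1 = (pairEquiv ι e y).1
    · simp [hxy, Pi.single_apply]
    · simp [hxy, Ne.symm hxy]
  have h2 : gram (LinearMap.comp (copies ι W.κ) (matAct W.ρ M)) sb =
      (diagBlocks ι K * bigRep ℚ (RingHom.id ℂ) W.ρ M).submatrix (pairEquiv ι e)
        (pairEquiv ι e) := by
    have h3 := bigRep_starM (A := ℚ) W.ρ K hKi M
    rw [hst] at h3
    rw [← h3]
    ext x y
    rw [gram_apply, LinearMap.comp_apply, hsb, hsb, copies_single, hKs, submatrix_apply,
      mul_diagBlocks_apply]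
    refine sum_congr rfl fun c _ => ?_
    rw [matAct_single, Matrix.mulVec_single_one, transpose_apply, bigRep_apply]
    rfl
  have h4 := hg (copies ι W.κ)
  rw [gram_copies, pfm_stdJ, h1] at h4
  rw [pfGram_eq_pfm_copies W hs hi hn ha, hg, h2, key, ← mul_assoc, ← h4, one_mul]

end

section

open scoped Matrix Kronecker

variable {V V' : Type v} [AddCommGroup V] [Module ℚ V]
  [AddCommGroup V'] [Module ℚ V'] {τ : Representation ℚ G V} {τ' : Representation ℚ G V'}

lemma tmap_zero (n : ℕ) (x : (Fin n → ℂ) ⊗[ℚ] V) : tmap n (0 : V →ₗ[ℚ] V') x = 0 := by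
  exact x.induction_on (by simp) (fun a b => tmul_zero _ a)
    fun a b ha hb => by rw [map_add, ha, hb, add_zero]

lemma tmap_tmap (n : ℕ) {V'' : Type v} [AddCommGroup V''] [Module ℚ V''] (f : V →ₗ[ℚ] V')
    (f' : V' →ₗ[ℚ] V'') (x : (Fin n → ℂ) ⊗[ℚ] V) :
    tmap n f' (tmap n f x) = tmap n (f'.comp f) x := by
  exact x.induction_on (by simp only [map_zero]) (fun a b => rfl)
    fun a b ha hb => by simp only [map_add, ha, hb]

lemma tmap_injective (n : ℕ) {f : V →ₗ[ℚ] V'} (hf : Function.Injective f) :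
    Function.Injective (tmap n f) :=
  Module.Flat.lTensor_preserves_injective_linearMap (M := Fin n → ℂ) f hf

lemma tmap_rep {n : ℕ} (ρ : CRep G n) {f : V →ₗ[ℚ] V'}
    (hf : ∀ g x, f (τ g x) = τ' g (f x)) (g : G) (x : (Fin n → ℂ) ⊗[ℚ] V) :
    tmap n f (tensorRep ρ τ g x) = tensorRep ρ τ' g (tmap n f x) := by
  exact x.induction_on (by simp) (fun a b => congrArg (ρ g a ⊗ₜ[ℚ] ·) (hf g b))
    fun a b ha hb => by simp only [map_add, ha, hb]

lemma invMap_injective {n : ℕ} (ρ : CRep G n) {f : V →ₗ[ℚ] V'}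
    (hf : ∀ g x, f (τ g x) = τ' g (f x)) (hi : Function.Injective f) :
    Function.Injective (invMap ρ f hf) := fun _ _ h =>
  Subtype.ext (tmap_injective n hi (congrArg val h))

lemma exists_invMap_eq_of_ker {n : ℕ} (ρ : CRep G n) {V'' : Type v}
    [AddCommGroup V''] [Module ℚ V''] {τ'' : Representation ℚ G V''} {f : V →ₗ[ℚ] V'}
    {k : V'' →ₗ[ℚ] V} (hf : ∀ g x, f (τ g x) = τ' g (f x)) (hk : ∀ g x, k (τ'' g x) = τ g (k x))
    (hi : Function.Injective k) (he : Function.Exact k f) (x : Inv ρ τ) (hx : invMap ρ f hf x = 0) :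
    ∃ y : Inv ρ τ'', invMap ρ k hk y = x := by
  have h1 : Function.Exact (k.lTensor (Fin n → ℂ)) (f.lTensor (Fin n → ℂ)) :=
    Module.Flat.lTensor_exact (Fin n → ℂ) he
  obtain ⟨y, hy⟩ := (h1 x).1 (congrArg val hx)
  have hy' : tmap n k y = x := hy
  refine ⟨⟨y, fun g => tmap_injective n hi ?_⟩, Subtype.ext hy⟩
  rw [tmap_rep ρ hk, hy', x.2 g]

lemma exists_definite_form [Module.Finite ℚ V] (τ : Representation ℚ G V) :
    ∃ β : BilinForm ℚ V, (∀ x y, β y x = β x y) ∧ (∀ g x y, β (τ g x) (τ g y) = β x y) ∧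
      ∀ x, β x x = 0 → x = 0 := by
  let b := finBasis ℚ V
  let β₀ : BilinForm ℚ V := ∑ i, (LinearMap.mul ℚ ℚ).compl₁₂ (b.coord i) (b.coord i)
  have h0 : ∀ x y, β₀ x y = ∑ i, b.repr x i * b.repr y i := fun x y => by simp [β₀]
  let β : BilinForm ℚ V := ∑ g, β₀.compl₁₂ (τ g) (τ g)
  have h1 : ∀ x y, β x y = ∑ g, β₀ (τ g x) (τ g y) := fun x y => by simp [β]
  refine ⟨β, fun x y => ?_, fun g x y => ?_, fun x hx => ?_⟩
  · rw [h1, h1]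
    refine sum_congr rfl fun g _ => ?_
    rw [h0, h0]
    exact sum_congr rfl fun i _ => mul_comm _ _
  · rw [h1, h1]
    refine sum_equiv (Equiv.mulRight g) _ _ fun h => ?_
    rw [Equiv.coe_mulRight, map_mul]
    rfl
  · have hp : ∀ y, 0 ≤ β₀ y y := fun y => by
      rw [h0]
      exact Finset.sum_nonneg fun i _ => mul_self_nonneg _
    rw [h1, Finset.sum_eq_zero_iff_of_nonneg fun g _ => hp _] at hx
    have h2 := hx 1 (mem_univ _)
    rw [map_one, Module.End.one_apply, h0,
      Finset.sum_eq_zero_iff_of_nonneg fun i _ => mul_self_nonneg _] at h2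
    refine b.ext_elem fun i => ?_
    rw [map_zero, Finsupp.zero_apply]
    exact mul_self_eq_zero.1 (h2 i (mem_univ _))

lemma finite_inv [Module.Finite ℚ V] {n : ℕ} (ρ : CRep G n)
    (τ : Representation ℚ G V) : Module.Finite ℂ (Inv ρ τ) := by
  have : Module.Finite ℂ ((Fin n → ℂ) ⊗[ℚ] V) :=
    Module.Finite.of_basis ((basisFun ℂ (Fin n)).tensorProduct (finBasis ℚ V))
  infer_instance

lemma tmulPair_rep {n : ℕ} {ρ : CRep G n}
    {κ : BilinForm ℂ (Fin n → ℂ)} (hκ : ∀ g x y, κ (ρ g x) (ρ g y) = κ x y)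
    {s : V →ₗ[ℚ] V' →ₗ[ℚ] ℚ} (hs : ∀ g x y, s (τ g x) (τ' g y) = s x y) (g : G)
    (x : (Fin n → ℂ) ⊗[ℚ] V) (y : (Fin n → ℂ) ⊗[ℚ] V') :
    tmulPair κ s (tensorRep ρ τ g x) (tensorRep ρ τ' g y) = tmulPair κ s x y := by
  have : (tmulPair κ s).compl₁₂ (tensorRep ρ τ g) (tensorRep ρ τ' g) = tmulPair κ s :=
    tmulPair_ext fun x u y u' => by
      rw [compl₁₂_apply, tensorRep_tmul, tensorRep_tmul, tmulPair_tmul, hκ, hs]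
  exact congrArg (fun P : (Fin n → ℂ) ⊗[ℚ] V →ₗ[ℂ] (Fin n → ℂ) ⊗[ℚ] V' →ₗ[ℂ] ℂ => P x y) this

lemma invForm_nondegenerate [Module.Finite ℚ V] (W : SymplecticRep G)
    {β : BilinForm ℚ V} (hs : ∀ x y, β y x = β x y)
    (hi : ∀ g x y, β (τ g x) (τ g y) = β x y) (hn : β.Nondegenerate) :
    (invForm W.ρ τ W.κ β).Nondegenerate := by
  let b := finBasis ℚ V
  let e := W.w.tensorProduct b
  have h1 : gram (tmulPair W.κ β) e = gram W.κ W.w ⊗ₖ (gram β b).map (algebraMap ℚ ℂ) := by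
    ext x y
    rw [gram_apply, Matrix.kroneckerMap_apply, gram_apply, map_apply, gram_apply,
      Basis.tensorProduct_apply', Basis.tensorProduct_apply', tmulPair_tmul, mul_comm]
    rfl
  have h2 : (gram β b).det ≠ 0 := by
    have := (LinearMap.BilinForm.nondegenerate_iff_det_ne_zero b).1 hn
    convert this using 2
    ext x y
    rw [toMatrix_apply, gram_apply]
  have h3 : (gram (tmulPair W.κ β) e).det ≠ 0 := by
    rw [h1, det_kronecker, (isHyperbolic_iff_gram W.κ W.alt W.w).1 W.hyp, stdJ_det, one_pow,
      one_mul]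
    refine pow_ne_zero _ ?_
    rw [show (gram β b).map (algebraMap ℚ ℂ) = (algebraMap ℚ ℂ).mapMatrix (gram β b) from rfl,
      ← map_det]
    exact (map_ne_zero _).2 h2
  have h4 := nondegenerate_of_gram _ e h3
  have key : ∀ x : Inv W.ρ τ, (∀ y, invForm W.ρ τ W.κ β x y = 0) → x = 0 := by
    intro x hx
    refine Subtype.ext (h4.1 x fun z => ?_)
    have hz : ∑ g, tensorRep W.ρ τ g z ∈ Inv W.ρ τ := fun g => by
      rw [map_sum]
      refine sum_equiv (mulLeft g) _ _ fun g' => ?_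
      rw [coe_mulLeft, map_mul]
      rfl
    have h5 := hx ⟨_, hz⟩
    rw [invForm_apply, map_sum] at h5
    have h6 : ∀ g, tmulPair W.κ β (x : (Fin W.n → ℂ) ⊗[ℚ] V) (tensorRep W.ρ τ g z) =
        tmulPair W.κ β (x : (Fin W.n → ℂ) ⊗[ℚ] V) z := fun g => by
      conv_lhs => rw [← x.2 g]
      exact tmulPair_rep W.inv hi g _ _
    rw [sum_congr rfl fun g _ => h6 g, Finset.sum_const, card_univ, nsmul_eq_mul] at h5
    exact (mul_eq_zero.1 h5).resolve_left (cast_ne_zero.2 card_ne_zero)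
  refine ⟨key, fun y hy => key y fun x => ?_⟩
  rw [← LinearMap.IsAlt.neg (invForm_isAlt τ W.alt hs), hy, neg_zero]

lemma even_finrank_of_isAlt {N : Type*} [AddCommGroup N] [Module ℂ N] [Module.Finite ℂ N]
    (h : BilinForm ℂ N) (ha : h.IsAlt) (hn : h.Nondegenerate) :
    Even (finrank ℂ N) := by
  obtain ⟨k, u, -⟩ := exists_hyperbolic h ha hn
  have h := finrank_eq_card_basis u
  rw [card_prod, card_fin, card_fin] at h
  exact ⟨k, by omega⟩

lemma even_finrank_inv [Module.Finite ℚ V] (W : SymplecticRep G) (τ : Representation ℚ G V) :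
    Even (finrank ℂ (Inv W.ρ τ)) := by
  obtain ⟨β, hs, hi, hd⟩ := exists_definite_form τ
  have hn : β.Nondegenerate := ⟨fun x hx => hd x (hx x), fun x hx => hd x (hx x)⟩
  have := finite_inv W.ρ τ
  have h1 := invForm_isAlt (ρ := W.ρ) τ W.alt hs
  have h2 := invForm_nondegenerate W hs hi hn
  have h3 := even_finrank_of_isAlt (N := Inv W.ρ τ) (invForm W.ρ τ W.κ β)
  exact h3 h1 h2

end

section

lemma exists_pair_family {N : Type*} [AddCommGroup N] [Module ℂ N] [Module.Finite ℂ N]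
    (K : Submodule ℂ N) (h : Even (finrank ℂ N)) (h' : Even (finrank ℂ K)) :
    ∃ (s : ℕ) (x : Fin s × Fin 2 → N), finrank ℂ N = finrank ℂ K + 2 * s ∧
      K ⊔ span ℂ (Set.range x) = ⊤ := by
  obtain ⟨U, hU⟩ := K.exists_isCompl
  have h1 := Submodule.finrank_add_eq_of_isCompl hU
  have h2 : Even (finrank ℂ U) := by
    rw [← h1] at h
    exact (Nat.even_add.1 h).1 h'
  obtain ⟨s, hs⟩ := h2
  let b : Basis (Fin s × Fin 2) ℂ U := (finBasis ℂ U).reindex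
    ((finCongr (by omega : finrank ℂ U = s * 2)).trans finProdFinEquiv.symm)
  refine ⟨s, fun x => (b x : N), by omega, ?_⟩
  have : span ℂ (Set.range fun x => (b x : N)) = U := by
    have h3 := congrArg (Submodule.map U.subtype) b.span_eq
    rw [Submodule.map_top, Submodule.range_subtype, Submodule.map_span, ← Set.range_comp] at h3
    exact h3
  rw [this]
  exact hU.sup_eq_top

lemma exists_adapted_bases {N Z : ℤ → Type*} [∀ i, AddCommGroup (N i)] [∀ i, Module ℂ (N i)]
    [∀ i, Module.Finite ℂ (N i)] [∀ i, AddCommGroup (Z i)] [∀ i, Module ℂ (Z i)]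
    (δ : ∀ i j, N i →ₗ[ℂ] N j) (hδ : ∀ i j k x, δ j k (δ i j x) = 0) (ζ : ∀ i, Z i →ₗ[ℂ] N i)
    (hζi : ∀ i, Function.Injective (ζ i))
    (hζ : ∀ i, range (ζ i) = ker (δ i (i + 1)))
    (hev : ∀ i, Even (finrank ℂ (N i))) (hevZ : ∀ i, Even (finrank ℂ (Z i))) :
    ∃ (s t : ℤ → ℕ)
      (v : ∀ i, Basis ((Fin (s (i - 1)) ⊕ Fin (t i) ⊕ Fin (s i)) × Fin 2) ℂ (N i))
      (y : ∀ i, Fin (t i) × Fin 2 → Z i),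
      (∀ i a ε, ζ i (y i (a, ε)) = v i (inr (inl a), ε)) ∧
      ∀ i a ε, δ (i - 1) i (v (i - 1) (inr (inr a), ε)) = v i (inl a, ε) := by
  have hker : ∀ i, Even (finrank ℂ (ker (δ i (i + 1)))) := fun i => by
    rw [← hζ, LinearMap.finrank_range_of_inj (hζi i)]
    exact hevZ i
  choose s u hs hu using fun i => exists_pair_family (ker (δ i (i + 1))) (hev i) (hker i)
  have hcast : ∀ i j, i + 1 = j → ker (δ i j) = ker (δ i (i + 1)) := by
    rintro i _ rfl
    rfl
  have hrange : ∀ i, finrank ℂ (range (δ (i - 1) i)) = 2 * s (i - 1) := by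
    intro i
    have h1 := LinearMap.finrank_range_add_finrank_ker (δ (i - 1) i)
    rw [hcast (i - 1) i (by ring), hs (i - 1)] at h1
    omega
  have hle : ∀ i, range (δ (i - 1) i) ≤ ker (δ i (i + 1)) := by
    rintro i _ ⟨y, rfl⟩
    exact hδ _ _ _ y
  have hcom : ∀ i, finrank ℂ ((range (δ (i - 1) i)).comap
      (ker (δ i (i + 1))).subtype) = 2 * s (i - 1) := fun i => by
    rw [← hrange i]
    exact (Submodule.comapSubtypeEquivOfLe (hle i)).finrank_eq
  choose t z ht hz using fun i => exists_pair_family ((range (δ (i - 1) i)).comap (ker (δ i (i + 1))).subtype) (hker i)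
    (by rw [hcom i]; exact even_two_mul _)
  have hy : ∀ i x, ∃ y, ζ i y = z i x := fun i x => by
    exact (hζ i).ge (z i x).2
  choose y hy using hy
  let v : ∀ i, (Fin (s (i - 1)) ⊕ Fin (t i) ⊕ Fin (s i)) × Fin 2 → N i := fun i x =>
    Sum.elim (fun a => δ (i - 1) i (u (i - 1) (a, x.2)))
      (Sum.elim (fun a => z i (a, x.2)) (fun a => u i (a, x.2))) x.1
  have hspan : ∀ i, ⊤ ≤ span ℂ (Set.range (v i)) := by
    intro i
    set S := span ℂ (Set.range (v i)) with hS
    have h1 : range (δ (i - 1) i) ≤ S := by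
      rintro _ ⟨x, rfl⟩
      have hx : x ∈ ker (δ (i - 1) (i - 1 + 1)) ⊔
          span ℂ (Set.range (u (i - 1))) := by rw [hu]; trivial
      rw [← hcast (i - 1) i (by ring)] at hx
      obtain ⟨a, ha, b, hb, rfl⟩ := Submodule.mem_sup.1 hx
      rw [map_add, mem_ker.1 ha, zero_add]
      have : span ℂ (Set.range (u (i - 1))) ≤ S.comap (δ (i - 1) i) := by
        rw [Submodule.span_le]
        rintro _ ⟨⟨a, ε⟩, rfl⟩
        exact subset_span ⟨(inl a, ε), rfl⟩
      exact this hb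
    have h2 : ker (δ i (i + 1)) ≤ S := by
      intro x hx
      have hx' : (⟨x, hx⟩ : ker (δ i (i + 1))) ∈
        (range (δ (i - 1) i)).comap
          (ker (δ i (i + 1))).subtype ⊔
          span ℂ (Set.range (z i)) := by rw [hz]; trivial
      obtain ⟨a, ha, b, hb, hab⟩ := Submodule.mem_sup.1 hx'
      have : span ℂ (Set.range (z i)) ≤
          S.comap (ker (δ i (i + 1))).subtype := by
        rw [Submodule.span_le]
        rintro _ ⟨⟨a, ε⟩, rfl⟩
        exact subset_span ⟨(inr (inl a), ε), rfl⟩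
      have h3 := congrArg val hab
      change (a : N i) + b = x at h3
      rw [← h3]
      exact S.add_mem (h1 ha) (this hb)
    rw [← hu i]
    refine sup_le h2 ?_
    rw [Submodule.span_le]
    rintro _ ⟨⟨a, ε⟩, rfl⟩
    exact subset_span ⟨(inr (inr a), ε), rfl⟩
  have hcard : ∀ i, card ((Fin (s (i - 1)) ⊕ Fin (t i) ⊕ Fin (s i)) × Fin 2) =
      finrank ℂ (N i) := fun i => by
    rw [hs i, ht i, hcom i]
    simp only [card_prod, Fintype.card_sum, card_fin]
    ring
  have hv : ∀ i x, basisOfTopLeSpanOfCardEqFinrank (v i) (hspan i) (hcard i) x = v i x := fun i x => by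
    rw [coe_basisOfTopLeSpanOfCardEqFinrank]
  refine ⟨s, t, fun i => basisOfTopLeSpanOfCardEqFinrank (v i) (hspan i) (hcard i), y,
    fun i a ε => ?_, fun i a ε => ?_⟩
  · rw [hv]
    exact hy i (a, ε)
  · rw [hv, hv]
    rfl

/-- The differentials of `(W ⊗ ℚP)^G`. -/
abbrev dInv (P : CochainComplex (ModuleCat.{v} ℤ[G]) ℤ) (W : SymplecticRep G)
    (i j : ℤ) : Inv W.ρ (repQ P i) →ₗ[ℂ] Inv W.ρ (repQ P j) :=
  invMap W.ρ (τ' := repQ P j) (dQ P i j) (extQ_rep _)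

lemma dQ_dQ (i j k : ℤ) (x : QT P i) : dQ P j k (dQ P i j x) = 0 := by
  rw [extQ_comp, P.d_comp_d, extQ_zero]

lemma dInv_dInv (W : SymplecticRep G) (i j k : ℤ) (x : Inv W.ρ (repQ P i)) :
    dInv P W j k (dInv P W i j x) = 0 := by
  have : (dQ P j k).comp (dQ P i j) = 0 := LinearMap.ext fun x => dQ_dQ i j k x
  refine Subtype.ext ?_
  exact (tmap_tmap W.n _ _ _).trans ((congrArg (fun f => tmap W.n f _) this).trans (tmap_zero _ _))

/-- The inclusion of `(W ⊗ Z)^G`, where `Z` are the cycles. -/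
abbrev zInv (P : CochainComplex (ModuleCat.{v} ℤ[G]) ℤ) (W : SymplecticRep G)
    (i : ℤ) : Inv W.ρ (repZ P i) →ₗ[ℂ] Inv W.ρ (repQ P i) :=
  invMap W.ρ (τ' := repQ P i) (Zc P i).subtype (fun _ _ => rfl)

lemma zInv_injective (W : SymplecticRep G) (i : ℤ) : Function.Injective (zInv P W i) :=
  invMap_injective W.ρ _ (Zc P i).injective_subtype

lemma range_zInv (W : SymplecticRep G) (i : ℤ) :
    range (zInv P W i) = ker (dInv P W i (i + 1)) := by
  refine le_antisymm ?_ fun x hx => ?_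
  · rintro _ ⟨y, rfl⟩
    have : (dQ P i (i + 1)).comp (Zc P i).subtype = 0 := LinearMap.ext fun x => x.2
    refine Subtype.ext ?_
    exact (tmap_tmap W.n _ _ _).trans
      ((congrArg (fun f => tmap W.n f _) this).trans (tmap_zero _ _))
  · exact exists_invMap_eq_of_ker W.ρ (extQ_rep _) _ (Zc P i).injective_subtype
      (LinearMap.exact_subtype_ker_map _) x hx

lemma LocalBases.finite_QT (L : LocalBases P) (i : ℤ) : Module.Finite ℚ (QT P i) :=
  Module.Finite.of_basis (L.a0_basis i).basis

lemma LocalBases.nonempty_adaptedBases (L : LocalBases P) (W : SymplecticRep G) :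
    Nonempty (AdaptedBases W L) := by
  have hfin := L.finite_QT
  have hN : ∀ i, Module.Finite ℂ (Inv W.ρ (repQ P i)) := fun i => finite_inv _ _
  obtain ⟨s, t, v, y, h1, h2⟩ := exists_adapted_bases (N := fun i => Inv W.ρ (repQ P i))
    (Z := fun i => Inv W.ρ (repZ P i)) (dInv P W) (dInv_dInv W) (zInv P W) (zInv_injective W)
    (range_zInv W) (fun i => even_finrank_inv _ _) (fun i => even_finrank_inv _ _)
  have he : ∀ i, Nonempty (Fin (L.r i) × Fin W.k ≃ Fin (s (i - 1)) ⊕ Fin (t i) ⊕ Fin (s i)) := by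
    intro i
    obtain ⟨b, -⟩ := (L.a0_basis i).exists_bfam_basis W
    have h1 := card_congr (b.indexEquiv (v i))
    rw [card_prod, card_prod (Fin (s (i - 1)) ⊕ Fin (t i) ⊕ Fin (s i))] at h1
    simp only [card_fin] at h1
    exact ⟨equivOfCardEq (by omega)⟩
  exact ⟨⟨s, t, v, y, h1, h2, fun i => (he i).some⟩⟩

end

section

lemma exists_zsmul_eq_zero_of_tmul_eq_zero (p : Primes) {C : Type*} [AddCommGroup C] (c : C)
    (hc : (1 : ℤ_[p]) ⊗ₜ[ℤ] c = 0) : ∃ m : ℤ, ¬ ((p : ℕ) : ℤ) ∣ m ∧ m • c = 0 := by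
  by_contra hcon
  push Not at hcon
  let f : ℤ →ₗ[ℤ] C := toSpanSingleton ℤ C c
  have hker : ker f ≤ ker (Int.castAddHom (ZMod (p : ℕ))).toIntLinearMap := by
    intro m hm
    have hm' : m • c = 0 := hm
    by_contra hd
    refine hcon m (fun h => hd ?_) hm'
    exact (ZMod.intCast_zmod_eq_zero_iff_dvd m (p : ℕ)).2 h
  let φ : range f →ₗ[ℤ] ZMod (p : ℕ) :=
    (Submodule.liftQ _ _ hker).comp f.quotKerEquivRange.symm.toLinearMap
  let c' : range f := ⟨c, 1, one_smul ℤ c⟩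
  have hφ : φ c' = 1 := by
    have : f.quotKerEquivRange.symm c' = Submodule.Quotient.mk 1 := by
      rw [LinearEquiv.symm_apply_eq]
      exact Subtype.ext (one_smul ℤ c).symm
    change Submodule.liftQ _ _ hker (f.quotKerEquivRange.symm c') = 1
    rw [this, Submodule.liftQ_apply]
    simp
  have h1 : (1 : ℤ_[p]) ⊗ₜ[ℤ] c' = 0 := by
    have hinj := Module.Flat.lTensor_preserves_injective_linearMap (M := ℤ_[p])
      (range f).subtype (range f).injective_subtype
    exact hinj (hc.trans (map_zero _).symm)
  let ψ : ℤ_[p] ⊗[ℤ] range f →ₗ[ℤ] ZMod (p : ℕ) :=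
    (LinearMap.mul' ℤ (ZMod (p : ℕ))).comp
      (TensorProduct.map (toZMod (p := (p : ℕ))).toAddMonoidHom.toIntLinearMap φ)
  have h2 : ψ ((1 : ℤ_[p]) ⊗ₜ[ℤ] c') = 1 := by
    change toZMod (1 : ℤ_[p]) * φ c' = 1
    rw [map_one, hφ, mul_one]
  rw [h1, map_zero] at h2
  exact zero_ne_one h2

lemma exists_approx (p : Primes) {M : Type*} [AddCommGroup M] (a : ℤ_[p] ⊗[ℤ] M) :
    ∃ (x : M) (y : ℤ_[p] ⊗[ℤ] M), (1 : ℤ_[p]) ⊗ₜ[ℤ] x = a + ((p : ℕ) : ℤ_[p]) • y := by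
  induction a using induction_on with
  | zero => exact ⟨0, 0, by simp⟩
  | add a b ha hb =>
    obtain ⟨x, y, h⟩ := ha
    obtain ⟨x', y', h'⟩ := hb
    refine ⟨x + x', y + y', ?_⟩
    rw [tmul_add, h, h', smul_add]
    abel
  | tmul z m =>
    obtain ⟨n, -, hn⟩ := PadicInt.exists_mem_range z
    rw [PadicInt.maximalIdeal_eq_span_p, Ideal.mem_span_singleton] at hn
    obtain ⟨t, ht⟩ := hn
    refine ⟨n • m, -(t ⊗ₜ m), ?_⟩
    have hz : z = n + ((p : ℕ) : ℤ_[p]) * t := by rw [← ht]; ring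
    rw [tmul_smul, smul_neg, smul_tmul', smul_tmul',
      smul_eq_mul, hz, add_tmul, add_neg_cancel_right, nsmul_eq_mul, mul_one]

variable {M : Type v} [AddCommGroup M]
  [Module ℤ[G] M]

lemma exists_integral_groupBasis (p : Primes) {r : ℕ} {a : Fin r → ℤ_[p] ⊗[ℤ] M}
    (ha : IsGroupBasis (G := G) (repOver ℤ_[p] M) a) :
    ∃ x : Fin r → M, IsGroupBasis (G := G) (repOver ℤ_[p] M) fun j => 1 ⊗ₜ[ℤ] x j := by
  classical
  choose x y hxy using fun j => exists_approx p (a j)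
  refine ⟨x, ?_⟩
  set v : G × Fin r → ℤ_[p] ⊗[ℤ] M := fun z => repOver ℤ_[p] M z.1 (1 ⊗ₜ[ℤ] x z.2) with hv
  have h1 : ∀ z, v z = ha.basis z + ((p : ℕ) : ℤ_[p]) • repOver ℤ_[p] M z.1 (y z.2) := by
    intro z
    rw [ha.basis_apply, ← map_smul, ← map_add, ← hxy]
  have h2 : (toZMod (p := (p : ℕ))).mapMatrix (ha.basis.toMatrix v) = 1 := by
    ext i j
    rw [mapMatrix_apply, map_apply, Basis.toMatrix_apply, h1, map_add, map_smul,
      Finsupp.add_apply, Finsupp.smul_apply, map_add, smul_eq_mul, map_mul, map_natCast,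
      ZMod.natCast_self, zero_mul, add_zero, repr_self, Finsupp.single_apply,
      one_apply]
    by_cases h : i = j
    · simp [h]
    · simp [h, Ne.symm h]
  have h3 : toZMod (p := (p : ℕ)) (ha.basis.det v) = 1 := by
    rw [Basis.det_apply, map_det, h2, Matrix.det_one]
  refine (Basis.is_basis_iff_det ha.basis).2 ?_
  by_contra hu
  have h4 : ha.basis.det v ∈ maximalIdeal ℤ_[p] := (IsLocalRing.mem_maximalIdeal _).2 hu
  rw [← PadicInt.ker_toZMod, RingHom.mem_ker, h3] at h4
  exact one_ne_zero h4

lemma tmul_groupRing_smul (A : Type*) [CommRing A] (c : ℤ[G]) (m : M) :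
    (1 : A) ⊗ₜ[ℤ] (c • m) = (repOver A M).asAlgebraHom (intG G A c) ((1 : A) ⊗ₜ[ℤ] m) := by
  induction c using MonoidAlgebra.induction_linear with
  | zero => simp
  | add x y hx hy => rw [add_smul, tmul_add, hx, hy, map_add, map_add,
      LinearMap.add_apply]
  | single g n =>
    have h1 : intG G A (MonoidAlgebra.single g n) = MonoidAlgebra.single g (n : A) := by
      simp [intG]
    have h2 : MonoidAlgebra.single g n = n • MonoidAlgebra.of ℤ G g := by
      simp
    rw [h1, Representation.asAlgebraHom_single, LinearMap.smul_apply, h2, smul_assoc,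
      tmul_smul, Int.cast_smul_eq_zsmul]
    rfl

lemma exists_factorization (p : Primes) [Module.Finite ℤ[G] M] {r : ℕ}
    {a : Fin r → ℤ_[p] ⊗[ℤ] M} (ha : IsGroupBasis (G := G) (repOver ℤ_[p] M) a) :
    ∃ (m : ℤ) (α : M →ₗ[ℤ[G]] (Fin r → ℤ[G]))
      (β : (Fin r → ℤ[G]) →ₗ[ℤ[G]] M), ¬ ((p : ℕ) : ℤ) ∣ m ∧
      ∀ x, β (α x) = m • x := by
  obtain ⟨x, hx⟩ := exists_integral_groupBasis p ha
  let β : (Fin r → ℤ[G]) →ₗ[ℤ[G]] M :=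
    Fintype.linearCombination ℤ[G] x
  have hβ : ∀ c, β c = ∑ j, c j • x j := fun c => Fintype.linearCombination_apply _ _ _
  have hβ' : ∀ c, (1 : ℤ_[p]) ⊗ₜ[ℤ] β c =
      ∑ j, (repOver ℤ_[p] M).asAlgebraHom (intG G ℤ_[p] (c j)) (1 ⊗ₜ[ℤ] x j) := by
    intro c
    rw [hβ, TensorProduct.tmul_sum]
    exact sum_congr rfl fun j _ => tmul_groupRing_smul _ _ _
  have hinj : Function.Injective β := by
    rw [injective_iff_map_eq_zero]
    intro c hc
    have h1 := hβ' c
    rw [hc, tmul_zero] at h1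
    have h2 := hx.coord_injective (c := fun j => intG G ℤ_[p] (c j)) (c' := 0) (by
      rw [← h1]; simp)
    funext j
    have h3 := congrFun h2 j
    refine MonoidAlgebra.ext (Finsupp.ext fun g => ?_)
    have h4 := congrArg (fun z : ℤ_[p][G] => z.coeff g) h3
    simpa [intG, coeff_mapRingHom] using h4
  have hann : ∀ y : M, ∃ m : ℤ, ¬ ((p : ℕ) : ℤ) ∣ m ∧ m • y ∈ range β := by
    intro y
    let R : Submodule ℤ M := (range β).toAddSubgroup.toIntSubmodule
    have hy : (1 : ℤ_[p]) ⊗ₜ[ℤ] y ∈ range (R.subtype.baseChange ℤ_[p]) := by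
      obtain ⟨c, hc⟩ := hx.exists_coord ((1 : ℤ_[p]) ⊗ₜ[ℤ] y)
      rw [← hc]
      refine Submodule.sum_mem _ fun j _ => ?_
      rw [asAlgebraHom_eq_sum]
      refine Submodule.sum_mem _ fun g _ => smul_mem _ _ ?_
      refine ⟨1 ⊗ₜ ⟨MonoidAlgebra.of ℤ G g • x j, ?_⟩, rfl⟩
      refine (range β).smul_mem _ ⟨Pi.single j 1, ?_⟩
      rw [hβ, sum_eq_single j]
      · simp
      · intro b _ hb
        rw [Pi.single_eq_of_ne hb, zero_smul]
      · simp
    have hq : (1 : ℤ_[p]) ⊗ₜ[ℤ] R.mkQ y = 0 := by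
      obtain ⟨t, ht⟩ := hy
      have h5 : (R.mkQ.baseChange ℤ_[p]) ((1 : ℤ_[p]) ⊗ₜ[ℤ] y) = 0 := by
        rw [← ht, ← LinearMap.comp_apply, ← LinearMap.baseChange_comp]
        rw [show R.mkQ.comp R.subtype = 0 from LinearMap.ext fun z => (Submodule.Quotient.mk_eq_zero R).2 z.2]
        simp
      exact h5
    obtain ⟨m, hm, h0⟩ := exists_zsmul_eq_zero_of_tmul_eq_zero p _ hq
    refine ⟨m, hm, ?_⟩
    rw [← map_zsmul] at h0
    exact (Submodule.Quotient.mk_eq_zero R).1 h0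
  obtain ⟨s, hs⟩ := (fg_top : (⊤ : Submodule ℤ[G] M).FG)
  choose m hm hmem using hann
  have hp : Prime ((p : ℕ) : ℤ) := Nat.prime_iff_prime_int.1 p.2
  let m₀ : ℤ := ∏ y ∈ s, m y
  have hm₀ : ¬ ((p : ℕ) : ℤ) ∣ m₀ := fun h => by
    obtain ⟨y, -, hy⟩ := (Prime.dvd_finsetProd_iff hp _).1 h
    exact hm y hy
  have hall : ∀ y : M, m₀ • y ∈ range β := by
    intro y
    have hy : y ∈ span ℤ[G] (s : Set M) := hs ▸ mem_top
    induction hy using Submodule.span_induction with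
    | mem z hz =>
      obtain ⟨c, hc⟩ := Finset.dvd_prod_of_mem m hz
      rw [show m₀ = m z * c from hc, mul_comm, mul_smul]
      exact zsmul_mem (hmem z) c
    | zero => rw [smul_zero]; exact Submodule.zero_mem _
    | add a b _ _ ha hb => rw [smul_add]; exact Submodule.add_mem _ ha hb
    | smul c a _ ha => rw [smul_comm]; exact smul_mem _ _ ha
  let e := LinearEquiv.ofInjective β hinj
  refine ⟨m₀, e.symm.toLinearMap.comp
    ((DistribSMul.toLinearMap ℤ[G] M m₀).codRestrict (range β) hall), β,
    hm₀, fun y => ?_⟩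
  have := e.apply_symm_apply ⟨m₀ • y, hall y⟩
  exact congrArg val this

lemma projective_of_locallyFree [Module.Finite ℤ[G] M]
    (h : ∀ p : Primes, ∃ (r : ℕ) (a : Fin r → ℤ_[p] ⊗[ℤ] M),
      IsGroupBasis (G := G) (repOver ℤ_[p] M) a) : Module.Projective ℤ[G] M := by
  let I : Ideal ℤ :=
    { carrier := {m | ∃ (F : Type u) (_ : AddCommGroup F) (_ : Module ℤ[G] F)
        (_ : Module.Projective ℤ[G] F) (α : M →ₗ[ℤ[G]] F)
        (β : F →ₗ[ℤ[G]] M), ∀ x, β (α x) = m • x}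
      add_mem' := by
        rintro m m' ⟨F, i1, i2, i3, α, β, h⟩ ⟨F', i1', i2', i3', α', β', h'⟩
        refine ⟨F × F', inferInstance, inferInstance, inferInstance, α.prod α', β.coprod β',
          fun x => ?_⟩
        rw [add_smul, ← h, ← h']
        simp
      zero_mem' := ⟨ℤ[G], inferInstance, inferInstance, inferInstance, 0, 0,
        fun x => by simp⟩
      smul_mem' := by
        rintro c m ⟨F, i1, i2, i3, α, β, h⟩
        refine ⟨F, i1, i2, i3, α, c • β, fun x => ?_⟩
        rw [smul_eq_mul, mul_smul, ← h]
        rfl }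
  have hI : I = ⊤ := by
    by_contra hne
    obtain ⟨J, hJ, hle⟩ := Ideal.exists_le_maximal I hne
    obtain ⟨n, hn⟩ := (IsPrincipalIdealRing.principal J).principal
    have hn0 : n ≠ 0 := by
      rintro rfl
      have h2 := hJ.ne_top
      rw [hn, Submodule.span_zero_singleton] at hJ
      exact Ring.not_isField_iff_exists_prime.1 Int.not_isField |>.elim fun P hP =>
        hP.1 (hJ.eq_of_le hP.2.ne_top bot_le).symm
    have hpr : Prime n := by
      have := hJ.isPrime
      rw [hn] at this
      exact (Ideal.span_singleton_prime hn0).1 this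
    let p : Primes := ⟨n.natAbs, Int.prime_iff_natAbs_prime.1 hpr⟩
    obtain ⟨r, a, ha⟩ := h p
    obtain ⟨m, α, β, hm, hαβ⟩ := exists_factorization p ha
    have : m ∈ J := hle ⟨_, inferInstance, inferInstance, inferInstance, α, β, hαβ⟩
    rw [hn] at this
    exact hm (Int.natAbs_dvd.2 (Ideal.mem_span_singleton.1 this))
  obtain ⟨F, i1, i2, i3, α, β, h1⟩ : (1 : ℤ) ∈ I := hI ▸ mem_top
  exact of_split α β (LinearMap.ext fun x => (h1 x).trans (one_smul ℤ x))

end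

section

lemma IsPerfect.exists_homotopy (hA : IsPerfect A) (hac : A.Acyclic) : Nonempty (Homotopy (𝟙 A) 0) := by
  obtain ⟨N, hN⟩ := hA.bounded
  have hle : A.IsStrictlyLE N := by
    rw [CochainComplex.isStrictlyLE_iff]
    intro i hi
    have := hN i (lt_of_lt_of_le hi (le_abs_self i))
    exact ModuleCat.isZero_of_subsingleton _
  have hproj : ∀ n, Projective (A.X n) := fun n => by
    have := hA.finite n
    have := projective_of_locallyFree (G := G) (M := A.X n) (hA.locallyFree n)
    infer_instance
  have := CochainComplex.isKProjective_of_projective A N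
  exact ⟨CochainComplex.IsKProjective.homotopyZero (𝟙 A) hac⟩

lemma IsPerfect.exists_contraction (hA : IsPerfect A) (hac : A.Acyclic) :
    ∃ s : ∀ i j, A.X i →ₗ[ℤ[G]] A.X j,
      (∀ i j k, j + 1 = i → k + 1 = j → ∀ x, s j k (s i j x) = 0) ∧
      ∀ i j k, i + 1 = j → k + 1 = i → ∀ x, s j i ((A.d i j).hom x) + (A.d k i).hom (s i k x) = x := by
  obtain ⟨h⟩ := hA.exists_homotopy hac
  have hd : ∀ i j k (x : A.X i), (A.d j k).hom ((A.d i j).hom x) = 0 := fun i j k x => by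
    have := congrArg (fun f => ModuleCat.Hom.hom f x) (A.d_comp_d i j k)
    exact this
  have h1 : ∀ i j k, i + 1 = j → k + 1 = i → ∀ x : A.X i,
      (h.hom j i).hom ((A.d i j).hom x) + (A.d k i).hom ((h.hom i k).hom x) = x := by
    intro i j k hij hki x
    have h2 := h.comm i
    rw [dNext_eq h.hom (show (ComplexShape.up ℤ).Rel i j from hij),
      prevD_eq h.hom (show (ComplexShape.up ℤ).Rel k i from hki)] at h2
    have h3 := congrArg (fun f => ModuleCat.Hom.hom f x) h2
    have h4 : x = (h.hom j i).hom ((A.d i j).hom x) + (A.d k i).hom ((h.hom i k).hom x) + 0 := h3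
    rw [add_zero] at h4
    exact h4.symm
  have h2 : ∀ i k, k + 1 = i → ∀ y : A.X k,
      (A.d k i).hom ((h.hom i k).hom ((A.d k i).hom y)) = (A.d k i).hom y := by
    intro i k hki y
    have := h1 i (i + 1) k rfl hki ((A.d k i).hom y)
    rwa [hd, map_zero, zero_add] at this
  refine ⟨fun i j => (h.hom i j).hom.comp ((A.d j i).hom.comp (h.hom i j).hom), ?_, ?_⟩
  · intro i j k hij hjk x
    have h3 := h1 j i k hij hjk ((A.d j i).hom.comp (h.hom i j).hom |> fun f => (h.hom i j).hom (f x))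
    change (h.hom j k).hom ((A.d k j).hom ((h.hom j k).hom
      ((h.hom i j).hom ((A.d j i).hom ((h.hom i j).hom x))))) = 0
    change (h.hom i j).hom ((A.d j i).hom ((h.hom i j).hom ((A.d j i).hom ((h.hom i j).hom x)))) +
      (A.d k j).hom ((h.hom j k).hom ((h.hom i j).hom ((A.d j i).hom ((h.hom i j).hom x)))) =
      (h.hom i j).hom ((A.d j i).hom ((h.hom i j).hom x)) at h3
    rw [h2 i j hij, add_eq_left] at h3
    rw [h3, map_zero]
  · intro i j k hij hki x
    change (h.hom j i).hom ((A.d i j).hom ((h.hom j i).hom ((A.d i j).hom x))) +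
      (A.d k i).hom ((h.hom i k).hom ((A.d k i).hom ((h.hom i k).hom x))) = x
    rw [h2 j i hij, h2 i k hki]
    exact h1 i j k hij hki x

end

section RepIso

variable {V V' V'' U U' : Type v} [AddCommGroup V] [Module ℚ V]
  [AddCommGroup V'] [Module ℚ V'] [AddCommGroup V''] [Module ℚ V''] [AddCommGroup U] [Module ℚ U]
  [AddCommGroup U'] [Module ℚ U'] {τ : Representation ℚ G V} {τ' : Representation ℚ G V'}
  {τ'' : Representation ℚ G V''} {μ : Representation ℚ G U} {μ' : Representation ℚ G U'}

/-- Two rational representations are isomorphic. -/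
def RepIso (τ : Representation ℚ G V) (τ' : Representation ℚ G V') : Prop :=
  ∃ e : V ≃ₗ[ℚ] V', ∀ g x, e (τ g x) = τ' g (e x)

namespace RepIso

lemma refl (τ : Representation ℚ G V) : RepIso τ τ := ⟨LinearEquiv.refl ℚ V, fun _ _ => rfl⟩

lemma symm (h : RepIso τ τ') : RepIso τ' τ := by
  obtain ⟨e, he⟩ := h
  refine ⟨e.symm, fun g x => e.injective ?_⟩
  rw [he, e.apply_symm_apply, e.apply_symm_apply]

lemma trans (h : RepIso τ τ') (h' : RepIso τ' τ'') : RepIso τ τ'' := by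
  obtain ⟨e, he⟩ := h
  obtain ⟨f, hf⟩ := h'
  exact ⟨e.trans f, fun g x => (congrArg f (he g x)).trans (hf g (e x))⟩

lemma prod (h : RepIso τ τ') (h' : RepIso μ μ') : RepIso (τ.prod μ) (τ'.prod μ') := by
  obtain ⟨e, he⟩ := h
  obtain ⟨f, hf⟩ := h'
  exact ⟨e.prodCongr f, fun g x => Prod.ext (he g x.1) (hf g x.2)⟩

lemma prodComm (τ : Representation ℚ G V) (τ' : Representation ℚ G V') :
    RepIso (τ.prod τ') (τ'.prod τ) :=
  ⟨LinearEquiv.prodComm ℚ V V', fun _ _ => rfl⟩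

lemma prodAssoc (τ : Representation ℚ G V) (τ' : Representation ℚ G V')
    (τ'' : Representation ℚ G V'') : RepIso ((τ.prod τ').prod τ'') (τ.prod (τ'.prod τ'')) :=
  ⟨LinearEquiv.prodAssoc ℚ V V' V'', fun _ _ => rfl⟩

lemma of_subsingleton [Subsingleton V] [Subsingleton V'] : RepIso τ τ' :=
  ⟨⟨0, fun _ => 0, fun _ => Subsingleton.elim _ _, fun _ => Subsingleton.elim _ _⟩,
    fun _ _ => Subsingleton.elim _ _⟩

lemma of_groupBasis {ι ι' : Type*} {a : ι → V} {a' : ι' → V'} (e : ι ≃ ι') (h : IsGroupBasis τ a)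
    (h' : IsGroupBasis τ' a') : RepIso τ τ' := by
  refine ⟨h.basis.equiv h'.basis ((Equiv.refl G).prodCongr e), fun g x => ?_⟩
  have : (h.basis.equiv h'.basis ((Equiv.refl G).prodCongr e)).toLinearMap.comp (τ g) =
      (τ' g).comp (h.basis.equiv h'.basis ((Equiv.refl G).prodCongr e)).toLinearMap := by
    refine h.basis.ext fun x => ?_
    have h1 : τ g (h.basis x) = h.basis (g * x.1, x.2) := by
      rw [h.basis_apply, h.basis_apply, map_mul]
      rfl
    have h2 : τ' g (h'.basis (x.1, e x.2)) = h'.basis (g * x.1, e x.2) := by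
      rw [h'.basis_apply, h'.basis_apply, map_mul]
      rfl
    rw [LinearMap.comp_apply, LinearMap.comp_apply, h1]
    simp only [LinearEquiv.coe_coe, Basis.equiv_apply, Equiv.prodCongr_apply, Prod.map,
      Equiv.refl_apply]
    exact h2.symm
  exact congrArg (fun f => f x) this

lemma of_pairing [Module.Finite ℚ V] [Module.Finite ℚ V'] {s : V →ₗ[ℚ] V' →ₗ[ℚ] ℚ}
    (hi : ∀ g x y, s (τ g x) (τ' g y) = s x y) (hn : s.Nondegenerate) : RepIso τ τ' := by
  obtain ⟨β, -, hβi, hβ⟩ := exists_definite_form τ'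
  have hβn : β.Nondegenerate := ⟨fun x hx => hβ x (hx x), fun x hx => hβ x (hx x)⟩
  have h1 : Function.Injective s := (injective_iff_map_eq_zero s).2 fun x hx =>
    hn.1 x fun y => by rw [hx]; rfl
  have h2 : Function.Injective s.flip := (injective_iff_map_eq_zero s.flip).2 fun x hx =>
    hn.2 x fun y => by
      have := congrArg (fun f => f y) hx
      exact this
  have h3 : finrank ℚ V = finrank ℚ (Module.Dual ℚ V') := by
    have h4 := LinearMap.finrank_le_finrank_of_injective h1
    have h5 := LinearMap.finrank_le_finrank_of_injective h2
    rw [Subspace.dual_finrank_eq] at h5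
    rw [Subspace.dual_finrank_eq] at h4 ⊢
    omega
  let e := (LinearEquiv.ofInjectiveOfFinrankEq s h1 h3).trans (β.toDual hβn).symm
  have he : ∀ x y, β (e x) y = s x y := fun x y => LinearMap.BilinForm.apply_toDual_symm_apply (hB := hβn) _ _
  refine ⟨e, fun g x => ?_⟩
  rw [← sub_eq_zero]
  refine hβn.1 _ fun y => ?_
  rw [map_sub, LinearMap.sub_apply, he]
  obtain ⟨z, rfl⟩ : ∃ z, τ' g z = y := ⟨τ' g⁻¹ y, by
    rw [← Module.End.mul_apply, ← map_mul, mul_inv_cancel, map_one]; rfl⟩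
  rw [hi, hβi, he, sub_self]

lemma exists_pairing [Module.Finite ℚ V] [Module.Finite ℚ V'] (h : RepIso τ τ') :
    ∃ s : V →ₗ[ℚ] V' →ₗ[ℚ] ℚ, (∀ g x y, s (τ g x) (τ' g y) = s x y) ∧ s.Nondegenerate := by
  obtain ⟨e, he⟩ := h
  obtain ⟨β, hβs, hβi, hβ⟩ := exists_definite_form τ'
  refine ⟨LinearMap.comp β e.toLinearMap, fun g x y => ?_, fun x hx => ?_, fun y hy => hβ y ?_⟩
  · rw [LinearMap.comp_apply, LinearMap.comp_apply, LinearEquiv.coe_coe, he, hβi]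
  · exact e.map_eq_zero_iff.1 (hβ _ (hx (e x)))
  · have := hy (e.symm y)
    rwa [LinearMap.comp_apply, LinearEquiv.coe_coe, e.apply_symm_apply] at this

lemma of_exact [Module.Finite ℚ V] {k : V'' →ₗ[ℚ] V} {f : V →ₗ[ℚ] V'}
    (hk : ∀ g x, k (τ'' g x) = τ g (k x)) (hf : ∀ g x, f (τ g x) = τ' g (f x))
    (hki : Function.Injective k) (hfs : Surjective f) (he : Function.Exact k f) :
    RepIso τ (τ''.prod τ') := by
  obtain ⟨s, hs⟩ := f.exists_rightInverse_of_surjective (LinearMap.range_eq_top.2 hfs)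
  have hs' : ∀ y, f (s y) = y := fun y => congrArg (fun f => f y) hs
  let s' : V' →ₗ[ℚ] V := (card G : ℚ)⁻¹ • ∑ g : G, (τ g).comp (s.comp (τ' g⁻¹))
  have hs1 : ∀ y, s' y = (card G : ℚ)⁻¹ • ∑ g : G, τ g (s (τ' g⁻¹ y)) := fun y => by
    simp [s']
  have hs2 : ∀ g y, s' (τ' g y) = τ g (s' y) := by
    intro g y
    rw [hs1, hs1, map_smul, map_sum]
    congr 1
    refine sum_equiv (mulLeft g⁻¹) _ _ fun h => ?_
    rw [coe_mulLeft, ← Module.End.mul_apply (τ g), ← map_mul, mul_inv_cancel_left, _root_.mul_inv_rev,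
      inv_inv, map_mul]
    rfl
  have hs3 : ∀ y, f (s' y) = y := by
    intro y
    rw [hs1, map_smul, map_sum]
    have : ∀ g : G, f (τ g (s (τ' g⁻¹ y))) = y := fun g => by
      rw [hf, hs', ← Module.End.mul_apply, ← map_mul, mul_inv_cancel, map_one]
      rfl
    rw [sum_congr rfl fun g _ => this g, Finset.sum_const, card_univ,
      ← Nat.cast_smul_eq_nsmul ℚ, smul_smul, inv_mul_cancel₀ (cast_ne_zero.2 card_ne_zero),
      one_smul]
  let e : V'' × V' →ₗ[ℚ] V := k.coprod s'
  have hinj : Function.Injective e := by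
    rw [injective_iff_map_eq_zero]
    rintro ⟨a, b⟩ hab
    have hab' : k a + s' b = 0 := by simpa [e] using hab
    have h1 := congrArg f hab'
    rw [map_add, he.apply_apply_eq_zero, hs3, zero_add, map_zero] at h1
    rw [h1, map_zero, add_zero] at hab'
    rw [h1, (injective_iff_map_eq_zero k).1 hki a hab']
    rfl
  have hsurj : Surjective e := by
    intro x
    obtain ⟨a, ha⟩ := (he (x - s' (f x))).1 (by rw [map_sub, hs3, sub_self])
    exact ⟨(a, f x), by simp [e, ha]⟩
  refine RepIso.symm ⟨ofBijective e ⟨hinj, hsurj⟩, fun g x => ?_⟩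
  change k (τ'' g x.1) + s' (τ' g x.2) = τ g (k x.1 + s' x.2)
  rw [hk, hs2, map_add]

end RepIso

/-- Two rational representations become isomorphic after the addition of free ones. -/
def StablyIso (τ : Representation ℚ G V) (τ' : Representation ℚ G V') : Prop :=
  ∃ (a b : ℕ) (F F' : Type v) (_ : AddCommGroup F) (_ : Module ℚ F) (_ : AddCommGroup F')
    (_ : Module ℚ F') (φ : Representation ℚ G F) (φ' : Representation ℚ G F') (x : Fin a → F)
    (x' : Fin b → F'), IsGroupBasis φ x ∧ IsGroupBasis φ' x' ∧ RepIso (τ.prod φ) (τ'.prod φ')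

lemma StablyIso.of_complements {X X' Y Y' : Type v} [AddCommGroup X] [Module ℚ X]
    [AddCommGroup X'] [Module ℚ X'] [AddCommGroup Y] [Module ℚ Y] [AddCommGroup Y'] [Module ℚ Y']
    {ξ : Representation ℚ G X} {ξ' : Representation ℚ G X'} {η : Representation ℚ G Y}
    {η' : Representation ℚ G Y'} {r r' : ℕ} {y : Fin r → Y} {y' : Fin r' → Y'}
    (hy : IsGroupBasis η y) (hy' : IsGroupBasis η' y') (h : RepIso η (τ.prod ξ))
    (h' : RepIso η' (τ'.prod ξ')) (hX : StablyIso ξ ξ') : StablyIso τ τ' := by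
  obtain ⟨a, b, F, F', i1, i2, i3, i4, φ, φ', x, x', hx, hx', hiso⟩ := hX
  refine ⟨r' + b, r + a, Y' × F', Y × F, inferInstance, inferInstance, inferInstance, inferInstance,
    η'.prod φ', η.prod φ, _, _, (hy'.prod hx').reindex finSumFinEquiv.symm,
    (hy.prod hx).reindex finSumFinEquiv.symm, ?_⟩
  have h1 : RepIso (η'.prod φ') (τ'.prod (ξ.prod φ)) :=
    ((h'.prod (RepIso.refl φ')).trans (RepIso.prodAssoc _ _ _)).trans
      ((RepIso.refl τ').prod hiso.symm)
  have h2 : RepIso (η.prod φ) (τ.prod (ξ.prod φ)) :=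
    (h.prod (RepIso.refl φ)).trans (RepIso.prodAssoc _ _ _)
  refine ((RepIso.refl τ).prod h1).trans (RepIso.symm ?_)
  refine ((RepIso.refl τ').prod h2).trans ?_
  refine (RepIso.prodAssoc _ _ _).symm.trans (RepIso.trans ?_ (RepIso.prodAssoc _ _ _))
  exact (RepIso.prodComm _ _).prod (RepIso.refl _)

lemma StablyIso.prod_left (h : RepIso μ μ') (h' : StablyIso τ τ') :
    StablyIso (μ.prod τ) (μ'.prod τ') := by
  obtain ⟨a, b, F, F', i1, i2, i3, i4, φ, φ', x, x', hx, hx', hiso⟩ := h'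
  exact ⟨a, b, F, F', i1, i2, i3, i4, φ, φ', x, x', hx, hx',
    (RepIso.prodAssoc _ _ _).trans ((h.prod hiso).trans (RepIso.prodAssoc _ _ _).symm)⟩

lemma StablyIso.of_subsingleton [Subsingleton V] [Subsingleton V'] : StablyIso τ τ' := by
  have hb : IsGroupBasis (1 : Representation ℚ G PUnit.{v + 1}) (fun x : Fin 0 => x.elim0) :=
    ⟨linearIndependent_empty_type, Subsingleton.elim _ _⟩
  exact ⟨0, 0, PUnit, PUnit, inferInstance, inferInstance, inferInstance, inferInstance, 1, 1, _, _,
    hb, hb, RepIso.of_subsingleton⟩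

lemma StablyIso.repIso_prod (h : StablyIso τ τ') : ∃ a b : ℕ, ∀ {F F' : Type v}
    [AddCommGroup F] [Module ℚ F] [AddCommGroup F'] [Module ℚ F'] (φ : Representation ℚ G F)
    (φ' : Representation ℚ G F') (x : Fin a → F) (x' : Fin b → F'), IsGroupBasis φ x →
    IsGroupBasis φ' x' → RepIso (τ.prod φ) (τ'.prod φ') := by
  obtain ⟨a, b, F, F', i1, i2, i3, i4, φ, φ', x, x', hx, hx', hiso⟩ := h
  refine ⟨a, b, fun ψ ψ' y y' hy hy' => ?_⟩
  exact ((RepIso.refl τ).prod (RepIso.of_groupBasis (Equiv.refl _) hy hx)).trans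
    (hiso.trans ((RepIso.refl τ').prod (RepIso.of_groupBasis (Equiv.refl _) hx' hy')))

end RepIso

section

variable {V : Type v} [AddCommGroup V] [Module ℚ V]

lemma exists_equivariant_projection (τ : Representation ℚ G V) (S : Submodule ℚ V)
    (hS : ∀ g, ∀ x ∈ S, τ g x ∈ S) :
    ∃ f : V →ₗ[ℚ] S, (∀ x : S, f x = x) ∧ ∀ g x, (f (τ g x) : V) = τ g (f x) := by
  obtain ⟨s, hs⟩ := S.subtype.exists_leftInverse_of_injective S.ker_subtype
  have hs' : ∀ x : S, s x = x := fun x => congrArg (fun f => f x) hs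
  let s' : V →ₗ[ℚ] V :=
    (card G : ℚ)⁻¹ • ∑ g : G, (τ g).comp (S.subtype.comp (s.comp (τ g⁻¹)))
  have hs1 : ∀ y, s' y = (card G : ℚ)⁻¹ • ∑ g : G, τ g (s (τ g⁻¹ y)) := fun y => by
    simp [s']
  refine ⟨s'.codRestrict S fun x => ?_, fun x => Subtype.ext ?_, fun g x => ?_⟩
  · rw [hs1]
    exact S.smul_mem _ (sum_mem fun g _ => hS g _ (s _).2)
  · rw [LinearMap.codRestrict_apply, hs1]
    have : ∀ g : G, τ g (s (τ g⁻¹ x)) = (x : V) := fun g => by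
      rw [hs' ⟨τ g⁻¹ x, hS _ _ x.2⟩, ← Module.End.mul_apply, ← map_mul, mul_inv_cancel, map_one]
      rfl
    rw [sum_congr rfl fun g _ => this g, Finset.sum_const, card_univ,
      ← Nat.cast_smul_eq_nsmul ℚ, smul_smul, inv_mul_cancel₀ (cast_ne_zero.2 card_ne_zero),
      one_smul]
  · rw [LinearMap.codRestrict_apply, LinearMap.codRestrict_apply, hs1, hs1, map_smul, map_sum]
    congr 1
    refine sum_equiv (mulLeft g⁻¹) _ _ fun h => ?_
    rw [coe_mulLeft, ← Module.End.mul_apply (τ g), ← map_mul, mul_inv_cancel_left, _root_.mul_inv_rev,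
      inv_inv, map_mul]
    rfl

end

section

lemma dQ_mem_Bc {k i : ℤ} (h : k + 1 = i) (x : QT Q k) : dQ Q k i x ∈ Bc Q i := by
  obtain rfl : k = i - 1 := by omega
  exact ⟨x, rfl⟩

lemma exists_of_mem_Bc {k i : ℤ} (h : k + 1 = i) {x : QT Q i} (hx : x ∈ Bc Q i) :
    ∃ y, dQ Q k i y = x := by
  obtain rfl : k = i - 1 := by omega
  exact hx

lemma mem_Zc_iff {i j : ℤ} (h : i + 1 = j) (x : QT Q i) : x ∈ Zc Q i ↔ dQ Q i j x = 0 := by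
  subst h
  exact mem_ker

lemma Bc_le_Zc (i : ℤ) : Bc Q i ≤ Zc Q i := by
  rintro _ ⟨x, rfl⟩
  exact dQ_dQ _ _ _ x

lemma repQ_mem_Bc (i : ℤ) (g : G) (x : QT Q i) (hx : x ∈ Bc Q i) : repQ Q i g x ∈ Bc Q i := by
  obtain ⟨y, rfl⟩ := hx
  exact ⟨repQ Q (i - 1) g y, extQ_rep _ g y⟩

lemma repQ_mem_Zc (i : ℤ) (g : G) (x : QT Q i) (hx : x ∈ Zc Q i) : repQ Q i g x ∈ Zc Q i :=
  (repZ Q i g ⟨x, hx⟩).2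

lemma classH_eq_zero_iff {i : ℤ} (z : Zc Q i) : classH Q i z = 0 ↔ (z : QT Q i) ∈ Bc Q i :=
  (Submodule.Quotient.mk_eq_zero _).trans Submodule.mem_comap

lemma classH_surjective (i : ℤ) : Surjective (classH Q i) :=
  Submodule.mkQ_surjective _

variable (Q) in
/-- The action of `G` on boundaries. -/
abbrev repB (i : ℤ) : Representation ℚ G (Bc Q i) :=
  (repQ Q i).subrepresentation (Bc Q i) fun g x hx => repQ_mem_Bc i g x hx

variable (Q) in
/-- The differential with values in the boundaries. -/
def toB (i : ℤ) : QT Q i →ₗ[ℚ] Bc Q (i + 1) :=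
  (dQ Q i (i + 1)).codRestrict _ fun x => dQ_mem_Bc rfl x

lemma toB_surjective (i : ℤ) : Surjective (toB Q i) := fun x => by
  obtain ⟨y, hy⟩ := exists_of_mem_Bc rfl x.2
  exact ⟨y, Subtype.ext hy⟩

lemma toB_eq_zero {i : ℤ} {x : QT Q i} : toB Q i x = 0 ↔ x ∈ Zc Q i :=
  Subtype.ext_iff.trans LinearMap.mem_ker.symm

lemma toB_rep (i : ℤ) (g : G) (x : QT Q i) : toB Q i (repQ Q i g x) = repB Q (i + 1) g (toB Q i x) :=
  Subtype.ext (extQ_rep _ g x)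

set_option maxHeartbeats 1000000 in
lemma nonempty_pairingLift {τ : GradedPairing Q} (hτ : IsSymmetricPairing τ)
    (q : ∀ i k : ℤ, i + k = 1 → Bc Q i →ₗ[ℚ] Bc Q k →ₗ[ℚ] ℚ)
    (hqs : ∀ i k h h' x y, q i k h x y = q k i h' y x)
    (hqi : ∀ i k h g x y, q i k h (repB Q i g x) (repB Q k g y) = q i k h x y)
    (hqn : ∀ i k h x, (∀ y, q i k h x y = 0) → x = 0) : Nonempty (PairingLift τ) := by
  choose πB hπB hπBg using fun i : ℤ => exists_equivariant_projection (repQ Q i) (Bc Q i)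
    (repQ_mem_Bc i)
  choose πZ hπZ hπZg using fun i : ℤ => exists_equivariant_projection (repQ Q i) (Zc Q i)
    (repQ_mem_Zc i)
  have hZ : ∀ i, ∀ x (hx : x ∈ Zc Q i), πZ i x = ⟨x, hx⟩ := fun i x hx => hπZ i ⟨x, hx⟩
  have hB : ∀ i, ∀ x (hx : x ∈ Bc Q i), πB i x = ⟨x, hx⟩ := fun i x hx => hπB i ⟨x, hx⟩
  let hm : ∀ i, QT Q i →ₗ[ℚ] H Q i := fun i => (classH Q i).comp (πZ i)
  let bm : ∀ i, QT Q i →ₗ[ℚ] Bc Q i := fun i => (πB i).comp ((Zc Q i).subtype.comp (πZ i))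
  have hmZ : ∀ i (z : Zc Q i), hm i z = classH Q i z := fun i z => congrArg (classH Q i) (hπZ i z)
  have bmZ : ∀ i (z : Zc Q i), bm i z = πB i z := fun i z =>
    congrArg (fun z : Zc Q i => πB i z) (hπZ i z)
  have hmg : ∀ i g x, hm i (repQ Q i g x) = repH Q i g (hm i x) := by
    intro i g x
    have : πZ i (repQ Q i g x) = repZ Q i g (πZ i x) := Subtype.ext (hπZg i g x)
    exact congrArg (classH Q i) this
  have bmg : ∀ i g x, bm i (repQ Q i g x) = repB Q i g (bm i x) := by
    intro i g x
    refine Subtype.ext ?_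
    change ((πB i (πZ i (repQ Q i g x) : QT Q i) : Bc Q i) : QT Q i) = _
    rw [hπZg, hπBg]
    rfl
  have hmB : ∀ i, ∀ x ∈ Bc Q i, hm i x = 0 := fun i x hx =>
    (hmZ i ⟨x, Bc_le_Zc i hx⟩).trans ((classH_eq_zero_iff _).2 hx)
  have bmB : ∀ i, ∀ x (hx : x ∈ Bc Q i), bm i x = ⟨x, hx⟩ := fun i x hx =>
    (bmZ i ⟨x, Bc_le_Zc i hx⟩).trans (hB i x hx)
  have dmB : ∀ i, ∀ x ∈ Bc Q i, toB Q i x = 0 := fun i x hx => toB_eq_zero.2 (Bc_le_Zc i hx)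
  have hmU : ∀ i, ∀ x ∈ ker (πZ i), hm i x = 0 := fun i x hx => by
    change classH Q i (πZ i x) = 0
    rw [mem_ker.1 hx, map_zero]
  have bmU : ∀ i, ∀ x ∈ ker (πZ i), bm i x = 0 := fun i x hx => by
    change πB i (πZ i x : QT Q i) = 0
    rw [mem_ker.1 hx, ZeroMemClass.coe_zero, map_zero]
  have bmH : ∀ i, ∀ x ∈ Zc Q i ⊓ ker (πB i), bm i x = 0 := fun i x hx =>
    (bmZ i ⟨x, hx.1⟩).trans hx.2
  have dmH : ∀ i, ∀ x ∈ Zc Q i ⊓ ker (πB i), toB Q i x = 0 := fun i x hx =>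
    toB_eq_zero.2 hx.1
  have hsub : ∀ i, ∀ x ∈ Zc Q i, x - πB i x ∈ Zc Q i ⊓ ker (πB i) := fun i x hx =>
    ⟨sub_mem hx (Bc_le_Zc i (πB i x).2), by
      change πB i (x - πB i x) = 0
      rw [map_sub, hπB, sub_self]⟩
  let p : ∀ i j : ℤ, i + j = 0 → QT Q i →ₗ[ℚ] QT Q j →ₗ[ℚ] ℚ := fun i j h =>
    (τ i j h).compl₁₂ (hm i) (hm j) +
      ((q i (j + 1) (by omega)).compl₁₂ (bm i) (toB Q j) +
        (q (i + 1) j (by omega)).compl₁₂ (toB Q i) (bm j))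
  have hp : ∀ i j h x y, p i j h x y = τ i j h (hm i x) (hm j y) +
      (q i (j + 1) (by omega) (bm i x) (toB Q j y) + q (i + 1) j (by omega) (toB Q i x) (bm j y)) :=
    fun i j h x y => rfl
  have hps : ∀ (i j : ℤ) (h : i + j = 0) (h' : j + i = 0) (x : QT Q i) (y : QT Q j),
      p i j h x y = p j i h' y x := by
    intro i j h h' x y
    rw [hp, hp, hτ.symm i j h h', hqs i (j + 1) _ (by omega), hqs (i + 1) j _ (by omega),
      add_comm (q (j + 1) i _ _ _)]
  have hpn : ∀ i j h x, (∀ y, p i j h x y = 0) → x = 0 := by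
    intro i j h x hx
    have h1 : hm i x = 0 := by
      refine (hτ.nondeg i j h).1 _ fun c => ?_
      obtain ⟨z, rfl⟩ := classH_surjective j c
      have hz := hsub j z z.2
      have h2 := hx (z - πB j z)
      rw [hp, bmH j _ hz, dmH j _ hz, map_sub, hmB j _ (πB j z).2, hmZ] at h2
      simpa using h2
    have h2 : toB Q i x = 0 := by
      refine hqn (i + 1) j (by omega) _ fun y => ?_
      have h2 := hx y
      rw [hp, hmB j _ y.2, dmB j _ y.2, bmB j _ y.2] at h2
      simpa using h2
    have h3 : bm i x = 0 := by
      refine hqn i (j + 1) (by omega) _ fun y => ?_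
      obtain ⟨z, rfl⟩ := toB_surjective j y
      have h3 := hx z
      rw [hp, h1, h2] at h3
      simpa using h3
    have h4 := toB_eq_zero.1 h2
    have h5 : x ∈ Bc Q i := (classH_eq_zero_iff ⟨x, h4⟩).1 ((hmZ i ⟨x, h4⟩).symm.trans h1)
    exact congrArg val ((bmB i x h5).symm.trans h3)
  have hadj : ∀ (k i j : ℤ) (hk : k + 1 = i) (h : i + j = 0) (h' : k + (j + 1) = 0),
      ∀ u ∈ ker (πZ k), ∀ u' ∈ ker (πZ j),
      p k (j + 1) h' u (dQ Q j (j + 1) u') = p i j h (dQ Q k i u) u' := by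
    intro k i j hk h h' u hu u' hu'
    subst hk
    rw [hp, hp, hmU k u hu, bmU k u hu, hmU j u' hu', bmU j u' hu', bmB _ _ (dQ_mem_Bc rfl u'),
      bmB _ _ (dQ_mem_Bc rfl u)]
    simp only [map_zero, LinearMap.zero_apply, zero_add, add_zero]
    rfl
  exact ⟨{
    Hc := fun i => Zc Q i ⊓ ker (πB i)
    U := fun i => ker (πZ i)
    Hc_stable := fun i g x hx => ⟨repQ_mem_Zc i g x hx.1, by
      refine mem_ker.2 (Subtype.ext ?_)
      rw [hπBg, mem_ker.1 hx.2]
      exact map_zero _⟩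
    U_stable := fun i g x hx => by
      refine mem_ker.2 (Subtype.ext ?_)
      rw [hπZg, mem_ker.1 hx]
      exact map_zero _
    Hc_le := fun i => inf_le_left
    disjoint_B_Hc := fun i => Submodule.disjoint_def.2 fun x hx hx' =>
      congrArg val ((hB i x hx).symm.trans hx'.2)
    isCompl_U := fun i => by
      have : Bc Q i ⊔ (Zc Q i ⊓ ker (πB i)) = Zc Q i := by
        refine le_antisymm (sup_le (Bc_le_Zc i) inf_le_left) fun x hx => ?_
        rw [← add_sub_cancel (πB i x : QT Q i) x]
        exact Submodule.add_mem_sup (πB i x).2 (hsub i x hx)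
      rw [this]
      exact LinearMap.isCompl_of_proj (hπZ i)
    disjoint_U := fun i => (LinearMap.isCompl_of_proj (hπZ i)).disjoint.symm
    map_U := fun i => by
      refine le_antisymm ?_ ?_
      · rintro _ ⟨x, -, rfl⟩
        exact ⟨x, rfl⟩
      · rintro _ ⟨x, rfl⟩
        refine ⟨x - πZ (i - 1) x, ?_, ?_⟩
        · change _ ∈ ker _
          rw [mem_ker, map_sub, hπZ, sub_self]
        · rw [map_sub, (mem_Zc_iff (by omega) _).1 (πZ (i - 1) x).2, sub_zero]
    p := p
    symm := hps
    inv := fun i j h g x y => by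
      rw [hp, hp, hmg, hmg, bmg, bmg, toB_rep, toB_rep, hτ.inv, hqi, hqi]
    nondeg := fun i j h => ⟨hpn i j h, fun y hy => hpn j i (by omega) y fun x => by
      rw [hps j i _ h]
      exact hy x⟩
    orth_B_B := fun i j h x hx y hy => by
      rw [hp, hmB i x hx, dmB i x hx, dmB j y hy]
      simp
    orth_B_H := fun i j h x hx y hy => by
      rw [hp, hmB i x hx, dmB i x hx, dmH j y hy]
      simp
    orth_U_H := fun i j h x hx y hy => by
      rw [hp, hmU i x hx, bmU i x hx, bmH j y hy]
      simp
    orth_U_U := fun i j h x hx y hy => by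
      rw [hp, hmU i x hx, bmU i x hx, bmU j y hy]
      simp
    lifts := fun i j h x y hx hy => by
      rw [hp, bmH i x hx, bmH j y hy, hmZ, hmZ]
      simp
    adjoint := fun i j h h' u hu u' hu' => hadj (i - 1) i j (by omega) h h' u hu u' hu' }⟩

lemma nonempty_pairingLift_of_repIso (hf : ∀ i, Module.Finite ℚ (QT Q i))
    {τ : GradedPairing Q} (hτ : IsSymmetricPairing τ)
    (hB : ∀ i k : ℤ, i + k = 1 → 1 ≤ i → RepIso (repB Q i) (repB Q k)) :
    Nonempty (PairingLift τ) := by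
  have hB' : ∀ i k : ℤ, i + k = 1 → 1 ≤ i → ∃ s : Bc Q i →ₗ[ℚ] Bc Q k →ₗ[ℚ] ℚ,
      (∀ g x y, s (repB Q i g x) (repB Q k g y) = s x y) ∧ s.Nondegenerate :=
    fun i k h h' => RepIso.exists_pairing (hB i k h h')
  choose s hs hn using hB'
  refine nonempty_pairingLift hτ (fun i k h => if h' : 1 ≤ i then s i k h h' else
    (s k i (by omega) (by omega)).flip) ?_ ?_ ?_
  · intro i k h h' x y
    by_cases hi : 1 ≤ i
    · rw [dif_pos hi, dif_neg (by omega)]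
      rfl
    · rw [dif_neg hi, dif_pos (by omega)]
      rfl
  · intro i k h g x y
    by_cases hi : 1 ≤ i
    · rw [dif_pos hi]
      exact hs _ _ _ _ g x y
    · rw [dif_neg hi]
      exact hs _ _ _ _ g y x
  · intro i k h x hx
    by_cases hi : 1 ≤ i
    · rw [dif_pos hi] at hx
      exact (hn _ _ _ _).1 x hx
    · rw [dif_neg hi] at hx
      exact (hn _ _ _ _).2 x hx

end

section

lemma repIso_repQ (hf : ∀ i, Module.Finite ℚ (QT Q i)) {i j : ℤ} (h : i + 1 = j) :
    RepIso (repQ Q i) ((repB Q i).prod ((repH Q i).prod (repB Q j))) := by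
  subst h
  have := hf i
  have h1 : RepIso (repQ Q i) ((repZ Q i).prod (repB Q (i + 1))) := by
    refine RepIso.of_exact (k := (Zc Q i).subtype) (f := toB Q i) (fun _ _ => rfl) (toB_rep i)
      (Zc Q i).subtype_injective (toB_surjective i) fun x => ?_
    rw [toB_eq_zero]
    exact ⟨fun hx => ⟨⟨x, hx⟩, rfl⟩, by rintro ⟨y, rfl⟩; exact y.2⟩
  have h2 : RepIso (repZ Q i) ((repB Q i).prod (repH Q i)) := by
    refine RepIso.of_exact (k := Submodule.inclusion (Bc_le_Zc i)) (f := classH Q i)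
      (fun _ _ => rfl) (fun _ _ => rfl) (Submodule.inclusion_injective _) (classH_surjective i)
      fun x => ?_
    rw [classH_eq_zero_iff]
    exact ⟨fun hx => ⟨⟨x, hx⟩, rfl⟩, by rintro ⟨y, rfl⟩; exact y.2⟩
  exact h1.trans ((h2.prod (RepIso.refl _)).trans (RepIso.prodAssoc _ _ _))

lemma stablyIso_repB (L : LocalBases Q) {N : ℤ} (hN : ∀ i, N < |i| → Subsingleton (Q.X i))
    {σ : GradedPairing Q} (hσ : IsSymmetricPairing σ) (i k : ℤ) (h : i + k = 1) (hi : 1 ≤ i) :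
    StablyIso (repB Q i) (repB Q k) := by
  have hf := L.finite_QT
  obtain ⟨n, hn⟩ : ∃ n : ℕ, N + 1 < i + n := ⟨(N + 2 - i).toNat, by omega⟩
  induction n generalizing i k with
  | zero =>
    have h1 : N < |i| := by rw [abs_of_nonneg (by omega)]; push_cast at hn; omega
    have h2 : N < |k| := by rw [abs_of_nonpos (by omega)]; push_cast at hn; omega
    have := hN i h1
    have := hN k h2
    have : Subsingleton (QT Q i) := subsingleton_tmul
    have : Subsingleton (QT Q k) := subsingleton_tmul
    exact StablyIso.of_subsingleton
  | succ n ih =>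
    obtain ⟨j, rfl⟩ : ∃ j, k = j + 1 := ⟨k - 1, by omega⟩
    have h1 := ih (i + 1) j (by omega) (by omega) (by push_cast at hn; omega)
    have h2 := repIso_repQ hf (Q := Q) (i := i) rfl
    have h3 := repIso_repQ hf (Q := Q) (i := j) rfl
    have h4 : RepIso (repQ Q j) ((repB Q (j + 1)).prod ((repH Q j).prod (repB Q j))) :=
      h3.trans ((RepIso.prodComm _ _).trans (((RepIso.prodComm _ _).prod (RepIso.refl _)).trans
        (RepIso.prodAssoc _ _ _)))
    refine StablyIso.of_complements (L.a0_basis i) (L.a0_basis j) h2 h4 (StablyIso.prod_left ?_ h1)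
    have : Module.Finite ℚ (H Q i) := Module.Finite.of_surjective (classH Q i) (classH_surjective i)
    have : Module.Finite ℚ (H Q j) := Module.Finite.of_surjective (classH Q j) (classH_surjective j)
    exact RepIso.of_pairing (hσ.inv i j (by omega)) (hσ.nondeg i j (by omega))

end

section

variable {M N : Type v} [AddCommGroup M]
  [Module ℤ[G] M] [AddCommGroup N] [Module ℤ[G] N]

lemma prodRight_rep (A : Type*) [CommRing A] (g : G) (x : A ⊗[ℤ] (M × N)) :
    TensorProduct.prodRight ℤ A A M N (repOver A (M × N) g x) =
      ((repOver A M).prod (repOver A N)) g (TensorProduct.prodRight ℤ A A M N x) := by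
  exact x.induction_on (by simp only [map_zero]) (fun q m => rfl)
    fun x y hx hy => by simp only [map_add, hx, hy]

lemma IsGroupBasis.tensor_prod {A : Type*} [CommRing A] {ι κ : Type*} [Fintype ι] [Fintype κ]
    {a : ι → A ⊗[ℤ] M} {b : κ → A ⊗[ℤ] N} (ha : IsGroupBasis (G := G) (repOver A M) a)
    (hb : IsGroupBasis (G := G) (repOver A N) b) :
    IsGroupBasis (G := G) (repOver A (M × N)) fun x =>
      (TensorProduct.prodRight ℤ A A M N).symm
        (Sum.elim (fun j => (a j, 0)) (fun j => (0, b j)) x) := by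
  refine (ha.prod hb).map (TensorProduct.prodRight ℤ A A M N).symm fun g x => ?_
  apply (TensorProduct.prodRight ℤ A A M N).injective
  rw [prodRight_rep, LinearEquiv.apply_symm_apply, LinearEquiv.apply_symm_apply]

lemma exists_groupBasis_of_free (A : Type*) [CommRing A] {m : ℕ}
    (e : M ≃ₗ[ℤ[G]] (Fin m → ℤ[G])) :
    ∃ a : Fin m → A ⊗[ℤ] M, IsGroupBasis (G := G) (repOver A M) a := by
  let b := Basis.ofEquivFun e
  let c : Basis G ℤ ℤ[G] := MonoidAlgebra.basis G ℤ
  refine ⟨fun j => 1 ⊗ₜ b j, IsGroupBasis.of_basis (Algebra.TensorProduct.basis A (c.smulTower b)) ?_⟩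
  intro x
  rw [Algebra.TensorProduct.basis_apply, Basis.smulTower_apply, MonoidAlgebra.basis_apply]
  rfl

end

section

variable (P A : CochainComplex (ModuleCat.{v} ℤ[G]) ℤ)

/-- The terms of a direct sum of complexes after the extension of scalars. -/
def prodQ (i : ℤ) : QT (dirSum P A) i ≃ₗ[ℚ] QT P i × QT A i :=
  TensorProduct.prodRight ℤ ℚ ℚ (P.X i) (A.X i)

variable {P A}

lemma prodQ_rep (i : ℤ) (g : G) (x : QT (dirSum P A) i) :
    prodQ P A i (repQ (dirSum P A) i g x) = ((repQ P i).prod (repQ A i)) g (prodQ P A i x) :=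
  prodRight_rep ℚ g x

lemma prodQ_dQ (i j : ℤ) (x : QT (dirSum P A) i) :
    prodQ P A j (dQ (dirSum P A) i j x) = (dQ P i j (prodQ P A i x).1, dQ A i j (prodQ P A i x).2) := by
  exact x.induction_on (by simp only [map_zero, Prod.fst_zero, Prod.snd_zero, Prod.mk_zero_zero]) (fun q m => rfl)
    fun x y hx hy => by simp only [map_add, hx, hy, Prod.fst_add, Prod.snd_add, Prod.mk_add_mk]

lemma prodQ_fst (i : ℤ) (x : QT (dirSum P A) i) :
    extQ ((dirSumFst P A).f i) x = (prodQ P A i x).1 := by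
  exact x.induction_on (by simp only [map_zero, Prod.fst_zero]) (fun q m => rfl)
    fun x y hx hy => by simp only [map_add, hx, hy, Prod.fst_add]

lemma mem_Zc_dirSum {i : ℤ} (x : QT (dirSum P A) i) :
    x ∈ Zc (dirSum P A) i ↔ (prodQ P A i x).1 ∈ Zc P i ∧ (prodQ P A i x).2 ∈ Zc A i := by
  rw [mem_ker, ← (prodQ P A (i + 1)).map_eq_zero_iff, prodQ_dQ, Prod.mk_eq_zero]
  rfl

lemma mem_Bc_dirSum {i : ℤ} (x : QT (dirSum P A) i) :
    x ∈ Bc (dirSum P A) i ↔ (prodQ P A i x).1 ∈ Bc P i ∧ (prodQ P A i x).2 ∈ Bc A i := by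
  constructor
  · rintro ⟨y, rfl⟩
    rw [prodQ_dQ]
    exact ⟨⟨_, rfl⟩, ⟨_, rfl⟩⟩
  · rintro ⟨⟨y, hy⟩, ⟨z, hz⟩⟩
    refine ⟨(prodQ P A (i - 1)).symm (y, z), (prodQ P A i).injective ?_⟩
    rw [prodQ_dQ, LinearEquiv.apply_symm_apply]
    exact Prod.ext hy hz

lemma repIso_repB_dirSum (i : ℤ) : RepIso (repB (dirSum P A) i) ((repB P i).prod (repB A i)) := by
  let f : Bc (dirSum P A) i →ₗ[ℚ] Bc P i × Bc A i :=
    LinearMap.prod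
      (((fst ℚ _ _).comp ((prodQ P A i).toLinearMap.comp (Bc (dirSum P A) i).subtype)).codRestrict
        _ fun x => ((mem_Bc_dirSum x.1).1 x.2).1)
      (((snd ℚ _ _).comp ((prodQ P A i).toLinearMap.comp (Bc (dirSum P A) i).subtype)).codRestrict
        _ fun x => ((mem_Bc_dirSum x.1).1 x.2).2)
  have hf : ∀ x, ((f x).1.1, (f x).2.1) = prodQ P A i x := fun x => rfl
  refine ⟨ofBijective f ⟨fun x y h => ?_, fun y => ?_⟩, fun g x => ?_⟩
  · refine Subtype.ext ((prodQ P A i).injective ?_)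
    rw [← hf, ← hf, h]
  · refine ⟨⟨(prodQ P A i).symm (y.1, y.2), (mem_Bc_dirSum _).2 ?_⟩, ?_⟩
    · rw [LinearEquiv.apply_symm_apply]
      exact ⟨y.1.2, y.2.2⟩
    · refine Prod.ext (Subtype.ext ?_) (Subtype.ext ?_)
      · exact congrArg Prod.fst ((prodQ P A i).apply_symm_apply (y.1.1, y.2.1))
      · exact congrArg Prod.snd ((prodQ P A i).apply_symm_apply (y.1.1, y.2.1))
  · have h := prodQ_rep (P := P) (A := A) i g x.1
    refine Prod.ext (Subtype.ext ?_) (Subtype.ext ?_)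
    · exact congrArg Prod.fst h
    · exact congrArg Prod.snd h

lemma IsPerfect.Zc_le_Bc (hA : IsPerfect A) (hac : A.Acyclic) (i : ℤ) : Zc A i ≤ Bc A i := by
  obtain ⟨s, -, hs⟩ := hA.exists_contraction hac
  intro x hx
  refine ⟨extQ (ModuleCat.ofHom (s i (i - 1))) x, ?_⟩
  have : ∀ x : QT A i, extQ (ModuleCat.ofHom (s (i + 1) i)) (dQ A i (i + 1) x) +
      dQ A (i - 1) i (extQ (ModuleCat.ofHom (s i (i - 1))) x) = x := by
    intro x
    induction x using induction_on with
    | zero => simp only [map_zero, add_zero]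
    | tmul q m =>
      refine (tmul_add q _ _).symm.trans (congrArg (q ⊗ₜ[ℤ] ·) ?_)
      exact hs i (i + 1) (i - 1) rfl (by omega) m
    | add x y hx hy =>
      rw [map_add, map_add, map_add, map_add, add_add_add_comm, hx, hy]
  have h := this x
  rwa [mem_ker.1 hx, map_zero, zero_add] at h

lemma mapH_classH (f : Q ⟶ P) (i : ℤ)
    (z : Zc Q i) : mapH f i (classH Q i z) = classH P i (mapZ f i z) := rfl

lemma mapH_dirSumFst_bijective (hA : IsPerfect A) (hac : A.Acyclic) (i : ℤ) :
    Function.Bijective (mapH (dirSumFst P A) i) := by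
  constructor
  · rw [injective_iff_map_eq_zero]
    intro c hc
    obtain ⟨z, rfl⟩ := classH_surjective i c
    rw [mapH_classH, classH_eq_zero_iff] at hc
    rw [classH_eq_zero_iff, mem_Bc_dirSum]
    refine ⟨?_, hA.Zc_le_Bc hac i ((mem_Zc_dirSum _).1 z.2).2⟩
    rw [← prodQ_fst]
    exact hc
  · intro c
    obtain ⟨z, rfl⟩ := classH_surjective i c
    have h1 := (prodQ P A i).apply_symm_apply (z.1, 0)
    refine ⟨classH _ i ⟨(prodQ P A i).symm (z, 0), (mem_Zc_dirSum _).2 ?_⟩, ?_⟩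
    · rw [h1]
      exact ⟨z.2, zero_mem _⟩
    · rw [mapH_classH]
      refine congrArg _ (Subtype.ext ?_)
      exact (prodQ_fst i _).trans (congrArg Prod.fst h1)

lemma mapH_rep (f : Q ⟶ P) (i : ℤ) (g : G)
    (c : H Q i) : mapH f i (repH Q i g c) = repH P i g (mapH f i c) := by
  obtain ⟨z, rfl⟩ := classH_surjective i c
  exact congrArg (classH P i) (Subtype.ext (extQ_rep (f.f i) g z))

lemma IsSymmetricPairing.pullback {σ : GradedPairing P} (hσ : IsSymmetricPairing σ)
    (f : Q ⟶ P)
    (hf : ∀ i, Function.Bijective (mapH f i)) : IsSymmetricPairing (σ.pullback f) where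
  symm i j h h' x y := hσ.symm i j h h' _ _
  inv i j h g x y := by
    change σ i j h (mapH f i _) (mapH f j _) = _
    rw [mapH_rep, mapH_rep, hσ.inv]
    rfl
  nondeg i j h := by
    constructor
    · intro x hx
      refine (injective_iff_map_eq_zero (mapH f i)).1 (hf i).1 x ((hσ.nondeg i j h).1 _ fun y => ?_)
      obtain ⟨y, rfl⟩ := (hf j).2 y
      exact hx y
    · intro x hx
      refine (injective_iff_map_eq_zero (mapH f j)).1 (hf j).1 x ((hσ.nondeg i j h).2 _ fun y => ?_)
      obtain ⟨y, rfl⟩ := (hf i).2 y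
      exact hx y

lemma IsSymmetricPairing.scale {σ : GradedPairing P} (hσ : IsSymmetricPairing σ) {c : ℚ} (hc : c ≠ 0) :
    IsSymmetricPairing (σ.scale c) where
  symm i j h h' x y := congrArg (c * ·) (hσ.symm i j h h' x y)
  inv i j h g x y := congrArg (c * ·) (hσ.inv i j h g x y)
  nondeg i j h := ⟨fun x hx => (hσ.nondeg i j h).1 x fun y =>
      (mul_eq_zero.1 (hx y : c * σ i j h x y = 0)).resolve_left hc,
    fun x hx => (hσ.nondeg i j h).2 x fun y =>
      (mul_eq_zero.1 (hx y : c * σ i j h y x = 0)).resolve_left hc⟩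

end

section

variable (C : ℤ → Type v) [∀ i, AddCommGroup (C i)]
  [∀ i, Module ℤ[G] (C i)]

/-- The direct sum of the complexes `C i → C i` in degrees `i - 1` and `i`. -/
def diskSum : CochainComplex (ModuleCat.{v} ℤ[G]) ℤ :=
  CochainComplex.of (fun i => ModuleCat.of ℤ[G] (C i × C (i + 1)))
    (fun i => ModuleCat.ofHom ((LinearMap.inl ℤ[G] (C (i + 1)) (C (i + 1 + 1))).comp
      (snd ℤ[G] (C i) (C (i + 1))))) fun _ => rfl

variable {C}

lemma diskSum_d (i : ℤ) : (diskSum (G := G) C).d i (i + 1) =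
    ModuleCat.ofHom ((LinearMap.inl ℤ[G] (C (i + 1)) (C (i + 1 + 1))).comp
      (snd ℤ[G] (C i) (C (i + 1)))) :=
  CochainComplex.of_d (fun i => ModuleCat.of ℤ[G] (C i × C (i + 1)))
    (fun i => ModuleCat.ofHom ((LinearMap.inl ℤ[G] (C (i + 1)) (C (i + 1 + 1))).comp
      (snd ℤ[G] (C i) (C (i + 1))))) i

lemma diskSum_acyclic : (diskSum (G := G) C).Acyclic := by
  intro i
  rw [HomologicalComplex.exactAt_iff' _ (i - 1) i (i + 1) (by simp) (by simp)]
  obtain ⟨k, rfl⟩ : ∃ k, i = k + 1 := ⟨i - 1, by omega⟩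
  rw [add_sub_cancel_right, ShortComplex.moduleCat_exact_iff]
  intro x hx
  have h1 : ((diskSum (G := G) C).d (k + 1) (k + 1 + 1)).hom x = 0 := hx
  rw [diskSum_d] at h1
  have h2 : (x : C (k + 1) × C (k + 1 + 1)).2 = 0 := congrArg Prod.fst h1
  refine ⟨((0, x.1) : C k × C (k + 1)), ?_⟩
  change ((diskSum (G := G) C).d k (k + 1)).hom _ = x
  rw [diskSum_d]
  exact Prod.ext rfl h2.symm

lemma repIso_repB_diskSum (i : ℤ) :
    RepIso (repO ℚ (C i)) (repB (diskSum (G := G) C) i) := by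
  obtain ⟨k, rfl⟩ : ∃ k, i = k + 1 := ⟨i - 1, by omega⟩
  let D := diskSum (G := G) C
  let f : ℚ ⊗[ℤ] C (k + 1) →ₗ[ℚ] QT D (k + 1) :=
    (LinearMap.inl ℤ (C (k + 1)) (C (k + 1 + 1))).baseChange ℚ
  let f' : QT D (k + 1) →ₗ[ℚ] ℚ ⊗[ℤ] C (k + 1) :=
    (fst ℤ (C (k + 1)) (C (k + 1 + 1))).baseChange ℚ
  let s : QT D k →ₗ[ℚ] ℚ ⊗[ℤ] C (k + 1) := (snd ℤ (C k) (C (k + 1))).baseChange ℚ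
  let r : ℚ ⊗[ℤ] C (k + 1) →ₗ[ℚ] QT D k := (LinearMap.inr ℤ (C k) (C (k + 1))).baseChange ℚ
  have hf'f : Function.LeftInverse f' f := by
    intro x
    exact x.induction_on (by rw [map_zero, map_zero]) (fun q m => rfl)
      fun x y hx hy => by rw [map_add, map_add, hx, hy]
  have hsr : Function.LeftInverse s r := by
    intro x
    exact x.induction_on (by rw [map_zero, map_zero]) (fun q m => rfl)
      fun x y hx hy => by rw [map_add, map_add, hx, hy]
  have hd : ∀ x : QT D k, dQ D k (k + 1) x = f (s x) := by
    intro x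
    induction x using induction_on with
    | zero => rw [map_zero, map_zero, map_zero]
    | tmul q m =>
      exact congrArg (q ⊗ₜ[ℤ] ·) (congrArg (fun f => f.hom m) (diskSum_d (G := G) (C := C) k))
    | add x y hx hy => rw [map_add, map_add, map_add, hx, hy]
  have hfr : range f = Bc D (k + 1) := by
    refine le_antisymm ?_ fun x hx => ?_
    · rintro _ ⟨x, rfl⟩
      have h := dQ_mem_Bc (Q := D) (k := k) rfl (r x)
      rwa [hd, hsr] at h
    · obtain ⟨y, rfl⟩ := exists_of_mem_Bc rfl hx
      exact ⟨_, (hd y).symm⟩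
  have hfg : ∀ g x, f (repO ℚ (C (k + 1)) g x) = repQ D (k + 1) g (f x) := by
    intro g x
    induction x using induction_on with
    | zero => rw [map_zero, map_zero, map_zero]
    | tmul q m =>
      refine congrArg (q ⊗ₜ[ℤ] ·) ?_
      exact Prod.ext rfl (smul_zero (MonoidAlgebra.of ℤ G g)).symm
    | add x y hx hy => rw [map_add, map_add, map_add, map_add, hx, hy]
  let e := (LinearEquiv.ofInjective f hf'f.injective).trans (LinearEquiv.ofEq _ _ hfr)
  exact ⟨e, fun g x => Subtype.ext (hfg g x)⟩

lemma diskSum_isPerfect {N : ℤ} (hN : ∀ i, N < |i| → Subsingleton (C i))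
    (hf : ∀ i, Module.Finite ℤ[G] (C i))
    (hb : ∀ (i : ℤ) (p : Primes), ∃ (r : ℕ) (a : Fin r → ℤ_[p] ⊗[ℤ] C i),
      IsGroupBasis (G := G) (repOver ℤ_[p] (C i)) a) : IsPerfect (diskSum (G := G) C) where
  bounded := ⟨N + 1, fun i hi => by
    have h1 := hN i (by omega)
    have h2 := hN (i + 1) (by
      have := abs_add_le (i + 1) (-1)
      rw [add_neg_cancel_right, abs_neg, abs_one] at this
      omega)
    exact inferInstanceAs (Subsingleton (C i × C (i + 1)))⟩
  finite i := inferInstanceAs (Module.Finite ℤ[G] (C i × C (i + 1)))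
  locallyFree i p := by
    obtain ⟨r, a, ha⟩ := hb i p
    obtain ⟨r', a', ha'⟩ := hb (i + 1) p
    exact ⟨r + r', _, (ha.tensor_prod ha').reindex finSumFinEquiv.symm⟩

end

section

lemma exists_freeModule (m : ℕ) : ∃ (C : Type v) (_ : AddCommGroup C)
    (_ : Module ℤ[G] C), Nonempty (C ≃ₗ[ℤ[G]] (Fin m → ℤ[G])) := by
  have hc : Countable ℤ[G] :=
    (MonoidAlgebra.coeffEquiv (R := ℤ) (M := G)).injective.countable
  exact ⟨Shrink.{v} (Fin m → ℤ[G]), inferInstance, inferInstance,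
    ⟨Shrink.linearEquiv _ _⟩⟩

lemma exists_stabilization (hP : IsPerfect P) {σ : GradedPairing P} (hσ : IsSymmetricPairing σ) :
    ∃ (A : CochainComplex (ModuleCat.{v} ℤ[G]) ℤ) (_ : IsPerfect A) (_ : A.Acyclic),
      ∀ i k : ℤ, i + k = 1 → 1 ≤ i → RepIso (repB (dirSum P A) i) (repB (dirSum P A) k) := by
  obtain ⟨N, hN⟩ := hP.bounded
  obtain ⟨L⟩ := hP.nonempty_localBases
  have h1 : ∀ i : ℤ, ∃ a b : ℕ, (N + 1 < i → a = 0 ∧ b = 0) ∧ (1 ≤ i → ∀ {F F' : Type v}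
      [AddCommGroup F] [Module ℚ F] [AddCommGroup F'] [Module ℚ F'] (φ : Representation ℚ G F)
      (φ' : Representation ℚ G F') (x : Fin a → F) (x' : Fin b → F'), IsGroupBasis φ x →
      IsGroupBasis φ' x' → RepIso ((repB P i).prod φ) ((repB P (1 - i)).prod φ')) := by
    intro i
    by_cases hi : N + 1 < i ∧ 1 ≤ i
    · refine ⟨0, 0, fun _ => ⟨rfl, rfl⟩, fun _ F F' _ _ _ _ φ φ' x x' hx hx' => ?_⟩
      have h1 : N < |i| := by rw [abs_of_nonneg (by omega)]; omega
      have h2 : N < |1 - i| := by rw [abs_of_nonpos (by omega)]; omega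
      have := hN i h1
      have := hN (1 - i) h2
      have : Subsingleton (QT P i) := subsingleton_tmul
      have : Subsingleton (QT P (1 - i)) := subsingleton_tmul
      have : Subsingleton F := hx.basis.repr.toEquiv.subsingleton
      have : Subsingleton F' := hx'.basis.repr.toEquiv.subsingleton
      exact RepIso.of_subsingleton
    · by_cases h : 1 ≤ i
      · obtain ⟨a, b, hab⟩ := (stablyIso_repB L hN hσ i (1 - i) (by omega) h).repIso_prod
        exact ⟨a, b, fun h' => absurd ⟨h', h⟩ hi, fun _ => hab⟩
      · exact ⟨0, 0, fun _ => ⟨rfl, rfl⟩, fun h' => absurd h' h⟩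
  choose a b h0 hab using h1
  let m : ℤ → ℕ := fun i => if 1 ≤ i then a i else b (1 - i)
  have hm1 : ∀ i, 1 ≤ i → m i = a i := fun i hi => if_pos hi
  have hm2 : ∀ i, 1 ≤ i → m (1 - i) = b i := fun i hi => by
    change (if 1 ≤ 1 - i then a (1 - i) else b (1 - (1 - i))) = b i
    rw [if_neg (by omega), sub_sub_cancel]
  choose C i1 i2 e' using fun i => exists_freeModule.{u, v} (G := G) (m i)
  have e := fun i => (e' i).some
  refine ⟨diskSum (G := G) C, diskSum_isPerfect (N := |N| + 2) (fun i hi => ?_) (fun i => ?_) fun i p =>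
    ⟨m i, exists_groupBasis_of_free ℤ_[p] (e i)⟩, diskSum_acyclic, fun i k h hi => ?_⟩
  · have h2 : m i = 0 := by
      have h3 := le_abs_self N
      rcases le_or_gt 1 i with h | h
      · rw [abs_of_nonneg (a := i) (by omega)] at hi
        rw [hm1 i h, (h0 i (by omega)).1]
      · rw [abs_of_nonpos (a := i) (by omega)] at hi
        have := hm2 (1 - i) (by omega)
        rw [sub_sub_cancel] at this
        rw [this, (h0 (1 - i) (by omega)).2]
    have h4 : IsEmpty (Fin (m i)) := by rw [h2]; infer_instance
    exact (e i).toEquiv.subsingleton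
  · exact Module.Finite.equiv (e i).symm
  · obtain rfl : k = 1 - i := by omega
    obtain ⟨x, hx⟩ := exists_groupBasis_of_free ℚ (e i)
    obtain ⟨y, hy⟩ := exists_groupBasis_of_free ℚ (e (1 - i))
    have h5 := hab i hi (repO ℚ (C i)) (repO ℚ (C (1 - i)))
      _ _ (hx.reindex (finCongr (hm1 i hi).symm)) (hy.reindex (finCongr (hm2 i hi).symm))
    exact (repIso_repB_dirSum i).trans (((RepIso.refl _).prod (repIso_repB_diskSum i).symm).trans
      (h5.trans (((RepIso.refl _).prod (repIso_repB_diskSum (1 - i))).trans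
        (repIso_repB_dirSum (1 - i)).symm)))

lemma IsPerfect.dirSum (hP : IsPerfect P)
    (hA : IsPerfect A) : IsPerfect (dirSum P A) where
  bounded := by
    obtain ⟨N, hN⟩ := hP.bounded
    obtain ⟨N', hN'⟩ := hA.bounded
    refine ⟨max N N', fun i hi => ?_⟩
    have h1 := hN i ((le_max_left _ _).trans_lt hi)
    have h2 := hN' i ((le_max_right _ _).trans_lt hi)
    exact inferInstanceAs (Subsingleton (P.X i × A.X i))
  finite i := by
    have h1 := hP.finite i
    have h2 := hA.finite i
    exact inferInstanceAs (Module.Finite ℤ[G] (P.X i × A.X i))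
  locallyFree i p := by
    obtain ⟨r, a, ha⟩ := hP.locallyFree i p
    obtain ⟨r', a', ha'⟩ := hA.locallyFree i p
    exact ⟨r + r', _, (ha.tensor_prod ha').reindex finSumFinEquiv.symm⟩

lemma exists_pairingLift (hP : IsPerfect P) {σ : GradedPairing P} (hσ : IsSymmetricPairing σ) :
    ∃ (A : CochainComplex (ModuleCat.{v} ℤ[G]) ℤ) (_ : IsPerfect A) (_ : A.Acyclic),
      Nonempty (PairingLift (σ.pullback (dirSumFst P A))) := by
  obtain ⟨A, hA, hac, h⟩ := exists_stabilization hP hσ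
  obtain ⟨L⟩ := (hP.dirSum hA).nonempty_localBases
  exact ⟨A, hA, hac, nonempty_pairingLift_of_repIso L.finite_QT
    (hσ.pullback _ (mapH_dirSumFst_bijective hA hac)) h⟩

end

section

lemma exists_sigma_nonempty_equiv {o : Type*} (X : o → Type*) [Finite (Σ i, X i)] :
    ∃ (_ : Fintype {i // Nonempty (X i)})
      (e : (Σ i : {i // Nonempty (X i)}, X i) ≃ Σ i, X i), ∀ x, e x = ⟨x.1, x.2⟩ := by
  have : Finite {i // Nonempty (X i)} :=
    Finite.of_injective (fun i : {i // Nonempty (X i)} => (⟨i, i.2.some⟩ : Σ i, X i)) fun i j h =>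
      Subtype.ext (congrArg Sigma.fst h)
  refine ⟨ofFinite _, ⟨fun x => ⟨x.1, x.2⟩, fun x => ⟨⟨x.1, ⟨x.2⟩⟩, x.2⟩, fun _ => rfl,
    fun _ => rfl⟩, fun _ => rfl⟩

lemma prod_nonempty_eq_finprod {o : Type*} {X : o → Type*} [Fintype {i // Nonempty (X i)}]
    {R : Type*} [CommMonoid R] (f : o → R) (hf : ∀ i, IsEmpty (X i) → f i = 1) :
    ∏ i : {i // Nonempty (X i)}, f i = ∏ᶠ i, f i := by
  rw [← finprod_eq_prod_of_fintype, finprod_subtype_eq_finprod_cond (fun i => Nonempty (X i))]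
  refine finprod_congr fun i => ?_
  by_cases h : Nonempty (X i)
  · simp [h]
  · simp [h, hf i (not_nonempty_iff.1 h)]

variable {o : Type*} [DecidableEq o] {X : o → Type*} [∀ i, Fintype (X i)] [∀ i, DecidableEq (X i)]
  [Fintype (Σ i, X i)] [DecidableEq (Σ i, X i)]

lemma det_blockDiagonal'_eq_finprod {R : Type*} [CommRing R] (B : ∀ i, Matrix (X i) (X i) R) :
    (blockDiagonal' B).det = ∏ᶠ i, (B i).det := by
  obtain ⟨_, e, he⟩ := exists_sigma_nonempty_equiv X
  rw [← prod_nonempty_eq_finprod (X := X) _ fun i _ => det_isEmpty, ← det_blockDiagonal',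
    ← det_submatrix_equiv_self e]
  congr 1
  ext x y
  simp only [submatrix_apply, he, blockDiagonal'_apply, Subtype.ext_iff]

variable {A S : Type*} [CommRing A] [CommRing S] [Algebra A S]

lemma detM_blockDiagonal'_eq_finprod (φ : ℂ →+* S) {n : ℕ} (ρ : CRep G n)
    (B : ∀ i, Matrix (X i) (X i) A[G]) :
    detM A φ ρ (blockDiagonal' B) = ∏ᶠ i, detM A φ ρ (B i) := by
  obtain ⟨_, e, he⟩ := exists_sigma_nonempty_equiv X
  rw [← prod_nonempty_eq_finprod (X := X) _ fun i _ => by rw [detM_apply, det_isEmpty],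
    ← detM_blockDiagonal', ← detM_reindex A φ ρ e]
  congr 1
  ext x y
  simp only [submatrix_apply, he, blockDiagonal'_apply, Subtype.ext_iff]

end

section

variable {α β : Type*} [Fintype α] [DecidableEq α] [Fintype β] [DecidableEq β]

lemma pfm_sum (A : Matrix ((α ⊕ β) × Fin 2) ((α ⊕ β) × Fin 2) ℂ)
    (hA : ∀ a b ε δ, A (inl a, ε) (inr b, δ) = 0) (ha : Aᵀ = -A) (hd : A.det ≠ 0) :
    pfm A = pfm (A.submatrix (fun x : α × Fin 2 => (inl x.1, x.2)) fun x => (inl x.1, x.2)) *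
      pfm (A.submatrix (fun x : β × Fin 2 => (inr x.1, x.2)) fun x => (inr x.1, x.2)) := by
  have hA' : ∀ a b ε δ, A (inr b, δ) (inl a, ε) = 0 := fun a b ε δ => by
    have := congrFun (congrFun ha (inl a, ε)) (inr b, δ)
    rw [transpose_apply, neg_apply, hA, neg_zero] at this
    exact this
  rw [pfm_colour (fun x : α ⊕ β => x.isLeft) A ?_ ha hd, finprod_eq_prod_of_fintype, Fintype.prod_bool]
  · congr 1
    · let e : α ≃ {x : α ⊕ β // x.isLeft = true} :=
        ⟨fun a => ⟨inl a, rfl⟩, fun x => x.1.getLeft x.2, fun _ => rfl, fun x => by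
          obtain ⟨x | x, hx⟩ := x
          · rfl
          · exact absurd hx (by simp)⟩
      convert (pfm_reindex e (A.submatrix (fun x : {x : α ⊕ β // x.isLeft = true} × Fin 2 => (x.1.1, x.2))
        fun x => (x.1.1, x.2))).symm
      rfl
    · let e : β ≃ {x : α ⊕ β // x.isLeft = false} :=
        ⟨fun a => ⟨inr a, rfl⟩, fun x => x.1.getRight (by simpa using x.2), fun _ => rfl, fun x => by
          obtain ⟨x | x, hx⟩ := x
          · exact absurd hx (by simp)
          · rfl⟩
      convert (pfm_reindex e (A.submatrix (fun x : {x : α ⊕ β // x.isLeft = false} × Fin 2 => (x.1.1, x.2))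
        fun x => (x.1.1, x.2))).symm
      rfl
  · rintro ⟨x | x, ε⟩ ⟨y | y, δ⟩ h
    · exact absurd rfl h
    · exact hA _ _ _ _
    · exact hA' _ _ _ _
    · exact absurd rfl h

lemma pfm_eq_of_antitriangular (c : α → Fin 3) (hsum : ∑ a, (c a : ℕ) = card α)
    (K K' : PairMatrix α ℂ)
    (hK : ∀ x y, (c x.1 : ℕ) + c y.1 < 2 → K x y = 0)
    (hK' : ∀ x y, K' x y = if (c x.1 : ℕ) + c y.1 = 2 then K x y else 0) :
    pfm K = pfm K' ∧ K.det = K'.det := by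
  let E : PairMatrix α (Polynomial ℂ) :=
    diagonal fun x => (Polynomial.X : Polynomial ℂ) ^ (c x.1 : ℕ)
  let D : PairMatrix α (Polynomial ℂ) := diagonal fun x => Polynomial.X
  let KX : PairMatrix α (Polynomial ℂ) := of fun x y =>
    Polynomial.C (K x y) * Polynomial.X ^ ((c x.1 : ℕ) + c y.1 - 2)
  have hKX : ∀ x y, KX x y = Polynomial.C (K x y) * Polynomial.X ^ ((c x.1 : ℕ) + c y.1 - 2) :=
    fun _ _ => rfl
  have hconj : E * K.map Polynomial.C * Eᵀ = D * KX * Dᵀ := by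
    refine Matrix.ext fun x y => ?_
    rw [diagonal_transpose, diagonal_transpose, mul_diagonal, diagonal_mul, mul_diagonal, diagonal_mul]
    rw [hKX, map_apply]
    by_cases h : (c x.1 : ℕ) + c y.1 < 2
    · rw [hK x y h]
      simp
    · obtain ⟨m, hm⟩ := Nat.exists_eq_add_of_le (not_lt.1 h)
      have h1 : (Polynomial.X : Polynomial ℂ) ^ (c x.1 : ℕ) * Polynomial.X ^ (c y.1 : ℕ) =
          Polynomial.X ^ 2 * Polynomial.X ^ m := by rw [← pow_add, hm, pow_add]
      rw [hm, Nat.add_sub_cancel_left]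
      linear_combination Polynomial.C (K x y) * h1
  have hdet : E.det = D.det := by
    rw [det_diagonal, det_diagonal, Fintype.prod_prod_type, Fintype.prod_prod_type]
    simp only [Finset.prod_pow_eq_pow_sum, prod_const, card_univ, Finset.sum_const,
      smul_eq_mul, mul_comm _ (card (Fin 2)), ← mul_sum, hsum]
  have hD : D.det ≠ 0 := by
    rw [det_diagonal]
    exact prod_ne_zero_iff.2 fun _ _ => Polynomial.X_ne_zero
  have h0 : KX.map (Polynomial.evalRingHom 0) = K' := by
    refine Matrix.ext fun x y => ?_
    rw [hK']
    rw [map_apply, hKX, Polynomial.coe_evalRingHom, Polynomial.eval_mul, Polynomial.eval_C, Polynomial.eval_pow, Polynomial.eval_X]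
    split_ifs with h
    · simp [h]
    · by_cases h' : (c x.1 : ℕ) + c y.1 < 2
      · rw [hK x y h', zero_mul]
      · rw [zero_pow (by omega), mul_zero]
  have hC : (K.map Polynomial.C).map (Polynomial.evalRingHom (0 : ℂ)) = K :=
    Matrix.ext fun x y => Polynomial.eval_C
  constructor
  · have h := congrArg pfm hconj
    rw [pfm_conj, pfm_conj, hdet] at h
    have h := congrArg (Polynomial.evalRingHom 0) (mul_left_cancel₀ hD h)
    rwa [← pfm_map, ← pfm_map, h0, hC] at h
  · have h := congrArg det hconj
    rw [det_mul, det_mul, det_mul, det_mul, det_transpose, det_transpose, hdet] at h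
    have h := congrArg (Polynomial.evalRingHom 0) (mul_left_cancel₀ hD (mul_right_cancel₀ hD h))
    rw [map_det, map_det] at h
    exact (congrArg det hC).symm.trans (h.trans (congrArg det h0))

lemma det_sum_prod (A : Matrix ((α ⊕ β) × Fin 2) ((α ⊕ β) × Fin 2) ℂ)
    (hA : ∀ a b ε δ, A (inl a, ε) (inr b, δ) = 0) :
    A.det =
      (A.submatrix (fun x : α × Fin 2 => (inl x.1, x.2)) fun x => (inl x.1, x.2)).det *
      (A.submatrix (fun x : β × Fin 2 => (inr x.1, x.2)) fun x => (inr x.1, x.2)).det := by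
  rw [← det_submatrix_equiv_self (sumProdDistrib α β (Fin 2)).symm,
    ← fromBlocks_toBlocks (A.submatrix _ _)]
  have h : (A.submatrix (sumProdDistrib α β (Fin 2)).symm
      (sumProdDistrib α β (Fin 2)).symm).toBlocks₁₂ = 0 := Matrix.ext fun x y => hA _ _ _ _
  rw [h, det_fromBlocks_zero₁₂]
  rfl

lemma pfm_eq_mul_of_antitriangular {τ : Type*} [Fintype τ] [DecidableEq τ]
    (hc : card α = card β)
    (K : Matrix ((α ⊕ τ ⊕ β) × Fin 2) ((α ⊕ τ ⊕ β) × Fin 2) ℂ) (ha : Kᵀ = -K) (hd : K.det ≠ 0)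
    (h0 : ∀ a b ε δ, K (inl a, ε) (inl b, δ) = 0)
    (h1 : ∀ a b ε δ, K (inl a, ε) (inr (inl b), δ) = 0)
    (M : Matrix ((α ⊕ β) × Fin 2) ((α ⊕ β) × Fin 2) ℂ)
    (hM : ∀ x y, M x y = if x.1.isLeft = y.1.isLeft then 0 else
      K (x.1.map id inr, x.2) (y.1.map id inr, y.2)) :
    pfm K = pfm M * pfm (K.submatrix (fun x : τ × Fin 2 => (inr (inl x.1), x.2))
      fun x => (inr (inl x.1), x.2)) ∧ pfm M ≠ 0 ∧
      (K.submatrix (fun x : τ × Fin 2 => (inr (inl x.1), x.2))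
        fun x => (inr (inl x.1), x.2)).det ≠ 0 := by
  have hs : ∀ x y, K y x = -K x y := fun x y => congrFun (congrFun ha x) y
  let c : α ⊕ τ ⊕ β → Fin 3 := Sum.elim (fun _ => 0) (Sum.elim (fun _ => 1) fun _ => 2)
  let K' : Matrix ((α ⊕ τ ⊕ β) × Fin 2) ((α ⊕ τ ⊕ β) × Fin 2) ℂ :=
    of fun x y => if (c x.1 : ℕ) + c y.1 = 2 then K x y else 0
  have hcc : ∑ a, (c a : ℕ) = card (α ⊕ τ ⊕ β) := by
    simp [c, hc]
    ring
  have hK0 : ∀ x y : (α ⊕ τ ⊕ β) × Fin 2, (c x.1 : ℕ) + c y.1 < 2 → K x y = 0 := by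
    rintro ⟨x | x | x, ε⟩ ⟨y | y | y, δ⟩ h
    · exact h0 _ _ _ _
    · exact h1 _ _ _ _
    · exact absurd h (by simp [c])
    · rw [hs, h1, neg_zero]
    · exact absurd h (by simp [c])
    · exact absurd h (by simp [c])
    · exact absurd h (by simp [c])
    · exact absurd h (by simp [c])
    · exact absurd h (by simp [c])
  obtain ⟨hp, hdet⟩ := pfm_eq_of_antitriangular c hcc K K' hK0 fun _ _ => rfl
  let e : τ ⊕ (α ⊕ β) ≃ α ⊕ τ ⊕ β :=
    (Equiv.sumAssoc τ α β).symm.trans (((sumComm τ α).sumCongr (Equiv.refl β)).trans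
      (Equiv.sumAssoc α τ β))
  let f : (τ ⊕ (α ⊕ β)) × Fin 2 → (α ⊕ τ ⊕ β) × Fin 2 := fun x => (e x.1, x.2)
  let L := K'.submatrix f f
  have hL' : ∀ x y, L x y = if (c (e x.1) : ℕ) + c (e y.1) = 2 then K (f x) (f y) else 0 :=
    fun _ _ => rfl
  have hL : pfm L = pfm K' := pfm_reindex e K'
  have hLd : L.det = K'.det := det_submatrix_equiv_self (e.prodCongr (Equiv.refl (Fin 2))) K'
  have hL0 : ∀ a b ε δ, L (inl a, ε) (inr b, δ) = 0 := by
    rintro a (b | b) ε δ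
    · rw [hL', if_neg (by simp [c, e])]
    · rw [hL', if_neg (by simp [c, e])]
  have hLs : Lᵀ = -L := Matrix.ext fun x y => by
    rw [transpose_apply, neg_apply, hL', hL', hs (f x), add_comm, apply_ite Neg.neg, neg_zero]
  have hL1 : L.submatrix (fun x : τ × Fin 2 => (inl x.1, x.2))
      (fun x : τ × Fin 2 => (inl x.1, x.2)) =
      K.submatrix (fun x : τ × Fin 2 => (inr (inl x.1), x.2))
        fun x : τ × Fin 2 => (inr (inl x.1), x.2) := Matrix.ext fun x y => rfl
  have hL2 : L.submatrix (fun x : (α ⊕ β) × Fin 2 => (inr x.1, x.2))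
      (fun x : (α ⊕ β) × Fin 2 => (inr x.1, x.2)) = M := by
    refine Matrix.ext fun x y => ?_
    rw [hM, submatrix_apply, hL']
    obtain ⟨x | x, ε⟩ := x <;> obtain ⟨y | y, δ⟩ := y
    · rw [if_neg (by simp [c, e])]
      rfl
    · rfl
    · rfl
    · rw [if_neg (by simp [c, e])]
      rfl
  have hLd0 : L.det ≠ 0 := by rw [hLd, ← hdet]; exact hd
  have hdd := det_sum_prod L hL0
  rw [hL1, hL2] at hdd
  have hMd : M.det ≠ 0 := fun h => hLd0 (by rw [hdd, h, mul_zero])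
  refine ⟨?_, pfm_ne_zero M ?_ hMd, fun h => hLd0 (by rw [hdd, h, zero_mul])⟩
  · rw [hp, ← hL, pfm_sum L hL0 hLs hLd0, hL1, hL2, mul_comm]
  · rw [← hL2]
    exact Matrix.ext fun x y => congrFun (congrFun hLs (inr x.1, x.2)) (inr y.1, y.2)

end

section

variable {o : Type*} [DecidableEq o] {α : o → Type*} [∀ i, Fintype (α i)] [∀ i, DecidableEq (α i)]
  [Fintype (Σ i, α i)] [DecidableEq (Σ i, α i)]

/-- A block diagonal matrix whose index set consists of pairs. -/
def sigmaBlock (C : ∀ i, Matrix (α i × Fin 2) (α i × Fin 2) ℂ) :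
    Matrix ((Σ i, α i) × Fin 2) ((Σ i, α i) × Fin 2) ℂ :=
  (blockDiagonal' C).submatrix (fun x => ⟨x.1.1, (x.1.2, x.2)⟩) fun x => ⟨x.1.1, (x.1.2, x.2)⟩

lemma det_sigmaBlock (C : ∀ i, Matrix (α i × Fin 2) (α i × Fin 2) ℂ) :
    (sigmaBlock C).det = ∏ᶠ i, (C i).det := by
  let e : (Σ i, α i) × Fin 2 ≃ Σ i, α i × Fin 2 :=
    ⟨fun x => ⟨x.1.1, (x.1.2, x.2)⟩, fun x => (⟨x.1, x.2.1⟩, x.2.2), fun _ => rfl, fun _ => rfl⟩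
  have _ : Fintype (Σ i, α i × Fin 2) := Fintype.ofEquiv _ e
  rw [← det_blockDiagonal'_eq_finprod, ← det_submatrix_equiv_self e]
  rfl

lemma sum_sigmaBlock {N : Type*} [AddCommGroup N] [Module ℂ N]
    (C : ∀ i, Matrix (α i × Fin 2) (α i × Fin 2) ℂ) (x : (Σ i, α i) × Fin 2)
    (f : (Σ i, α i) × Fin 2 → N) : ∑ y, sigmaBlock C x y • f y =
      ∑ z, C x.1.1 (x.1.2, x.2) z • f (⟨x.1.1, z.1⟩, z.2) := by
  refine (Fintype.sum_of_injective (fun z : α x.1.1 × Fin 2 =>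
    ((⟨x.1.1, z.1⟩ : Σ i, α i), z.2)) ?_ _ _ ?_ ?_).symm
  · rintro ⟨a, ε⟩ ⟨b, δ⟩ h
    simp only [Prod.mk.injEq, Sigma.mk.injEq, heq_eq_eq, true_and] at h
    rw [h.1, h.2]
  · rintro ⟨⟨j, a⟩, ε⟩ hy
    have hne : x.1.1 ≠ j := by
      rintro rfl
      exact hy ⟨(a, ε), rfl⟩
    rw [show sigmaBlock C x (⟨j, a⟩, ε) = 0 from
      blockDiagonal'_apply_ne C (x.1.2, x.2) (a, ε) hne, zero_smul]
  · intro z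
    rw [show sigmaBlock C x (⟨x.1.1, z.1⟩, z.2) = C x.1.1 (x.1.2, x.2) z from
      blockDiagonal'_apply_eq C x.1.1 (x.1.2, x.2) z]

end

section

variable {N : ℤ → Type*} [∀ i, AddCommGroup (N i)] [∀ i, Module ℂ (N i)]
  (k : ∀ i j : ℤ, i + j = 0 → N i →ₗ[ℂ] N j →ₗ[ℂ] ℂ) (S : Set ℤ)

/-- The Gram matrix of graded pairings for families of vectors in the degrees which belong to `S`. -/
def gradedGram {α : ℤ → Type*} (v : ∀ i, α i × Fin 2 → N i) :
    Matrix ((Σ i : S, α i) × Fin 2) ((Σ i : S, α i) × Fin 2) ℂ :=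
  of fun x y => if h : (x.1.1 : ℤ) + y.1.1 = 0 then
    k _ _ h (v _ (x.1.2, x.2)) (v _ (y.1.2, y.2)) else 0

variable {k S}

lemma gradedGram_apply {α : ℤ → Type*} (v : ∀ i, α i × Fin 2 → N i)
    (x y : (Σ i : S, α i) × Fin 2) (h : (x.1.1 : ℤ) + y.1.1 = 0) :
    gradedGram k S v x y = k _ _ h (v _ (x.1.2, x.2)) (v _ (y.1.2, y.2)) := dif_pos h

lemma gradedGram_eq_zero {α : ℤ → Type*} (v : ∀ i, α i × Fin 2 → N i)
    (x y : (Σ i : S, α i) × Fin 2) (h : (x.1.1 : ℤ) + y.1.1 ≠ 0) : gradedGram k S v x y = 0 := dif_neg h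

lemma gradedGram_transpose (hk : ∀ i j h h' x y, k j i h' y x = -k i j h x y) {α : ℤ → Type*}
    (v : ∀ i, α i × Fin 2 → N i) : (gradedGram k S v)ᵀ = -gradedGram k S v := by
  refine Matrix.ext fun x y => ?_
  rw [transpose_apply, neg_apply]
  by_cases h : (x.1.1 : ℤ) + y.1.1 = 0
  · rw [gradedGram_apply v x y h, gradedGram_apply v y x (by omega), hk]
  · rw [gradedGram_eq_zero v x y h, gradedGram_eq_zero v y x (by omega), neg_zero]

lemma gradedGram_eq_conj {α : ℤ → Type*} [∀ i, Fintype (α i)] [∀ i, DecidableEq (α i)]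
    [Fintype (Σ i : S, α i)] [DecidableEq (Σ i : S, α i)] (v b : ∀ i, α i × Fin 2 → N i)
    (C : ∀ i, Matrix (α i × Fin 2) (α i × Fin 2) ℂ) (hb : ∀ i x, b i x = ∑ y, C i x y • v i y) :
    ∃ D : Matrix ((Σ i : S, α i) × Fin 2) ((Σ i : S, α i) × Fin 2) ℂ,
      D.det = ∏ᶠ i : S, (C i).det ∧ gradedGram k S b = D * gradedGram k S v * Dᵀ := by
  let D := sigmaBlock fun i : S => C i
  refine ⟨D, det_sigmaBlock _, Matrix.ext fun x y => ?_⟩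
  have hD := fun x f => sum_sigmaBlock (N := ℂ) (fun i : S => C i) x f
  simp only [smul_eq_mul] at hD
  have h1 : (D * gradedGram k S v * Dᵀ) x y =
      ∑ z', C y.1.1 (y.1.2, y.2) z' * ∑ z, C x.1.1 (x.1.2, x.2) z *
        gradedGram k S v (⟨x.1.1, z.1⟩, z.2) (⟨y.1.1, z'.1⟩, z'.2) := by
    rw [mul_apply, ← hD y fun y' => ∑ z, C x.1.1 (x.1.2, x.2) z *
        gradedGram k S v (⟨x.1.1, z.1⟩, z.2) y']
    refine sum_congr rfl fun y' _ => ?_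
    rw [transpose_apply, mul_comm, mul_apply, hD x fun x' => gradedGram k S v x' y']
  rw [h1]
  by_cases h : (x.1.1 : ℤ) + y.1.1 = 0
  · rw [gradedGram_apply b x y h, hb, hb, map_sum]
    refine sum_congr rfl fun z' _ => ?_
    rw [map_smul, map_sum, LinearMap.sum_apply, smul_eq_mul]
    congr 1
    refine sum_congr rfl fun z _ => ?_
    rw [gradedGram_apply v (⟨x.1.1, z.1⟩, z.2) (⟨y.1.1, z'.1⟩, z'.2) h, map_smul,
      LinearMap.smul_apply, smul_eq_mul]
  · rw [gradedGram_eq_zero b x y h]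
    refine (sum_eq_zero fun z' _ => ?_).symm
    rw [sum_eq_zero fun z _ => ?_, mul_zero]
    rw [gradedGram_eq_zero v (⟨x.1.1, z.1⟩, z.2) (⟨y.1.1, z'.1⟩, z'.2) h, mul_zero]

lemma card_le_of_det_ne_zero {α : Type*} [Fintype α] [DecidableEq α]
    (K : PairMatrix α ℂ) (hK : K.det ≠ 0) (p q : α → Prop)
    (h : ∀ x y, p x.1 → ¬ q y.1 → K x y = 0) : Nat.card {a // p a} ≤ Nat.card {a // q a} := by
  classical
  rw [det_apply] at hK
  obtain ⟨σ, -, hσ⟩ := Finset.exists_ne_zero_of_sum_ne_zero hK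
  have h1 : ∀ x : α × Fin 2, p (σ x).1 → q x.1 := fun x hx => by
    by_contra hq
    refine hσ ?_
    have h0 : ∏ i, K (σ i) i = 0 := Finset.prod_eq_zero (mem_univ x) (h _ _ hx hq)
    rw [h0, smul_zero]
  have h2 : Nat.card ({a // p a} × Fin 2) ≤ Nat.card ({a // q a} × Fin 2) := by
    refine Nat.card_le_card_of_injective (fun x => (⟨(σ.symm (x.1.1, x.2)).1, h1 _ (by
      rw [σ.apply_symm_apply]; exact x.1.2)⟩, (σ.symm (x.1.1, x.2)).2)) ?_
    rintro ⟨⟨a, ha⟩, ε⟩ ⟨⟨b, hb⟩, δ⟩ hab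
    simp only [Prod.mk.injEq, Subtype.mk.injEq] at hab
    have := σ.symm.injective (Prod.ext hab.1 hab.2)
    simp only [Prod.mk.injEq] at this ⊢
    exact ⟨Subtype.ext this.1, this.2⟩
  rw [Nat.card_prod, Nat.card_prod, Nat.card_eq_fintype_card (α := Fin 2), card_fin] at h2
  omega

section

variable {υ τ : ℤ → Type*}

variable (υ τ) in
/-- The index set of adapted bases in the degrees which belong to `T`, split in three parts. -/
def sumSigma (T : Set ℤ) : (Σ i : T, υ (i - 1)) ⊕ (Σ i : T, τ i) ⊕ (Σ i : T, υ i) ≃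
    Σ i : T, υ (i - 1) ⊕ τ i ⊕ υ i :=
  ((Equiv.refl _).sumCongr (Equiv.sigmaSumDistrib _ _).symm).trans (Equiv.sigmaSumDistrib _ _).symm

variable (υ) in
/-- The shift of the index set of boundaries. -/
def shiftSigma {T T' : Set ℤ} (hT : ∀ i, i + 1 ∈ T ↔ i ∈ T') : (Σ i : T, υ (i - 1)) ≃ Σ i : T', υ i :=
  Equiv.sigmaCongrLeft (β := fun i : T' => υ i)
    (⟨fun i => ⟨i - 1, (hT _).1 (by rw [sub_add_cancel]; exact i.2)⟩,
      fun i => ⟨i + 1, (hT _).2 i.2⟩, fun i => Subtype.ext (sub_add_cancel _ _),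
      fun i => Subtype.ext (add_sub_cancel_right _ _)⟩ : T ≃ T')

variable (k) in
/-- The Gram matrix of an adapted basis for the split index set. -/
def splitGram (v : ∀ i, (υ (i - 1) ⊕ τ i ⊕ υ i) × Fin 2 → N i) (T : Set ℤ) :
    Matrix (((Σ i : T, υ (i - 1)) ⊕ (Σ i : T, τ i) ⊕ (Σ i : T, υ i)) × Fin 2)
      (((Σ i : T, υ (i - 1)) ⊕ (Σ i : T, τ i) ⊕ (Σ i : T, υ i)) × Fin 2) ℂ :=
  (gradedGram k T v).submatrix ((sumSigma υ τ T).prodCongr (Equiv.refl (Fin 2)))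
    ((sumSigma υ τ T).prodCongr (Equiv.refl (Fin 2)))

variable (k) in
/-- The part of the Gram matrix of an adapted basis which pairs boundaries with their complement. -/
def outerGram (v : ∀ i, (υ (i - 1) ⊕ τ i ⊕ υ i) × Fin 2 → N i) (T : Set ℤ) :
    Matrix (((Σ i : T, υ (i - 1)) ⊕ (Σ i : T, υ i)) × Fin 2)
      (((Σ i : T, υ (i - 1)) ⊕ (Σ i : T, υ i)) × Fin 2) ℂ :=
  of fun x y => if x.1.isLeft = y.1.isLeft then 0 else
    splitGram k v T (x.1.map id inr, x.2) (y.1.map id inr, y.2)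

variable {v : ∀ i, (υ (i - 1) ⊕ τ i ⊕ υ i) × Fin 2 → N i}

lemma splitGram_transpose (hk : ∀ i j h h' x y, k j i h' y x = -k i j h x y) (T : Set ℤ) :
    (splitGram k v T)ᵀ = -splitGram k v T :=
  Matrix.ext fun x y => congrFun (congrFun (gradedGram_transpose hk v) _) _

lemma outerGram_transpose (hk : ∀ i j h h' x y, k j i h' y x = -k i j h x y) (T : Set ℤ) :
    (outerGram k v T)ᵀ = -outerGram k v T := by
  refine Matrix.ext fun x y => ?_
  change (if _ then _ else _) = -(if _ then _ else (_ : ℂ))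
  by_cases h : x.1.isLeft = y.1.isLeft
  · rw [if_pos h, if_pos h.symm, neg_zero]
  · rw [if_neg h, if_neg (Ne.symm h)]
    exact congrFun (congrFun (splitGram_transpose hk T) _) _

lemma splitGram_dual {S S' : Set ℤ} (hS : ∀ i, i + 1 ∈ S ↔ i ∈ S') (hS' : ∀ i, i + 1 ∈ S' ↔ i ∈ S)
    (δ : ∀ i j, N i →ₗ[ℂ] N j)
    (hδ : ∀ i' i j j' h h', i' + 1 = i → j + 1 = j' → ∀ x y,
      k i' j' h' x (δ j j' y) = k i j h (δ i' i x) y)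
    (hv : ∀ i a ε, δ (i - 1) i (v (i - 1) (inr (inr a), ε)) = v i (inl a, ε)) (a b ε ε') :
    splitGram k v S (inl a, ε) (inr (inr (shiftSigma υ hS' b)), ε') =
      splitGram k v S' (inr (inr (shiftSigma υ hS a)), ε) (inl b, ε') := by
  obtain ⟨i, a⟩ := a
  obtain ⟨j, b⟩ := b
  change (if h : (i : ℤ) + (j - 1) = 0 then k i (j - 1) h (v i (inl a, ε))
      (v (j - 1) (inr (inr b), ε')) else 0) = if h : (i : ℤ) - 1 + j = 0 then
    k (i - 1) j h (v (i - 1) (inr (inr a), ε)) (v j (inl b, ε')) else (0 : ℂ)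
  by_cases h : (i : ℤ) + (j - 1) = 0
  · rw [dif_pos h, dif_pos (by omega), ← hv i, ← hv j]
    exact (hδ (i - 1) i (j - 1) j h (by omega) (by omega) (by omega) _ _).symm
  · rw [dif_neg h, dif_neg (by omega)]

lemma pfm_outerGram {S S' : Set ℤ} [Fintype (Σ i : S, υ (i - 1))] [DecidableEq (Σ i : S, υ (i - 1))]
    [Fintype (Σ i : S, υ i)] [DecidableEq (Σ i : S, υ i)] [Fintype (Σ i : S', υ (i - 1))]
    [DecidableEq (Σ i : S', υ (i - 1))] [Fintype (Σ i : S', υ i)] [DecidableEq (Σ i : S', υ i)]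
    (hk : ∀ i j h h' x y, k j i h' y x = -k i j h x y)
    (hS : ∀ i, i + 1 ∈ S ↔ i ∈ S') (hS' : ∀ i, i + 1 ∈ S' ↔ i ∈ S) (δ : ∀ i j, N i →ₗ[ℂ] N j)
    (hδ : ∀ i' i j j' h h', i' + 1 = i → j + 1 = j' → ∀ x y,
      k i' j' h' x (δ j j' y) = k i j h (δ i' i x) y)
    (hv : ∀ i a ε, δ (i - 1) i (v (i - 1) (inr (inr a), ε)) = v i (inl a, ε)) :
    pfm (outerGram k v S) = pfm (outerGram k v S') := by
  let g : (Σ i : S, υ (i - 1)) ⊕ (Σ i : S, υ i) ≃ (Σ i : S', υ (i - 1)) ⊕ (Σ i : S', υ i) :=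
    ((shiftSigma υ hS).sumCongr (shiftSigma υ hS').symm).trans (sumComm _ _)
  have h1 : ∀ x ε y ε', outerGram k v S (inl x, ε) (inr y, ε') =
      outerGram k v S' (g (inl x), ε) (g (inr y), ε') := fun x ε y ε' => by
    obtain ⟨y, rfl⟩ := (shiftSigma υ hS').surjective y
    have h := splitGram_dual hS hS' δ hδ hv x y ε ε'
    have hg : g (inr (shiftSigma υ hS' y)) = inl y :=
      congrArg inl ((shiftSigma υ hS').symm_apply_apply y)
    rw [hg]
    exact h
  rw [← pfm_reindex g]
  congr 1
  refine Matrix.ext fun x y => ?_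
  obtain ⟨x | x, ε⟩ := x <;> obtain ⟨y | y, ε'⟩ := y
  · rfl
  · exact h1 x ε y ε'
  · have h2 := congrFun (congrFun (outerGram_transpose (v := v) hk S) (inl y, ε')) (inr x, ε)
    have h3 := congrFun (congrFun (outerGram_transpose (v := v) hk S') (g (inl y), ε'))
      (g (inr x), ε)
    exact h2.trans ((congrArg Neg.neg (h1 y ε' x ε)).trans h3.symm)
  · rfl

lemma splitGram_inl_inl (h0 : ∀ i j h a b ε ε', k i j h (v i (inl a, ε)) (v j (inl b, ε')) = 0)
    (T : Set ℤ) (a b ε ε') : splitGram k v T (inl a, ε) (inl b, ε') = 0 := by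
  change (if h : (a.1 : ℤ) + b.1 = 0 then k _ _ h (v _ (inl a.2, ε)) (v _ (inl b.2, ε'))
    else 0) = (0 : ℂ)
  split_ifs with h
  · exact h0 _ _ h _ _ _ _
  · rfl

lemma splitGram_inl_inr
    (h1 : ∀ i j h a b ε ε', k i j h (v i (inl a, ε)) (v j (inr (inl b), ε')) = 0)
    (T : Set ℤ) (a b ε ε') : splitGram k v T (inl a, ε) (inr (inl b), ε') = 0 := by
  change (if h : (a.1 : ℤ) + b.1 = 0 then k _ _ h (v _ (inl a.2, ε))
    (v _ (inr (inl b.2), ε')) else 0) = (0 : ℂ)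
  split_ifs with h
  · exact h1 _ _ h _ _ _ _
  · rfl

lemma card_le_of_splitGram (T : Set ℤ) [Fintype (Σ i : T, υ (i - 1))]
    [DecidableEq (Σ i : T, υ (i - 1))] [Fintype (Σ i : T, υ i)] [DecidableEq (Σ i : T, υ i)]
    [Fintype (Σ i : T, τ i)] [DecidableEq (Σ i : T, τ i)] (hT : (splitGram k v T).det ≠ 0)
    (h0 : ∀ i j h a b ε ε', k i j h (v i (inl a, ε)) (v j (inl b, ε')) = 0)
    (h1 : ∀ i j h a b ε ε', k i j h (v i (inl a, ε)) (v j (inr (inl b), ε')) = 0) :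
    card (Σ i : T, υ (i - 1)) ≤ card (Σ i : T, υ i) := by
  let f : (Σ i : T, υ (i - 1)) → (Σ i : T, υ (i - 1)) ⊕ (Σ i : T, τ i) ⊕ (Σ i : T, υ i) := inl
  let f' : (Σ i : T, υ i) → (Σ i : T, υ (i - 1)) ⊕ (Σ i : T, τ i) ⊕ (Σ i : T, υ i) :=
    fun y => inr (inr y)
  have h := card_le_of_det_ne_zero (splitGram k v T) hT (· ∈ Set.range f) (· ∈ Set.range f') ?_
  · rw [← Nat.card_eq_fintype_card, ← Nat.card_eq_fintype_card,
      Nat.card_congr (Equiv.ofInjective f Sum.inl_injective),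
      Nat.card_congr (Equiv.ofInjective f' (Sum.inr_injective.comp Sum.inr_injective))]
    exact h
  · rintro ⟨_, ε⟩ ⟨y | y | y, ε'⟩ ⟨x, rfl⟩ hy
    · exact splitGram_inl_inl h0 T _ _ _ _
    · exact splitGram_inl_inr h1 T _ _ _ _
    · exact absurd ⟨y, rfl⟩ hy

lemma pfm_gradedGram_mul {S S' : Set ℤ} (hS : ∀ i, i + 1 ∈ S ↔ i ∈ S')
    (hS' : ∀ i, i + 1 ∈ S' ↔ i ∈ S)
    [Fintype (Σ i : S, υ (i - 1) ⊕ τ i ⊕ υ i)] [DecidableEq (Σ i : S, υ (i - 1) ⊕ τ i ⊕ υ i)]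
    [Fintype (Σ i : S', υ (i - 1) ⊕ τ i ⊕ υ i)] [DecidableEq (Σ i : S', υ (i - 1) ⊕ τ i ⊕ υ i)]
    [Fintype (Σ i : S, τ i)] [DecidableEq (Σ i : S, τ i)] [Fintype (Σ i : S', τ i)]
    [DecidableEq (Σ i : S', τ i)]
    (hk : ∀ i j h h' x y, k j i h' y x = -k i j h x y) (δ : ∀ i j, N i →ₗ[ℂ] N j)
    (hδ : ∀ i' i j j' h h', i' + 1 = i → j + 1 = j' → ∀ x y,
      k i' j' h' x (δ j j' y) = k i j h (δ i' i x) y)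
    (hv : ∀ i a ε, δ (i - 1) i (v (i - 1) (inr (inr a), ε)) = v i (inl a, ε))
    (h0 : ∀ i j h a b ε ε', k i j h (v i (inl a, ε)) (v j (inl b, ε')) = 0)
    (h1 : ∀ i j h a b ε ε', k i j h (v i (inl a, ε)) (v j (inr (inl b), ε')) = 0)
    (hd : (gradedGram k S v).det ≠ 0) (hd' : (gradedGram k S' v).det ≠ 0) :
    ∃ c : ℂ, c ≠ 0 ∧
      pfm (gradedGram k S v) = c * pfm (gradedGram k S fun i x => v i (inr (inl x.1), x.2)) ∧
      pfm (gradedGram k S' v) = c * pfm (gradedGram k S' fun i x => v i (inr (inl x.1), x.2)) ∧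
      (gradedGram k S fun i x => v i (inr (inl x.1), x.2)).det ≠ 0 ∧
      (gradedGram k S' fun i x => v i (inr (inl x.1), x.2)).det ≠ 0 := by
  classical
  have hfin : ∀ T : Set ℤ, Finite (Σ i : T, υ (i - 1) ⊕ τ i ⊕ υ i) →
      Finite (Σ i : T, υ (i - 1)) ∧ Finite (Σ i : T, υ i) := fun T hf =>
    ⟨Finite.of_injective _ ((sumSigma υ τ T).injective.comp Sum.inl_injective),
      Finite.of_injective _ ((sumSigma υ τ T).injective.comp
        (Sum.inr_injective.comp Sum.inr_injective))⟩
  obtain ⟨_, _⟩ := hfin S inferInstance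
  obtain ⟨_, _⟩ := hfin S' inferInstance
  let _ := ofFinite (Σ i : S, υ (i - 1))
  let _ := ofFinite (Σ i : S, υ i)
  let _ := ofFinite (Σ i : S', υ (i - 1))
  let _ := ofFinite (Σ i : S', υ i)
  have hKd : (splitGram k v S).det ≠ 0 := by rwa [splitGram, det_submatrix_equiv_self]
  have hKd' : (splitGram k v S').det ≠ 0 := by rwa [splitGram, det_submatrix_equiv_self]
  have hc1 := card_congr (shiftSigma υ hS)
  have hc2 := card_congr (shiftSigma υ hS')
  have hc3 := card_le_of_splitGram S hKd h0 h1
  have hc4 := card_le_of_splitGram S' hKd' h0 h1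
  obtain ⟨p1, p2, p3⟩ := pfm_eq_mul_of_antitriangular (by omega) (splitGram k v S)
    (splitGram_transpose hk S) hKd (splitGram_inl_inl h0 S) (splitGram_inl_inr h1 S)
    (outerGram k v S) fun _ _ => rfl
  obtain ⟨q1, -, q3⟩ := pfm_eq_mul_of_antitriangular (by omega) (splitGram k v S')
    (splitGram_transpose hk S') hKd' (splitGram_inl_inl h0 S') (splitGram_inl_inr h1 S')
    (outerGram k v S') fun _ _ => rfl
  refine ⟨pfm (outerGram k v S), p2, (pfm_reindex (sumSigma υ τ S) _).symm.trans p1, ?_, p3, q3⟩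
  rw [pfm_outerGram hk hS hS' δ hδ hv]
  exact (pfm_reindex (sumSigma υ τ S') _).symm.trans q1

end

end

section

variable {L M N : Type v} [AddCommGroup L] [Module ℤ[G] L]
  [AddCommGroup M] [Module ℤ[G] M] [AddCommGroup N] [Module ℤ[G] N]

/-- The `A`-linear extension of a homomorphism of `ℤ[G]`-modules. -/
def mapOver (A : Type*) [CommRing A] (f : M →ₗ[ℤ[G]] N) : A ⊗[ℤ] M →ₗ[A] A ⊗[ℤ] N :=
  f.toAddMonoidHom.toIntLinearMap.baseChange A

variable (A : Type*) [CommRing A]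

lemma mapOver_rep (f : M →ₗ[ℤ[G]] N) (g : G) (x : A ⊗[ℤ] M) :
    mapOver A f (repOver A M g x) = repOver A N g (mapOver A f x) := by
  exact x.induction_on (by simp only [map_zero]) (fun q m => congrArg (q ⊗ₜ[ℤ] ·) (f.map_smul (MonoidAlgebra.of ℤ G g) m))
    fun x y hx hy => by simp only [map_add, hx, hy]

lemma mapOver_comp (f : L →ₗ[ℤ[G]] M) (f' : M →ₗ[ℤ[G]] N)
    (x : A ⊗[ℤ] L) : mapOver A f' (mapOver A f x) = mapOver A (f' ∘ₗ f) x := by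
  exact x.induction_on (by simp only [map_zero]) (fun q m => rfl)
    fun x y hx hy => by simp only [map_add, hx, hy]

lemma mapOver_add (f f' : M →ₗ[ℤ[G]] N) (x : A ⊗[ℤ] M) :
    mapOver A (f + f') x = mapOver A f x + mapOver A f' x := by
  exact x.induction_on (by simp only [map_zero, add_zero]) (fun q m => tmul_add _ _ _)
    fun x y hx hy => by rw [map_add, map_add, map_add, hx, hy]; abel

lemma mapOver_zero (x : A ⊗[ℤ] M) : mapOver A (0 : M →ₗ[ℤ[G]] N) x = 0 := by
  exact x.induction_on (by simp only [map_zero]) (fun q m => tmul_zero _ _)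
    fun x y hx hy => by simp only [map_add, hx, hy, add_zero]

lemma mapOver_id (x : A ⊗[ℤ] M) : mapOver A (LinearMap.id : M →ₗ[ℤ[G]] M) x = x := by
  exact x.induction_on (by simp only [map_zero]) (fun q m => rfl)
    fun x y hx hy => by simp only [map_add, hx, hy]

lemma fromBase_mapOver {A B : Type*} [CommRing A] [CommRing B] [Algebra A B]
    (f : M →ₗ[ℤ[G]] N) (x : A ⊗[ℤ] M) :
    fromBase A B N (mapOver A f x) = mapOver B f (fromBase A B M x) := by
  exact x.induction_on (by simp only [map_zero]) (fun q m => rfl)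
    fun x y hx hy => by simp only [map_add, hx, hy]

/-- The isomorphism of tensor products defined by an isomorphism of modules. -/
def equivOver (Φ : M ≃ₗ[ℤ[G]] N) : A ⊗[ℤ] M ≃ₗ[A] A ⊗[ℤ] N :=
  LinearEquiv.ofLinearMap (mapOver A Φ.toLinearMap) (mapOver A Φ.symm.toLinearMap)
    (LinearMap.ext fun x => by
      rw [LinearMap.comp_apply, mapOver_comp, LinearEquiv.comp_symm, mapOver_id]; rfl)
    (LinearMap.ext fun x => by
      rw [LinearMap.comp_apply, mapOver_comp, LinearEquiv.symm_comp, mapOver_id]; rfl)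

lemma IsGroupBasis.mapOver {A : Type*} [CommRing A] (Φ : M ≃ₗ[ℤ[G]] N) {ι : Type*}
    {a : ι → A ⊗[ℤ] M} [Fintype ι] (h : IsGroupBasis (G := G) (repOver A M) a) :
    IsGroupBasis (G := G) (repOver A N) fun x => mapOver A Φ.toLinearMap (a x) :=
  h.map (equivOver A Φ) (mapOver_rep A _)

lemma exists_directSum_basis {R o : Type*} [DecidableEq o] [Semiring R] {X : o → Type*}
    [∀ i, AddCommMonoid (X i)] [∀ i, Module R (X i)] {η : o → Type*}
    (b : ∀ i, Basis (η i) R (X i)) :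
    ∃ B : Basis (Σ i, η i) R (⨁ i, X i), ∀ x, B x = DirectSum.lof R o X x.1 (b x.1 x.2) := by
  classical
  refine ⟨DFinsupp.basis b, fun x => Basis.apply_eq_iff.2 ?_⟩
  refine (LinearEquiv.symm_apply_eq _).2 ?_
  refine (DFinsupp.mapRange_single (f := fun i => (b i).repr) (hf := fun i => map_zero _)).trans ?_
  rw [repr_self]
  exact (sigmaFinsuppEquivDFinsupp_single x 1).symm

lemma directSumRight_symm_lof {A : Type*} [CommRing A] {o : Type} [DecidableEq o]
    {X : o → Type v} [∀ i, AddCommGroup (X i)] [∀ i, Module ℤ[G] (X i)] (i : o)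
    (y : A ⊗[ℤ] X i) : (TensorProduct.directSumRight ℤ A A X).symm
      (DirectSum.lof A o (fun i => A ⊗[ℤ] X i) i y) =
      HermEuler.mapOver A (DirectSum.lof ℤ[G] o X i) y := by
  exact y.induction_on (by simp only [map_zero]) (fun q m => TensorProduct.directSumRight_symm_lof_tmul ℤ A q i m)
    fun x y hx hy => by simp only [map_add, hx, hy]

lemma IsGroupBasis.tensor_directSum {A : Type*} [CommRing A] {o : Type} [DecidableEq o]
    {X : o → Type v} [∀ i, AddCommGroup (X i)] [∀ i, Module ℤ[G] (X i)]
    {ι : o → Type*} [∀ i, Fintype (ι i)] {a : ∀ i, ι i → A ⊗[ℤ] X i}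
    (h : ∀ i, IsGroupBasis (G := G) (repOver A (X i)) (a i)) :
    IsGroupBasis (G := G) (repOver A (⨁ i, X i)) fun x : Σ i, ι i =>
      HermEuler.mapOver A (DirectSum.lof ℤ[G] o X x.1) (a x.1 x.2) := by
  obtain ⟨B, hB⟩ := exists_directSum_basis fun i => (h i).basis
  let e : G × (Σ i, ι i) ≃ Σ i, G × ι i :=
    ⟨fun x => ⟨x.2.1, x.1, x.2.2⟩, fun x => (x.2.1, ⟨x.1, x.2.2⟩), fun _ => rfl, fun _ => rfl⟩
  refine IsGroupBasis.of_basis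
    ((B.map (TensorProduct.directSumRight ℤ A A X).symm).reindex e.symm) fun x => ?_
  rw [Basis.reindex_apply, Basis.map_apply, hB, directSumRight_symm_lof (G := G), ← mapOver_rep,
    (h _).basis_apply]
  rfl

end

section

variable {M M' : Type v} [AddCommGroup M]
  [Module ℤ[G] M] [AddCommGroup M'] [Module ℤ[G] M']
  {ι ι' : Type*} [Fintype ι] [DecidableEq ι] [Fintype ι']

lemma exists_transport (Φ : M ≃ₗ[ℤ[G]] M') {a0 : ι → ℚ ⊗[ℤ] M}
    {a0' : ι' → ℚ ⊗[ℤ] M'} (h0 : IsGroupBasis (G := G) (repOver ℚ M) a0)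
    (h0' : IsGroupBasis (G := G) (repOver ℚ M') a0')
    {ap : ∀ p : Primes, ι → ℤ_[p] ⊗[ℤ] M} {ap' : ∀ p : Primes, ι' → ℤ_[p] ⊗[ℤ] M'}
    (hp : ∀ p : Primes, IsGroupBasis (G := G) (repOver ℤ_[p] M) (ap p))
    (hp' : ∀ p : Primes, IsGroupBasis (G := G) (repOver ℤ_[p] M') (ap' p))
    {lam : ∀ p : Primes, Matrix ι ι ℚ_[p][G]}
    {lam' : ∀ p : Primes, Matrix ι' ι' ℚ_[p][G]}
    (hl : ∀ p : Primes, mact (repOver ℚ_[p] M) (lam p) (fun k => fromZp p M (ap p k)) =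
      fun j => fromQ p M (a0 j))
    (hl' : ∀ p : Primes, mact (repOver ℚ_[p] M') (lam' p) (fun k => fromZp p M' (ap' p k)) =
      fun j => fromQ p M' (a0' j)) :
    ∃ (e : ι ≃ ι') (X : (Matrix ι ι ℚ[G])ˣ)
      (Y : ∀ p : Primes, (Matrix ι ι ℤ_[p][G])ˣ),
      (∀ j, mapOver ℚ Φ.toLinearMap (a0 j) = mact (repOver ℚ M') X.1 (a0' ∘ e) j) ∧
      ∀ p : Primes, lam p * (Y p).1.map (toQp G p) =
        X.1.map (MonoidAlgebra.mapRingHom G (algebraMap ℚ ℚ_[p])) * (lam' p).submatrix e e := by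
  let e := equivOfCardEq ((h0.mapOver Φ).card_eq h0')
  obtain ⟨X, hX⟩ := (h0'.reindex e).exists_unit_matrix (h0.mapOver Φ)
  choose Y hY using fun p => ((hp' p).reindex e).exists_unit_matrix ((hp p).mapOver Φ)
  refine ⟨e, X, Y, fun j => (congrFun hX j).symm, fun p => ?_⟩
  have hb : IsGroupBasis (G := G) (repOver ℚ_[p] M') fun k => fromZp p M' ((ap' p ∘ e) k) := by
    simp only [fromZp_eq]
    exact ((hp' p).reindex e).baseChange
  refine hb.mact_injective ?_
  have h1 : mact (repOver ℚ_[p] M') ((lam' p).submatrix e e)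
      (fun k => fromZp p M' ((ap' p ∘ e) k)) = fun j => fromQ p M' ((a0' ∘ e) j) := by
    funext j
    refine Eq.trans ?_ (congrFun (hl' p) (e j))
    exact sum_equiv e _ _ fun _ => rfl
  have h2 : mact (repOver ℚ_[p] M') ((Y p).1.map (toQp G p))
      (fun k => fromZp p M' ((ap' p ∘ e) k)) =
      fun k => mapOver ℚ_[p] Φ.toLinearMap (fromZp p M (ap p k)) := by
    funext k
    simp only [fromZp_eq]
    rw [← fromBase_mapOver, ← congrFun (hY p) k]
    exact (fromBase_mact _ _ _).symm
  rw [mact_mul, mact_mul, h1, h2, ← mact_map _ (mapOver_rep _ _), hl p]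
  funext j
  simp only [fromQ_eq]
  rw [← fromBase_mapOver, ← congrFun hX j]
  exact fromBase_mact _ _ _

end

section

variable {L M N : Type v} [AddCommGroup L] [Module ℤ[G] L]
  [AddCommGroup M] [Module ℤ[G] M] [AddCommGroup N] [Module ℤ[G] N]
  (W : SymplecticRep G)

/-- The map on invariants defined by a homomorphism of `ℤ[G]`-modules. -/
def invOver (f : M →ₗ[ℤ[G]] N) :
    Inv W.ρ (repO ℚ M) →ₗ[ℂ] Inv W.ρ (repO ℚ N) :=
  invMap W.ρ (mapOver ℚ f) (mapOver_rep ℚ f)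

lemma invOver_comp (f : L →ₗ[ℤ[G]] M) (f' : M →ₗ[ℤ[G]] N)
    (x : Inv W.ρ (repO ℚ L)) : invOver W f' (invOver W f x) = invOver W (f' ∘ₗ f) x :=
  Subtype.ext ((tmap_tmap W.n _ _ _).trans (congrArg (fun h => tmap W.n h x.1)
    (LinearMap.ext fun y => mapOver_comp ℚ f f' y)))

lemma invOver_zero (x : Inv W.ρ (repO ℚ M)) :
    invOver W (0 : M →ₗ[ℤ[G]] N) x = 0 :=
  Subtype.ext ((congrArg (fun h => tmap W.n h x.1)
    (LinearMap.ext fun y => mapOver_zero ℚ y)).trans (tmap_zero W.n x.1))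

lemma invOver_add (f f' : M →ₗ[ℤ[G]] N) (x : Inv W.ρ (repO ℚ M)) :
    invOver W (f + f') x = invOver W f x + invOver W f' x := by
  refine Subtype.ext ((congrArg (fun h => tmap W.n h x.1)
    (LinearMap.ext fun y => mapOver_add ℚ f f' y : _ = mapOver ℚ f + mapOver ℚ f')).trans ?_)
  change _ = tmap W.n (mapOver ℚ f) x.1 + tmap W.n (mapOver ℚ f') x.1
  generalize x.1 = y
  exact y.induction_on (by simp only [map_zero, add_zero]) (fun q m => tmul_add _ _ _)
    fun x y hx hy => by rw [map_add, map_add, map_add, hx, hy]; abel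

lemma invOver_id (x : Inv W.ρ (repO ℚ M)) :
    invOver W (LinearMap.id : M →ₗ[ℤ[G]] M) x = x := by
  refine Subtype.ext ((congrArg (fun h => tmap W.n h x.1)
    (LinearMap.ext fun y => mapOver_id ℚ y : _ = LinearMap.id)).trans ?_)
  exact LinearMap.congr_fun TensorProduct.AlgebraTensorModule.map_id x.1

end

section

lemma det_submatrix_pairs {α β : Type*} [Fintype α] [DecidableEq α] [Fintype β] [DecidableEq β]
    (C : Matrix (β × Fin 2) (β × Fin 2) ℂ) (π h : α ≃ β) :
    (C.submatrix (fun x : α × Fin 2 => (π x.1, x.2)) fun x => (h x.1, x.2)).det = C.det := by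
  have h1 := det_permute (Equiv.prodCongrLeft fun _ : Fin 2 => π.trans h.symm)
    (C.submatrix (h.prodCongr (Equiv.refl (Fin 2))) (h.prodCongr (Equiv.refl (Fin 2))))
  rw [Equiv.Perm.sign_prodCongrLeft, prod_const, card_univ, card_fin,
    Int.units_sq, det_submatrix_equiv_self, Units.val_one, Int.cast_one, one_mul] at h1
  rw [← h1]
  congr 1
  ext x y
  change _ = C (h (h.symm (π x.1)), x.2) _
  rw [Equiv.apply_symm_apply]
  rfl

variable (W : SymplecticRep G) {o : Type} [DecidableEq o]
  {X X' : o → Type v} [∀ i, AddCommGroup (X i)] [∀ i, Module ℤ[G] (X i)]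
  [∀ i, AddCommGroup (X' i)] [∀ i, Module ℤ[G] (X' i)]
  {ι ι' J J' : o → Type} [∀ i, Fintype (ι i)] [∀ i, Fintype (ι' i)]
  [Fintype (Σ i, ι i)] [DecidableEq (Σ i, ι i)] [Fintype (Σ i, ι' i)]
  [∀ i, Fintype (J i)] [∀ i, DecidableEq (J i)] [∀ i, Fintype (J' i)] [∀ i, DecidableEq (J' i)]

/-- The basis of a direct sum of tensor products which belongs to bases of the summands. -/
def directFam {A : Type*} [CommRing A] (a : ∀ i, ι i → A ⊗[ℤ] X i) (x : Σ i, ι i) :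
    A ⊗[ℤ] (⨁ i, X i) :=
  mapOver A (DirectSum.lof ℤ[G] o X x.1) (a x.1 x.2)

lemma sum_sigmaBlock_bfam [Fintype (Σ i, J i)] [DecidableEq (Σ i, J i)]
    (a : ∀ i, ι i → ℚ ⊗[ℤ] X i) (e : ∀ i, ι i × Fin W.k ≃ J i)
    (T : ∀ i, Matrix (J i × Fin 2) (J i × Fin 2) ℂ)
    (v : ∀ i, J i × Fin 2 → Inv W.ρ (repO ℚ (X i)))
    (hv : ∀ i x, v i x = ∑ y, T i x y • bfam W (repO ℚ (X i)) (a i)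
      ((e i).symm y.1, y.2)) (k : (Σ i, J i) × Fin 2) :
    invOver W (DirectSum.lof ℤ[G] o X k.1.1) (v k.1.1 (k.1.2, k.2)) =
      ∑ y, sigmaBlock T k y • bfam W (repO ℚ (⨁ i, X i)) (directFam (G := G) a)
        ((⟨y.1.1, ((e _).symm y.1.2).1⟩, ((e _).symm y.1.2).2), y.2) := by
  refine Eq.trans ?_ (sum_sigmaBlock (N := Inv W.ρ (repO ℚ (⨁ i, X i))) T k
    fun y => bfam W (repO ℚ (⨁ i, X i)) (directFam (G := G) a)
      ((⟨y.1.1, ((e _).symm y.1.2).1⟩, ((e _).symm y.1.2).2), y.2)).symm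
  rw [hv, map_sum]
  refine sum_congr rfl fun y _ => ?_
  rw [map_smul]
  congr 1
  exact invMap_bfam W _ _ _ _

lemma prod_det_transport (Φ : (⨁ i, X i) ≃ₗ[ℤ[G]] ⨁ i, X' i)
    {a : ∀ i, ι i → ℚ ⊗[ℤ] X i} {a' : ∀ i, ι' i → ℚ ⊗[ℤ] X' i}
    (ha' : ∀ i, IsGroupBasis (G := G) (repOver ℚ (X' i)) (a' i))
    {E : (Σ i, ι i) ≃ Σ i, ι' i} {Y : Matrix (Σ i, ι i) (Σ i, ι i) ℚ[G]}
    (hY : IsUnit Y) (hΦ : ∀ j, mapOver ℚ Φ.toLinearMap (directFam (G := G) a j) =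
      mact (repOver ℚ (⨁ i, X' i)) Y (directFam (G := G) a' ∘ E) j)
    (e : ∀ i, ι i × Fin W.k ≃ J i) (e' : ∀ i, ι' i × Fin W.k ≃ J' i)
    {T : ∀ i, Matrix (J i × Fin 2) (J i × Fin 2) ℂ} {T' : ∀ i, Matrix (J' i × Fin 2) (J' i × Fin 2) ℂ}
    (hT : ∀ i, (T i).det ≠ 0) (v : ∀ i, J i × Fin 2 → Inv W.ρ (repO ℚ (X i)))
    (v' : ∀ i, J' i × Fin 2 → Inv W.ρ (repO ℚ (X' i)))
    (hv : ∀ i x, v i x = ∑ y, T i x y • bfam W (repO ℚ (X i)) (a i)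
      ((e i).symm y.1, y.2))
    (hv' : ∀ i x, v' i x = ∑ y, T' i x y • bfam W (repO ℚ (X' i)) (a' i)
      ((e' i).symm y.1, y.2))
    (hπ : ∀ k : Σ i, J i, ∃ k' : Σ i, J' i, ∀ ε,
      invOver W Φ.toLinearMap (invOver W (DirectSum.lof ℤ[G] o X k.1) (v k.1 (k.2, ε))) =
        invOver W (DirectSum.lof ℤ[G] o X' k'.1) (v' k'.1 (k'.2, ε))) :
    (∏ᶠ i, (T i).det) * detC W.ρ Y = ∏ᶠ i, (T' i).det := by
  classical
  let t : ∀ (κ K : o → Type), (∀ i, κ i × Fin W.k ≃ K i) → (Σ i, κ i) × Fin W.k ≃ Σ i, K i :=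
    fun κ K e => ⟨fun x => ⟨x.1.1, e _ (x.1.2, x.2)⟩,
      fun y => (⟨y.1, ((e _).symm y.2).1⟩, ((e _).symm y.2).2), fun x => by simp, fun x => by simp⟩
  let q := t ι J e
  let q' := t ι' J' e'
  let _ : Fintype (Σ i, J i) := Fintype.ofEquiv _ q
  let _ : Fintype (Σ i, J' i) := Fintype.ofEquiv _ q'
  let h : (Σ i, ι i) × Fin W.k ≃ Σ i, J' i := (E.prodCongr (Equiv.refl _)).trans q'
  choose π hπ using hπ
  obtain ⟨B, hB⟩ := ((IsGroupBasis.tensor_directSum ha').reindex E).exists_bfam_basis W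
  let R : Matrix ((Σ i, J i) × Fin 2) (((Σ i, ι i) × Fin W.k) × Fin 2) ℂ :=
    sigmaBlock T * (invMatrix W Y).submatrix (fun y => (q.symm y.1, y.2)) id
  have h1 : ∀ k, ∑ z, R k z • B z =
      ∑ z, (sigmaBlock T').submatrix (fun k => (π k.1, k.2)) (fun z => (h z.1, z.2)) k z • B z := by
    intro k
    have hl := congrArg (invOver W Φ.toLinearMap) (sum_sigmaBlock_bfam W a e T v hv k)
    have hr := sum_sigmaBlock_bfam W a' e' T' v' hv' (π k.1, k.2)
    rw [← hπ k.1 k.2] at hr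
    refine Eq.trans ?_ ((hl.symm.trans hr).trans ?_)
    · have hRk : ∀ z, R k z = ∑ y, sigmaBlock T k y * invMatrix W Y (q.symm y.1, y.2) z := fun _ => rfl
      rw [map_sum]
      simp only [map_smul, hRk, Finset.sum_smul]
      rw [sum_comm]
      refine sum_congr rfl fun y _ => ?_
      simp only [mul_smul, ← smul_sum]
      congr 1
      refine Eq.trans ?_ (invMap_bfam W _ _ _ _).symm
      rw [show (fun j => mapOver ℚ Φ.toLinearMap (directFam (G := G) a j)) = _ from funext hΦ,
        bfam_mact]
      refine sum_congr rfl fun z _ => ?_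
      rw [hB]
      rfl
    · refine (sum_equiv (h.prodCongr (Equiv.refl (Fin 2))) _ _ fun z => ?_).symm
      rw [hB]
      congr 1
      change bfam W _ _ _ = bfam W _ _ ((q'.symm (h z.1)), z.2)
      rw [show q'.symm (h z.1) = (E z.1.1, z.1.2) from q'.symm_apply_apply _]
      rfl
  have h2 : R = (sigmaBlock T').submatrix (fun k => (π k.1, k.2)) (fun z => (h z.1, z.2)) :=
    Matrix.ext fun k z => congrFun (B.equivFun.symm.injective
      (by simpa only [Basis.equivFun_symm_apply] using h1 k)) z
  let s : (Σ i, J i) × Fin 2 ≃ ((Σ i, ι i) × Fin W.k) × Fin 2 := q.symm.prodCongr (Equiv.refl _)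
  have hR : (R.submatrix id s).det = (∏ᶠ i, (T i).det) * detC W.ρ Y := by
    rw [← det_invMatrix, ← det_sigmaBlock, ← det_submatrix_equiv_self s (invMatrix W Y), ← det_mul]
    rfl
  have hne : (R.submatrix id s).det ≠ 0 := by
    rw [hR]
    refine mul_ne_zero ?_ (detM_ne_zero _ hY)
    rw [← det_sigmaBlock, det_sigmaBlock]
    exact finprod_induction (· ≠ 0) one_ne_zero (fun _ _ => mul_ne_zero) hT
  have hinj : Function.Injective π := by
    intro k k' hk
    by_contra hkk
    refine hne (det_zero_of_row_eq (i := (k, 0)) (j := (k', 0))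
      (fun H => hkk (congrArg Prod.fst H)) ?_)
    funext z
    rw [h2]
    change sigmaBlock T' (π k, 0) _ = sigmaBlock T' (π k', 0) _
    rw [hk]
  let π' : (Σ i, J i) ≃ Σ i, J' i := Equiv.ofBijective π
    ((Fintype.bijective_iff_injective_and_card π).2 ⟨hinj, card_congr (q.symm.trans h)⟩)
  rw [← hR, h2, ← det_sigmaBlock, ← det_submatrix_pairs (sigmaBlock T') π' (q.symm.trans h)]
  rfl

end

section

variable (P A : CochainComplex (ModuleCat.{v} ℤ[G]) ℤ)

/-- A complex and its sum with another complex. -/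
def pairC : Bool → CochainComplex (ModuleCat.{v} ℤ[G]) ℤ
  | false => P
  | true => dirSum P A

/-- The inclusion of a complex in the sum and the projection of the sum. -/
def swapMap : ∀ (c c' : Bool) (i : ℤ),
    (pairC P A c).X i →ₗ[ℤ[G]] (pairC P A c').X i
  | false, true, i => LinearMap.inl ℤ[G] (P.X i) (A.X i)
  | true, false, i => fst ℤ[G] (P.X i) (A.X i)
  | false, false, _ => 0
  | true, true, _ => 0

variable {A} in
/-- A map between terms of the second summand, on the terms of the sum. -/
def offMap (f : ∀ i j, A.X i →ₗ[ℤ[G]] A.X j) : ∀ (c c' : Bool) (i j : ℤ),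
    (pairC P A c).X i →ₗ[ℤ[G]] (pairC P A c').X j
  | true, true, i, j => LinearMap.inr ℤ[G] (P.X j) (A.X j) ∘ₗ f i j ∘ₗ
      snd ℤ[G] (P.X i) (A.X i)
  | false, _, _, _ => 0
  | true, false, _, _ => 0

variable {P A}

lemma offMap_swapMap (f : ∀ i j, A.X i →ₗ[ℤ[G]] A.X j) (c c' c'' : Bool) (i j : ℤ)
    (z : (pairC P A c).X i) : offMap P f c' c'' i j (swapMap P A c c' i z) = 0 := by
  cases c <;> cases c' <;> cases c''
  all_goals first
    | rfl
    | exact map_zero (offMap P f _ _ i j)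
    | exact (congrArg (fun y => ((0, y) : P.X j × A.X j)) (map_zero (f i j)))

lemma swapMap_offMap (f : ∀ i j, A.X i →ₗ[ℤ[G]] A.X j) (c c' c'' : Bool) (i j : ℤ)
    (z : (pairC P A c).X i) : swapMap P A c' c'' j (offMap P f c c' i j z) = 0 := by
  cases c <;> cases c' <;> cases c'' <;> rfl

lemma offMap_offMap {f : ∀ i j, A.X i →ₗ[ℤ[G]] A.X j} {i j k : ℤ}
    (hf : ∀ x, f j k (f i j x) = 0) (c c' c'' : Bool) (z : (pairC P A c).X i) :
    offMap P f c' c'' j k (offMap P f c c' i j z) = 0 := by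
  cases c <;> cases c' <;> cases c''
  all_goals first
    | rfl
    | exact map_zero (offMap P f _ _ j k)
    | exact (congrArg (fun y => ((0, y) : P.X k × A.X k)) (hf _))

variable (A) in
/-- The differentials of a complex as a family of linear maps. -/
def diffMap (i j : ℤ) : A.X i →ₗ[ℤ[G]] A.X j := (A.d i j).hom

variable {s : ∀ i j, A.X i →ₗ[ℤ[G]] A.X j}

lemma swapMap_swapMap {i k l : ℤ}
    (hs : ∀ x, s k i (diffMap A i k x) + diffMap A l i (s i l x) = x) (c c' c₁ c₂ : Bool) (h : c' = !c)
    (h₁ : c₁ = c) (h₂ : c₂ = c) (z : (pairC P A c).X i) :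
    swapMap P A c' c i (swapMap P A c c' i z) + (offMap P s c₁ c k i (offMap P (diffMap A) c c₁ i k z) +
      offMap P (diffMap A) c₂ c l i (offMap P s c c₂ i l z)) = z := by
  subst h h₁ h₂
  cases c₂
  · exact (congrArg _ (add_zero (0 : P.X i))).trans (add_zero z)
  · refine Prod.ext ?_ ?_
    · exact (congrArg _ (add_zero (0 : P.X i))).trans (add_zero _)
    · exact (zero_add _).trans (hs _)

variable (P s) in
/-- The comparison map on a term of a sum of terms of two complexes with alternating parities. -/
def totTerm (b b' : ℤ → Bool) (i : ℤ) : (pairC P A (b i)).X i →ₗ[ℤ[G]]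
    ⨁ i, (pairC P A (b' i)).X i :=
  DirectSum.lof _ ℤ (fun i => (pairC P A (b' i)).X i) i ∘ₗ swapMap P A (b i) (b' i) i +
    (DirectSum.lof _ ℤ (fun i => (pairC P A (b' i)).X i) (i + 1) ∘ₗ
      offMap P (diffMap A) (b i) (b' (i + 1)) i (i + 1) +
    DirectSum.lof _ ℤ (fun i => (pairC P A (b' i)).X i) (i - 1) ∘ₗ
      offMap P s (b i) (b' (i - 1)) i (i - 1))

variable (P s) in
/-- The comparison of the sums of the terms of two complexes with alternating parities. -/
def totMap (b b' : ℤ → Bool) : (⨁ i, (pairC P A (b i)).X i) →ₗ[ℤ[G]]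
    ⨁ i, (pairC P A (b' i)).X i :=
  DirectSum.toModule _ ℤ _ (totTerm P s b b')

lemma totMap_comp_lof (b b' : ℤ → Bool) (i : ℤ) :
    totMap P s b b' ∘ₗ DirectSum.lof _ ℤ (fun i => (pairC P A (b i)).X i) i = totTerm P s b b' i :=
  LinearMap.ext fun z => DirectSum.toModule_lof ℤ[G] (φ := totTerm P s b b') i z

lemma totMap_totMap (hs0 : ∀ i j k, j + 1 = i → k + 1 = j → ∀ x, s j k (s i j x) = 0)
    (hs1 : ∀ i j k, i + 1 = j → k + 1 = i → ∀ x,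
      s j i ((A.d i j).hom x) + (A.d k i).hom (s i k x) = x) {b b' : ℤ → Bool}
    (hb : ∀ i, b (i + 1) = !b i) (hb' : ∀ i, b' i = !b i) :
    totMap P s b' b ∘ₗ totMap P s b b' = LinearMap.id := by
  refine DirectSum.linearMap_ext _ fun i => LinearMap.ext fun z => ?_
  have h1 : ∀ (F : ∀ j, (pairC P A (b j)).X j) (j : ℤ), j = i →
      DirectSum.lof ℤ[G] ℤ (fun i => (pairC P A (b i)).X i) j (F j) =
        DirectSum.lof ℤ[G] ℤ (fun i => (pairC P A (b i)).X i) i (F i) := by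
    rintro F j rfl
    rfl
  have hd : ∀ i j x, diffMap A j (j + 1) (diffMap A i j x) = 0 := fun i j x =>
    LinearMap.congr_fun (congrArg ModuleCat.Hom.hom (A.d_comp_d i j (j + 1))) x
  have hT := fun b b' j z => LinearMap.congr_fun (totMap_comp_lof (P := P) (s := s) b b' j) z
  simp only [totTerm, LinearMap.comp_apply, LinearMap.add_apply] at hT ⊢
  rw [hT]
  simp only [map_add, hT, offMap_swapMap, swapMap_offMap, map_zero, add_zero, zero_add]
  rw [offMap_offMap (hd i (i + 1)), offMap_offMap (hs0 _ _ _ (by omega) (by omega)),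
    h1 (fun j => offMap P s (b' (i + 1)) (b j) (i + 1) j _) (i + 1 - 1) (by omega),
    h1 (fun j => offMap P (diffMap A) (b' (i - 1)) (b j) (i - 1) j _) (i - 1 + 1) (by omega),
    map_zero, map_zero, zero_add, add_zero, ← map_add, ← map_add,
    swapMap_swapMap (hs1 i (i + 1) (i - 1) rfl (by omega)) (b i) (b' i) (b' (i + 1)) (b' (i - 1))
      (hb' i) (by rw [hb', hb, Bool.not_not]) (by rw [hb', ← hb, sub_add_cancel])]
  rfl

end

section

lemma mact_blockDiagonal' {A V o : Type*} [CommRing A] [AddCommGroup V] [Module A V] [DecidableEq o]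
    (τ : Representation A G V) {κ : o → Type*} [∀ i, Fintype (κ i)] [Fintype (Σ i, κ i)]
    (B : ∀ i, Matrix (κ i) (κ i) A[G]) (y : (Σ i, κ i) → V) (j : Σ i, κ i) :
    mact τ (blockDiagonal' B) y j = mact τ (B j.1) (fun k => y ⟨j.1, k⟩) j.2 := by
  refine (Fintype.sum_of_injective (Sigma.mk j.1) sigma_mk_injective _ _ ?_ ?_).symm
  · rintro ⟨i, k⟩ hk
    have hne : j.1 ≠ i := by
      rintro rfl
      exact hk ⟨k, rfl⟩
    rw [show blockDiagonal' B j ⟨i, k⟩ = 0 from blockDiagonal'_apply_ne B j.2 k hne, map_zero]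
    rfl
  · intro k
    rw [show blockDiagonal' B j ⟨j.1, k⟩ = B j.1 j.2 k from blockDiagonal'_apply_eq B j.1 j.2 k]

lemma mact_directFam (p : Primes) {o : Type} [DecidableEq o] {X : o → Type v}
    [∀ i, AddCommGroup (X i)] [∀ i, Module ℤ[G] (X i)] {ι : o → Type}
    [∀ i, Fintype (ι i)] [Fintype (Σ i, ι i)] {a : ∀ i, ι i → ℚ ⊗[ℤ] X i}
    {ap : ∀ i, ι i → ℤ_[p] ⊗[ℤ] X i} {lam : ∀ i, Matrix (ι i) (ι i) ℚ_[p][G]}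
    (hl : ∀ i, mact (repOver ℚ_[p] (X i)) (lam i) (fun k => fromZp p (X i) (ap i k)) =
      fun j => fromQ p (X i) (a i j)) :
    mact (repOver ℚ_[p] (⨁ i, X i)) (blockDiagonal' lam)
      (fun k => fromZp p (⨁ i, X i) (directFam (G := G) ap k)) =
        fun j => fromQ p (⨁ i, X i) (directFam (G := G) a j) := by
  funext j
  rw [mact_blockDiagonal']
  simp only [fromZp_eq, fromQ_eq, directFam, fromBase_mapOver] at hl ⊢
  rw [← congrFun (hl j.1) j.2]
  exact (congrFun (mact_map _ (mapOver_rep _ _) _ _) _).symm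

lemma exists_direct_transport {o : Type} [DecidableEq o] {X X' : o → Type v}
    [∀ i, AddCommGroup (X i)] [∀ i, Module ℤ[G] (X i)] [∀ i, AddCommGroup (X' i)]
    [∀ i, Module ℤ[G] (X' i)] {ι ι' : o → Type} [∀ i, Fintype (ι i)]
    [∀ i, DecidableEq (ι i)] [∀ i, Fintype (ι' i)] [∀ i, DecidableEq (ι' i)] [Fintype (Σ i, ι i)]
    [Fintype (Σ i, ι' i)] (Φ : (⨁ i, X i) ≃ₗ[ℤ[G]] ⨁ i, X' i)
    {a : ∀ i, ι i → ℚ ⊗[ℤ] X i} {a' : ∀ i, ι' i → ℚ ⊗[ℤ] X' i}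
    (h0 : ∀ i, IsGroupBasis (G := G) (repOver ℚ (X i)) (a i))
    (h0' : ∀ i, IsGroupBasis (G := G) (repOver ℚ (X' i)) (a' i))
    {ap : ∀ (p : Primes) i, ι i → ℤ_[p] ⊗[ℤ] X i}
    {ap' : ∀ (p : Primes) i, ι' i → ℤ_[p] ⊗[ℤ] X' i}
    (hp : ∀ (p : Primes) i, IsGroupBasis (G := G) (repOver ℤ_[p] (X i)) (ap p i))
    (hp' : ∀ (p : Primes) i, IsGroupBasis (G := G) (repOver ℤ_[p] (X' i)) (ap' p i))
    {lam : ∀ (p : Primes) i, Matrix (ι i) (ι i) ℚ_[p][G]}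
    {lam' : ∀ (p : Primes) i, Matrix (ι' i) (ι' i) ℚ_[p][G]}
    (hl : ∀ (p : Primes) i, mact (repOver ℚ_[p] (X i)) (lam p i) (fun k => fromZp p (X i) (ap p i k)) =
      fun j => fromQ p (X i) (a i j))
    (hl' : ∀ (p : Primes) i, mact (repOver ℚ_[p] (X' i)) (lam' p i) (fun k => fromZp p (X' i) (ap' p i k)) =
      fun j => fromQ p (X' i) (a' i j)) :
    ∃ (E : (Σ i, ι i) ≃ Σ i, ι' i) (Z : (Matrix (Σ i, ι i) (Σ i, ι i) ℚ[G])ˣ)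
      (Y : ∀ p : Primes, (Matrix (Σ i, ι i) (Σ i, ι i) ℤ_[p][G])ˣ),
      (∀ j, mapOver ℚ Φ.toLinearMap (directFam (G := G) a j) =
        mact (repOver ℚ (⨁ i, X' i)) Z.1 (directFam (G := G) a' ∘ E) j) ∧
      ∀ (p : Primes) (n : ℕ) (ρ : CRep G n),
        (∏ᶠ i, detM ℚ_[p] (localInclC p) ρ (lam p i)) *
          detM ℚ_[p] (localInclC p) ρ ((Y p).1.map (toQp G p)) =
        detM ℚ_[p] (localInclC p) ρ
          (Z.1.map (MonoidAlgebra.mapRingHom G (algebraMap ℚ ℚ_[p]))) *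
          ∏ᶠ i, detM ℚ_[p] (localInclC p) ρ (lam' p i) := by
  obtain ⟨E, Z, Y, hZ, hY⟩ := exists_transport Φ (IsGroupBasis.tensor_directSum h0)
    (IsGroupBasis.tensor_directSum h0') (fun p => IsGroupBasis.tensor_directSum (hp p))
    (fun p => IsGroupBasis.tensor_directSum (hp' p)) (lam := fun p => blockDiagonal' (lam p))
    (lam' := fun p => blockDiagonal' (lam' p)) (fun p => mact_directFam p (hl p))
    fun p => mact_directFam p (hl' p)
  refine ⟨E, Z, Y, hZ, fun p n ρ => ?_⟩
  have h1 := congrArg (detM ℚ_[p] (localInclC p) ρ) (hY p)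
  rwa [map_mul, map_mul, detM_reindex, detM_blockDiagonal'_eq_finprod,
    detM_blockDiagonal'_eq_finprod] at h1

end

section

lemma finprod_parity {K : Type*} [DivisionCommMonoid K] (f : Bool → ℤ → K) {t : Finset ℤ}
    (hf : ∀ c i, i ∉ t → f c i = 1) {b b' : ℤ → Bool} (hb : ∀ i, b i = !decide (Even i))
    (hb' : ∀ i, b' i = !b i) :
    (∏ᶠ i, f (b i) i) / ∏ᶠ i, f (b' i) i = (∏ᶠ i, f false i ^ (Int.negOnePow i : ℤ)) /
      ∏ᶠ i, f true i ^ (Int.negOnePow i : ℤ) := by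
  have hs : ∀ F : ℤ → K, (∀ i, i ∉ t → F i = 1) → (mulSupport F).Finite := fun F hF =>
    t.finite_toSet.subset fun i hi => by_contra fun h => hi (hF i h)
  rw [← finprod_div_distrib (hs _ fun i hi => hf _ i hi) (hs _ fun i hi => hf _ i hi),
    ← finprod_div_distrib (hs _ fun i hi => by rw [hf _ i hi, _root_.one_zpow])
      (hs _ fun i hi => by rw [hf _ i hi, _root_.one_zpow])]
  refine finprod_congr fun i => ?_
  by_cases h : Even i
  · simp [hb', hb, h, Int.negOnePow_even]
  · simp [hb', hb, h, Int.negOnePow_odd i (Int.not_even_iff_odd.1 h)]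
    rw [div_eq_mul_inv, mul_comm]

end

section

variable {N N₀ N₁ N₂ N' : Type v} [AddCommGroup N] [Module ℤ[G] N]
  [AddCommGroup N'] [Module ℤ[G] N'] [AddCommGroup N₀] [Module ℤ[G] N₀]
  [AddCommGroup N₁] [Module ℤ[G] N₁] [AddCommGroup N₂] [Module ℤ[G] N₂]

lemma invOver_sum_cases {L : Type v} [AddCommGroup L] [Module ℤ[G] L]
    (W : SymplecticRep G) {f₀ : N →ₗ[ℤ[G]] N₀} {f₁ : N →ₗ[ℤ[G]] N₁}
    {f₂ : N →ₗ[ℤ[G]] N₂} {l₀ : N₀ →ₗ[ℤ[G]] N'}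
    {l₁ : N₁ →ₗ[ℤ[G]] N'} {l₂ : N₂ →ₗ[ℤ[G]] N'}
    {ℓ : N →ₗ[ℤ[G]] L} {Φ : L →ₗ[ℤ[G]] N'}
    (h : Φ ∘ₗ ℓ = l₀ ∘ₗ f₀ + (l₁ ∘ₗ f₁ + l₂ ∘ₗ f₂)) (x : Inv W.ρ (repO ℚ N)) :
    (invOver W f₁ x = 0 → invOver W f₂ x = 0 →
      invOver W Φ (invOver W ℓ x) = invOver W l₀ (invOver W f₀ x)) ∧
    (invOver W f₀ x = 0 → invOver W f₂ x = 0 →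
      invOver W Φ (invOver W ℓ x) = invOver W l₁ (invOver W f₁ x)) ∧
    (invOver W f₀ x = 0 → invOver W f₁ x = 0 →
      invOver W Φ (invOver W ℓ x) = invOver W l₂ (invOver W f₂ x)) := by
  rw [invOver_comp, h, invOver_add, invOver_add, ← invOver_comp, ← invOver_comp, ← invOver_comp]
  refine ⟨fun h h' => ?_, fun h h' => ?_, fun h h' => ?_⟩
  · rw [h, h', map_zero, map_zero, add_zero, add_zero]
  · rw [h, h', map_zero, map_zero, zero_add, add_zero]
  · rw [h, h', map_zero, map_zero, zero_add, zero_add]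

end

section

/-- Local bases of a complex and of its sum with another complex. -/
def pairL (L : LocalBases P) (L' : LocalBases (dirSum P A)) : ∀ c, LocalBases (pairC P A c)
  | false => L
  | true => L'

/-- The determinants of the bases defined by local bases with respect to other bases of the
invariants. -/
def relDet {W : SymplecticRep G} (L : LocalBases P) {J : ℤ → Type} [∀ i, Fintype (J i)]
    [∀ i, DecidableEq (J i)] (e : ∀ i, Fin (L.r i) × Fin W.k ≃ J i)
    (v : ∀ i, Basis (J i × Fin 2) ℂ (Inv W.ρ (repQ P i))) (i : ℤ) : ℂ :=
  (v i).det fun x => bVec W L i ((e i).symm x.1, x.2)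

lemma exists_coordMatrix {W : SymplecticRep G} (L : LocalBases P) {J : ℤ → Type}
    [∀ i, Fintype (J i)] [∀ i, DecidableEq (J i)] (e : ∀ i, Fin (L.r i) × Fin W.k ≃ J i)
    (v : ∀ i, Basis (J i × Fin 2) ℂ (Inv W.ρ (repQ P i))) (i : ℤ) :
    ∃ T : Matrix (J i × Fin 2) (J i × Fin 2) ℂ, T.det = (relDet L e v i)⁻¹ ∧ T.det ≠ 0 ∧
      ∀ x, v i x = ∑ y, T x y • bfam W (repQ P i) (L.a0 i) ((e i).symm y.1, y.2) := by
  obtain ⟨b, hb⟩ := (L.a0_basis i).exists_bfam_basis W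
  let B := b.reindex ((e i).prodCongr (Equiv.refl (Fin 2)))
  have hB : ∀ y, B y = bfam W (repQ P i) (L.a0 i) ((e i).symm y.1, y.2) := fun y => by
    rw [Basis.reindex_apply, hb]
    rfl
  have h1 : (B.toMatrix (v i)).det * relDet L e v i = 1 := by
    rw [relDet, show (fun x => bVec W L i ((e i).symm x.1, x.2)) = B from (funext hB).symm,
      Basis.det_apply, ← det_mul, Basis.toMatrix_mul_toMatrix_flip, det_one]
  refine ⟨(B.toMatrix (v i))ᵀ, ?_, ?_, fun x => ?_⟩
  · rw [det_transpose]
    exact eq_inv_of_mul_eq_one_left h1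
  · rw [det_transpose]
    exact left_ne_zero_of_mul_eq_one h1
  · simp only [← hB]
    exact (B.sum_repr (v i x)).symm

variable {s : ∀ i j, A.X i →ₗ[ℤ[G]] A.X j}

/-- The bases `v` of the invariants are permuted by the comparison map. -/
def IsPermuted (s : ∀ i j, A.X i →ₗ[ℤ[G]] A.X j) {W : SymplecticRep G}
    {J : Bool → ℤ → Type} (v : ∀ c i, J c i × Fin 2 → Inv W.ρ (repQ (pairC P A c) i)) : Prop :=
  ∀ i c c₀ c₁ c₂, c₀ = !c → c₁ = c → c₂ = c → ∀ a : J c i,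
    (∃ a' : J c₀ i, ∀ ε, invOver W (swapMap P A c c₀ i) (v c i (a, ε)) = v c₀ i (a', ε) ∧
      invOver W (offMap P (diffMap A) c c₁ i (i + 1)) (v c i (a, ε)) = 0 ∧
      invOver W (offMap P s c c₂ i (i - 1)) (v c i (a, ε)) = 0) ∨
    (∃ a' : J c₁ (i + 1), ∀ ε, invOver W (swapMap P A c c₀ i) (v c i (a, ε)) = 0 ∧
      invOver W (offMap P (diffMap A) c c₁ i (i + 1)) (v c i (a, ε)) = v c₁ (i + 1) (a', ε) ∧
      invOver W (offMap P s c c₂ i (i - 1)) (v c i (a, ε)) = 0) ∨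
    ∃ a' : J c₂ (i - 1), ∀ ε, invOver W (swapMap P A c c₀ i) (v c i (a, ε)) = 0 ∧
      invOver W (offMap P (diffMap A) c c₁ i (i + 1)) (v c i (a, ε)) = 0 ∧
      invOver W (offMap P s c c₂ i (i - 1)) (v c i (a, ε)) = v c₂ (i - 1) (a', ε)

lemma IsPermuted.exists_totMap {W : SymplecticRep G} {J : Bool → ℤ → Type}
    {v : ∀ c i, J c i × Fin 2 → Inv W.ρ (repQ (pairC P A c) i)} (hv : IsPermuted s v)
    {b b' : ℤ → Bool} (hb : ∀ i, b (i + 1) = !b i) (hb' : ∀ i, b' i = !b i) (k : Σ i, J (b i) i) :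
    ∃ k' : Σ i, J (b' i) i, ∀ ε, invOver W (totMap P s b b')
      (invOver W (DirectSum.lof _ ℤ (fun i => (pairC P A (b i)).X i) k.1) (v (b k.1) k.1 (k.2, ε))) =
        invOver W (DirectSum.lof _ ℤ (fun i => (pairC P A (b' i)).X i) k'.1)
          (v (b' k'.1) k'.1 (k'.2, ε)) := by
  have key := fun x => invOver_sum_cases W (totMap_comp_lof (P := P) (s := s) b b' k.1) x
  rcases hv k.1 (b k.1) (b' k.1) (b' (k.1 + 1)) (b' (k.1 - 1)) (hb' _)
    (by rw [hb', hb, Bool.not_not]) (by rw [hb', ← hb, sub_add_cancel]) k.2 with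
    ⟨a, h⟩ | ⟨a, h⟩ | ⟨a, h⟩
  · exact ⟨⟨_, a⟩, fun ε => ((key _).1 (h ε).2.1 (h ε).2.2).trans (congrArg _ (h ε).1)⟩
  · exact ⟨⟨_, a⟩, fun ε => ((key _).2.1 (h ε).1 (h ε).2.2).trans (congrArg _ (h ε).2.1)⟩
  · exact ⟨⟨_, a⟩, fun ε => ((key _).2.2 (h ε).1 (h ε).2.1).trans (congrArg _ (h ε).2.2)⟩

lemma exists_comparison (hP : IsPerfect P) (hA : IsPerfect A)
    (hs0 : ∀ i j k, j + 1 = i → k + 1 = j → ∀ x, s j k (s i j x) = 0)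
    (hs1 : ∀ i j k, i + 1 = j → k + 1 = i → ∀ x,
      s j i ((A.d i j).hom x) + (A.d k i).hom (s i k x) = x)
    (L : LocalBases P) (L' : LocalBases (dirSum P A)) :
    ∃ (ι : Type) (_ : Fintype ι) (_ : DecidableEq ι) (X : (Matrix ι ι ℚ[G])ˣ)
      (Y : ∀ p : Primes, (Matrix ι ι ℤ_[p][G])ˣ),
      (∀ (p : Primes) (n : ℕ) (ρ : CRep G n),
        ((L.detLam p ρ / L'.detLam p ρ : (LocalC p)ˣ) : LocalC p) *
          detM ℚ_[p] (localInclC p) ρ ((Y p).1.map (toQp G p)) =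
        detM ℚ_[p] (localInclC p) ρ
          (X.1.map (MonoidAlgebra.mapRingHom G (algebraMap ℚ ℚ_[p])))) ∧
      ∀ (W : SymplecticRep G) {J : Bool → ℤ → Type} [∀ c i, Fintype (J c i)]
        [∀ c i, DecidableEq (J c i)] (e : ∀ c i, Fin ((pairL L L' c).r i) × Fin W.k ≃ J c i)
        (v : ∀ c i, Basis (J c i × Fin 2) ℂ (Inv W.ρ (repQ (pairC P A c) i))),
        IsPermuted s (fun c i => v c i) →
        ∏ᶠ i, relDet L (e false) (v false) i ^ (Int.negOnePow i : ℤ) =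
          detC W.ρ X.1 *
            ∏ᶠ i, relDet L' (e true) (v true) i ^ (Int.negOnePow i : ℤ) := by
  classical
  let b : ℤ → Bool := fun i => !decide (Even i)
  let b' : ℤ → Bool := fun i => !b i
  have hb : ∀ i, b (i + 1) = !b i := fun i => by simp only [b, Int.even_add_one, decide_not]
  have hb' : ∀ i, b' (i + 1) = !b' i := fun i => congrArg not (hb i)
  let Φ : (⨁ i, (pairC P A (b i)).X i) ≃ₗ[ℤ[G]] ⨁ i, (pairC P A (b' i)).X i :=
    LinearEquiv.ofLinearMap (totMap P s b b') (totMap P s b' b)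
      (totMap_totMap hs0 hs1 hb' fun i => (Bool.not_not _).symm)
      (totMap_totMap hs0 hs1 hb fun i => rfl)
  have hpair : ∀ c, IsPerfect (pairC P A c) := fun c => by
    cases c
    exacts [hP, hP.dirSum hA]
  choose t ht using fun c => (hpair c).exists_finset
  have ht' : ∀ c i, i ∉ t false ∪ t true → Subsingleton ((pairC P A c).X i) := fun c i hi => by
    refine ht c i fun h => hi (Finset.mem_union.2 ?_)
    cases c
    exacts [Or.inl h, Or.inr h]
  let Λ := pairL L L'
  let F : ∀ β : ℤ → Bool, Fintype (Σ i, Fin ((Λ (β i)).r i)) := fun β =>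
    ⟨(t false ∪ t true).sigma fun _ => univ, fun x => Finset.mem_sigma.2
      ⟨by_contra fun h => by
        have := ht' (β x.1) x.1 h
        have h0 := (Λ (β x.1)).r_eq_zero x.1
        exact absurd x.2.2 (by omega), mem_univ _⟩⟩
  let _ := F b
  let _ := F b'
  obtain ⟨E, X, Y, hX, hXY⟩ := exists_direct_transport Φ (fun i => (Λ (b i)).a0_basis i)
    (fun i => (Λ (b' i)).a0_basis i) (fun p i => (Λ (b i)).ap_basis p i)
    (fun p i => (Λ (b' i)).ap_basis p i) (fun p i => (Λ (b i)).mact_lam p i)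
    (fun p i => (Λ (b' i)).mact_lam p i)
  refine ⟨_, F b, inferInstance, X, Y, fun p n ρ => ?_, fun W J _ _ e v hv => ?_⟩
  · let f : Bool → ℤ → (LocalC p)ˣ := fun c i => detGL ℚ_[p] (localInclC p) ρ ((Λ c).lam p i)
    have hf : ∀ c i, i ∉ t false ∪ t true → f c i = 1 := fun c i hi => by
      have := ht' c i hi
      exact (Λ c).detGL_eq_one p i ρ
    have hprod : ∀ β : ℤ → Bool, ((∏ᶠ i, f (β i) i : (LocalC p)ˣ) : LocalC p) =
        ∏ᶠ i, detM ℚ_[p] (localInclC p) ρ ((Λ (β i)).lam p i).1 := fun β => by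
      refine ((Units.coeHom (LocalC p)).map_finprod ?_).trans (finprod_congr fun i => detGL_val _ _ _ _)
      exact (t false ∪ t true).finite_toSet.subset fun i hi => by_contra fun h => hi (hf _ i h)
    have h1 := hXY p n ρ
    rw [← hprod b, ← hprod b'] at h1
    rw [show L.detLam p ρ / L'.detLam p ρ = _ from
      (finprod_parity f hf (b := b) (b' := b') (fun _ => rfl) fun _ => rfl).symm, div_eq_mul_inv,
      val_mul, mul_right_comm, h1, mul_assoc, Units.mul_inv, mul_one]
  · choose T hT1 hT2 hT3 using fun c => exists_coordMatrix (pairL L L' c) (e c) (v c)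
    let f : Bool → ℤ → ℂ := fun c => relDet (pairL L L' c) (e c) (v c)
    have hf : ∀ c i, i ∉ t false ∪ t true → f c i = 1 := fun c i hi => by
      have := ht' c i hi
      have h0 : (pairL L L' c).r i = 0 := (Λ c).r_eq_zero i
      have : IsEmpty (J c i) := ⟨fun x => absurd ((e c i).symm x).1.2 (by omega)⟩
      exact (Basis.det_apply _ _).trans det_isEmpty
    have h1 := prod_det_transport W Φ (fun i => (Λ (b' i)).a0_basis i) X.isUnit hX
      (fun i => e (b i) i) (fun i => e (b' i) i) (fun i => hT2 (b i) i) (fun i => v (b i) i)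
      (fun i => v (b' i) i) (fun i => hT3 (b i) i) (fun i => hT3 (b' i) i)
      (hv.exists_totMap hb fun _ => rfl)
    have h2 := finprod_parity f hf (b := b) (b' := b') (fun _ => rfl) fun _ => rfl
    have hne : ∀ β : ℤ → Bool, ∏ᶠ i, f (β i) i ≠ 0 := fun β =>
      finprod_induction (· ≠ 0) one_ne_zero (fun _ _ => mul_ne_zero) fun i => by
        have := hT2 (β i) i
        rw [hT1] at this
        exact fun h => this (inv_eq_zero.2 h)
    have hne' : ∏ᶠ i, f true i ^ (Int.negOnePow i : ℤ) ≠ 0 :=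
      finprod_induction (· ≠ 0) one_ne_zero (fun _ _ => mul_ne_zero) fun i => by
        have := hT2 true i
        rw [hT1] at this
        exact zpow_ne_zero _ fun h => this (inv_eq_zero.2 h)
    have h3 : ∀ β : ℤ → Bool, ∏ᶠ i, (T (β i) i).det = (∏ᶠ i, f (β i) i)⁻¹ := fun β => by
      rw [← finprod_inv_distrib]
      exact finprod_congr fun i => hT1 _ _
    rw [h3 b, h3 b'] at h1
    rw [div_eq_div_iff (hne b') hne'] at h2
    have h4 := hne b
    have h5 := hne b'
    field_simp at h1
    refine mul_left_cancel₀ h5 ((mul_comm _ _).trans (h2.symm.trans ?_))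
    rw [← h1, mul_comm _ (∏ᶠ i, f (b' i) i), mul_assoc]
    rfl

end

section

variable {N : ℤ → Type*} [∀ i, AddCommGroup (N i)] [∀ i, Module ℂ (N i)]
  (δ S : ∀ i j, N i →ₗ[ℂ] N j)

/-- A contraction decomposes the terms of a complex into boundaries and a kernel of the contraction. -/
def splitEquiv (hS : ∀ i j k, j + 1 = i → k + 1 = j → ∀ x, S j k (S i j x) = 0)
    (hδ : ∀ i j k x, δ j k (δ i j x) = 0)
    (h1 : ∀ i j k, i + 1 = j → k + 1 = i → ∀ x, S j i (δ i j x) + δ k i (S i k x) = x) (i : ℤ) :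
    (ker (S (i - 1) (i - 1 - 1)) × ker (S i (i - 1))) ≃ₗ[ℂ] N i :=
  LinearEquiv.ofLinearMap
    ((δ (i - 1) i ∘ₗ Submodule.subtype _).coprod (Submodule.subtype _))
    (((S i (i - 1)).codRestrict _ fun x => hS _ _ _ (by omega) (by omega) x).prod
      ((S (i + 1) i ∘ₗ δ i (i + 1)).codRestrict _ fun x => hS _ _ _ rfl (by omega) _))
    (LinearMap.ext fun x => by
      change δ (i - 1) i (S i (i - 1) x) + S (i + 1) i (δ i (i + 1) x) = x
      rw [add_comm]
      exact h1 i (i + 1) (i - 1) rfl (by omega) x)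
    (LinearMap.ext fun x => by
      obtain ⟨⟨a, ha⟩, b, hb⟩ := x
      have h2 := h1 (i - 1) i (i - 1 - 1) (by omega) (by omega) a
      have h3 := h1 i (i + 1) (i - 1) rfl (by omega) b
      rw [mem_ker.1 ha, map_zero, add_zero] at h2
      rw [mem_ker.1 hb, map_zero, add_zero] at h3
      refine Prod.ext (Subtype.ext ?_) (Subtype.ext ?_)
      · change S i (i - 1) (δ (i - 1) i a + b) = a
        rw [map_add, h2, mem_ker.1 hb, add_zero]
      · change S (i + 1) i (δ i (i + 1) (δ (i - 1) i a + b)) = b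
        rw [map_add, hδ, zero_add, h3])

lemma finrank_ker_contraction (hS : ∀ i j k, j + 1 = i → k + 1 = j → ∀ x, S j k (S i j x) = 0)
    (hδ : ∀ i j k x, δ j k (δ i j x) = 0)
    (h1 : ∀ i j k, i + 1 = j → k + 1 = i → ∀ x, S j i (δ i j x) + δ k i (S i k x) = x) (i : ℤ)
    {Z : Type*} [AddCommGroup Z] [Module ℂ Z] (ζ : Z →ₗ[ℂ] N (i + 1)) (hζ : Function.Injective ζ)
    (hζr : range ζ = ker (δ (i + 1) (i + 1 + 1))) :
    finrank ℂ (ker (S i (i - 1))) = finrank ℂ Z := by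
  let f : Z →ₗ[ℂ] ker (S i (i - 1)) :=
    (S (i + 1) i ∘ₗ ζ).codRestrict _ fun x => hS _ _ _ rfl (by omega) _
  have hz : ∀ z, δ (i + 1) (i + 1 + 1) (ζ z) = 0 := fun z => hζr.le ⟨z, rfl⟩
  refine (ofBijective f ⟨(injective_iff_map_eq_zero _).2 fun z h => hζ ?_, ?_⟩).finrank_eq.symm
  · have h2 := h1 (i + 1) (i + 1 + 1) i rfl rfl (ζ z)
    rw [hz, map_zero, zero_add, show S (i + 1) i (ζ z) = 0 from congrArg val h, map_zero] at h2
    rw [map_zero, h2]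
  · rintro ⟨k, hk⟩
    obtain ⟨z, hz⟩ := hζr.ge (hδ i (i + 1) _ k)
    refine ⟨z, Subtype.ext ?_⟩
    change S (i + 1) i (ζ z) = k
    have h2 := h1 i (i + 1) (i - 1) rfl (by omega) k
    rwa [mem_ker.1 hk, map_zero, add_zero, ← hz] at h2

lemma exists_contracted_basis [∀ i, Module.Finite ℂ (N i)]
    (hS : ∀ i j k, j + 1 = i → k + 1 = j → ∀ x, S j k (S i j x) = 0)
    (hδ : ∀ i j k x, δ j k (δ i j x) = 0)
    (h1 : ∀ i j k, i + 1 = j → k + 1 = i → ∀ x, S j i (δ i j x) + δ k i (S i k x) = x)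
    {Z : ℤ → Type*} [∀ i, AddCommGroup (Z i)] [∀ i, Module ℂ (Z i)] (ζ : ∀ i, Z i →ₗ[ℂ] N i)
    (hζi : ∀ i, Function.Injective (ζ i))
    (hζ : ∀ i, range (ζ i) = ker (δ i (i + 1)))
    (hev : ∀ i, Even (finrank ℂ (Z i))) :
    ∃ (m : ℤ → ℕ) (x : ∀ i, Basis ((Fin (m (i - 1)) ⊕ Fin (m i)) × Fin 2) ℂ (N i)),
      (∀ i a ε, δ (i - 1) i (x (i - 1) (inr a, ε)) = x i (inl a, ε)) ∧
      ∀ i a ε, S i (i - 1) (x i (inr a, ε)) = 0 := by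
  choose m hm using fun i => (finrank_ker_contraction δ S hS hδ h1 i (ζ (i + 1)) (hζi _) (hζ _)).symm ▸
    hev (i + 1)
  let y : ∀ i, Basis (Fin (m i) × Fin 2) ℂ (ker (S i (i - 1))) := fun i =>
    (Module.finBasisOfFinrankEq ℂ _ ((hm i).trans (mul_two (m i)).symm)).reindex finProdFinEquiv.symm
  let x : ∀ i, Basis ((Fin (m (i - 1)) ⊕ Fin (m i)) × Fin 2) ℂ (N i) := fun i =>
    (((y (i - 1)).prod (y i)).map (splitEquiv δ S hS hδ h1 i)).reindex
      (sumProdDistrib _ _ _).symm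
  have hr : ∀ i a ε, x i (inr a, ε) = y i (a, ε) := fun i a ε => by
    simp [x, splitEquiv, Basis.reindex_apply]
  refine ⟨m, x, fun i a ε => ?_, fun i a ε => ?_⟩
  · rw [hr]
    simp [x, splitEquiv, Basis.reindex_apply]
  · rw [hr]
    exact (y i (a, ε)).2

end

section

lemma exists_contracted_basis_inv (hA : IsPerfect A) {s : ∀ i j, A.X i →ₗ[ℤ[G]] A.X j}
    (hs0 : ∀ i j k, j + 1 = i → k + 1 = j → ∀ x, s j k (s i j x) = 0)
    (hs1 : ∀ i j k, i + 1 = j → k + 1 = i → ∀ x,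
      s j i ((A.d i j).hom x) + (A.d k i).hom (s i k x) = x) (W : SymplecticRep G) :
    ∃ (m : ℤ → ℕ)
      (x : ∀ i, Basis ((Fin (m (i - 1)) ⊕ Fin (m i)) × Fin 2) ℂ (Inv W.ρ (repQ A i))),
      (∀ i a ε, dInv A W (i - 1) i (x (i - 1) (inr a, ε)) = x i (inl a, ε)) ∧
      (∀ i a ε, invOver W (s i (i - 1)) (x i (inr a, ε)) = 0) ∧
      ∀ i a ε, invOver W (s i (i - 1)) (x i (inl a, ε)) = x (i - 1) (inr a, ε) := by
  obtain ⟨L⟩ := hA.nonempty_localBases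
  have hf : ∀ i, Module.Finite ℚ (QT A i) := L.finite_QT
  have hfi : ∀ i, Module.Finite ℂ (Inv W.ρ (repQ A i)) := fun i => finite_inv _ _
  have hS : ∀ i j k, j + 1 = i → k + 1 = j → ∀ x : Inv W.ρ (repQ A i),
      invOver W (s j k) (invOver W (s i j) x) = 0 := fun i j k h h' x => by
    rw [invOver_comp, show s j k ∘ₗ s i j = 0 from LinearMap.ext (hs0 i j k h h'), invOver_zero]
  have h1 : ∀ i j k, i + 1 = j → k + 1 = i → ∀ x : Inv W.ρ (repQ A i),
      invOver W (s j i) (dInv A W i j x) + dInv A W k i (invOver W (s i k) x) = x :=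
    fun i j k h h' x => by
      refine (congrArg₂ (· + ·) (invOver_comp W (diffMap A i j) (s j i) x)
        (invOver_comp W (s i k) (diffMap A k i) x)).trans ?_
      rw [← invOver_add, show s j i ∘ₗ diffMap A i j + diffMap A k i ∘ₗ s i k = LinearMap.id from
        LinearMap.ext (hs1 i j k h h'), invOver_id]
  obtain ⟨m, x, hx, hx'⟩ := exists_contracted_basis (dInv A W)
    (fun i j => invOver W (s i j)) hS (dInv_dInv W) h1 (zInv A W)
    (zInv_injective W) (range_zInv W) fun i => even_finrank_inv W _
  refine ⟨m, x, hx, hx', fun i a ε => ?_⟩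
  have h2 := h1 (i - 1) i (i - 1 - 1) (by omega) (by omega) (x (i - 1) (inr a, ε))
  rwa [hx', map_zero, add_zero, hx] at h2

end

section

variable (s t m : ℤ → ℕ)

/-- The index types of bases of the invariants of a complex, and of its sum with an acyclic complex. -/
def JIndex : Bool → ℤ → Type
  | false, i => Fin (s (i - 1)) ⊕ Fin (t i) ⊕ Fin (s i)
  | true, i => (Fin (s (i - 1)) ⊕ Fin (m (i - 1))) ⊕ Fin (t i) ⊕ (Fin (s i) ⊕ Fin (m i))

instance : ∀ c i, Fintype (JIndex s t m c i)
  | false, i => inferInstanceAs (Fintype (Fin (s (i - 1)) ⊕ Fin (t i) ⊕ Fin (s i)))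
  | true, i => inferInstanceAs
      (Fintype ((Fin (s (i - 1)) ⊕ Fin (m (i - 1))) ⊕ Fin (t i) ⊕ (Fin (s i) ⊕ Fin (m i))))

instance : ∀ c i, DecidableEq (JIndex s t m c i)
  | false, i => inferInstanceAs (DecidableEq (Fin (s (i - 1)) ⊕ Fin (t i) ⊕ Fin (s i)))
  | true, i => inferInstanceAs
      (DecidableEq ((Fin (s (i - 1)) ⊕ Fin (m (i - 1))) ⊕ Fin (t i) ⊕ (Fin (s i) ⊕ Fin (m i))))

end

/-- Rearrangement of the parts of two adapted bases. -/
def joinEquiv (α β γ α' γ' : Type*) :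
    (α ⊕ β ⊕ γ) ⊕ (α' ⊕ γ') ≃ (α ⊕ α') ⊕ β ⊕ (γ ⊕ γ') where
  toFun
    | .inl (.inl a) => .inl (.inl a)
    | .inl (.inr (.inl b)) => .inr (.inl b)
    | .inl (.inr (.inr c)) => .inr (.inr (.inl c))
    | .inr (.inl a) => .inl (.inr a)
    | .inr (.inr c) => .inr (.inr (.inr c))
  invFun
    | .inl (.inl a) => .inl (.inl a)
    | .inr (.inl b) => .inl (.inr (.inl b))
    | .inr (.inr (.inl c)) => .inl (.inr (.inr c))
    | .inl (.inr a) => .inr (.inl a)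
    | .inr (.inr (.inr c)) => .inr (.inr c)
  left_inv := by rintro ((a | b | c) | a | c) <;> rfl
  right_inv := by rintro ((a | a) | b | c | c) <;> rfl

section

section

variable {K L M N : Type v} [AddCommGroup K] [Module ℤ[G] K] [AddCommGroup L]
  [Module ℤ[G] L] [AddCommGroup M] [Module ℤ[G] M] [AddCommGroup N]
  [Module ℤ[G] N] (W : SymplecticRep G)

lemma invOver_square {f : L →ₗ[ℤ[G]] M} {f' : M →ₗ[ℤ[G]] N}
    {g : L →ₗ[ℤ[G]] K} {g' : K →ₗ[ℤ[G]] N} (h : ∀ x, f' (f x) = g' (g x))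
    (x : Inv W.ρ (repO ℚ L)) :
    invOver W f' (invOver W f x) = invOver W g' (invOver W g x) := by
  rw [invOver_comp, invOver_comp, show f' ∘ₗ f = g' ∘ₗ g from LinearMap.ext h]

lemma invOver_comp_eq_zero {f : L →ₗ[ℤ[G]] M} {f' : M →ₗ[ℤ[G]] N}
    (h : ∀ x, f' (f x) = 0) (x : Inv W.ρ (repO ℚ L)) :
    invOver W f' (invOver W f x) = 0 := by
  rw [invOver_comp, show f' ∘ₗ f = 0 from LinearMap.ext h, invOver_zero]

end

/-- The invariants of a direct sum. -/
def invProdEquiv (W : SymplecticRep G) (M N : Type v) [AddCommGroup M] [Module ℤ[G] M]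
    [AddCommGroup N] [Module ℤ[G] N] :
    (Inv W.ρ (repO ℚ M) × Inv W.ρ (repO ℚ N)) ≃ₗ[ℂ]
      Inv W.ρ (repO ℚ (M × N)) :=
  LinearEquiv.ofLinearMap
    ((invOver W (LinearMap.inl ℤ[G] M N)).coprod
      (invOver W (LinearMap.inr ℤ[G] M N)))
    ((invOver W (fst ℤ[G] M N)).prod
      (invOver W (snd ℤ[G] M N)))
    (LinearMap.ext fun x => by
      change invOver W _ (invOver W _ x) + invOver W _ (invOver W _ x) = x
      rw [invOver_comp, invOver_comp, ← invOver_add, show LinearMap.inl ℤ[G] M N ∘ₗ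
        fst _ M N + LinearMap.inr _ M N ∘ₗ snd _ M N = LinearMap.id from
        LinearMap.ext fun z => Prod.ext (add_zero _) (zero_add _), invOver_id])
    (LinearMap.ext fun x => by
      refine Prod.ext ?_ ?_
      · change invOver W _ (invOver W _ x.1 + invOver W _ x.2) = x.1
        rw [map_add, invOver_comp, invOver_comp, LinearMap.fst_comp_inl, LinearMap.fst_comp_inr,
          invOver_id, invOver_zero, add_zero]
      · change invOver W _ (invOver W _ x.1 + invOver W _ x.2) = x.2
        rw [map_add, invOver_comp, invOver_comp, LinearMap.snd_comp_inl, LinearMap.snd_comp_inr,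
          invOver_id, invOver_zero, zero_add])

/-- The basis of the invariants of a direct sum obtained from bases for the summands. -/
def joinBasis (W : SymplecticRep G) {M N : Type v} [AddCommGroup M] [Module ℤ[G] M]
    [AddCommGroup N] [Module ℤ[G] N] {α β γ α' γ' : Type*}
    (b : Basis ((α ⊕ β ⊕ γ) × Fin 2) ℂ (Inv W.ρ (repO ℚ M)))
    (x : Basis ((α' ⊕ γ') × Fin 2) ℂ (Inv W.ρ (repO ℚ N))) :
    Basis (((α ⊕ α') ⊕ β ⊕ (γ ⊕ γ')) × Fin 2) ℂ (Inv W.ρ (repO ℚ (M × N))) :=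
  ((b.prod x).map (invProdEquiv W M N)).reindex
    ((sumProdDistrib _ _ _).symm.trans
      ((joinEquiv α β γ α' γ').prodCongr (Equiv.refl (Fin 2))))

lemma joinBasis_inl (W : SymplecticRep G) {M N : Type v} [AddCommGroup M]
    [Module ℤ[G] M] [AddCommGroup N] [Module ℤ[G] N]
    {α β γ α' γ' : Type*} (b : Basis ((α ⊕ β ⊕ γ) × Fin 2) ℂ (Inv W.ρ (repO ℚ M)))
    (x : Basis ((α' ⊕ γ') × Fin 2) ℂ (Inv W.ρ (repO ℚ N))) (a ε) :
    joinBasis W b x (joinEquiv α β γ α' γ' (inl a), ε) = invOver W (LinearMap.inl _ M N) (b (a, ε)) := by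
  simp [joinBasis, Basis.reindex_apply, invProdEquiv]

lemma joinBasis_inr (W : SymplecticRep G) {M N : Type v} [AddCommGroup M]
    [Module ℤ[G] M] [AddCommGroup N] [Module ℤ[G] N]
    {α β γ α' γ' : Type*} (b : Basis ((α ⊕ β ⊕ γ) × Fin 2) ℂ (Inv W.ρ (repO ℚ M)))
    (x : Basis ((α' ⊕ γ') × Fin 2) ℂ (Inv W.ρ (repO ℚ N))) (a ε) :
    joinBasis W b x (joinEquiv α β γ α' γ' (inr a), ε) = invOver W (LinearMap.inr _ M N) (x (a, ε)) := by
  simp [joinBasis, Basis.reindex_apply, invProdEquiv]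

/-- Bases of the invariants for a complex and for its sum with an acyclic complex. -/
def pairBasis {W : SymplecticRep G} {L : LocalBases P} (E : AdaptedBases W L) {m : ℤ → ℕ}
    (x : ∀ i, Basis ((Fin (m (i - 1)) ⊕ Fin (m i)) × Fin 2) ℂ (Inv W.ρ (repQ A i))) :
    ∀ c i, Basis (JIndex E.s E.t m c i × Fin 2) ℂ (Inv W.ρ (repQ (pairC P A c) i))
  | false, i => E.v i
  | true, i => joinBasis W (E.v i) (x i)

lemma isPermuted_pairBasis {s : ∀ i j, A.X i →ₗ[ℤ[G]] A.X j} {W : SymplecticRep G}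
    {L : LocalBases P} (E : AdaptedBases W L) {m : ℤ → ℕ}
    {x : ∀ i, Basis ((Fin (m (i - 1)) ⊕ Fin (m i)) × Fin 2) ℂ (Inv W.ρ (repQ A i))}
    (h1 : ∀ i a ε, dInv A W (i - 1) i (x (i - 1) (inr a, ε)) = x i (inl a, ε))
    (h2 : ∀ i a ε, invOver W (s i (i - 1)) (x i (inr a, ε)) = 0)
    (h3 : ∀ i a ε, invOver W (s i (i - 1)) (x i (inl a, ε)) = x (i - 1) (inr a, ε)) :
    IsPermuted (P := P) s (fun c i => pairBasis E x c i) := by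
  have hd0 : ∀ i a ε, dInv A W i (i + 1) (x i (inl a, ε)) = 0 := fun i a ε => by
    rw [← h1]
    exact dInv_dInv W _ _ _ _
  have hd1 : ∀ i j, i + 1 = j → ∀ a, ∃ a', ∀ ε,
      dInv A W i j (x i (inr a, ε)) = x j (inl a', ε) := fun i j h a => by
    obtain rfl : i = j - 1 := by omega
    exact ⟨a, h1 j a⟩
  have hoff : ∀ (f : ∀ i j, A.X i →ₗ[ℤ[G]] A.X j) (i j : ℤ) (y : Inv W.ρ (repQ P i)),
      invOver W (offMap P f true true i j) (invOver W (LinearMap.inl _ (P.X i) (A.X i)) y) = 0 :=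
    fun f i j => invOver_comp_eq_zero W fun z =>
      congrArg (fun y => ((0, y) : P.X j × A.X j)) (map_zero (f i j))
  have hoff' : ∀ (f : ∀ i j, A.X i →ₗ[ℤ[G]] A.X j) (i j : ℤ) (y : Inv W.ρ (repQ A i)),
      invOver W (offMap P f true true i j) (invOver W (LinearMap.inr _ (P.X i) (A.X i)) y) =
        invOver W (LinearMap.inr _ (P.X j) (A.X j)) (invOver W (f i j) y) :=
    fun f i j => invOver_square W fun z => rfl
  have hsw : ∀ (i : ℤ) (y : Inv W.ρ (repQ A i)),
      invOver W (swapMap P A true false i) (invOver W (LinearMap.inr _ (P.X i) (A.X i)) y) = 0 :=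
    fun i => invOver_comp_eq_zero W fun z => rfl
  intro i c c₀ c₁ c₂ e₀ e₁ e₂ a
  subst e₀ e₁ e₂
  cases c₂
  · refine Or.inl ⟨joinEquiv _ _ _ _ _ (inl a), fun ε => ⟨(joinBasis_inl W (E.v i) (x i) a ε).symm,
      invOver_zero W _, invOver_zero W _⟩⟩
  · obtain ⟨a, rfl⟩ := (joinEquiv _ _ _ _ _).surjective a
    rcases a with a | a | a
    · refine Or.inl ⟨a, fun ε => ?_⟩
      have e1 := joinBasis_inl W (E.v i) (x i) a ε
      exact ⟨(congrArg _ e1).trans ((invOver_comp W _ _ _).trans (invOver_id W _)),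
        (congrArg _ e1).trans (hoff _ _ _ _), (congrArg _ e1).trans (hoff _ _ _ _)⟩
    · refine Or.inr (Or.inr ⟨joinEquiv _ _ _ _ _ (inr (inr a)), fun ε => ?_⟩)
      have e1 := joinBasis_inr W (E.v i) (x i) (inl a) ε
      refine ⟨(congrArg _ e1).trans (hsw _ _), (congrArg _ e1).trans ((hoff' _ _ _ _).trans
        ((congrArg _ (hd0 _ _ _)).trans (map_zero _))), ?_⟩
      exact (congrArg _ e1).trans ((hoff' _ _ _ _).trans ((congrArg _ (h3 _ _ _)).trans
        (joinBasis_inr W (E.v (i - 1)) (x (i - 1)) (inr a) ε).symm))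
    · obtain ⟨a', ha'⟩ := hd1 i (i + 1) rfl a
      refine Or.inr (Or.inl ⟨joinEquiv _ _ _ _ _ (inr (inl a')), fun ε => ?_⟩)
      have e1 := joinBasis_inr W (E.v i) (x i) (inr a) ε
      refine ⟨(congrArg _ e1).trans (hsw _ _), ?_, (congrArg _ e1).trans ((hoff' _ _ _ _).trans
        ((congrArg _ (h2 _ _ _)).trans (map_zero _)))⟩
      exact (congrArg _ e1).trans ((hoff' _ _ _ _).trans ((congrArg _ (ha' _)).trans
        (joinBasis_inr W (E.v (i + 1)) (x (i + 1)) (inl a') ε).symm))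

lemma dInv_joinBasis {W : SymplecticRep G} {L : LocalBases P} (E : AdaptedBases W L) {m : ℤ → ℕ}
    {x : ∀ i, Basis ((Fin (m (i - 1)) ⊕ Fin (m i)) × Fin 2) ℂ (Inv W.ρ (repQ A i))}
    (h1 : ∀ i a ε, dInv A W (i - 1) i (x (i - 1) (inr a, ε)) = x i (inl a, ε)) (i : ℤ) (a ε) :
    dInv (dirSum P A) W (i - 1) i (joinBasis W (E.v (i - 1)) (x (i - 1)) (inr (inr a), ε)) =
      joinBasis W (E.v i) (x i) (inl a, ε) := by
  have key : ∀ (j : ℤ) (y : Inv W.ρ (repQ P j)) (y' : Inv W.ρ (repQ A j)),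
      invOver W (diffMap (dirSum P A) j i) (invOver W (LinearMap.inl _ (P.X j) (A.X j)) y) =
        invOver W (LinearMap.inl _ (P.X i) (A.X i)) (invOver W (diffMap P j i) y) ∧
      invOver W (diffMap (dirSum P A) j i) (invOver W (LinearMap.inr _ (P.X j) (A.X j)) y') =
        invOver W (LinearMap.inr _ (P.X i) (A.X i)) (invOver W (diffMap A j i) y') :=
    fun j y y' => ⟨invOver_square W (fun z => congrArg (fun w => ((P.d j i).hom z, w))
      (map_zero (A.d j i).hom)) y, invOver_square W (fun z => congrArg (fun w => (w, (A.d j i).hom z))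
      (map_zero (P.d j i).hom)) y'⟩
  rcases a with a | a
  · refine (congrArg _ (joinBasis_inl W (E.v (i - 1)) (x (i - 1)) (inr (inr a)) ε)).trans ?_
    refine ((key (i - 1) _ 0).1.trans (congrArg _ (E.v_boundary i a ε))).trans ?_
    exact (joinBasis_inl W (E.v i) (x i) (inl a) ε).symm
  · refine (congrArg _ (joinBasis_inr W (E.v (i - 1)) (x (i - 1)) (inr a) ε)).trans ?_
    refine ((key (i - 1) 0 _).2.trans (congrArg _ (h1 i a ε))).trans ?_
    exact (joinBasis_inr W (E.v i) (x i) (inl a) ε).symm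

end

section

lemma det_ne_zero_of_colour {α Γ : Type*} [Fintype α] [DecidableEq α] [LinearOrder Γ] (c : α → Γ)
    (A : PairMatrix α ℂ) (hA : ∀ x y, c x.1 ≠ c y.1 → A x y = 0)
    (hd : ∀ γ, (A.submatrix (fun x : {a // c a = γ} × Fin 2 => (x.1.1, x.2))
      (fun x : {a // c a = γ} × Fin 2 => (x.1.1, x.2))).det ≠ 0) : A.det ≠ 0 := by
  rw [BlockTriangular.det (b := fun x : α × Fin 2 => c x.1) fun x y h => hA x y h.ne']
  refine prod_ne_zero_iff.2 fun γ _ => ?_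
  let e : {x : α × Fin 2 // c x.1 = γ} ≃ {a // c a = γ} × Fin 2 :=
    ⟨fun x => (⟨x.1.1, x.2⟩, x.1.2), fun x => ⟨(x.1.1, x.2), x.1.2⟩, fun _ => rfl, fun _ => rfl⟩
  have h := hd γ
  rwa [← det_submatrix_equiv_self e] at h

lemma exists_fibre_equiv_zero {α : ℤ → Type*} {S : Set ℤ} (h : 0 ∈ S) :
    ∃ e : α 0 ≃ {a : Σ i : S, α i // |(a.1 : ℤ)| = 0}, ∀ x, (e x).1 = ⟨⟨0, h⟩, x⟩ := by
  refine ⟨Equiv.ofBijective (fun x => ⟨⟨⟨0, h⟩, x⟩, abs_zero⟩) ⟨fun x y hxy => ?_, ?_⟩, fun _ => rfl⟩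
  · exact eq_of_heq (Sigma.mk.inj (congrArg val hxy)).2
  · rintro ⟨⟨⟨i, hi⟩, x⟩, hx⟩
    obtain rfl : i = 0 := abs_eq_zero.1 hx
    exact ⟨x, rfl⟩

lemma exists_fibre_equiv {α : ℤ → Type*} {S : Set ℤ} {n : ℤ} (hn : 0 < n) (h : n ∈ S) (h' : -n ∈ S) :
    ∃ e : α n ⊕ α (-n) ≃ {a : Σ i : S, α i // |(a.1 : ℤ)| = n},
      (∀ x, (e (inl x)).1 = ⟨⟨n, h⟩, x⟩) ∧ ∀ x, (e (inr x)).1 = ⟨⟨-n, h'⟩, x⟩ := by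
  refine ⟨Equiv.ofBijective (Sum.elim (fun x => ⟨⟨⟨n, h⟩, x⟩, abs_of_pos hn⟩)
    fun x => ⟨⟨⟨-n, h'⟩, x⟩, (abs_neg n).trans (abs_of_pos hn)⟩) ⟨?_, ?_⟩, fun _ => rfl, fun _ => rfl⟩
  · rintro (x | x) (y | y) hxy
    · exact congrArg inl (eq_of_heq (Sigma.mk.inj (congrArg val hxy)).2)
    · have := congrArg val (Sigma.mk.inj (congrArg val hxy)).1
      change n = -n at this
      omega
    · have := congrArg val (Sigma.mk.inj (congrArg val hxy)).1
      change -n = n at this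
      omega
    · exact congrArg inr (eq_of_heq (Sigma.mk.inj (congrArg val hxy)).2)
  · rintro ⟨⟨⟨i, hi⟩, x⟩, hx⟩
    rcases eq_or_eq_neg_of_abs_eq hx with rfl | rfl
    · exact ⟨inl x, rfl⟩
    · exact ⟨inr x, rfl⟩

lemma finprod_abs_parity {F₀ F₁ : ℤ → ℂ} (q : ℤ → ℂ) (t : Finset ℤ) (ht : ∀ i, i ∉ t → q i = 1)
    (h0 : ∀ i, 0 ≤ i → Even i → F₀ i = q i) (h0' : ∀ i, 0 ≤ i → ¬ Even i → F₁ i = q i)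
    (h1 : ∀ i, i < 0 ∨ ¬ Even i → F₀ i = 1) (h1' : ∀ i, i < 0 ∨ Even i → F₁ i = 1) :
    (∏ᶠ i, F₀ i) / ∏ᶠ i, F₁ i = q 0 * ∏ᶠ i : {i : ℤ // 0 < i},
      q i ^ (((i : ℤ).negOnePow : ℤˣ) : ℤ) := by
  rw [finprod_subtype_eq_finprod_cond (f := fun i => q i ^ (i.negOnePow : ℤ)) fun i : ℤ => 0 < i]
  have hs : ∀ F : ℤ → ℂ, (∀ i, i ∉ t → F i = 1) → (mulSupport F).Finite := fun F hF =>
    t.finite_toSet.subset fun i hi => by_contra fun h => hi (hF i h)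
  have e0 : ∀ i, i ∉ t → F₀ i = 1 := fun i hi => by
    by_cases h : i < 0 ∨ ¬ Even i
    · exact h1 i h
    · push Not at h
      rw [h0 i h.1 h.2, ht i hi]
  have e1 : ∀ i, i ∉ t → F₁ i = 1 := fun i hi => by
    by_cases h : i < 0 ∨ Even i
    · exact h1' i h
    · push Not at h
      rw [h0' i h.1 (Int.not_even_iff_odd.2 (by simpa using h.2)), ht i hi]
  have e2 : q 0 = ∏ᶠ i : ℤ, if i = 0 then q i else 1 := by
    rw [finprod_eq_single _ (0 : ℤ) fun i hi => if_neg hi, if_pos rfl]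
  rw [← finprod_div_distrib (hs F₀ e0) (hs F₁ e1), e2, ← finprod_mul_distrib]
  · refine finprod_congr fun i => ?_
    rcases lt_trichotomy i 0 with h | h | h
    · simp [h1 i (Or.inl h), h1' i (Or.inl h), h.ne, h.not_gt]
    · simp [h, h0 0 le_rfl, h1' 0]
    · by_cases hi : Even i
      · simp [h, h.ne', h0 i h.le hi, h1' i (Or.inr hi), Int.negOnePow_even i hi]
      · simp [h, h.ne', h0' i h.le hi, h1 i (Or.inr hi),
          Int.negOnePow_odd i (Int.not_even_iff_odd.1 hi)]
  · exact hs _ fun i hi => by simp [ht i hi]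
  · exact hs _ fun i hi => by simp [ht i hi]

end

section

lemma exists_of_adapted_cycle {N : ℤ → Type*} [∀ i, AddCommGroup (N i)] [∀ i, Module ℂ (N i)]
    (δ : ∀ i j, N i →ₗ[ℂ] N j) (hδ : ∀ i j k x, δ j k (δ i j x) = 0) {υ τ : ℤ → Type*}
    [∀ i, Fintype (υ i)] [∀ i, Fintype (τ i)]
    (v : ∀ i, Basis ((υ (i - 1) ⊕ τ i ⊕ υ i) × Fin 2) ℂ (N i))
    (hv : ∀ i a ε, δ (i - 1) i (v (i - 1) (inr (inr a), ε)) = v i (inl a, ε))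
    (hc : ∀ i j a ε, i + 1 = j → δ i j (v i (inr (inl a), ε)) = 0) {i j : ℤ} (h : i + 1 = j)
    (y : N i) (hy : δ i j y = 0) :
    ∃ (w : N (i - 1)) (c : τ i × Fin 2 → ℂ),
      y = δ (i - 1) i w + ∑ x, c x • v i (inr (inl x.1), x.2) := by
  have hsum : ∀ i (f : (υ (i - 1) ⊕ τ i ⊕ υ i) × Fin 2 → N j),
      ∑ x, f x = ∑ x : υ (i - 1) × Fin 2, f (inl x.1, x.2) +
        (∑ x : τ i × Fin 2, f (inr (inl x.1), x.2) +
          ∑ x : υ i × Fin 2, f (inr (inr x.1), x.2)) := fun i f => by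
    simp only [sum_prod_type, sum_sum_type]
  have hsum' : ∀ i (f : (υ (i - 1) ⊕ τ i ⊕ υ i) × Fin 2 → N i),
      ∑ x, f x = ∑ x : υ (i - 1) × Fin 2, f (inl x.1, x.2) +
        (∑ x : τ i × Fin 2, f (inr (inl x.1), x.2) +
          ∑ x : υ i × Fin 2, f (inr (inr x.1), x.2)) := fun i f => by
    simp only [sum_prod_type, sum_sum_type]
  obtain rfl : i = j - 1 := by omega
  have h3 : ∀ x : υ (j - 1) × Fin 2, (v (j - 1)).repr y (inr (inr x.1), x.2) = 0 := by
    refine Fintype.linearIndependent_iff.1 ((v j).linearIndependent.comp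
      (fun x : υ (j - 1) × Fin 2 => (inl x.1, x.2)) ?_) _ ?_
    · rintro ⟨a, ε⟩ ⟨b, ε'⟩ hab
      simpa using hab
    · rw [← (v (j - 1)).sum_repr y, map_sum, hsum] at hy
      simp only [map_smul, hv, hc _ _ _ _ h] at hy
      rw [← hy, sum_eq_zero (s := univ (α := υ (j - 1 - 1) × Fin 2)), zero_add]
      · simp
      · intro x _
        rw [← hv, hδ, smul_zero]
  refine ⟨∑ x : υ (j - 1 - 1) × Fin 2, (v (j - 1)).repr y (inl x.1, x.2) •
    v (j - 1 - 1) (inr (inr x.1), x.2),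
    fun x => (v (j - 1)).repr y (inr (inl x.1), x.2), ?_⟩
  conv_lhs => rw [← (v (j - 1)).sum_repr y, hsum']
  simp only [h3, zero_smul, Finset.sum_const_zero, add_zero, map_sum, map_smul, hv]

lemma mem_of_map_eq_add_sum {Z N N' ι : Type*} [Fintype ι] [AddCommGroup Z] [Module ℂ Z]
    [AddCommGroup N] [Module ℂ N] [AddCommGroup N'] [Module ℂ N'] (ζ : Z →ₗ[ℂ] N) (f : Z →ₗ[ℂ] N')
    {K : Submodule ℂ N'} {z : Z} {b : N} {c : ι → ℂ} (y : ι → Z) (hz : ζ z = b + ∑ x, c x • ζ (y x))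
    (hb : ∀ z', ζ z' = b → f z' = 0) (hK : ∀ x, f (y x) ∈ K) : f z ∈ K := by
  have h := hb (z - ∑ x, c x • y x) (by simp [hz])
  rw [map_sub, sub_eq_zero] at h
  rw [h, map_sum]
  exact K.sum_mem fun x _ => by rw [map_smul]; exact K.smul_mem _ (hK x)

lemma exists_rG_span {n : ℕ} {ρ : CRep G n} {V : Type v} [AddCommGroup V]
    [Module ℚ V] {τ : Representation ℚ G V} (K : Submodule ℂ (Inv ρ τ))
    (hK : ∀ w u, rG ρ τ w u ∈ K) (x : Inv ρ τ) : x ∈ K := by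
  have h1 : ∀ y : (Fin n → ℂ) ⊗[ℚ] V, ∃ z ∈ K, z.1 = ∑ g, tensorRep ρ τ g y := fun y => by
    induction y using induction_on with
    | zero => exact ⟨0, K.zero_mem, by simp⟩
    | tmul w u => exact ⟨_, hK w u, rfl⟩
    | add y y' hy hy' =>
      obtain ⟨z, hz, e⟩ := hy
      obtain ⟨z', hz', e'⟩ := hy'
      exact ⟨z + z', K.add_mem hz hz', by simp only [map_add, sum_add_distrib, ← e, ← e']; rfl⟩
  obtain ⟨z, hz, e⟩ := h1 x.1
  have h2 : z = (card G : ℂ) • x := Subtype.ext (e.trans (by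
    rw [sum_congr rfl fun g _ => x.2 g, Finset.sum_const, card_univ,
      ← Nat.cast_smul_eq_nsmul ℂ]
    rfl))
  rw [← inv_smul_smul₀ (cast_ne_zero.2 card_ne_zero : (card G : ℂ) ≠ 0) x, ← h2]
  exact K.smul_mem _ hz

lemma invMap_classPart_eq_zero (W : SymplecticRep G) (S : Set ℤ) (i : S) (z : Inv W.ρ (repZ P i))
    (w : Inv W.ρ (repQ P (i - 1))) (h : zInv P W i z = dInv P W (i - 1) i w) :
    invMap W.ρ (classPart P S i) (classPart_rep S i) z = 0 := by
  have hr : ∀ x, dQ P (i - 1) i x ∈ Zc P i := fun x => dQ_dQ _ _ _ x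
  have h1 : z.1 = tmap W.n ((dQ P (i - 1) i).codRestrict (Zc P i) hr) w.1 := by
    refine tmap_injective W.n (Zc P (i : ℤ)).injective_subtype ?_
    rw [tmap_tmap]
    exact congrArg val h
  refine Subtype.ext ((congrArg (tmap W.n (classPart P S i)) h1).trans ?_)
  rw [tmap_tmap, show (classPart P S i).comp ((dQ P (i - 1) i).codRestrict (Zc P i) hr) = 0 from
    LinearMap.ext fun x => ?_, tmap_zero]
  · rfl
  · refine (congrArg (DirectSum.lof ℚ S (fun i : S => H P i) i) ?_).trans (map_zero _)
    exact (Submodule.Quotient.mk_eq_zero _).2 ⟨x, rfl⟩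

lemma AdaptedBases.span_classes {W : SymplecticRep G} {L : LocalBases P} (E : AdaptedBases W L)
    (S : Set ℤ) : span ℂ (Set.range (E.classes S)) = ⊤ := by
  refine (eq_top_iff.2 fun x _ => exists_rG_span _ (fun w u => ?_) x)
  have h1 : ∀ (i : S) (z : Inv W.ρ (repZ P i)),
      invMap W.ρ (τ' := repPart P S) (classPart P S i) (classPart_rep S i) z ∈
        span ℂ (Set.range (E.classes S)) := fun i z => by
    obtain ⟨b, c, hbc⟩ := exists_of_adapted_cycle (N := fun i => Inv W.ρ (repQ P i)) (dInv P W)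
      (dInv_dInv W) (υ := fun i => Fin (E.s i)) (τ := fun i => Fin (E.t i)) E.v E.v_boundary
      (fun i j a ε h => by
        subst h
        rw [← E.v_cycle]
        exact mem_ker.1 ((range_zInv W i).le ⟨_, rfl⟩)) rfl (zInv P W i z)
      (mem_ker.1 ((range_zInv W i).le ⟨_, rfl⟩))
    refine mem_of_map_eq_add_sum (N := Inv W.ρ (repQ P i)) (N' := Inv W.ρ (repPart P S))
      (b := dInv P W (i - 1) i b) (c := c) (zInv P W i)
      (invMap W.ρ (τ := repZ P i) (classPart P S i) (classPart_rep S i))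
      (fun x : Fin (E.t i) × Fin 2 => E.y i (x.1, x.2)) (hbc.trans (congrArg _ (sum_congr rfl
        fun x _ => congrArg (c x • ·) (E.v_cycle i x.1 x.2).symm)))
      (fun z' h => invMap_classPart_eq_zero W S i z' b h) fun x =>
        subset_span ⟨(⟨i, x.1⟩, x.2), rfl⟩
  induction u using DirectSum.induction_on with
  | zero => exact (rG_zero_right (τ := repPart P S) w).symm ▸ Submodule.zero_mem _
  | of i h =>
    obtain ⟨z, rfl⟩ := mk_surjective _ h
    have h3 := h1 i (rG W.ρ (repZ P i) w z)
    rwa [invMap_rG] at h3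
  | add a b ha hb =>
    exact (rG_add_right (τ := repPart P S) w a b).symm ▸ Submodule.add_mem _ ha hb

end

namespace PairingLift

variable   {τ : GradedPairing Q} (D : PairingLift τ)

lemma exists_add_of_mem_Zc {i : ℤ} {z : QT Q i} (hz : z ∈ Zc Q i) :
    ∃ b ∈ Bc Q i, ∃ h ∈ D.Hc i, z = b + h := by
  obtain ⟨y, hy, u, hu, rfl⟩ := Submodule.mem_sup.1 ((D.isCompl_U i).sup_eq_top.ge (mem_top (x := z)))
  obtain ⟨b, hb, h, hh, rfl⟩ := Submodule.mem_sup.1 hy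
  have h1 : u ∈ Zc Q i := by
    have h2 := (Zc Q i).sub_mem hz ((Zc Q i).add_mem (Bc_le_Zc i hb) (D.Hc_le i hh))
    rwa [add_sub_cancel_left] at h2
  rw [show u = 0 from (Submodule.disjoint_def.1 (D.disjoint_U i)) u hu h1, add_zero]
  exact ⟨b, hb, h, hh, rfl⟩

lemma p_Bc_Zc {i j : ℤ} (h : i + j = 0) {x : QT Q i} (hx : x ∈ Bc Q i) {z : QT Q j}
    (hz : z ∈ Zc Q j) : D.p i j h x z = 0 := by
  obtain ⟨b, hb, c, hc, rfl⟩ := D.exists_add_of_mem_Zc hz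
  rw [map_add, D.orth_B_B i j h x hx b hb, D.orth_B_H i j h x hx c hc, add_zero]

lemma p_cycles {i j : ℤ} (h : i + j = 0) (z : Zc Q i) (z' : Zc Q j) :
    D.p i j h z z' = τ i j h (classH Q i z) (classH Q j z') := by
  have key : ∀ {i : ℤ} (z : Zc Q i), ∃ c : Zc Q i, c.1 ∈ D.Hc i ∧ z.1 - c.1 ∈ Bc Q i ∧
      classH Q i z = classH Q i c := fun {i} z => by
    obtain ⟨b, hb, c, hc, e⟩ := D.exists_add_of_mem_Zc z.2
    have h1 : z.1 - c ∈ Bc Q i := by rwa [e, add_sub_cancel_right]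
    refine ⟨⟨c, D.Hc_le i hc⟩, hc, h1, sub_eq_zero.1 ?_⟩
    rw [← map_sub]
    exact (classH_eq_zero_iff _).2 h1
  obtain ⟨c, hc, h1, e⟩ := key z
  obtain ⟨c', hc', h1', e'⟩ := key z'
  rw [e, e', ← D.lifts i j h c c' hc hc', ← sub_add_cancel z.1 c.1, map_add, LinearMap.add_apply,
    D.p_Bc_Zc h h1 z'.2, zero_add, ← sub_add_cancel z'.1 c'.1, map_add,
    D.symm i j h ((add_comm j i).trans h), D.p_Bc_Zc _ h1' c.2, zero_add]

lemma p_adjoint {i' i j j' : ℤ} (h : i + j = 0) (h' : i' + j' = 0) (hi : i' + 1 = i) (hj : j + 1 = j')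
    (x : QT Q i') (y : QT Q j) : D.p i' j' h' x (dQ Q j j' y) = D.p i j h (dQ Q i' i x) y := by
  obtain rfl : i' = i - 1 := by omega
  subst hj
  have key : ∀ (k : ℤ) (x : QT Q k), ∃ z ∈ Zc Q k, ∃ u ∈ D.U k, x = z + u := fun k x => by
    obtain ⟨y, hy, u, hu, e⟩ := Submodule.mem_sup.1 ((D.isCompl_U k).sup_eq_top.ge (mem_top (x := x)))
    exact ⟨y, sup_le (Bc_le_Zc k) (D.Hc_le k) hy, u, hu, e.symm⟩
  obtain ⟨z, hz, u, hu, rfl⟩ := key _ x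
  obtain ⟨z', hz', u', hu', rfl⟩ := key _ y
  rw [map_add, map_add (dQ Q (i - 1) i), map_add (dQ Q j (j + 1)), (mem_Zc_iff hi z).1 hz, (mem_Zc_iff rfl z').1 hz',
    zero_add, zero_add, LinearMap.add_apply, map_add, D.adjoint i j h h' u hu u' hu',
    D.p_Bc_Zc h (dQ_mem_Bc hi u) hz', D.symm _ _ h' ((add_comm _ _).trans h'),
    D.p_Bc_Zc _ (dQ_mem_Bc rfl u') hz, zero_add]

variable (W : SymplecticRep G)

/-- The pairings `κ ⊗ p / |G|` between the invariants for the terms of a complex. -/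
def invPair (i j : ℤ) (h : i + j = 0) :
    Inv W.ρ (repQ Q i) →ₗ[ℂ] Inv W.ρ (repQ Q j) →ₗ[ℂ] ℂ :=
  (tmulPair W.κ ((card G : ℚ)⁻¹ • D.p i j h)).compl₁₂ (Submodule.subtype _)
    (Submodule.subtype _)

lemma invPair_flip (i j : ℤ) (h : i + j = 0) (h' : j + i = 0) (x y) :
    D.invPair W j i h' y x = -D.invPair W i j h x y :=
  tmulPair_flip W.κ W.alt _ _ (fun _ _ => congrArg (_ * ·) (D.symm j i h' h _ _)) x.1 y.1

lemma invPair_adjoint (i' i j j' : ℤ) (h : i + j = 0) (h' : i' + j' = 0) (hi : i' + 1 = i)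
    (hj : j + 1 = j') (x y) : D.invPair W i' j' h' x (dInv Q W j j' y) =
      D.invPair W i j h (dInv Q W i' i x) y := by
  have h1 := tmulPair_map W.κ ((card G : ℚ)⁻¹ • D.p i' j' h') LinearMap.id (dQ Q j j') x.1 y.1
  have h2 := tmulPair_map W.κ ((card G : ℚ)⁻¹ • D.p i j h) (dQ Q i' i) LinearMap.id x.1 y.1
  rw [show tmap W.n (LinearMap.id : QT Q i' →ₗ[ℚ] QT Q i') = LinearMap.id from
    TensorProduct.AlgebraTensorModule.map_id] at h1
  rw [show tmap W.n (LinearMap.id : QT Q j →ₗ[ℚ] QT Q j) = LinearMap.id from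
    TensorProduct.AlgebraTensorModule.map_id] at h2
  refine h1.trans (Eq.trans ?_ h2.symm)
  congr 3
  exact LinearMap.ext fun x => LinearMap.ext fun y => congrArg (_ * ·) (D.p_adjoint h h' hi hj x y)

end PairingLift

lemma Pf_eq_pfm_of_span {V α : Type*} [AddCommGroup V] [Module ℂ V] [Fintype α] [DecidableEq α]
    (h : BilinForm ℂ V) (ha : h.IsAlt) {v : α × Fin 2 → V} (hd : (gram h v).det ≠ 0)
    (hs : span ℂ (Set.range v) = ⊤) : Pf h v = pfm (gram h v) := by
  let b := Basis.mk (linearIndependent_of_gram h v hd) hs.ge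
  have hb : ⇑b = v := Basis.coe_mk _ _
  exact Pf_eq_pfm h ha (nondegenerate_of_gram h b (by rwa [hb])) b v

section

variable   {σ : GradedPairing P} {S : Set ℤ} (hS : ∀ i ∈ S, -i ∈ S)

lemma GradedPairing.part_classPart (i j : S) (h : (i : ℤ) + j = 0) (z : Zc P i) (z' : Zc P j) :
    σ.part S hS (classPart P S i z) (classPart P S j z') = σ i j h (classH P i z) (classH P j z') := by
  obtain ⟨i, hi⟩ := i
  obtain ⟨j, hj⟩ := j
  obtain rfl : j = -i := by change i + j = 0 at h; omega
  change DirectSum.toModule ℚ S ((⨁ i : S, H P i) →ₗ[ℚ] ℚ) _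
    (DirectSum.lof ℚ S (fun i : S => H P i) ⟨i, hi⟩ (classH P i z)) _ = _
  rw [DirectSum.toModule_lof]
  exact congrArg (σ i (-i) _ _) (DirectSum.component.lof_self ℚ _ _)

lemma GradedPairing.part_classPart_of_ne (i j : S) (h : (i : ℤ) + j ≠ 0) (z : Zc P i) (z' : Zc P j) :
    σ.part S hS (classPart P S i z) (classPart P S j z') = 0 := by
  change DirectSum.toModule ℚ S ((⨁ i : S, H P i) →ₗ[ℚ] ℚ) _
    (DirectSum.lof ℚ S (fun i : S => H P i) i (classH P i z)) _ = _
  rw [DirectSum.toModule_lof]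
  refine (congrArg (σ i (-i) _ _) ?_).trans (map_zero _)
  exact DFinsupp.single_eq_of_ne fun H => h (by have := congrArg val H; simp only at this; omega)

lemma IsSymmetricPairing.part_symm (hσ : IsSymmetricPairing σ) (x y : Hpart P S) :
    σ.part S hS y x = σ.part S hS x y := by
  suffices h : σ.part S hS = (σ.part S hS).flip from LinearMap.congr_fun₂ h y x
  refine DirectSum.linearMap_ext (M := fun i : S => H P i) _ fun i => LinearMap.ext fun c =>
    DirectSum.linearMap_ext (M := fun i : S => H P i) _ fun j => LinearMap.ext fun c' => ?_
  obtain ⟨z, rfl⟩ := mk_surjective _ c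
  obtain ⟨z', rfl⟩ := mk_surjective _ c'
  change σ.part S hS (classPart P S i z) (classPart P S j z') =
    σ.part S hS (classPart P S j z') (classPart P S i z)
  by_cases h : (i : ℤ) + j = 0
  · rw [GradedPairing.part_classPart hS i j h, GradedPairing.part_classPart hS j i ((add_comm _ _).trans h)]
    exact hσ.symm _ _ _ _ _ _
  · rw [GradedPairing.part_classPart_of_ne hS i j h,
      GradedPairing.part_classPart_of_ne hS j i fun h' => h ((add_comm _ _).trans h')]

variable (D : PairingLift ((σ.scale (card G : ℚ)).pullback (dirSumFst P A)))

lemma PairingLift.p_inl {i j : ℤ} (h : i + j = 0) (z : Zc P i) (z' : Zc P j) :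
    (card G : ℚ)⁻¹ • D.p i j h (mapOver ℚ (LinearMap.inl ℤ[G] (P.X i) (A.X i)) z)
      (mapOver ℚ (LinearMap.inl ℤ[G] (P.X j) (A.X j)) z') =
      σ i j h (classH P i z) (classH P j z') := by
  have key : ∀ {i : ℤ} (z : Zc P i), ∃ c : Zc (dirSum P A) i,
      c.1 = mapOver ℚ (LinearMap.inl ℤ[G] (P.X i) (A.X i)) z ∧
      mapH (dirSumFst P A) i (classH _ i c) = classH P i z := fun {i} z => by
    refine ⟨⟨_, mem_ker.2 ?_⟩, rfl, ?_⟩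
    · exact (mapOver_comp ℚ _ (diffMap (dirSum P A) i (i + 1)) z.1).trans
        ((congrArg (fun g => mapOver ℚ g z.1) (LinearMap.ext fun z =>
          congrArg (fun w => ((P.d i (i + 1)).hom z, w)) (map_zero (A.d i (i + 1)).hom))).trans
        ((mapOver_comp ℚ (diffMap P i (i + 1)) (LinearMap.inl _ _ (A.X (i + 1))) z.1).symm.trans
        ((congrArg _ (mem_ker.1 z.2)).trans (map_zero _))))
    · refine congrArg (classH P i) (Subtype.ext ?_)
      exact (mapOver_comp ℚ _ (fst _ (P.X i) (A.X i)) z.1).trans (mapOver_id ℚ z.1)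
  obtain ⟨c, e, hc⟩ := key z
  obtain ⟨c', e', hc'⟩ := key z'
  rw [← e, ← e', D.p_cycles]
  change _ * (_ * σ i j h (mapH _ i _) (mapH _ j _)) = _
  rw [hc, hc', inv_mul_cancel_left₀ (cast_ne_zero.2 card_ne_zero)]

lemma PairingLift.gradedGram_eq_gram {W : SymplecticRep G} {L : LocalBases P} (E : AdaptedBases W L)
    {v : ∀ i, Fin (E.t i) × Fin 2 → Inv W.ρ (repQ (dirSum P A) i)}
    (hv : ∀ i a ε, v i (a, ε) = invOver W (LinearMap.inl _ (P.X i) (A.X i))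
      (E.v i (inr (inl a), ε))) :
    gradedGram (D.invPair W) S v =
      gram (invForm W.ρ (repPart P S) W.κ (σ.part S hS)) (E.classes S) := by
  have hv' : ∀ i x, (v i x).1 = tmap W.n (mapOver ℚ (LinearMap.inl ℤ[G] (P.X i) (A.X i)) ∘ₗ
      (Zc P i).subtype) (E.y i x).1 := fun i x => by
    rw [hv i x.1 x.2, ← E.v_cycle]
    exact tmap_tmap _ _ _ _
  refine Matrix.ext fun x y => ?_
  rw [gram_apply, invForm_apply]
  refine Eq.trans ?_ (tmulPair_map W.κ (σ.part S hS) (classPart P S x.1.1) (classPart P S y.1.1)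
    (E.y _ (x.1.2, x.2)).1 (E.y _ (y.1.2, y.2)).1).symm
  by_cases h : (x.1.1 : ℤ) + y.1.1 = 0
  · rw [gradedGram_apply v x y h]
    change tmulPair W.κ _ (v _ _).1 (v _ _).1 = _
    rw [hv', hv']
    refine (tmulPair_map W.κ _ _ _ _ _).trans ?_
    congr 3
    exact LinearMap.ext fun z => LinearMap.ext fun z' =>
      (D.p_inl h z z').trans (σ.part_classPart hS x.1.1 y.1.1 h z z').symm
  · rw [gradedGram_eq_zero v x y h, show (σ.part S hS).compl₁₂ (classPart P S x.1.1)
      (classPart P S y.1.1) = 0 from LinearMap.ext fun z => LinearMap.ext fun z' =>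
        σ.part_classPart_of_ne hS x.1.1 y.1.1 h z z', show tmulPair W.κ (0 : Zc P x.1.1 →ₗ[ℚ] Zc P y.1.1 →ₗ[ℚ] ℚ) = 0 from
        (tmulPair_ext fun x u y u' => by simp).symm]
    rfl

lemma AdaptedBases.Pf_classes {W : SymplecticRep G} {L : LocalBases P} (E : AdaptedBases W L)
    (hσ : IsSymmetricPairing σ) [Fintype (Σ i : S, Fin (E.t i))] [DecidableEq (Σ i : S, Fin (E.t i))]
    (hd : (gram (invForm W.ρ (repPart P S) W.κ (σ.part S hS)) (E.classes S)).det ≠ 0) :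
    Pf (invForm W.ρ (repPart P S) W.κ (σ.part S hS)) (E.classes S) =
      pfm (gram (invForm W.ρ (repPart P S) W.κ (σ.part S hS)) (E.classes S)) := by
  have h := E.span_classes S
  have ha := invForm_isAlt (ρ := W.ρ) (repPart P S) W.alt fun x y => hσ.part_symm hS x y
  generalize E.classes S = c at hd h ⊢
  generalize invForm W.ρ (repPart P S) W.κ (σ.part S hS) = β at hd ha ⊢
  exact Pf_eq_pfm_of_span (V := Inv W.ρ (repPart P S)) β ha hd h

end

namespace PairingLift

variable   {τ : GradedPairing Q} (D : PairingLift τ)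

lemma sumForm_apply (i : ℤ) (x y : QT Q i × QT Q (-i)) : D.sumForm i x y =
    D.p i (-i) (add_neg_cancel i) x.1 y.2 + D.p (-i) i (neg_add_cancel i) x.2 y.1 := rfl

lemma sumForm_symm (i : ℤ) (x y : QT Q i × QT Q (-i)) : D.sumForm i x y = D.sumForm i y x :=
  (congrArg₂ (· + ·) (D.symm i (-i) _ (neg_add_cancel i) _ _)
    (D.symm (-i) i _ (add_neg_cancel i) _ _)).trans (add_comm (G := ℚ) _ _)

lemma sumForm_rep (i : ℤ) (g : G) (x y : QT Q i × QT Q (-i)) :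
    D.sumForm i ((repQ Q i).prod (repQ Q (-i)) g x) ((repQ Q i).prod (repQ Q (-i)) g y) =
      D.sumForm i x y :=
  congrArg₂ (· + ·) (D.inv _ _ _ g _ _) (D.inv _ _ _ g _ _)

lemma eq_zero_of_sumForm (i : ℤ) (x : QT Q i × QT Q (-i)) (h : ∀ y, D.sumForm i x y = 0) : x = 0 := by
  refine Prod.ext ((D.nondeg i (-i) (add_neg_cancel i)).1 _ fun y => ?_)
    ((D.nondeg (-i) i (neg_add_cancel i)).1 _ fun y => ?_)
  · have := h (0, y)
    rwa [sumForm_apply, map_zero, add_zero] at this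
  · have := h (y, 0)
    rwa [sumForm_apply, map_zero, zero_add] at this

variable (L : LocalBases Q) (W : SymplecticRep G)

lemma invPair_rG (i j : ℤ) (h : i + j = 0) (w w' : Fin W.n → ℂ) (u : QT Q i) (u' : QT Q j) :
    D.invPair W i j h (rG W.ρ (repQ Q i) w u) (rG W.ρ (repQ Q j) w' u') =
      (card G : ℂ) * ∑ g, (((card G : ℚ)⁻¹ • D.p i j h) u (repQ Q j g u') : ℂ) *
        W.κ w (W.ρ g w') :=
  tmulPair_rG W.inv (fun g x y => congrArg (_ * ·) (D.inv i j h g x y)) w w' u u'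

section

variable {J : ℤ → Type} (e : ∀ i, Fin (L.r i) × Fin W.k ≃ J i)

/-- The Pfaffians which occur in the definition of the hermitian class. -/
def pfFactor (i : ℤ) : ℂ :=
  if 0 < i then pfGram W ((repQ Q i).prod (repQ Q (-i))) (D.sumForm i)
    (Sum.elim (fun j => (L.a0 i j, 0)) (fun j => (0, L.a0 (-i) j)))
  else pfGram W (repQ Q 0) (D.p 0 0 (add_zero 0)) (L.a0 0)

variable (S : Set ℤ)

/-- The Gram matrix of the bases which belong to rational bases of the terms of a complex. -/
def bGram : Matrix ((Σ i : S, J i) × Fin 2) ((Σ i : S, J i) × Fin 2) ℂ :=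
  gradedGram (D.invPair W) S fun i x => bVec W L i ((e i).symm x.1, x.2)

variable {S}

lemma bGram_apply {i j : ℤ} (hi : i ∈ S) (hj : j ∈ S) (h : i + j = 0) (x y) (ε ε' : Fin 2) :
    D.bGram L W e S (⟨⟨i, hi⟩, e i x⟩, ε) (⟨⟨j, hj⟩, e j y⟩, ε') =
      D.invPair W i j h (bVec W L i (x, ε)) (bVec W L j (y, ε')) := by
  refine (gradedGram_apply (k := D.invPair W) (S := S) _ (⟨⟨i, hi⟩, e i x⟩, ε)
    (⟨⟨j, hj⟩, e j y⟩, ε') h).trans ?_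
  change D.invPair W i j h (bVec W L i ((e i).symm (e i x), ε)) (bVec W L j ((e j).symm (e j y), ε')) = _
  rw [Equiv.symm_apply_apply, Equiv.symm_apply_apply]

lemma bGram_eq_zero {i j : ℤ} (hi : i ∈ S) (hj : j ∈ S) (h : i + j ≠ 0) (x y) (ε ε' : Fin 2) :
    D.bGram L W e S (⟨⟨i, hi⟩, x⟩, ε) (⟨⟨j, hj⟩, y⟩, ε') = 0 :=
  gradedGram_eq_zero (k := D.invPair W) (S := S) _ (⟨⟨i, hi⟩, x⟩, ε) (⟨⟨j, hj⟩, y⟩, ε') h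

lemma fibre_zero (h0 : 0 ∈ S) [Fintype {a : Σ i : S, J i // |(a.1 : ℤ)| = 0}]
    [DecidableEq {a : Σ i : S, J i // |(a.1 : ℤ)| = 0}] :
    let K := (D.bGram L W e S).submatrix
      (fun x : {a : Σ i : S, J i // |(a.1 : ℤ)| = 0} × Fin 2 => (x.1.1, x.2)) fun x => (x.1.1, x.2)
    pfm K = D.pfFactor L W 0 ∧ K.det ≠ 0 := by
  obtain ⟨E, hE⟩ := exists_fibre_equiv_zero (α := J) h0
  let E' := (e 0).trans E
  have hc : (card G : ℚ) ≠ 0 := cast_ne_zero.2 card_ne_zero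
  have hs := fun x y => D.symm 0 0 (add_zero 0) (add_zero 0) x y
  have hi := D.inv 0 0 (add_zero 0)
  have hn := (D.nondeg 0 0 (add_zero 0)).1
  have hB : ∀ x y, D.p 0 0 (add_zero 0) x y =
      (card G : ℚ) * ((card G : ℚ)⁻¹ • D.p 0 0 (add_zero 0)) x y := fun x y =>
    (mul_inv_cancel_left₀ hc _).symm
  intro K
  have hK : K.submatrix (fun x => (E' x.1, x.2)) (fun x => (E' x.1, x.2)) =
      gram (invForm W.ρ (repQ Q 0) W.κ ((card G : ℚ)⁻¹ • D.p 0 0 (add_zero 0)))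
        (bfam W (repQ Q 0) (L.a0 0)) := by
    refine Matrix.ext fun x y => ?_
    change D.bGram L W e S ((E (e 0 x.1)).1, x.2) ((E (e 0 y.1)).1, y.2) = _
    rw [hE, hE, D.bGram_apply L W e h0 h0 (add_zero 0), gram_apply, invForm_apply]
    rfl
  refine ⟨?_, ?_⟩
  · rw [← pfm_reindex E' K, hK, pfFactor, if_neg (lt_irrefl 0), pfGram_eq_pfm W hs hB hi hn (L.a0_basis 0)]
  · rw [← det_submatrix_equiv_self (E'.prodCongr (Equiv.refl (Fin 2)))]
    exact hK ▸ det_gram_bfam_ne_zero W hs hB hi hn (L.a0_basis 0)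

lemma fibre_pos {n : ℤ} (hn : 0 < n) (h : n ∈ S) (h' : -n ∈ S)
    [Fintype {a : Σ i : S, J i // |(a.1 : ℤ)| = n}] [DecidableEq {a : Σ i : S, J i // |(a.1 : ℤ)| = n}] :
    let K := (D.bGram L W e S).submatrix
      (fun x : {a : Σ i : S, J i // |(a.1 : ℤ)| = n} × Fin 2 => (x.1.1, x.2)) fun x => (x.1.1, x.2)
    pfm K = D.pfFactor L W n ∧ K.det ≠ 0 := by
  obtain ⟨E, hE, hE'⟩ := exists_fibre_equiv (α := J) hn h h'
  let E' := (sumProdDistrib _ _ _).trans (((e n).sumCongr (e (-n))).trans E)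
  have hc : (card G : ℚ) ≠ 0 := cast_ne_zero.2 card_ne_zero
  have hB : ∀ x y, D.sumForm n x y =
      (card G : ℚ) * ((card G : ℚ)⁻¹ • D.sumForm n) x y := fun x y =>
    (mul_inv_cancel_left₀ hc _).symm
  have ha := (L.a0_basis n).prod (L.a0_basis (-n))
  intro K
  have hK : K.submatrix (fun x => (E' x.1, x.2)) (fun x => (E' x.1, x.2)) =
      gram (invForm W.ρ ((repQ Q n).prod (repQ Q (-n))) W.κ ((card G : ℚ)⁻¹ • D.sumForm n))
        (bfam W ((repQ Q n).prod (repQ Q (-n)))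
          (Sum.elim (fun j => (L.a0 n j, 0)) (fun j => (0, L.a0 (-n) j)))) := by
    have h1 : ∀ w w' u u', invForm W.ρ ((repQ Q n).prod (repQ Q (-n))) W.κ
        ((card G : ℚ)⁻¹ • D.sumForm n) (rG W.ρ _ w u) (rG W.ρ _ w' u') =
        (card G : ℂ) * ∑ g, (((card G : ℚ)⁻¹ • D.sumForm n) u
          ((repQ Q n).prod (repQ Q (-n)) g u') : ℂ) * W.κ w (W.ρ g w') := fun w w' u u' =>
      (invForm_apply _ _ _ _ _).trans
        (tmulPair_rG W.inv (fun g x y => congrArg (_ * ·) (D.sumForm_rep n g x y)) w w' u u')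
    refine Matrix.ext fun x y => ?_
    rw [gram_apply]
    obtain ⟨⟨a, l⟩, ε⟩ := x
    obtain ⟨⟨a', l'⟩, ε'⟩ := y
    rw [bfam, bfam, h1]
    rcases a with a | a <;> rcases a' with a' | a'
    · change D.bGram L W e S ((E (inl (e n (a, l)))).1, ε) ((E (inl (e n (a', l')))).1, ε') = _
      rw [hE, hE, D.bGram_eq_zero L W e h h (by omega)]
      simp [sumForm_apply, Representation.prod]
    · change D.bGram L W e S ((E (inl (e n (a, l)))).1, ε) ((E (inr (e (-n) (a', l')))).1, ε') = _
      rw [hE, hE', D.bGram_apply L W e h h' (add_neg_cancel n), bVec, bVec, invPair_rG]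
      simp [sumForm_apply, Representation.prod]
    · change D.bGram L W e S ((E (inr (e (-n) (a, l)))).1, ε) ((E (inl (e n (a', l')))).1, ε') = _
      rw [hE, hE', D.bGram_apply L W e h' h (neg_add_cancel n), bVec, bVec, invPair_rG]
      simp [sumForm_apply, Representation.prod]
    · change D.bGram L W e S ((E (inr (e (-n) (a, l)))).1, ε)
        ((E (inr (e (-n) (a', l')))).1, ε') = _
      rw [hE', hE', D.bGram_eq_zero L W e h' h' (by omega)]
      simp [sumForm_apply, Representation.prod]
  refine ⟨?_, ?_⟩
  · rw [← pfm_reindex E' K, hK, pfFactor, if_pos hn,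
      pfGram_eq_pfm W (D.sumForm_symm n) hB (D.sumForm_rep n) (D.eq_zero_of_sumForm n) ha]
  · rw [← det_submatrix_equiv_self (E'.prodCongr (Equiv.refl (Fin 2)))]
    exact hK ▸ det_gram_bfam_ne_zero W (D.sumForm_symm n) hB (D.sumForm_rep n) (D.eq_zero_of_sumForm n) ha

lemma bGram_colour (hS : ∀ i ∈ S, -i ∈ S) [Fintype (Σ i : S, J i)] [DecidableEq (Σ i : S, J i)] :
    ∃ F : ℤ → ℂ, pfm (D.bGram L W e S) = ∏ᶠ i, F i ∧ (D.bGram L W e S).det ≠ 0 ∧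
      (∀ i, 0 ≤ i → i ∈ S → F i = D.pfFactor L W i) ∧ (∀ i, i < 0 ∨ i ∉ S → F i = 1) ∧
      ∃ t : Finset ℤ, ∀ i, i ∉ t → F i = 1 := by
  classical
  have hA : ∀ x y : (Σ i : S, J i) × Fin 2, |(x.1.1 : ℤ)| ≠ |(y.1.1 : ℤ)| →
      D.bGram L W e S x y = 0 := fun x y h => D.bGram_eq_zero L W e x.1.1.2 y.1.1.2
        (fun h' => h (by rw [eq_neg_of_add_eq_zero_left h', abs_neg])) _ _ _ _
  have hne : ∀ γ : ℤ, (∃ a : Σ i : S, J i, |(a.1 : ℤ)| = γ) → 0 ≤ γ ∧ γ ∈ S ∧ -γ ∈ S := by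
    rintro _ ⟨⟨⟨i, hi⟩, a⟩, rfl⟩
    refine ⟨abs_nonneg i, ?_⟩
    rcases abs_choice i with h | h
    · exact ⟨h.symm ▸ hi, h.symm ▸ hS i hi⟩
    · exact ⟨h.symm ▸ hS i hi, h.symm ▸ (neg_neg i).symm ▸ hi⟩
  have key : ∀ γ : ℤ, 0 ≤ γ → γ ∈ S →
      let K := (D.bGram L W e S).submatrix
        (fun x : {a : Σ i : S, J i // |(a.1 : ℤ)| = γ} × Fin 2 => (x.1.1, x.2)) fun x => (x.1.1, x.2)
      pfm K = D.pfFactor L W γ ∧ K.det ≠ 0 := fun γ h0 h => by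
    rcases h0.eq_or_lt with rfl | h0
    · convert D.fibre_zero L W e h
    · convert D.fibre_pos L W e h0 h (hS γ h)
  have hem : ∀ γ : ℤ, ¬ (∃ a : Σ i : S, J i, |(a.1 : ℤ)| = γ) →
      IsEmpty {a : Σ i : S, J i // |(a.1 : ℤ)| = γ} := fun γ h => ⟨fun a => h ⟨a.1, a.2⟩⟩
  have hd : (D.bGram L W e S).det ≠ 0 :=
    det_ne_zero_of_colour (fun a : Σ i : S, J i => |(a.1 : ℤ)|) _ hA fun γ => by
      by_cases h : ∃ a : Σ i : S, J i, |(a.1 : ℤ)| = γ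
      · obtain ⟨h1, h2, -⟩ := hne γ h
        convert (key γ h1 h2).2
      · have := hem γ h
        rw [Matrix.det_isEmpty]
        exact one_ne_zero
  refine ⟨_, pfm_colour (fun a : Σ i : S, J i => |(a.1 : ℤ)|) _ hA
    (gradedGram_transpose (D.invPair_flip W) _) hd, hd, fun i hi h => ?_, fun i hi => ?_,
    univ.image fun a : Σ i : S, J i => |(a.1 : ℤ)|, fun i hi => ?_⟩
  · convert (key i hi h).1
  · have := hem i fun h => by
      have := hne i h
      rcases hi with hi | hi
      · exact hi.not_ge this.1
      · exact hi this.2.1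
    exact @pfm_of_isEmpty _ (_) (_) this _
  · have := hem i fun ⟨a, ha⟩ => hi (Finset.mem_image.2 ⟨a, mem_univ _, ha⟩)
    exact @pfm_of_isEmpty _ (_) (_) this _

lemma pfProd_eq [Fintype (Σ i : {i : ℤ | Even i}, J i)] [DecidableEq (Σ i : {i : ℤ | Even i}, J i)]
    [Fintype (Σ i : {i : ℤ | Odd i}, J i)] [DecidableEq (Σ i : {i : ℤ | Odd i}, J i)] :
    D.pfProd L W = pfm (D.bGram L W e {i | Even i}) / pfm (D.bGram L W e {i | Odd i}) ∧
      (D.bGram L W e {i | Even i}).det ≠ 0 ∧ (D.bGram L W e {i | Odd i}).det ≠ 0 := by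
  obtain ⟨F₀, h0, hd0, ha0, hb0, t0, ht0⟩ :=
    D.bGram_colour L W e (S := {i | Even i}) fun _ h => Even.neg h
  obtain ⟨F₁, h1, hd1, ha1, hb1, t1, ht1⟩ :=
    D.bGram_colour L W e (S := {i | Odd i}) fun _ h => Odd.neg h
  refine ⟨?_, hd0, hd1⟩
  rw [h0, h1, finprod_abs_parity (fun i => if 0 ≤ i then D.pfFactor L W i else 1) (t0 ∪ t1)]
  · rw [pfProd]
    refine congrArg₂ (· * ·) ?_ (finprod_congr fun i => ?_)
    · rw [if_pos le_rfl, pfFactor, if_neg (lt_irrefl _)]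
    · rw [if_pos i.2.le, pfFactor, if_pos i.2]
  · intro i hi
    rw [Finset.mem_union, not_or] at hi
    split_ifs with h
    · by_cases he : Even i
      · rw [← ha0 i h he, ht0 i hi.1]
      · rw [← ha1 i h (Int.not_even_iff_odd.1 he), ht1 i hi.2]
    · rfl
  · exact fun i hi he => by rw [ha0 i hi he, if_pos hi]
  · exact fun i hi he => by rw [ha1 i hi (Int.not_even_iff_odd.1 he), if_pos hi]
  · exact fun i hi => hb0 i hi
  · exact fun i hi => hb1 i (hi.imp_right fun h h' => Int.not_even_iff_odd.2 h' h)

end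

end PairingLift

lemma finprod_even_div_odd (f : ℤ → ℂ) {t : Finset ℤ} (ht : ∀ i, i ∉ t → f i = 1) :
    (∏ᶠ i : {i : ℤ | Even i}, f i) / ∏ᶠ i : {i : ℤ | Odd i}, f i =
      ∏ᶠ i : ℤ, f i ^ (i.negOnePow : ℤ) := by
  rw [show ∏ᶠ i : {i : ℤ | Even i}, f i = _ from finprod_subtype_eq_finprod_cond (f := f) fun i : ℤ => Even i,
    show ∏ᶠ i : {i : ℤ | Odd i}, f i = _ from finprod_subtype_eq_finprod_cond (f := f) fun i : ℤ => Odd i,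
    ← finprod_div_distrib]
  · refine finprod_congr fun i => ?_
    by_cases h : Even i
    · simp [h, Int.negOnePow_even i h, Int.not_odd_iff_even.2 h]
    · simp [h, Int.negOnePow_odd i (Int.not_even_iff_odd.1 h), Int.not_even_iff_odd.1 h]
  all_goals exact t.finite_toSet.subset fun i hi => by_contra fun h => hi (by simp [ht i h])

section

lemma PairingLift.pfProd_eq_mul     (hQ : IsPerfect Q) {τ : GradedPairing Q} (D : PairingLift τ) (L : LocalBases Q) (W : SymplecticRep G)
    {υ κ : ℤ → Type} [∀ i, Fintype (υ i)] [∀ i, DecidableEq (υ i)] [∀ i, Fintype (κ i)]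
    [∀ i, DecidableEq (κ i)] [Fintype (Σ i : {i : ℤ | Even i}, κ i)]
    [DecidableEq (Σ i : {i : ℤ | Even i}, κ i)] [Fintype (Σ i : {i : ℤ | Odd i}, κ i)]
    [DecidableEq (Σ i : {i : ℤ | Odd i}, κ i)]
    (v : ∀ i, Basis ((υ (i - 1) ⊕ κ i ⊕ υ i) × Fin 2) ℂ (Inv W.ρ (repQ Q i)))
    (hv : ∀ i a ε, dInv Q W (i - 1) i (v (i - 1) (inr (inr a), ε)) = v i (inl a, ε))
    (hc : ∀ i j a ε, i + 1 = j → dInv Q W i j (v i (inr (inl a), ε)) = 0)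
    (e : ∀ i, Fin (L.r i) × Fin W.k ≃ υ (i - 1) ⊕ κ i ⊕ υ i) :
    let K := fun S => gradedGram (D.invPair W) S
      fun i (x : κ i × Fin 2) => v i (inr (inl x.1), x.2)
    D.pfProd L W = (∏ᶠ i, relDet L e v i ^ (Int.negOnePow i : ℤ)) *
      (pfm (K {i | Even i}) / pfm (K {i | Odd i})) ∧
      (K {i | Even i}).det ≠ 0 ∧ (K {i | Odd i}).det ≠ 0 := by
  classical
  intro K
  obtain ⟨t, ht⟩ := hQ.exists_finset
  have hr : ∀ i, i ∉ t → L.r i = 0 := fun i hi => by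
    have := ht i hi
    exact L.r_eq_zero i
  have hJ : ∀ i, i ∉ t → IsEmpty (υ (i - 1) ⊕ κ i ⊕ υ i) := fun i hi =>
    ⟨fun x => absurd ((e i).symm x).1.2 (by have := hr i hi; omega)⟩
  have hF : ∀ S : Set ℤ, Finite (Σ i : S, υ (i - 1) ⊕ κ i ⊕ υ i) := fun S =>
    Finite.of_injective (β := Σ i : t, υ ((i : ℤ) - 1) ⊕ κ i ⊕ υ i)
      (fun x => ⟨⟨x.1, by_contra fun h => (hJ _ h).elim x.2⟩, x.2⟩) fun x y h => by
        obtain ⟨⟨i, hi⟩, x⟩ := x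
        obtain ⟨⟨j, hj⟩, y⟩ := y
        simp only [Sigma.mk.injEq, Subtype.mk.injEq] at h
        obtain ⟨rfl, h⟩ := h
        rw [eq_of_heq h]
  let _ : Fintype (Σ i : {i : ℤ | Even i}, υ ((i : ℤ) - 1) ⊕ κ i ⊕ υ i) := ofFinite _
  let _ : Fintype (Σ i : {i : ℤ | Odd i}, υ ((i : ℤ) - 1) ⊕ κ i ⊕ υ i) := ofFinite _
  obtain ⟨h1, h2, h3⟩ := D.pfProd_eq L W e
  let b : ∀ i, (υ (i - 1) ⊕ κ i ⊕ υ i) × Fin 2 → Inv W.ρ (repQ Q i) := fun i x =>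
    bVec W L i ((e i).symm x.1, x.2)
  have hC : ∀ i x, b i x = ∑ y, ((v i).toMatrix (b i))ᵀ x y • v i y := fun i x =>
    ((v i).sum_repr _).symm
  have hconj : ∀ (S : Set ℤ) [Fintype (Σ i : S, υ ((i : ℤ) - 1) ⊕ κ i ⊕ υ i)],
      (D.bGram L W e S).det ≠ 0 →
      pfm (D.bGram L W e S) = (∏ᶠ i : S, relDet L e v i) * pfm (gradedGram (D.invPair W) S fun i => v i) ∧
      (gradedGram (D.invPair W) S fun i => v i).det ≠ 0 := fun S _ hS => by
    obtain ⟨M, hM, hM'⟩ := gradedGram_eq_conj (k := D.invPair W) (S := S) (fun i => v i) _ _ hC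
    rw [show D.bGram L W e S = _ from hM'] at hS ⊢
    rw [pfm_conj, hM]
    refine ⟨congrArg (· * _) (finprod_congr fun i => ?_), fun h => hS ?_⟩
    · rw [det_transpose, relDet, Basis.det_apply]
    · rw [det_mul, det_mul, h, mul_zero, zero_mul]
  obtain ⟨h4, h5⟩ := hconj _ h2
  obtain ⟨h6, h7⟩ := hconj _ h3
  have h0 : ∀ i j h a ε z, dInv Q W j (j + 1) z = 0 →
      D.invPair W i j h (v i (inl a, ε)) z = 0 := fun i j h a ε z hz => by
    rw [← hv, ← D.invPair_adjoint W (i - 1) i j (j + 1) h (by omega) (by omega) rfl, hz, map_zero]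
  obtain ⟨c, hc0, h8, h9, h10, h11⟩ := pfm_gradedGram_mul (k := D.invPair W) (υ := υ) (τ := κ)
    (S := {i | Even i}) (S' := {i | Odd i}) (v := fun i => v i)
    (fun i => Int.even_add_one.trans Int.not_even_iff_odd)
    (fun i => (Int.not_even_iff_odd.symm.trans Int.even_add_one.not).trans not_not)
    (D.invPair_flip W) (dInv Q W) (fun i' i j j' h h' hi hj x y => D.invPair_adjoint W i' i j j' h h' hi hj x y)
    hv (fun i j h a b ε ε' => h0 i j h a ε _ (by rw [← hv, dInv_dInv]))
    (fun i j h a b ε ε' => h0 i j h a ε _ (hc _ _ _ _ rfl)) h5 h7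
  refine ⟨?_, h10, h11⟩
  rw [h1, h4, h6, h8, h9, ← finprod_even_div_odd (relDet L e v) (t := t) fun i hi => ?_]
  · rw [mul_div_mul_comm, mul_div_mul_left _ _ hc0]
  · have := hJ i hi
    exact (Basis.det_apply _ _).trans det_isEmpty

lemma exists_pfValue_eq (hP : IsPerfect P) (hA : IsPerfect A) (hac : A.Acyclic) {σ : GradedPairing P}
    (hσ : IsSymmetricPairing σ) (L : LocalBases P) (L' : LocalBases (dirSum P A))
    (D : PairingLift ((σ.scale (card G : ℚ)).pullback (dirSumFst P A))) :
    ∃ (ι : Type) (_ : Fintype ι) (_ : DecidableEq ι) (X : (Matrix ι ι ℚ[G])ˣ)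
      (Y : ∀ p : Primes, (Matrix ι ι ℤ_[p][G])ˣ),
      (∀ (p : Primes) (n : ℕ) (ρ : CRep G n),
        ((L.detLam p ρ / L'.detLam p ρ : (LocalC p)ˣ) : LocalC p) *
          detM ℚ_[p] (localInclC p) ρ ((Y p).1.map (toQp G p)) =
        detM ℚ_[p] (localInclC p) ρ
          (X.1.map (MonoidAlgebra.mapRingHom G (algebraMap ℚ ℚ_[p])))) ∧
      ∀ (W : SymplecticRep G) (E : AdaptedBases W L),
        E.pfValue σ = detC W.ρ X.1 * D.pfProd L' W := by
  classical
  obtain ⟨s, hs0, hs1⟩ := hA.exists_contraction hac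
  obtain ⟨ι, i1, i2, X, Y, h1, h2⟩ := exists_comparison hP hA hs0 hs1 L L'
  refine ⟨ι, i1, i2, X, Y, h1, fun W E => ?_⟩
  obtain ⟨m, x, hx1, hx2, hx3⟩ := exists_contracted_basis_inv hA hs0 hs1 W
  have he : ∀ i, Nonempty (Fin (L'.r i) × Fin W.k ≃ JIndex E.s E.t m true i) := fun i => by
    obtain ⟨b, -⟩ := (L'.a0_basis i).exists_bfam_basis W
    have h3 := card_congr (b.indexEquiv (pairBasis E x true i))
    rw [card_prod, card_prod (JIndex E.s E.t m true i), card_fin] at h3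
    exact ⟨equivOfCardEq (by omega)⟩
  let e : ∀ c i, Fin ((pairL L L' c).r i) × Fin W.k ≃ JIndex E.s E.t m c i := fun c => match c with
    | false => E.e
    | true => fun i => (he i).some
  have h3 := h2 W e (pairBasis E x) (isPermuted_pairBasis E hx1 hx2 hx3)
  have hF : ∀ S : Set ℤ, Finite (Σ i : S, Fin (E.t i)) := fun S => by
    obtain ⟨t, ht⟩ := hP.exists_finset
    exact Finite.of_injective (β := Σ i : t, Fin (E.t i))
      (fun x => ⟨⟨x.1, by_contra fun h => by
        have := ht _ h
        have h0 := L.r_eq_zero x.1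
        exact absurd ((E.e x.1).symm (inr (inl x.2))).1.2 (by omega)⟩, x.2⟩) fun x y h => by
        obtain ⟨⟨i, hi⟩, x⟩ := x
        obtain ⟨⟨j, hj⟩, y⟩ := y
        simp only [Sigma.mk.injEq, Subtype.mk.injEq] at h
        obtain ⟨rfl, h⟩ := h
        rw [eq_of_heq h]
  let _ : Fintype (Σ i : {i : ℤ | Even i}, Fin (E.t i)) := ofFinite _
  let _ : Fintype (Σ i : {i : ℤ | Odd i}, Fin (E.t i)) := ofFinite _
  have hmid : ∀ i a ε, joinBasis W (E.v i) (x i) (inr (inl a), ε) =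
      invOver W (LinearMap.inl _ (P.X i) (A.X i)) (E.v i (inr (inl a), ε)) := fun i a ε =>
    joinBasis_inl W (E.v i) (x i) (inr (inl a)) ε
  have hmid0 : ∀ i j a ε, i + 1 = j →
      dInv (dirSum P A) W i j (joinBasis W (E.v i) (x i) (inr (inl a), ε)) = 0 := by
    rintro i _ a ε rfl
    refine (congrArg _ (hmid i a ε)).trans ((invOver_square W (g' := LinearMap.inl _ _ (A.X (i + 1)))
      (fun z => congrArg (fun w => ((P.d i (i + 1)).hom z, w)) (map_zero (A.d i (i + 1)).hom)) _).trans
      ((congrArg _ ?_).trans (map_zero _)))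
    rw [← E.v_cycle]
    exact mem_ker.1 ((range_zInv W i).le ⟨_, rfl⟩)
  obtain ⟨h4, h5, h6⟩ := D.pfProd_eq_mul (hP.dirSum hA) L' W (υ := fun i => Fin (E.s i) ⊕ Fin (m i))
    (κ := fun i => Fin (E.t i)) (fun i => joinBasis W (E.v i) (x i)) (dInv_joinBasis E hx1) hmid0 (e true)
  dsimp only at h4 h5 h6
  rw [D.gradedGram_eq_gram (S := {i | Even i}) (fun _ h => Even.neg h) E hmid] at h4 h5
  rw [D.gradedGram_eq_gram (S := {i | Odd i}) (fun _ h => Odd.neg h) E hmid] at h4 h6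
  rw [AdaptedBases.pfValue, E.Pf_classes _ hσ h5, E.Pf_classes _ hσ h6, h4, mul_assoc, ← div_eq_mul_inv,
    ← mul_assoc]
  exact congrArg (· * _) h3

end

section

lemma pfGram_of_isEmpty (W : SymplecticRep G) {V : Type*} [AddCommGroup V] [Module ℚ V]
    {ι : Type*} [Fintype ι] [IsEmpty ι] (τ : Representation ℚ G V) (B : BilinForm ℚ V)
    (a : ι → V) : pfGram W τ B a = 1 := by
  rw [pfGram, pfEnd, dif_pos ⟨0, fun x y => by rw [Subsingleton.elim x 0]; simp⟩]
  exact LinearMap.det_eq_one_of_subsingleton _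

lemma PairingLift.exists_pfProdHom     (hQ : IsPerfect Q) {τ : GradedPairing Q} (D : PairingLift τ) (L : LocalBases Q) :
    ∃ h : equivHom (RGs G) Qbarˣ galUnits, ∀ W : SymplecticRep G,
      ((h.1 (ofAdd (charRs W.ρ W.isSymplectic)) : Qbar) : ℂ) = D.pfProd L W := by
  classical
  obtain ⟨t, ht⟩ := hQ.exists_finset
  have hr : ∀ i, i ∉ t → L.r i = 0 := fun i hi => by
    have := ht i hi
    exact L.r_eq_zero i
  obtain ⟨h0, H0⟩ := exists_pfGramHom (D.symm 0 0 _ _) (D.inv 0 0 (add_zero 0)) (D.nondeg 0 0 _).1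
    (L.a0_basis 0)
  choose h H using fun i : {i : ℤ // 0 < i} => exists_pfGramHom (D.sumForm_symm i) (D.sumForm_rep i)
    (D.eq_zero_of_sumForm i) ((L.a0_basis i).prod (L.a0_basis (-i)))
  let s : Finset {i : ℤ // 0 < i} := (t ∪ t.image Neg.neg).subtype _
  refine ⟨h0 * ∏ i ∈ s, h i ^ (Int.negOnePow i : ℤ), fun W => ?_⟩
  let ev : equivHom (RGs G) Qbarˣ galUnits →* ℂˣ := qbarToC.comp ((MonoidHom.eval
    (ofAdd (charRs W.ρ W.isSymplectic))).comp (Subgroup.subtype _))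
  change ((ev (h0 * ∏ i ∈ s, h i ^ (Int.negOnePow i : ℤ)) : ℂˣ) : ℂ) = _
  rw [map_mul, map_prod, val_mul, Units.coe_prod, PairingLift.pfProd,
    finprod_eq_prod_of_mulSupport_subset (s := s)]
  · refine congrArg₂ _ (H0 W) (prod_congr rfl fun i _ => ?_)
    rw [map_zpow, Units.val_zpow_eq_zpow_val]
    exact congrArg (· ^ _) (H i W)
  · intro i hi
    by_contra his
    simp only [s, Finset.mem_coe, Finset.mem_subtype, Finset.mem_union,
      Finset.mem_image, not_or, not_exists, not_and] at his
    have h1 := hr _ his.1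
    have h2 := hr (-i) fun h => his.2 _ h (neg_neg _)
    have : IsEmpty (Fin (L.r i) ⊕ Fin (L.r (-i))) := by
      rw [h1, h2]
      infer_instance
    exact hi (show pfGram W _ _ _ ^ _ = _ by rw [pfGram_of_isEmpty, _root_.one_zpow])

lemma toReal_val (f : equivHom (RGs G) Qbarˣ galUnits) (ψ : Multiplicative (RGs G)) :
    (((toReal f ψ : ℝˣ) : ℝ) : ℂ) = ((f.1 ψ : Qbar) : ℂ) :=
  equivHom_real f ψ

lemma toReal_eq_absQ {f : equivHom (RGs G) Qbarˣ galUnits} (hf : f ∈ posHom G) :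
    toReal f = absQ.comp f.1 := by
  refine MonoidHom.ext fun ψ => Units.ext ?_
  obtain ⟨r, hr, h⟩ := hf ψ 1
  apply Complex.ofReal_injective
  rw [toReal_val]
  change _ = ((‖((f.1 ψ : Qbar) : ℂ)‖ : ℝ) : ℂ)
  rw [show ((f.1 ψ : Qbar) : ℂ) = r from h, Complex.norm_real, Real.norm_of_nonneg hr.le]

lemma toIdele_toReal_mem {f : equivHom (RGs G) Qbarˣ galUnits} (hf : f ∈ posHom G) :
    ((toIdele (RGs G) f, toReal f) : HsNum G) ∈ HsDen G :=
  Subgroup.mem_sup_left ⟨⟨f, hf⟩, Prod.ext rfl (toReal_eq_absQ hf).symm⟩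

lemma restrict_detZhat_mem {z : equivHom (RG G) FinIdele galIdele} (hz : z ∈ detZhat G) :
    ((restrictHom FinIdele galIdele z, 1) : HsNum G) ∈ HsDen G :=
  Subgroup.mem_sup_right ⟨⟨z, hz, rfl⟩, rfl⟩

lemma HClDen_le_comap : HClDen G ≤ (HsDen G).comap (comparisonNum G) := by
  refine sup_le ?_ ?_
  · rintro _ ⟨⟨f, x, hx⟩, rfl⟩
    have hu : IsUnit (of fun _ _ : Unit => x.1) :=
      ⟨⟨of fun _ _ => x.1, of fun _ _ => x⁻¹.1, by ext; simp [mul_apply],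
        by ext; simp [mul_apply]⟩, rfl⟩
    have h := toIdele_toReal_mem (detHom_mem_posHom _ hu f fun n ρ =>
      (congrArg Units.val (hx n ρ)).trans (detUnit_val _ _ _ x))
    have e : comparisonNum G (deltaTilde G ⟨f, x, hx⟩) =
        (toIdele (RGs G) (restrictHom Qbarˣ galUnits f), toReal (restrictHom Qbarˣ galUnits f)) :=
      Prod.ext rfl (by
        change (toReal (restrictHom Qbarˣ galUnits f)⁻¹)⁻¹ = toReal (restrictHom Qbarˣ galUnits f)
        rw [map_inv]
        exact MonoidHom.ext fun ψ => inv_inv (toReal _ ψ))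
    exact Subgroup.mem_comap.2 (e ▸ h)
  · rintro ⟨z, a, b⟩ ⟨hz, -, hb⟩
    obtain rfl : b = 1 := hb
    have e : comparisonNum G (z, a, 1) = (restrictHom FinIdele galIdele z, 1) :=
      Prod.ext rfl (by
        change (toReal 1)⁻¹ = 1
        rw [map_one]
        exact MonoidHom.ext fun _ => inv_one)
    exact Subgroup.mem_comap.2 (e ▸ restrict_detZhat_mem hz)

lemma SymplecticFamily.hom_ext (F : SymplecticFamily G) {M : Type*} [CommGroup M]
    {f g : Multiplicative (RGs G) →* M} (h : ∀ m, f (F.elem m) = g (F.elem m)) : f = g := by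
  have : MonoidHom.toAdditiveRight f = MonoidHom.toAdditiveRight g :=
    AddMonoidHom.toIntLinearMap_injective (F.θ.ext fun m => h m)
  exact MonoidHom.toAdditiveRight.injective this

end

section

lemma ideleAt_diagIdele (p : Primes) (z : Qbarˣ) :
    ((ideleAt p (diagIdele z) : (LocalC p)ˣ) : LocalC p) = localInclC p ((z : Qbar) : ℂ) := by
  change adeleAt p ((1 : Zhat) ⊗ₜ[ℤ] (z : Qbar)) = (1 : ℚ_[p]) ⊗ₜ[ℤ] ((z : Qbar) : ℂ)
  refine (Algebra.TensorProduct.map_tmul _ _ _ _).trans (congrArg (· ⊗ₜ[ℤ] _) ?_)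
  exact map_one ((ringHom (p := (p : ℕ))).comp (zhatProj p))

lemma detM_localInclC {ι : Type*} [Fintype ι] [DecidableEq ι] (p : Primes) {n : ℕ}
    (ρ : CRep G n) (X : Matrix ι ι ℚ[G]) :
    detM ℚ_[p] (localInclC p) ρ (X.map (MonoidAlgebra.mapRingHom G (algebraMap ℚ ℚ_[p]))) =
      localInclC p (detC ρ X) :=
  detM_map (A := ℚ) (φ := RingHom.id ℂ) (ρ := ρ) (localInclC p) (algebraMap ℚ ℚ_[p])
    (RingHom.congr_fun (RingHom.ext_rat ((localInclC p).comp (algebraMap ℚ ℂ))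
      ((algebraMap ℚ_[p] (LocalC p)).comp (algebraMap ℚ ℚ_[p])))) X

lemma exists_comparison_homs (hP : IsPerfect P) (hA : IsPerfect A) (hac : A.Acyclic)
    {σ : GradedPairing P} (hσ : IsSymmetricPairing σ) (L : LocalBases P) (L' : LocalBases (dirSum P A))
    (D : PairingLift ((σ.scale (card G : ℚ)).pullback (dirSumFst P A))) :
    ∃ f ∈ posHom G, ∃ z ∈ detZhat G, ∃ h : equivHom (RGs G) Qbarˣ galUnits, ∀ W : SymplecticRep G,
      let ψ := ofAdd (charRs W.ρ W.isSymplectic)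
      (∀ p, L.detLam p W.ρ / L'.detLam p W.ρ * ideleAt p ((restrictHom FinIdele galIdele z).1 ψ) =
        ideleAt p ((toIdele (RGs G) f).1 ψ)) ∧
      ((h.1 ψ : Qbar) : ℂ) = D.pfProd L' W ∧
      ∀ E : AdaptedBases W L, E.pfValue σ = ((f.1 ψ : Qbar) : ℂ) * ((h.1 ψ : Qbar) : ℂ) := by
  classical
  obtain ⟨ι, _, _, X, Y, hXY, hpf⟩ := exists_pfValue_eq hP hA hac hσ L L' D
  obtain ⟨f, hf⟩ := exists_detHom X.1 X.isUnit
  let e := (equivFin ι).symm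
  obtain ⟨z, hz, hzY⟩ := exists_mem_detZhat_matrix (fun p => (Y p).1.submatrix e e) fun p =>
    (Y p).isUnit.map (Matrix.reindexRingEquiv _ (equivFin ι))
  obtain ⟨h, hh⟩ := D.exists_pfProdHom (hP.dirSum hA) L'
  refine ⟨restrictHom Qbarˣ galUnits f, detHom_mem_posHom _ X.isUnit f hf, z, hz, h, fun W => ?_⟩
  intro ψ
  have hfW : (((restrictHom Qbarˣ galUnits f).1 ψ : Qbar) : ℂ) = detC W.ρ X.1 := by
    rw [charRs_ofAdd_eq, hf]
  refine ⟨fun p => Units.ext ?_, hh W, fun E => by rw [hpf W E, hfW, hh]⟩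
  refine Eq.trans ?_ ((hXY p W.n W.ρ).trans ?_)
  · rw [val_mul]
    refine congrArg (_ * ·) ((hzY W.n W.ρ p).trans ?_)
    exact detM_reindex _ (localInclC p) W.ρ e ((Y p).1.map (toQp G p))
  · rw [detM_localInclC, ← hfW]
    exact (ideleAt_diagIdele p _).symm

lemma eq_comparison_inv (hP : IsPerfect P) {σ : GradedPairing P} (hσ : IsSymmetricPairing σ)
    {c : Hs G} {d : HCl G} (hc : IsHermitianEulerChar P σ c)
    (hd : IsFroehlichClass P (σ.scale (card G : ℚ)) d) :
    c = (comparison G HClDen_le_comap d)⁻¹ := by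
  obtain ⟨F, L, E, f, g, hf, hg, rfl⟩ := hc
  obtain ⟨A, hA, hac, D, F', L', f', h', hf', hh', rfl⟩ := hd
  obtain ⟨f1, hf1, z, hz, h, H⟩ := exists_comparison_homs hP hA hac hσ L L' D
  have hh : h' = h := Subtype.ext (F'.hom_ext fun m => Units.ext (Subtype.ext (by
    rw [hh' m, SymplecticFamily.elem, F'.θ_eq]
    exact (H (F'.W m)).2.1.symm)))
  have hF : f * restrictHom FinIdele galIdele f' * restrictHom FinIdele galIdele z =
      toIdele (RGs G) f1 := Subtype.ext (F.hom_ext fun m => finIdele_ext fun p => by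
    have h1 := hf m p
    have h2 := (H (F.W m)).1 p
    have h3 := hf' _ (F.W m).ρ p
    rw [SymplecticFamily.elem, F.θ_eq] at h1 ⊢
    rw [← h2, div_eq_mul_inv, ← h1, ← h3, ← charRs_ofAdd_eq _ _ (F.W m).isSymplectic, ← map_mul,
      ← map_mul]
    rfl)
  have hG : g = toReal f1 * toReal h' := F.hom_ext fun m => Units.ext (Complex.ofReal_injective (by
    rw [hg m, MonoidHom.mul_apply, val_mul, Complex.ofReal_mul, toReal_val, toReal_val,
      SymplecticFamily.elem, F.θ_eq, hh]
    exact (H (F.W m)).2.2 (E m)))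
  rw [eq_inv_iff_mul_eq_one]
  let x : HsNum G := (f, g)
  refine (QuotientGroup.eq_one_iff (N := HsDen G) (x * comparisonNum G (f', 1, h'))).2 ?_
  convert (HsDen G).mul_mem (toIdele_toReal_mem hf1)
    ((HsDen G).inv_mem (restrict_detZhat_mem hz)) using 1
  refine Prod.ext (eq_mul_inv_of_mul_eq hF) (MonoidHom.ext fun ψ => ?_)
  change g ψ * (toReal h' ψ)⁻¹ = toReal f1 ψ * 1⁻¹
  rw [hG, MonoidHom.mul_apply, mul_inv_cancel_right, inv_one, mul_one]

lemma exists_isFroehlichClass (hP : IsPerfect P) {τ : GradedPairing P} (hτ : IsSymmetricPairing τ) :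
    ∃ d, IsFroehlichClass P τ d := by
  obtain ⟨A, hA, hac, ⟨D⟩⟩ := exists_pairingLift hP hτ
  obtain ⟨F⟩ := exists_symplecticFamily (G := G)
  obtain ⟨L⟩ := (hP.dirSum hA).nonempty_localBases
  obtain ⟨f, hf⟩ := L.exists_detLam_hom (hP.dirSum hA)
  obtain ⟨h, hh⟩ := D.exists_pfProdHom (hP.dirSum hA) L
  refine ⟨_, A, hA, hac, D, F, L, f⁻¹, h, fun n ρ p => ?_, fun m => ?_, rfl⟩
  · rw [← hf]
    exact map_inv (ideleAt p) _
  · rw [SymplecticFamily.elem, F.θ_eq, hh]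

lemma exists_isHermitianEulerChar (hP : IsPerfect P) {σ : GradedPairing P}
    (hσ : IsSymmetricPairing σ) : ∃ c, IsHermitianEulerChar P σ c := by
  obtain ⟨A, hA, hac, ⟨D⟩⟩ := exists_pairingLift hP
    (hσ.scale (c := (card G : ℚ)) (cast_ne_zero.2 card_ne_zero))
  obtain ⟨F⟩ := exists_symplecticFamily (G := G)
  obtain ⟨L⟩ := hP.nonempty_localBases
  obtain ⟨L'⟩ := (hP.dirSum hA).nonempty_localBases
  obtain ⟨f, hf⟩ := L.exists_detLam_hom hP
  obtain ⟨f1, -, z, -, h, H⟩ := exists_comparison_homs hP hA hac hσ L L' D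
  refine ⟨_, F, L, fun m => (L.nonempty_adaptedBases (F.W m)).some, restrictHom FinIdele galIdele f,
    toReal (f1 * h), fun m p => ?_, fun m => ?_, rfl⟩
  · rw [SymplecticFamily.elem, F.θ_eq, charRs_ofAdd_eq, hf]
  · rw [(H (F.W m)).2.2, toReal_val, SymplecticFamily.elem, F.θ_eq]
    rfl

end

end HermEuler

end

theorem theorem44 {G : Type u} [Group G] [Fintype G]
    (P : CochainComplex (ModuleCat.{v} (MonoidAlgebra ℤ G)) ℤ) (hP : HermEuler.IsPerfect P)
    (σ : HermEuler.GradedPairing P) (hσ : HermEuler.IsSymmetricPairing σ) :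
    ∃ h : HermEuler.HClDen G ≤ (HermEuler.HsDen G).comap (HermEuler.comparisonNum G),
      (∃ c, HermEuler.IsHermitianEulerChar P σ c) ∧
      (∃ d, HermEuler.IsFroehlichClass P (σ.scale (Fintype.card G : ℚ)) d) ∧
      ∀ (c : HermEuler.Hs G) (d : HermEuler.HCl G),
        HermEuler.IsHermitianEulerChar P σ c →
        HermEuler.IsFroehlichClass P (σ.scale (Fintype.card G : ℚ)) d →
        c = (HermEuler.comparison G h d)⁻¹ :=
  ⟨HermEuler.HClDen_le_comap, HermEuler.exists_isHermitianEulerChar hP hσ,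
    HermEuler.exists_isFroehlichClass hP (hσ.scale (Nat.cast_ne_zero.2 Fintype.card_ne_zero)),
    fun _ _ hc hd => HermEuler.eq_comparison_inv hP hσ hc hd⟩
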